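/- Let $k$ be an algebraically closed field of arbitrary characteristic. All schemes and morphisms are over $k$. **Jets and arcs.** For a $k$-scheme $X$ and $m\ge 0$, let $J_m(X)$ be the $m$-th jet scheme, i.e. the $k$-scheme representing $T\mapsto \mathrm{Hom}_k(T\times_k \mathrm{Spec}\,k[t]/(t^{m+1}),X)$. An arc on $X$ is a $k$-morphism $\gamma:\mathrm{Spec}\,k[[t]]\to X$; write $J_\infty(X)$ for the set of arcs and $\psi_m^X:J_\infty(X)\to J_m(X)(k)$ for the truncation map. A morphism $f:X'\to X$ induces $f_m:J_m(X')\to J_m(X)$ and $f_\infty:J_\infty(X')\to J_\infty(X)$ by composition. For an ideal sheaf $\mathfrak a$ on $X$ and $e\ge 0$, let $\mathrm{Cont}^e(\mathfrak a)$ be the set of arcs $\gamma$ with $\gamma^{-1}\mathfrak a\cdot k[[t]]=(t^e)$. **Weakly piecewise trivial fibrations.** Let $g:V'\to V$ be a morphism of schemes, $W'\subseteq V'$ and $W\subseteq V$ sets of $k$-points with $g(W')\subseteq W$, and $F$ a scheme. We say that $g$ induces a weakly piecewise trivial fibration $W'\to W$ with fiber $F$ if $W=T_1\sqcup\dots\sqcup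 T_r$ with all $T_i$ locally closed (with the reduced scheme structure), such that each $W'\cap g^{-1}(T_i)$ is locally closed in $V'$ and, with its reduced scheme structure, the morphism $W'\cap g^{-1}(T_i)\to T_i$ induced by $g$ factors as $$W'\cap g^{-1}(T_i)\xrightarrow{\;u\;}T_i'\times F\xrightarrow{\;v\;}T_i'\xrightarrow{\;w\;}T_i,$$ where $u$ is an isomorphism, $v$ is the projection and $w$ is a bijective morphism. (In particular $W$ and $W'$ are then constructible.) **Theorem (Birational Transformation Theorem).** Let $X$ be a reduced scheme of finite type over $k$, of pure dimension $n$, and let $f:X'\to X$ be a proper birational morphism with $X'$ nonsingular. Put $\mathrm{Jac}_f=\mathrm{Fitt}^0(\Omega_{X'/X})$ and $\mathrm{Jac}_X=\mathrm{Fitt}^n(\Omega_{X/k})$, and for $e,e'\ge 0$ let $$C_{e,e'}=\mathrm{Cont}^e(\mathrm{Jac}_f)\cap f_\infty^{-1}\bigl(\mathrm{Cont}^{e'}(\mathrm{Jac}_X)\bigr)\subseteq J_\infty(X').$$ Let $m\ge\max\{2e,\,e+e'\}$. Then: (i) $\psi_m^{X'}(C_{e,e'})$ is a union of fibers of $f_m$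 (on $k$-points); (ii) $f_m$ induces a weakly piecewise trivial fibration $\psi_m^{X'}(C_{e,e'})\to f_m\bigl(\psi_m^{X'}(C_{e,e'})\bigr)$ with fiber $\mathbf A^e$. -/

import Mathlib

open CategoryTheory AlgebraicGeometry Limits MonoidalCategory CartesianMonoidalCategory Opposite

universe u

namespace JetScheme

section
variable {C : Type*} [Category.{u} C]

/-- A universal element of a presheaf yields a representation. -/
noncomputable def reprOfUniversal (F : Cᵒᵖ ⥤ Type u) (Y : C) (x : F.obj (op Y))
    (h : ∀ (Z : C) (z : F.obj (op Z)), ∃! φ : Z ⟶ Y, F.map φ.op x = z) : F.RepresentableBy Y where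
  homEquiv {Z} := Equiv.ofBijective (fun φ => F.map φ.op x) (by
    refine ⟨fun φ ψ e => (h Z (F.map ψ.op x)).unique e rfl, fun z => (h Z z).exists⟩)
  homEquiv_comp f g := by
    change F.map (f ≫ g).op x = F.map f.op (F.map g.op x)
    simp

lemma exists_universal {F : Cᵒᵖ ⥤ Type u} {Y : C} (R : F.RepresentableBy Y) :
    ∃ x : F.obj (op Y), ∀ (Z : C) (z : F.obj (op Z)), ∃! φ : Z ⟶ Y, F.map φ.op x = z := by
  refine ⟨R.homEquiv (𝟙 Y), fun Z z => ⟨R.homEquiv.symm z, ?_, fun φ hφ => ?_⟩⟩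
  · dsimp only; rw [← R.homEquiv_comp]; simp
  · dsimp only at hφ; rw [← R.homEquiv_comp] at hφ; simp [← hφ]

end

section
variable {S : Scheme.{u}} (F : (Over S)ᵒᵖ ⥤ Type u)

lemma sigma_ext {T : Scheme.{u}} {s s' : T ⟶ S} (x : F.obj (op (Over.mk s)))
    (x' : F.obj (op (Over.mk s'))) (h : s' = s)
    (hx : F.map (Over.homMk (𝟙 T) (by simp [h]) : Over.mk s' ⟶ Over.mk s).op x = x') :
    (⟨s, x⟩ : Σ s : T ⟶ S, F.obj (op (Over.mk s))) = ⟨s', x'⟩ := by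
  subst h hx
  congr 1
  have : (Over.homMk (𝟙 T) (by simp) : Over.mk s' ⟶ Over.mk s') = 𝟙 _ := by ext; simp
  rw [this]; simp

/-- The presheaf on schemes whose sections over `T` are pairs of a structure morphism `T ⟶ S` and
a section of `F` over the resulting object of `Over S`. -/
def sig : Scheme.{u}ᵒᵖ ⥤ Type u where
  obj T := Σ s : T.unop ⟶ S, F.obj (op (Over.mk s))
  map {T T'} φ := ↾ fun x => ⟨φ.unop ≫ x.1, F.map (Over.homMk φ.unop : Over.mk (φ.unop ≫ x.1) ⟶ Over.mk x.1).op x.2⟩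
  map_id T := by
    refine ConcreteCategory.hom_ext _ _ fun ⟨s, x⟩ => ?_
    refine (sigma_ext F _ _ (by simp) ?_).symm
    rfl
  map_comp φ ψ := by
    refine ConcreteCategory.hom_ext _ _ fun ⟨s, x⟩ => ?_
    refine sigma_ext F _ _ (Category.assoc ψ.unop φ.unop s).symm ?_
    change _ = F.map (Over.homMk ψ.unop : Over.mk (ψ.unop ≫ φ.unop ≫ s) ⟶ Over.mk (φ.unop ≫ s)).op
      (F.map (Over.homMk φ.unop : Over.mk (φ.unop ≫ s) ⟶ Over.mk s).op x)
    rw [← Functor.map_comp_apply]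
    rw [← Functor.map_comp_apply]
    rw [← op_comp, ← op_comp]
    congr 3

lemma sig_map_mk {T T' : Scheme.{u}} (φ : T' ⟶ T) (s : T ⟶ S) (x : F.obj (op (Over.mk s))) :
    (sig F).map φ.op ⟨s, x⟩ =
      ⟨φ ≫ s, F.map (Over.homMk φ : Over.mk (φ ≫ s) ⟶ Over.mk s).op x⟩ := rfl

lemma sig_map_eq {T T' : Scheme.{u}} (φ : T' ⟶ T) (s : T ⟶ S) (x : F.obj (op (Over.mk s)))
    {s' : T' ⟶ S} (x' : F.obj (op (Over.mk s'))) (ψ : Over.mk s' ⟶ Over.mk s) (hψ : ψ.left = φ)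
    (hx : F.map ψ.op x = x') : (sig F).map φ.op ⟨s, x⟩ = ⟨s', x'⟩ := by
  subst hψ hx
  rw [sig_map_mk]
  refine sigma_ext F _ _ (by simpa using (Over.w ψ).symm) ?_
  rw [← Functor.map_comp_apply, ← op_comp]
  congr 3

lemma sig_map_eq_iff {T T' : Scheme.{u}} (φ : T' ⟶ T) (s : T ⟶ S) (x : F.obj (op (Over.mk s)))
    {s' : T' ⟶ S} (x' : F.obj (op (Over.mk s'))) : (sig F).map φ.op ⟨s, x⟩ = ⟨s', x'⟩ ↔
      ∃ ψ : Over.mk s' ⟶ Over.mk s, ψ.left = φ ∧ F.map ψ.op x = x' := by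
  constructor
  · intro h
    rw [sig_map_mk] at h
    obtain ⟨h1, h2⟩ := Sigma.mk.inj_iff.mp h
    subst h1
    exact ⟨Over.homMk φ, rfl, eq_of_heq h2⟩
  · rintro ⟨ψ, h, h'⟩
    exact sig_map_eq F _ _ _ _ ψ h h'

theorem isRepresentable_of_sig (h : (sig F).IsRepresentable) : F.IsRepresentable := by
  obtain ⟨J, ⟨R⟩⟩ := h
  obtain ⟨⟨j, x⟩, hu⟩ := exists_universal R
  refine ⟨Over.mk j, ⟨reprOfUniversal F _ x fun Z z => ?_⟩⟩
  obtain ⟨φ, h1, h2⟩ := hu Z.left ⟨Z.hom, z⟩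
  obtain ⟨ψ, hψ, hz⟩ := (sig_map_eq_iff F _ _ _ _).mp h1
  refine ⟨ψ, hz, fun ψ' h' => ?_⟩
  have := h2 ψ'.left (sig_map_eq F _ _ _ _ ψ' rfl h')
  ext
  exact this.trans hψ.symm

theorem sig_isRepresentable (h : F.IsRepresentable) : (sig F).IsRepresentable := by
  obtain ⟨J, ⟨R⟩⟩ := h
  obtain ⟨x, hu⟩ := exists_universal R
  refine ⟨J.left, ⟨reprOfUniversal (sig F) _ ⟨J.hom, x⟩ fun Z ⟨s, z⟩ => ?_⟩⟩
  obtain ⟨φ, h1, h2⟩ := hu (Over.mk s) z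
  refine ⟨φ.left, sig_map_eq F _ _ _ _ φ rfl h1, fun ψ' h' => ?_⟩
  obtain ⟨ψ, hψ, hz⟩ := (sig_map_eq_iff F _ _ _ _).mp h'
  rw [← hψ, h2 ψ hz]
end

section
open scoped TensorProduct
variable (k : Type u) [CommRing k] (B : Type u) [CommRing B] [Algebra k B]

theorem exists_weilRestriction [Module.Free k B] [Module.Finite k B] (R : Type u) [CommRing R] [Algebra k R] :
    ∃ (H : Type u) (_ : CommRing H) (_ : Algebra k H) (w : R →ₐ[k] H ⊗[k] B),
      ∀ (A : Type u) [CommRing A] [Algebra k A] (v : R →ₐ[k] A ⊗[k] B),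
        ∃! φ : H →ₐ[k] A, (Algebra.TensorProduct.map φ (AlgHom.id k B)).comp w = v := by
  let ι := Module.Free.ChooseBasisIndex k B
  let b : Module.Basis ι k B := Module.Free.chooseBasis k B
  let bA (A : Type u) [CommRing A] [Algebra k A] : Module.Basis ι A (A ⊗[k] B) :=
    Algebra.TensorProduct.basis A b
  have hX (A : Type u) [CommRing A] [Algebra k A] (g : R × ι → A) (x : R × ι) :
      MvPolynomial.aeval (R := k) g (MvPolynomial.X x) = g x := MvPolynomial.aeval_X _ _
  let P := MvPolynomial (R × ι) k
  have hmap (A A' : Type u) [CommRing A] [Algebra k A] [CommRing A'] [Algebra k A']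
      (φ : A →ₐ[k] A') (x : A ⊗[k] B) (i : ι) :
      (bA A').repr (Algebra.TensorProduct.map φ (AlgHom.id k B) x) i = φ ((bA A).repr x i) := by
    induction x with
    | zero => simp
    | tmul a y => simp [bA, Algebra.TensorProduct.basis_repr_tmul]
    | add x y hx hy => simp [hx, hy]
  let U (r : R) : P ⊗[k] B := ∑ i, MvPolynomial.X (r, i) ⊗ₜ b i
  let I : Ideal P := Ideal.span
    ({p | ∃ r s i, p = (bA P).repr (U (r + s) - (U r + U s)) i} ∪
     {p | ∃ r s i, p = (bA P).repr (U (r * s) - U r * U s) i} ∪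
     {p | ∃ c i, p = (bA P).repr (U (algebraMap k R c) - algebraMap k _ c) i})
  let π : P →ₐ[k] P ⧸ I := Ideal.Quotient.mkₐ k I
  let q := Algebra.TensorProduct.map π (AlgHom.id k B)
  have hq (x y : P ⊗[k] B) (h : ∀ i, (bA P).repr (x - y) i ∈ I) : q x = q y := by
    refine (bA (P ⧸ I)).ext_elem fun i => ?_
    rw [hmap, hmap, ← sub_eq_zero, ← map_sub]
    have := h i
    rw [map_sub] at this
    exact Ideal.Quotient.eq_zero_iff_mem.mpr this
  have h1 (r s) : q (U (r + s)) = q (U r) + q (U s) := by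
    rw [← map_add]
    exact hq _ _ fun i => Ideal.subset_span (Or.inl (Or.inl ⟨r, s, i, rfl⟩))
  have h2 (r s) : q (U (r * s)) = q (U r) * q (U s) := by
    rw [← map_mul]
    exact hq _ _ fun i => Ideal.subset_span (Or.inl (Or.inr ⟨r, s, i, rfl⟩))
  have h3 (c) : q (U (algebraMap k R c)) = algebraMap k _ c := by
    rw [← q.commutes c]
    exact hq _ _ fun i => Ideal.subset_span (Or.inr ⟨c, i, rfl⟩)
  let w : R →ₐ[k] (P ⧸ I) ⊗[k] B :=
    { toFun r := q (U r)
      map_one' := by have := h3 1; rwa [map_one, map_one] at this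
      map_mul' := h2
      map_zero' := by have := h3 0; rwa [map_zero, map_zero] at this
      map_add' := h1
      commutes' := h3 }
  refine ⟨P ⧸ I, inferInstance, inferInstance, w, fun A _ _ v => ?_⟩
  let ev : P →ₐ[k] A := MvPolynomial.aeval fun x => (bA A).repr (v x.1) x.2
  have hev (r) : Algebra.TensorProduct.map ev (AlgHom.id k B) (U r) = v r := by
    conv_rhs => rw [← (bA A).sum_repr (v r)]
    simp only [U, map_sum, Algebra.TensorProduct.map_tmul]
    refine Finset.sum_congr rfl fun i _ => ?_
    erw [hX]
    simp [bA, TensorProduct.smul_tmul']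
  have hI : ∀ a ∈ I, ev a = 0 := by
    intro a ha
    refine (Ideal.span_le (I := RingHom.ker ev)).mpr ?_ ha
    rintro p ((⟨r, s, i, rfl⟩ | ⟨r, s, i, rfl⟩) | ⟨c, i, rfl⟩) <;>
    · simp only [SetLike.mem_coe, RingHom.mem_ker]
      rw [← hmap]
      simp [hev, -map_sub, map_sub (Algebra.TensorProduct.map ev (AlgHom.id k B))]
  refine ⟨Ideal.Quotient.liftₐ I ev hI, ?_, fun φ hφ => ?_⟩
  · ext r
    change Algebra.TensorProduct.map _ _ (q (U r)) = _
    rw [← hev r, ← AlgHom.comp_apply, ← Algebra.TensorProduct.map_comp]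
    congr 2
  · refine Ideal.Quotient.algHom_ext _ ?_
    refine MvPolynomial.algHom_ext fun ⟨r, i⟩ => ?_
    have hU : (bA P).repr (U r) i = MvPolynomial.X (r, i) := by
      simp [U, bA, Algebra.TensorProduct.basis_repr_tmul, Finsupp.single_apply]
    have e := congr((bA A).repr ($hφ r) i)
    change (bA A).repr (Algebra.TensorProduct.map φ (AlgHom.id k B) (q (U r))) i = _ at e
    rw [hmap, hmap, hU] at e
    refine e.trans ?_
    change _ = ev (MvPolynomial.X (r, i))
    exact (hX A (fun x => (bA A).repr (v x.1) x.2) (r, i)).symm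
end

section
variable {S : Scheme.{u}} (D X : Over S)

/-- The presheaf `T ↦ Hom_S(T ×_S D, X)` on `S`-schemes. -/
noncomputable abbrev homPresheaf : (Over S)ᵒᵖ ⥤ Type u := (tensorRight D).op ⋙ yoneda.obj X

lemma homPresheaf_map {Y Z : Over S} (φ : Z ⟶ Y) (γ : Y ⊗ D ⟶ X) :
    (homPresheaf D X).map φ.op γ = φ ▷ D ≫ γ := rfl

theorem existsUnique_glue (Y : Over S) (𝒰 : Y.left.OpenCover) (s : ∀ j, 𝒰.X j ⟶ S)
    (hs : ∀ j, 𝒰.f j ≫ Y.hom = s j) (γ : ∀ j, Over.mk (s j) ⊗ D ⟶ X)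
    (hγ : ∀ i j (Z : Over S) (a : Z ⟶ Over.mk (s i)) (b : Z ⟶ Over.mk (s j)),
      a.left ≫ 𝒰.f i = b.left ≫ 𝒰.f j → a ▷ D ≫ γ i = b ▷ D ≫ γ j) :
    ∃! δ : Y ⊗ D ⟶ X, ∀ j, (Over.homMk (𝒰.f j) (hs j) : Over.mk (s j) ⟶ Y) ▷ D ≫ δ = γ j := by
  let 𝒱 : Scheme.OpenCover (Y ⊗ D).left := 𝒰.pullback₁ (fst Y D).left
  let W (j : 𝒰.I₀) : Over S := Over.mk (𝒱.f j ≫ (Y ⊗ D).hom)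
  let v (j : 𝒰.I₀) : W j ⟶ Y ⊗ D := Over.homMk (𝒱.f j)
  have hcond (j : 𝒰.I₀) : 𝒱.f j ≫ (fst Y D).left = pullback.snd _ _ ≫ 𝒰.f j := pullback.condition
  let p (j : 𝒰.I₀) : W j ⟶ Over.mk (s j) := Over.homMk (pullback.snd (fst Y D).left (𝒰.f j)) (by
    have := hcond j
    change pullback.snd (fst Y D).left (𝒰.f j) ≫ s j = 𝒱.f j ≫ (Y ⊗ D).hom
    rw [← hs j, ← Over.w (fst Y D)]
    exact (Category.assoc _ _ _).symm.trans ((congr_arg (· ≫ Y.hom) this.symm).trans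
      (Category.assoc _ _ _)))
  let q (j : 𝒰.I₀) : W j ⟶ Over.mk (s j) ⊗ D := lift (p j) (v j ≫ snd Y D)
  have hq (j) : q j ≫ (Over.homMk (𝒰.f j) (hs j) : Over.mk (s j) ⟶ Y) ▷ D = v j := by
    ext1 <;> simp [q]
    ext1
    exact (hcond j).symm
  have hcomp (i j) : pullback.fst (𝒱.f i) (𝒱.f j) ≫ (q i ≫ γ i).left =
      pullback.snd (𝒱.f i) (𝒱.f j) ≫ (q j ≫ γ j).left := by
    let Q : Over S := Over.mk (pullback.fst (𝒱.f i) (𝒱.f j) ≫ (W i).hom)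
    let a : Q ⟶ W i := Over.homMk (pullback.fst (𝒱.f i) (𝒱.f j))
    let b : Q ⟶ W j := Over.homMk (pullback.snd (𝒱.f i) (𝒱.f j)) (by
      simp [Q, W, pullback.condition_assoc])
    have hab : a ≫ v i = b ≫ v j := by
      refine Over.OverMorphism.ext ?_; exact pullback.condition
    have h1 : a ≫ q i = lift (𝟙 Q) (a ≫ v i ≫ snd Y D) ≫ (a ≫ p i) ▷ D := by
      ext1 <;> simp [q]
    have h2 : b ≫ q j = lift (𝟙 Q) (a ≫ v i ≫ snd Y D) ≫ (b ≫ p j) ▷ D := by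
      rw [← Category.assoc a, hab, Category.assoc]
      ext1 <;> simp [q]
    have h3 := hγ i j Q (a ≫ p i) (b ≫ p j) (by
      have e := congr(($hab ≫ fst Y D).left)
      simp only [Over.comp_left, Category.assoc] at e ⊢
      have e1 := hcond i
      have e2 := hcond j
      change _ ≫ 𝒱.f i ≫ _ = _ ≫ 𝒱.f j ≫ _ at e
      rw [e1, e2] at e
      exact e)
    have h4 : a ≫ q i ≫ γ i = b ≫ q j ≫ γ j := by
      rw [← Category.assoc, ← Category.assoc, h1, h2, Category.assoc, Category.assoc, h3]
    exact congr($(h4).left)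
  have hext (δ δ' : Y ⊗ D ⟶ X) (h : ∀ j, v j ≫ δ = v j ≫ δ') : δ = δ' := by
    refine Over.OverMorphism.ext (Scheme.Cover.hom_ext 𝒱 _ _ fun j => ?_)
    exact congr_arg CommaMorphism.left (h j)
  obtain ⟨δ, hδ⟩ : ∃ δ : Y ⊗ D ⟶ X, ∀ j, v j ≫ δ = q j ≫ γ j := by
    have key (j : 𝒰.I₀) := Scheme.Cover.ι_glueMorphisms 𝒱 (fun j => (q j ≫ γ j).left) hcomp j
    refine ⟨Over.homMk (Scheme.Cover.glueMorphisms 𝒱 (fun j => (q j ≫ γ j).left) hcomp) ?_, fun j => ?_⟩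
    · refine Scheme.Cover.hom_ext 𝒱 _ _ fun j => ?_
      refine (Category.assoc _ _ _).symm.trans ((congr_arg (· ≫ X.hom) (key j)).trans ?_)
      exact Over.w (q j ≫ γ j)
    · exact Over.OverMorphism.ext (key j)
  refine ⟨δ, fun j => ?_, fun δ' hδ' => hext _ _ fun j => ?_⟩
  · let r : Over.mk (s j) ⊗ D ⟶ W j := Over.homMk (pullback.lift
      (((Over.homMk (𝒰.f j) (hs j) : Over.mk (s j) ⟶ Y) ▷ D).left) (fst _ D).left (by
        rw [← Over.comp_left, whiskerRight_fst]; rfl)) (by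
        change _ ≫ pullback.fst _ _ ≫ _ = _
        rw [pullback.lift_fst_assoc, Over.w])
    have hr : r ≫ v j = (Over.homMk (𝒰.f j) (hs j) : Over.mk (s j) ⟶ Y) ▷ D := by
      refine Over.OverMorphism.ext ?_; exact pullback.lift_fst _ _ _
    have hrp : r ≫ p j = fst _ D := by
      refine Over.OverMorphism.ext ?_; exact pullback.lift_snd _ _ _
    have hrq : r ≫ q j = 𝟙 _ := by
      ext1
      · simp [q, hrp]
      · simp [q, reassoc_of% hr]
    rw [← hr, Category.assoc, hδ, ← Category.assoc, hrq, Category.id_comp]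
  · rw [hδ, ← hδ' j, ← Category.assoc, hq]

theorem isSheaf_sig_homPresheaf :
    Presieve.IsSheaf Scheme.zariskiTopology (sig (homPresheaf D X)) := by
  rw [Precoverage.isSheaf_toGrothendieck_iff_of_isStableUnderBaseChange]
  intro Y R hR
  obtain ⟨(𝒰 : Scheme.OpenCover Y), rfl⟩ := Scheme.exists_cover_of_mem_pretopology hR
  rw [Presieve.isSheafFor_arrows_iff]
  intro x hx
  have hx' (i j) (Z : Scheme.{u}) (a : Z ⟶ 𝒰.X i) (b : Z ⟶ 𝒰.X j) (h : a ≫ 𝒰.f i = b ≫ 𝒰.f j) :=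
    hx i j Z a b h
  let s : Y ⟶ S := 𝒰.glueMorphisms (fun j => (x j).1) fun i j =>
    congr_arg Sigma.fst (hx i j _ _ _ pullback.condition)
  have hs (j) : 𝒰.f j ≫ s = (x j).1 := 𝒰.ι_glueMorphisms _ _ _
  obtain ⟨δ, h1, h2⟩ := existsUnique_glue D X (Over.mk s) 𝒰 (fun j => (x j).1) hs
    (fun j => (x j).2) (by
      intro i j Z a b hab
      have h := hx i j _ a.left b.left hab
      have ha := sig_map_eq (homPresheaf D X) a.left (x i).1 (x i).2 (s' := Z.hom) _ a rfl rfl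
      have hb := sig_map_eq (homPresheaf D X) b.left (x j).1 (x j).2 (s' := Z.hom) _ b rfl rfl
      exact eq_of_heq (Sigma.mk.inj_iff.mp (ha.symm.trans (h.trans hb))).2)
  refine ⟨⟨s, δ⟩, fun j => ?_, ?_⟩
  · exact sig_map_eq (homPresheaf D X) (𝒰.f j) s δ (x j).2 (Over.homMk (𝒰.f j) (hs j)) rfl (h1 j)
  · rintro ⟨s', δ'⟩ h
    have : s' = s := Scheme.Cover.hom_ext 𝒰 _ _ fun j => by
      rw [hs]; exact congr_arg Sigma.fst (h j)
    subst this
    congr 1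
    refine h2 _ fun j => ?_
    obtain ⟨ψ, hψ, h'⟩ := (sig_map_eq_iff (homPresheaf D X) _ _ _ _).mp (h j)
    rw [← h']
    congr 2
    ext1; exact hψ.symm
end

section
open scoped TensorProduct
variable (k : Type u) [CommRing k] (B : Type u) [CommRing B] [Algebra k B]

/-- An algebra as a scheme over the base. -/
noncomputable abbrev specOver : Over (Spec (.of k)) :=
  Over.mk (Spec.map (CommRingCat.ofHom (algebraMap k B)))

variable {B} in
/-- The morphism of schemes over the base given by an algebra homomorphism. -/
noncomputable abbrev specOverMap {A : Type u} [CommRing A] [Algebra k A] (φ : B →ₐ[k] A) :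
    specOver k A ⟶ specOver k B :=
  Over.homMk (Spec.map (CommRingCat.ofHom φ.toRingHom)) (by
    simp only [Over.mk_left, Over.mk_hom, ← Spec.map_comp, ← CommRingCat.ofHom_comp]
    congr 2
    ext x
    simp)

lemma exists_specOverMap {A : Type u} [CommRing A] [Algebra k A] (f : specOver k A ⟶ specOver k B) :
    ∃ φ : B →ₐ[k] A, f = specOverMap k φ := by
  have hf := Over.w f
  obtain ⟨φ, hφ⟩ := Spec.map_surjective f.left
  simp only [Over.mk_hom] at hf
  rw [← hφ, ← Spec.map_comp] at hf
  have hf' := Spec.map_injective hf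
  refine ⟨{ φ.hom with commutes' := fun r => ?_ }, ?_⟩
  · exact congr($(hf').hom r)
  · refine Over.OverMorphism.ext ?_
    rw [← hφ]; rfl

lemma specOverMap_injective {A : Type u} [CommRing A] [Algebra k A] {φ ψ : B →ₐ[k] A}
    (h : specOverMap k φ = specOverMap k ψ) : φ = ψ := by
  have h1 : Spec.map (CommRingCat.ofHom φ.toRingHom) = Spec.map (CommRingCat.ofHom ψ.toRingHom) :=
    congr_arg CommaMorphism.left h
  have h2 := Spec.map_injective h1
  ext x
  exact congr($(h2).hom x)

/-- `Spec A ×_k Spec B` is `Spec (A ⊗_k B)`. -/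
noncomputable def tensorSpec (A : Type u) [CommRing A] [Algebra k A] :
    specOver k A ⊗ specOver k B ≅ specOver k (A ⊗[k] B) :=
  Over.isoMk (pullbackSpecIso k A B) (by
    exact pullbackSpecIso_hom_base k A B)

lemma tensorSpec_naturality (A A' : Type u) [CommRing A] [Algebra k A] [CommRing A'] [Algebra k A']
    (φ : A →ₐ[k] A') :
    (tensorSpec k B A').inv ≫ specOverMap k φ ▷ specOver k B =
      specOverMap k (Algebra.TensorProduct.map φ (AlgHom.id k B)) ≫ (tensorSpec k B A).inv := by
  have e1 (A : Type u) [CommRing A] [Algebra k A] : (tensorSpec k B A).inv.left ≫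
      (fst (specOver k A) (specOver k B)).left =
      Spec.map (CommRingCat.ofHom Algebra.TensorProduct.includeLeftRingHom) :=
    pullbackSpecIso_inv_fst k A B
  have e2 (A : Type u) [CommRing A] [Algebra k A] : (tensorSpec k B A).inv.left ≫
      (snd (specOver k A) (specOver k B)).left =
      Spec.map (CommRingCat.ofHom (Algebra.TensorProduct.includeRight (R := k)
        (A := A) (B := B)).toRingHom) :=
    pullbackSpecIso_inv_snd k A B
  have l {R R' : Type u} [CommRing R] [Algebra k R] [CommRing R'] [Algebra k R'] (ψ : R →ₐ[k] R') :
    (specOverMap k ψ).left = Spec.map (CommRingCat.ofHom ψ.toRingHom) := rfl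
  ext1
  · rw [Category.assoc, Category.assoc, whiskerRight_fst]
    refine Over.OverMorphism.ext ?_
    rw [Over.comp_left, Over.comp_left, Over.comp_left, Over.comp_left, ← Category.assoc, e1, e1,
      l, l, ← Spec.map_comp, ← Spec.map_comp]
    congr 1
  · rw [Category.assoc, Category.assoc, whiskerRight_snd]
    refine Over.OverMorphism.ext ?_
    rw [Over.comp_left, Over.comp_left, Over.comp_left, e2, e2, l, ← Spec.map_comp]
    congr 1
    ext x
    simp

theorem affine_universal [Module.Free k B] [Module.Finite k B] (R : Type u) [CommRing R]
    [Algebra k R] : ∃ (J : Over (Spec (.of k))) (x : J ⊗ specOver k B ⟶ specOver k R),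
      ∀ (A : CommRingCat.{u}) (s : Spec A ⟶ Spec (.of k))
        (z : Over.mk s ⊗ specOver k B ⟶ specOver k R),
        ∃! φ : Over.mk s ⟶ J, φ ▷ specOver k B ≫ x = z := by
  obtain ⟨H, _, _, w, hw⟩ := exists_weilRestriction k B R
  refine ⟨specOver k H, (tensorSpec k B H).hom ≫ specOverMap k w, fun A s z => ?_⟩
  obtain ⟨σ, rfl⟩ := Spec.map_surjective s
  let _ : Algebra k A := σ.hom.toAlgebra
  change ∃! φ : specOver k A ⟶ specOver k H, _
  obtain ⟨v, hv⟩ := exists_specOverMap k R ((tensorSpec k B A).inv ≫ z)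
  obtain ⟨φ, h1, h2⟩ := hw A v
  have key (ψ : H →ₐ[k] A) : specOverMap k ψ ▷ specOver k B ≫ (tensorSpec k B H).hom ≫
      specOverMap k w = (tensorSpec k B A).hom ≫
        specOverMap k ((Algebra.TensorProduct.map ψ (AlgHom.id k B)).comp w) := by
    have h := tensorSpec_naturality k B H A ψ
    rw [Iso.inv_comp_eq] at h
    rw [h]
    simp only [Category.assoc, Iso.inv_hom_id_assoc]
    congr 1
    refine Over.OverMorphism.ext ?_
    simp only [Over.comp_left, Over.homMk_left, ← Spec.map_comp]
    rfl
  refine ⟨specOverMap k φ, ?_, fun ψ hψ => ?_⟩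
  · beta_reduce
    rw [key, h1, ← hv, Iso.hom_inv_id_assoc]
  · obtain ⟨ψ, rfl⟩ := exists_specOverMap k H ψ
    rw [key, ← Iso.eq_inv_comp, hv] at hψ
    rw [h2 ψ (specOverMap_injective k R hψ)]
end

section
variable {S : Scheme.{u}} {D X : Over S}

theorem universal_of_affine {J : Over S} {x : J ⊗ D ⟶ X}
    (h : ∀ (A : CommRingCat.{u}) (s : Spec A ⟶ S) (z : Over.mk s ⊗ D ⟶ X),
      ∃! φ : Over.mk s ⟶ J, φ ▷ D ≫ x = z) (Z : Over S) (z : Z ⊗ D ⟶ X) :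
    ∃! φ : Z ⟶ J, φ ▷ D ≫ x = z := by
  have uniq (Z : Over S) (φ ψ : Z ⟶ J) (e : φ ▷ D ≫ x = ψ ▷ D ≫ x) : φ = ψ := by
    refine Over.OverMorphism.ext (Scheme.Cover.hom_ext Z.left.affineCover _ _ fun j => ?_)
    let i : Over.mk (Z.left.affineCover.f j ≫ Z.hom) ⟶ Z := Over.homMk (Z.left.affineCover.f j)
    refine congr_arg CommaMorphism.left ((h _ _ (i ▷ D ≫ φ ▷ D ≫ x)).unique
      (y₁ := i ≫ φ) (y₂ := i ≫ ψ) ?_ ?_)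
    · exact (congr_arg (· ≫ x) (comp_whiskerRight i φ D)).trans (Category.assoc _ _ _)
    · rw [e]
      exact (congr_arg (· ≫ x) (comp_whiskerRight i ψ D)).trans (Category.assoc _ _ _)
  let 𝒰 : Scheme.OpenCover Z.left := Z.left.affineCover
  let s (j : 𝒰.I₀) : 𝒰.X j ⟶ S := 𝒰.f j ≫ Z.hom
  let i (j : 𝒰.I₀) : Over.mk (s j) ⟶ Z := Over.homMk (𝒰.f j)
  have hφ (j : 𝒰.I₀) : ∃ φ : Over.mk (s j) ⟶ J, φ ▷ D ≫ x = i j ▷ D ≫ z := (h _ (s j) _).exists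
  choose φ hφ using hφ
  have hcomp (j l) : pullback.fst (𝒰.f j) (𝒰.f l) ≫ (φ j).left =
      pullback.snd (𝒰.f j) (𝒰.f l) ≫ (φ l).left := by
    let Q : Over S := Over.mk (pullback.fst (𝒰.f j) (𝒰.f l) ≫ s j)
    let a : Q ⟶ Over.mk (s j) := Over.homMk (pullback.fst (𝒰.f j) (𝒰.f l))
    let b : Q ⟶ Over.mk (s l) := Over.homMk (pullback.snd (𝒰.f j) (𝒰.f l)) (by
      simp [Q, s, pullback.condition_assoc])
    have hab : a ≫ i j = b ≫ i l := Over.OverMorphism.ext pullback.condition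
    refine congr_arg CommaMorphism.left (uniq Q (a ≫ φ j) (b ≫ φ l) ?_)
    rw [comp_whiskerRight, comp_whiskerRight, Category.assoc, Category.assoc, hφ, hφ,
      ← comp_whiskerRight_assoc, ← comp_whiskerRight_assoc, hab]
  have key (j : 𝒰.I₀) := Scheme.Cover.ι_glueMorphisms 𝒰 (fun j => (φ j).left) hcomp j
  let Φ : Z ⟶ J := Over.homMk (Scheme.Cover.glueMorphisms 𝒰 (fun j => (φ j).left) hcomp) (by
    refine Scheme.Cover.hom_ext 𝒰 _ _ fun j => ?_
    exact (Category.assoc _ _ _).symm.trans ((congr_arg (· ≫ J.hom) (key j)).trans (Over.w (φ j))))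
  have hΦ (j) : i j ≫ Φ = φ j := Over.OverMorphism.ext (key j)
  have hz : Φ ▷ D ≫ x = z := by
    refine (existsUnique_glue D X Z 𝒰 s (fun _ => rfl) (fun j => i j ▷ D ≫ z) ?_).unique ?_ ?_
    · intro j l Z a b hab
      rw [← comp_whiskerRight_assoc, ← comp_whiskerRight_assoc]
      congr 2
      exact Over.OverMorphism.ext hab
    · intro j
      change i j ▷ D ≫ Φ ▷ D ≫ x = _
      rw [← comp_whiskerRight_assoc, hΦ, hφ]
    · exact fun _ => rfl
  exact ⟨Φ, hz, fun Ψ e => uniq _ _ _ (e.trans hz.symm)⟩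
end

section
variable {F : Scheme.{u}ᵒᵖ ⥤ Type u}

/-- An element `w` of `F(J)` that makes `J` an open subfunctor of `F`. -/
structure IsOpenElement {J : Scheme.{u}} (w : F.obj (op J)) : Prop where
  inj : ∀ (T : Scheme.{u}) (φ ψ : T ⟶ J), F.map φ.op w = F.map ψ.op w → φ = ψ
  exists_open : ∀ (T : Scheme.{u}) (t : F.obj (op T)), ∃ (V : Scheme.{u}) (p : V ⟶ T) (v : V ⟶ J),
    IsOpenImmersion p ∧ F.map v.op w = F.map p.op t ∧
      ∀ (T' : Scheme.{u}) (φ : T' ⟶ T) (v' : T' ⟶ J), F.map v'.op w = F.map φ.op t →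
        ∃ ψ : T' ⟶ V, ψ ≫ p = φ

lemma IsOpenElement.presheaf {J : Scheme.{u}} {w : F.obj (op J)} (h : IsOpenElement w) :
    MorphismProperty.presheaf (@IsOpenImmersion) (yonedaEquiv.symm w) := by
  refine MorphismProperty.relative.of_exists fun T g => ?_
  obtain ⟨t, rfl⟩ := yonedaEquiv.symm.surjective g
  obtain ⟨V, p, v, hp, hv, hV⟩ := h.exists_open T t
  refine ⟨V, yoneda.map v, p, ?_, hp⟩
  refine IsPullback.of_forall_isPullback_app fun ⟨T'⟩ => ?_
  rw [Types.isPullback_iff]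
  refine ⟨?_, ?_, ?_⟩
  · refine ConcreteCategory.hom_ext _ _ fun φ => ?_
    change F.map (φ ≫ v).op w = F.map (φ ≫ p).op t
    rw [op_comp, op_comp, Functor.map_comp_apply, Functor.map_comp_apply, hv]
  · rintro (φ : T' ⟶ V) (ψ : T' ⟶ V) ⟨-, (e : φ ≫ p = ψ ≫ p)⟩
    exact (cancel_mono p).mp e
  · rintro (v' : T' ⟶ J) (φ : T' ⟶ T) (e : F.map v'.op w = F.map φ.op t)
    obtain ⟨ψ, rfl⟩ := hV T' φ v' e
    refine ⟨ψ, h.inj _ _ _ ?_, rfl⟩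
    change F.map (ψ ≫ v).op w = _
    rw [e, op_comp, op_comp, Functor.map_comp_apply, Functor.map_comp_apply, hv]

theorem isRepresentable_of_openElements (hF : Presieve.IsSheaf Scheme.zariskiTopology F)
    {ι : Type u} {J : ι → Scheme.{u}} (w : ∀ i, F.obj (op (J i))) (h : ∀ i, IsOpenElement (w i))
    (hs : ∀ (T : Scheme.{u}) (t : F.obj (op T)), ∃ 𝒰 : Scheme.OpenCover.{u} T, ∀ j,
      ∃ (i : ι) (φ : 𝒰.X j ⟶ J i), F.map φ.op (w i) = F.map (𝒰.f j).op t) :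
    F.IsRepresentable := by
  let G : Sheaf Scheme.zariskiTopology.{u} (Type u) := ⟨F, (isSheaf_iff_isSheaf_of_type _ _).mpr hF⟩
  let f (i : ι) : yoneda.obj (J i) ⟶ G.1 := yonedaEquiv.symm (w i)
  have : Presheaf.IsLocallySurjective Scheme.zariskiTopology (Sigma.desc f) := ⟨by
    intro T t
    obtain ⟨𝒰, h𝒰⟩ := hs T t
    refine GrothendieckTopology.superset_covering _ ?_ 𝒰.mem_grothendieckTopology
    rw [Sieve.generate_le_iff]
    rintro _ _ ⟨j⟩
    obtain ⟨i, φ, hφ⟩ := h𝒰 j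
    refine ⟨(Sigma.ι (fun i => yoneda.obj (J i)) i).app _ φ, ?_⟩
    refine Eq.trans ?_ hφ
    exact congr($(Sigma.ι_desc f i).app (op (𝒰.X j)) φ)⟩
  exact Scheme.LocalRepresentability.isRepresentable (F := G) (f := f) fun i => (h i).presheaf
end

section
variable {S : Scheme.{u}} {D : Over S} (σ : 𝟙_ (Over S) ⟶ D)

/-- The section of `Z ⊗ D ⟶ Z` induced by a section of `D`. -/
noncomputable def zeroSec (Z : Over S) : Z ⟶ Z ⊗ D := lift (𝟙 Z) (toUnit Z ≫ σ)

lemma zeroSec_naturality {Z Z' : Over S} (φ : Z' ⟶ Z) :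
    zeroSec σ Z' ≫ φ ▷ D = φ ≫ zeroSec σ Z := by
  ext1 <;> simp [zeroSec]

lemma zeroSec_surjective [hσ : Surjective σ.left] (Z : Over S) : Surjective (zeroSec σ Z).left := by
  have h : IsPullback (zeroSec σ Z) (toUnit Z) (snd Z D) σ := by
    refine ⟨⟨by simp [zeroSec]⟩, ⟨PullbackCone.IsLimit.mk _ (fun s => s.fst ≫ fst Z D) ?_ ?_ ?_⟩⟩
    · intro s
      have e := s.condition
      have e' : s.snd = toUnit _ := Subsingleton.elim _ _
      ext1
      · simp [zeroSec]
      · rw [e, e']; simp [zeroSec]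
    · intro s; exact Subsingleton.elim _ _
    · intro s m h1 _
      rw [← h1]; simp [zeroSec]
  have h' := h.map (Over.forget S)
  exact MorphismProperty.of_isPullback (P := @Surjective) h'.flip hσ

theorem isOpenElement [Surjective σ.left] {X U J : Over S} (i : U ⟶ X) [IsOpenImmersion i.left]
    (x : J ⊗ D ⟶ U) (hx : ∀ (Z : Over S) (z : Z ⊗ D ⟶ U), ∃! φ : Z ⟶ J, φ ▷ D ≫ x = z) :
    IsOpenElement (F := sig (homPresheaf D X)) (J := J.left) ⟨J.hom, x ≫ i⟩ where
  inj T φ ψ e := by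
    have : Mono i := Over.mono_of_mono_left i
    let a : Over.mk (φ ≫ J.hom) ⟶ J := Over.homMk φ
    obtain ⟨b, hb, hba⟩ := (sig_map_eq_iff (homPresheaf D X) ψ J.hom (x ≫ i) (a ▷ D ≫ x ≫ i)).mp
      e.symm
    have hb' : b ▷ D ≫ x = a ▷ D ≫ x := by
      rw [← cancel_mono i, Category.assoc, Category.assoc]; exact hba
    have hab : b = a := (hx _ _).unique hb' rfl
    rw [← hb, hab]; rfl
  exists_open T t := by
    obtain ⟨s, γ⟩ := t
    let Z : Over S := Over.mk s
    change Z ⊗ D ⟶ X at γ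
    let V : T.Opens := (zeroSec σ Z ≫ γ).left ⁻¹ᵁ i.left.opensRange
    let Z' : Over S := Over.mk (V.ι ≫ s)
    let P : Z' ⟶ Z := Over.homMk V.ι
    have hr : Set.range (P ▷ D ≫ γ).left ⊆ Set.range i.left := by
      rintro _ ⟨y, rfl⟩
      obtain ⟨q, rfl⟩ := (zeroSec_surjective σ Z').surj y
      rw [← Scheme.Hom.comp_apply, ← Over.comp_left, ← Category.assoc, zeroSec_naturality,
        Category.assoc, Over.comp_left, Scheme.Hom.comp_apply]
      exact (q : V).2
    let z : Z' ⊗ D ⟶ U := Over.homMk (IsOpenImmersion.lift i.left (P ▷ D ≫ γ).left hr) (by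
      rw [← Over.w i, ← Over.w (P ▷ D ≫ γ), ← Category.assoc, IsOpenImmersion.lift_fac])
    have hz : z ≫ i = P ▷ D ≫ γ := Over.OverMorphism.ext (IsOpenImmersion.lift_fac _ _ _)
    obtain ⟨v, hv, -⟩ := hx Z' z
    refine ⟨V, V.ι, v.left, inferInstance, ?_, fun T' φ v' e => ?_⟩
    · refine (sig_map_eq (homPresheaf D X) v.left J.hom (x ≫ i) (P ▷ D ≫ γ) v rfl ?_).trans
        (sig_map_eq (homPresheaf D X) V.ι s γ (P ▷ D ≫ γ) P rfl rfl).symm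
      change v ▷ D ≫ x ≫ i = _
      rw [← Category.assoc, hv, hz]
    · let W : Over S := Over.mk (v' ≫ J.hom)
      let a : W ⟶ J := Over.homMk v'
      obtain ⟨b, hb, hba⟩ := (sig_map_eq_iff (homPresheaf D X) φ s γ (a ▷ D ≫ x ≫ i)).mp e.symm
      change W ⟶ Z at b
      change b ▷ D ≫ γ = a ▷ D ≫ x ≫ i at hba
      refine ⟨IsOpenImmersion.lift V.ι φ ?_, IsOpenImmersion.lift_fac _ _ _⟩
      rw [Scheme.Opens.range_ι]
      rintro _ ⟨q, rfl⟩
      have h := zeroSec_naturality σ b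
      have h2 : (b ≫ zeroSec σ Z ≫ γ) = (zeroSec σ W ≫ a ▷ D ≫ x) ≫ i := by
        rw [← Category.assoc, ← h, Category.assoc, hba, Category.assoc, Category.assoc]
      change (zeroSec σ Z ≫ γ).left (φ q) ∈ Set.range i.left
      rw [← hb]
      refine ⟨(zeroSec σ W ≫ a ▷ D ≫ x).left q, ?_⟩
      rw [← Scheme.Hom.comp_apply, ← Scheme.Hom.comp_apply]
      exact congr($(congr_arg CommaMorphism.left h2) q).symm

theorem homPresheaf_isRepresentable_of_open [Surjective σ.left] (X : Over S)
    (𝒲 : Scheme.OpenCover.{u} X.left) (h : ∀ j : 𝒲.I₀, ∃ (J : Over S)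
      (x : J ⊗ D ⟶ Over.mk (𝒲.f j ≫ X.hom)), ∀ (Z : Over S)
      (z : Z ⊗ D ⟶ Over.mk (𝒲.f j ≫ X.hom)), ∃! φ : Z ⟶ J, φ ▷ D ≫ x = z) :
    (homPresheaf D X).IsRepresentable := by
  choose J x hx using h
  let U (j : 𝒲.I₀) : Over S := Over.mk (𝒲.f j ≫ X.hom)
  let i (j : 𝒲.I₀) : U j ⟶ X := Over.homMk (𝒲.f j)
  have hi (j) : IsOpenImmersion (i j).left := 𝒲.map_prop j
  refine isRepresentable_of_sig _ (isRepresentable_of_openElements (isSheaf_sig_homPresheaf D X)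
    (J := fun j => (J j).left) (fun j => ⟨(J j).hom, x j ≫ i j⟩)
    (fun j => isOpenElement σ (i j) (x j) (hx j)) fun T ⟨s, γ⟩ => ?_)
  let Z : Over S := Over.mk s
  change Z ⊗ D ⟶ X at γ
  let g : T ⟶ X.left := (zeroSec σ Z ≫ γ).left
  suffices H : ∀ j : 𝒲.I₀, ∃ (i : 𝒲.I₀) (φ : pullback g (𝒲.f j) ⟶ (J i).left),
      (sig (homPresheaf D X)).map φ.op ⟨(J i).hom, x i ≫ Over.homMk (𝒲.f i)⟩ =
        (sig (homPresheaf D X)).map (pullback.fst g (𝒲.f j)).op ⟨s, γ⟩ from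
    ⟨𝒲.pullback₁ g, H⟩
  intro j
  let Z' : Over S := Over.mk (pullback.fst g (𝒲.f j) ≫ s)
  let P : Z' ⟶ Z := Over.homMk (pullback.fst g (𝒲.f j))
  have hr : Set.range (P ▷ D ≫ γ).left ⊆ Set.range (i j).left := by
    rintro _ ⟨y, rfl⟩
    obtain ⟨q, rfl⟩ := (zeroSec_surjective σ Z').surj y
    rw [← Scheme.Hom.comp_apply, ← Over.comp_left, ← Category.assoc, zeroSec_naturality,
      Category.assoc, Over.comp_left, Scheme.Hom.comp_apply]
    refine ⟨pullback.snd g (𝒲.f j) q, ?_⟩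
    have e : pullback.snd g (𝒲.f j) ≫ 𝒲.f j = pullback.fst g (𝒲.f j) ≫ g :=
      pullback.condition.symm
    have e' := congr($e q)
    rw [Scheme.Hom.comp_apply, Scheme.Hom.comp_apply] at e'
    exact e'
  let z : Z' ⊗ D ⟶ U j := Over.homMk (IsOpenImmersion.lift (i j).left (P ▷ D ≫ γ).left hr) (by
    rw [← Over.w (i j), ← Over.w (P ▷ D ≫ γ), ← Category.assoc, IsOpenImmersion.lift_fac])
  have hz : z ≫ i j = P ▷ D ≫ γ := Over.OverMorphism.ext (IsOpenImmersion.lift_fac _ _ _)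
  obtain ⟨v, hv, -⟩ := hx j Z' z
  refine ⟨j, v.left, ?_⟩
  refine (sig_map_eq (homPresheaf D X) v.left (J j).hom (x j ≫ i j) (P ▷ D ≫ γ) v rfl ?_).trans
    (sig_map_eq (homPresheaf D X) _ s γ (P ▷ D ≫ γ) P rfl rfl).symm
  change v ▷ D ≫ x j ≫ i j = _
  rw [← Category.assoc, hv, hz]
end

section
variable (k : Type u) [CommRing k] (B : Type u) [CommRing B] [Algebra k B]

theorem affine_universal' [Module.Free k B] [Module.Finite k B] (R : CommRingCat.{u})
    (s : Spec R ⟶ Spec (.of k)) : ∃ (J : Over (Spec (.of k))) (x : J ⊗ specOver k B ⟶ Over.mk s),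
      ∀ (Z : Over (Spec (.of k))) (z : Z ⊗ specOver k B ⟶ Over.mk s),
        ∃! φ : Z ⟶ J, φ ▷ specOver k B ≫ x = z := by
  obtain ⟨τ, rfl⟩ := Spec.map_surjective s
  let _ : Algebra k R := τ.hom.toAlgebra
  obtain ⟨J, x, h⟩ := affine_universal k B R
  exact ⟨J, x, universal_of_affine h⟩

/-- Weil restriction along a finite free algebra `B` with a nilpotent augmentation exists. -/
theorem homPresheaf_isRepresentable [Module.Free k B] [Module.Finite k B] (aug : B →ₐ[k] k)
    (haug : ∀ b, aug b = 0 → IsNilpotent b) (X : Over (Spec (.of k))) :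
    (homPresheaf (specOver k B) X).IsRepresentable := by
  let σ : 𝟙_ (Over (Spec (.of k))) ⟶ specOver k B :=
    Over.homMk (Spec.map (CommRingCat.ofHom aug.toRingHom)) (by
      change Spec.map _ ≫ Spec.map _ = 𝟙 _
      rw [← Spec.map_comp, ← CommRingCat.ofHom_comp, ← Spec.map_id]
      congr 2
      ext x
      simp)
  have : Surjective σ.left := by
    have hsurj : Function.Surjective aug := fun c => ⟨algebraMap k B c, aug.commutes c⟩
    have hp (p : PrimeSpectrum B) : p ∈ Set.range (PrimeSpectrum.comap aug.toRingHom) := by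
      rw [range_comap_of_surjective _ aug.toRingHom hsurj, PrimeSpectrum.mem_zeroLocus]
      intro b hb
      obtain ⟨n, hn⟩ := haug b hb
      exact p.2.mem_of_pow_mem n (hn ▸ p.asIdeal.zero_mem)
    exact ⟨hp⟩
  refine homPresheaf_isRepresentable_of_open σ X X.left.affineCover fun j => ?_
  exact affine_universal' k B _ _
end

section
variable (k : Type u) [CommRing k] (m : ℕ)

/-- The ring `k[t]/(t^(m+1))`. -/
abbrev TruncRing : Type u := Polynomial k ⧸ Ideal.span {(Polynomial.X : Polynomial k) ^ (m + 1)}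

instance : Module.Free k (TruncRing k m) := (Polynomial.monic_X_pow (m + 1)).free_quotient

instance : Module.Finite k (TruncRing k m) := (Polynomial.monic_X_pow (m + 1)).finite_quotient

lemma truncRing_mk_eq_iff (p q : Polynomial k) : (Ideal.Quotient.mk _ p : TruncRing k m) =
    Ideal.Quotient.mk _ q ↔ ∀ i < m + 1, p.coeff i = q.coeff i := by
  rw [Ideal.Quotient.mk_eq_mk_iff_sub_mem, Ideal.mem_span_singleton, Polynomial.X_pow_dvd_iff]
  simp [sub_eq_zero]

/-- The truncation `k⟦t⟧ → k[t]/(t^(m+1))`. -/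
noncomputable def truncHom : PowerSeries k →ₐ[k] TruncRing k m where
  toFun f := Ideal.Quotient.mk _ (PowerSeries.trunc (m + 1) f)
  map_one' := by rw [PowerSeries.trunc_one, map_one]
  map_mul' f g := by
    rw [← map_mul, truncRing_mk_eq_iff]
    intro i hi
    rw [PowerSeries.coeff_trunc, if_pos hi, PowerSeries.coeff_mul_eq_coeff_trunc_mul_trunc f g hi,
      ← Polynomial.coe_mul, Polynomial.coeff_coe]
  map_zero' := by simp
  map_add' f g := by rw [map_add, map_add]
  commutes' c := PowerSeries.trunc_C m c ▸ rfl

/-- The augmentation `t ↦ 0`. -/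
noncomputable def truncAug : TruncRing k m →ₐ[k] k :=
  Ideal.Quotient.liftₐ _ (Polynomial.aeval 0) (by
    intro a ha
    obtain ⟨b, rfl⟩ := Ideal.mem_span_singleton.mp ha
    simp)

lemma isNilpotent_of_truncAug (b : TruncRing k m) (hb : truncAug k m b = 0) : IsNilpotent b := by
  obtain ⟨p, rfl⟩ := Ideal.Quotient.mk_surjective b
  change Polynomial.aeval (0 : k) p = 0 at hb
  rw [Polynomial.aeval_def, Algebra.algebraMap_self, Polynomial.eval₂_id] at hb
  obtain ⟨q, rfl⟩ := Polynomial.dvd_iff_isRoot.mpr hb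
  refine ⟨m + 1, ?_⟩
  rw [← map_pow, Ideal.Quotient.eq_zero_iff_mem, Ideal.mem_span_singleton, map_zero, sub_zero,
    mul_pow]
  exact dvd_mul_right _ _

/-- `Spec k[t]/(t^(m+1))`. -/
noncomputable abbrev jetDisk : Over (Spec (.of k)) := specOver k (TruncRing k m)

/-- `Spec k⟦t⟧`. -/
noncomputable abbrev arcDisk : Over (Spec (.of k)) := specOver k (PowerSeries k)

/-- The closed immersion `Spec k[t]/(t^(m+1)) ⟶ Spec k⟦t⟧`. -/
noncomputable def jetDiskToArcDisk : jetDisk k m ⟶ arcDisk k := specOverMap k (truncHom k m)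

variable {k} (X X' : Over (Spec (.of k)))

theorem exists_jetScheme : (homPresheaf (jetDisk k m) X).IsRepresentable :=
  homPresheaf_isRepresentable k (TruncRing k m) (truncAug k m) (isNilpotent_of_truncAug k m) X

/-- The `m`-th jet scheme of `X`: the `k`-scheme with
`Hom_k(T, J_m X) = Hom_k(T ×_k Spec k[t]/(t^(m+1)), X)`, naturally in the `k`-scheme `T`. -/
noncomputable def jetScheme : Over (Spec (.of k)) := (exists_jetScheme m X).has_representation.choose

/-- The universal property of `J_m X`. -/
noncomputable def jetSchemeRepr : (homPresheaf (jetDisk k m) X).RepresentableBy (jetScheme m X) :=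
  (exists_jetScheme m X).has_representation.choose_spec.some

variable {X X'} in
/-- The morphism `J_m X' ⟶ J_m X` induced by `f`, by composing jets with `f`. -/
noncomputable def jetMap (f : X' ⟶ X) : jetScheme m X' ⟶ jetScheme m X :=
  (jetSchemeRepr m X).homEquiv.symm ((jetSchemeRepr m X').homEquiv (𝟙 _) ≫ f)

/-- The `k`-points of a `k`-scheme. -/
abbrev KPoint : Type u := 𝟙_ (Over (Spec (.of k))) ⟶ X

/-- The `k`-valued points of the arc space `J_∞ X`. -/
abbrev Arc : Type u := arcDisk k ⟶ X

variable {X} in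
/-- The truncation map from arcs to the `k`-points of `J_m X`. -/
noncomputable def arcTrunc (γ : Arc X) : KPoint (jetScheme m X) :=
  (jetSchemeRepr m X).homEquiv.symm (snd _ _ ≫ jetDiskToArcDisk k m ≫ γ)

end

section

/-- The `i`-th Fitting ideal of an `R`-module `M`. If `x` generates `M` and has `N` terms, it is
generated by the `(N - i)`-minors of the matrices whose rows are relations among the terms of `x`;
it does not depend on `x`, and it is the unit ideal for `N ≤ i`. -/
def fittingIdeal (R : Type*) [CommRing R] (M : Type*) [AddCommGroup M] [Module R M] (i : ℕ) :
    Ideal R :=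
  Ideal.span {d | ∃ (N : ℕ) (x : Fin N → M) (r : Fin (N - i) → Fin N → R)
    (c : Fin (N - i) → Fin N), Submodule.span R (Set.range x) = ⊤ ∧
      (∀ a, ∑ j, r a j • x j = 0) ∧ d = Matrix.det (fun a b => r a (c b))}

/-- The `i`-th Fitting ideal of the module of differentials of a ring homomorphism. -/
noncomputable def fittingKaehler {A B : CommRingCat.{u}} (φ : A ⟶ B) (i : ℕ) : Ideal B :=
  let _ : Algebra A B := φ.hom.toAlgebra
  fittingIdeal B (Ω[B⁄A]) i

/-- The Fitting ideal sheaf `Fitt^i(Ω_{X/Y})`. It is the ideal sheaf whose sections over an affine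
open `V` are those functions whose restrictions to every affine open `V' ⊆ V` that maps into an
affine open `U` of `Y` lie in the `i`-th Fitting ideal of the differentials of `𝒪(V')` over
`𝒪(U)`. -/
noncomputable def fittingSheaf {X Y : Scheme.{u}} (f : X ⟶ Y) (i : ℕ) : X.IdealSheafData :=
  Scheme.IdealSheafData.ofIdeals fun V =>
    ⨅ (V' : X.affineOpens) (U : Y.affineOpens) (h : V'.1 ≤ V.1) (e : V'.1 ≤ f ⁻¹ᵁ U.1),
      (fittingKaehler (f.appLE U.1 V'.1 e) i).comap (X.presheaf.map (homOfLE h).op).hom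

variable {k : Type u} [CommRing k]

/-- The Jacobian ideal `Jac_X = Fitt^n(Ω_{X/k})` of a scheme of pure dimension `n`. -/
noncomputable def jacScheme (X : Over (Spec (.of k))) (n : ℕ) : X.left.IdealSheafData :=
  fittingSheaf X.hom n

/-- The Jacobian ideal `Jac_f = Fitt^0(Ω_{X'/X})` of a morphism `f : X' ⟶ X`. -/
noncomputable def jacMor {X' X : Over (Spec (.of k))} (f : X' ⟶ X) : X'.left.IdealSheafData :=
  fittingSheaf f.left 0

/-- The ideal of `k⟦t⟧` generated by the pullback of an ideal sheaf along an arc. -/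
noncomputable def arcIdeal {X : Over (Spec (.of k))} (I : X.left.IdealSheafData) (γ : Arc X) :
    Ideal (PowerSeries k) :=
  ((I.comap γ.left).ideal ⟨⊤, isAffineOpen_top (Spec (.of (PowerSeries k)))⟩).map
    (Scheme.ΓSpecIso (.of (PowerSeries k))).hom.hom

/-- The contact locus `Cont^e(I)`: the arcs along which `I` has order exactly `e`. -/
def contact {X : Over (Spec (.of k))} (I : X.left.IdealSheafData) (e : ℕ) : Set (Arc X) :=
  {γ | arcIdeal I γ = Ideal.span {(PowerSeries.X : PowerSeries k) ^ e}}

/-- The set `C_{e,e'} = Cont^e(Jac_f) ∩ f_∞⁻¹(Cont^{e'}(Jac_X))`, where `n = dim X`. -/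
def jacContact {X' X : Over (Spec (.of k))} (f : X' ⟶ X) (n e e' : ℕ) : Set (Arc X') :=
  contact (jacMor f) e ∩ {γ | γ ≫ f ∈ contact (jacScheme X n) e'}

/-- `f` is birational: it restricts to an isomorphism between dense open subschemes. -/
def IsBirational {X' X : Scheme.{u}} (f : X' ⟶ X) : Prop :=
  ∃ p : Scheme.PartialIso X' X, p.iso.hom ≫ p.target.ι = p.source.ι ≫ f

/-- Every irreducible component of `X` has dimension `n`. -/
def IsPureDimensional (X : Scheme.{u}) (n : ℕ) : Prop :=
  ∀ Z ∈ irreducibleComponents X, topologicalKrullDim Z = n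

/-- The affine space `𝔸^e` over `k`. -/
noncomputable def affineSpace (k : Type u) [CommRing k] (e : ℕ) : Over (Spec (.of k)) :=
  Over.mk (𝔸(ULift.{u} (Fin e); Spec (.of k)) ↘ Spec (.of k))

/-- The subset of the `k`-points of `V` that lie in the image of `i : T ⟶ V`. -/
def kPointsIn {T V : Over (Spec (.of k))} (i : T ⟶ V) : Set (KPoint V) :=
  Set.range fun t : KPoint T => t ≫ i

/-- The morphism `g : V' ⟶ V` gives a weakly piecewise trivial fibration `W' → W` with fiber `F`,
where `W'` and `W` are sets of `k`-points: `g` maps `W'` into `W`, and `W` is a finite disjoint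
union of locally closed subsets `T i` (given as reduced subschemes of `V`) such that each
`W' ∩ g⁻¹(T i)` is locally closed in `V'` and, with its reduced scheme structure `T'`, the morphism
`q : T' ⟶ T i` induced by `g` factors as an isomorphism `T' ≅ Y × F` followed by the projection to
`Y` and by a bijective morphism `w : Y ⟶ T i`. -/
def IsWeaklyPiecewiseTrivial {V' V : Over (Spec (.of k))} (g : V' ⟶ V) (W' : Set (KPoint V'))
    (W : Set (KPoint V)) (F : Over (Spec (.of k))) : Prop :=
  (∀ x ∈ W', x ≫ g ∈ W) ∧
  ∃ (r : ℕ) (T : Fin r → Over (Spec (.of k))) (i : ∀ a, T a ⟶ V),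
    (∀ a, AlgebraicGeometry.IsReduced (T a).left ∧ IsImmersion (i a).left) ∧
    (Pairwise fun a b => Disjoint (kPointsIn (i a)) (kPointsIn (i b))) ∧
    W = ⋃ a, kPointsIn (i a) ∧
    ∀ a, ∃ (T' : Over (Spec (.of k))) (i' : T' ⟶ V') (q : T' ⟶ T a),
      AlgebraicGeometry.IsReduced T'.left ∧ IsImmersion i'.left ∧
      kPointsIn i' = {x | x ∈ W' ∧ x ≫ g ∈ kPointsIn (i a)} ∧
      q ≫ i a = i' ≫ g ∧
      ∃ (Y : Over (Spec (.of k))) (v : T' ≅ Y ⊗ F) (w : Y ⟶ T a),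
        Function.Bijective w.left ∧ q = v.hom ≫ fst Y F ≫ w

end
end JetScheme

/-! The heart of the proof concerns one arc γ in C_{e,e'} and one m-jet δ₀ of X' with the same image
in J_m(X) as γ: such a δ₀ is congruent to γ modulo t^(m+1-e) (`JetChart.exists_arc_of_jet_comp_eq`).
To see this, lift δ₀ to an arc δ whose generic point lies where f is an isomorphism. This is
possible because the étale coordinates of a lift are free in degrees above m
(`exists_generic_lift`). The arc β = f∘δ agrees with f∘γ modulo t^(m+1). Among the generators of the
functions on a target chart, pick n whose Jacobian determinant has order e along γ. Since m ≥ 2e,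
Newton iteration (`newton`) alters γ, only in degrees ≥ m+1-e, into an arc w on which these n
functions take the values prescribed by β. The other generators then follow. The relations among the
differentials of the target have a maximal minor of order e' along γ; linearising them doubles the
precision at the cost of e' powers of t, a net gain because m+1-e > e' (`exists_lift_of_close`).
Hence f∘w = f∘δ, and w = δ because f is separated (`arc_ext`).

Statement (i) follows at once: the contact orders e and e' are read off from coefficients of degree
below m+1-e, so δ again lies in C_{e,e'}.

For (ii), the jets with the same image as γ arise by adding t^(m+1-e)·y to the coordinates. As
2(m+1-e) ≥ m+1, the Taylor expansion stops after its linear term, and the image is unchanged exactly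
when Jac·y vanishes modulo t^e. By Smith normal form this is a vector space of dimension e
(`finrank_ker_toeplitz`). To treat all jets together, the contact locus is cut into finitely many
locally closed strata on which this linear system is solved by one fixed choice of e free
coordinates and an invertible selection of rows (`JetChart.exists_strata`). On a stratum the motions
translate e chosen coefficients, the pivots. The slice where the pivots vanish splits off a factor
𝔸^e and maps bijectively to the image (`PointModel.fibration`, `JetChart.fibration`); it is only
shown to be bijective, whence the word "weakly". Chevalley's theorem cuts the images into locally
closed pieces, and saturation of the strata under f_m keeps the images of different strata disjoint.

Three preparations are needed. The Fitting ideals must be computed by minors in charts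
(`fittingSheaf_ideal`, `fittingIdeal_kaehler_eq_span_minors`). The number of étale coordinates on X'
must be n (`JetChart.dim_eq`). The jets lying in an affine chart must form an affine open subscheme
of finite type of the jet scheme (`nonempty_jetAlgebra`). -/

namespace JetScheme

/-! ### Fitting ideals: independence of the generators. -/

section MinorIdeal
variable {R M : Type*} [CommRing R] [AddCommGroup M] [Module R M]

/-- The ideal of `p`-minors of the matrices whose rows are relations among the terms of `x`. -/
def minorIdeal {ι : Type*} [Fintype ι] (x : ι → M) (p : ℕ) : Ideal R :=
  Ideal.span {d | ∃ (r : Fin p → ι → R) (c : Fin p → ι),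
    (∀ a, ∑ j, r a j • x j = 0) ∧ d = Matrix.det (Matrix.of fun a b => r a (c b))}

variable {ι κ : Type*} [Fintype ι] [Fintype κ]

lemma det_mem_minorIdeal {x : ι → M} {p : ℕ} (r : Fin p → ι → R) (c : Fin p → ι)
    (h : ∀ a, ∑ j, r a j • x j = 0) :
    Matrix.det (Matrix.of fun a b => r a (c b)) ∈ (minorIdeal x p : Ideal R) :=
  Ideal.subset_span ⟨r, c, h, rfl⟩

lemma det_mem_of_submatrix {p : ℕ} (I : Ideal R) (A : Matrix (Fin (p + 1)) (Fin (p + 1)) R)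
    (b : Fin (p + 1)) (h : ∀ a, (A.submatrix (Fin.succAbove a) (Fin.succAbove b)).det ∈ I) :
    A.det ∈ I := by
  rw [Matrix.det_succ_column A b]
  exact I.sum_mem fun a _ => I.mul_mem_left _ (h a)

lemma minorIdeal_zero (x : ι → M) : (minorIdeal x 0 : Ideal R) = ⊤ := by
  rw [Ideal.eq_top_iff_one]
  have := det_mem_minorIdeal (R := R) (x := x) (p := 0) (fun a => a.elim0) (fun a => a.elim0)
    (fun a => a.elim0)
  rwa [Matrix.det_fin_zero] at this

lemma minorIdeal_succ_le (x : ι → M) (p : ℕ) :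
    (minorIdeal x (p + 1) : Ideal R) ≤ minorIdeal x p := by
  refine Ideal.span_le.mpr ?_
  rintro _ ⟨r, c, h, rfl⟩
  refine det_mem_of_submatrix _ _ 0 fun a => ?_
  exact det_mem_minorIdeal (fun a' => r (Fin.succAbove a a')) (fun b => c (Fin.succAbove 0 b))
    fun a' => h _

lemma minorIdeal_anti (x : ι → M) : Antitone fun p => (minorIdeal x p : Ideal R) :=
  antitone_nat_of_succ_le (minorIdeal_succ_le x)

lemma minorIdeal_reindex_le (e : ι ≃ κ) (x : κ → M) (p : ℕ) :
    (minorIdeal (x ∘ e) p : Ideal R) ≤ minorIdeal x p := by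
  refine Ideal.span_le.mpr ?_
  rintro _ ⟨r, c, h, rfl⟩
  have := det_mem_minorIdeal (x := x) (fun a j => r a (e.symm j)) (fun b => e (c b)) fun a => by
    rw [← h a, ← e.sum_comp]; simp
  simpa using this

lemma minorIdeal_reindex (e : ι ≃ κ) (x : κ → M) (p : ℕ) :
    (minorIdeal (x ∘ e) p : Ideal R) = minorIdeal x p := by
  refine le_antisymm (minorIdeal_reindex_le e x p) ?_
  have := minorIdeal_reindex_le (R := R) e.symm (x ∘ e) p
  simpa [Function.comp_assoc] using this

/-- The index `none` stands for a zero column, so the determinant is zero or a genuine minor. Such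
columns appear when a redundant generator is eliminated. -/
lemma det_mem_minorIdeal_of_option {x : ι → M} {p : ℕ} (r : Fin p → ι → R) (c : Fin p → Option ι)
    (h : ∀ a, ∑ j, r a j • x j = 0) :
    Matrix.det (Matrix.of fun a b => (c b).elim 0 (r a)) ∈ (minorIdeal x p : Ideal R) := by
  by_cases hc : ∀ b, (c b).isSome
  · choose c' hc' using fun b => Option.isSome_iff_exists.mp (hc b)
    simp only [hc', Option.elim_some]
    exact det_mem_minorIdeal r c' h
  · push Not at hc
    obtain ⟨b, hb⟩ := hc
    rw [Matrix.det_eq_zero_of_column_eq_zero b]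
    · exact zero_mem _
    · intro a
      have : c b = none := by simpa using hb
      simp [this]

/-- Expand a rank-one perturbation multilinearly in the columns. Terms with two columns proportional
to `u` vanish; the others expand along one column into the minors of `A` in `h`. -/
lemma det_add_mul_mem {p : ℕ} (I : Ideal R) (A : Matrix (Fin (p + 1)) (Fin (p + 1)) R)
    (u v : Fin (p + 1) → R)
    (h : ∀ a b, (A.submatrix (Fin.succAbove a) (Fin.succAbove b)).det ∈ I) :
    (Matrix.of fun a b => A a b + u a * v b).det ∈ I := by
  rw [← Matrix.det_transpose]
  have e : Matrix.transpose (Matrix.of fun a b => A a b + u a * v b) = A.transpose + Matrix.of fun b => v b • u := by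
    ext a b; simp [mul_comm]
  rw [e]
  let A' : Fin (p + 1) → Fin (p + 1) → R := A.transpose
  change Matrix.detRowAlternating.toMultilinearMap (A' + fun b => v b • u) ∈ I
  rw [MultilinearMap.map_add_univ]
  refine I.sum_mem fun s _ => ?_
  by_cases hs : s = Finset.univ
  · subst hs
    have : (Finset.univ.piecewise A' fun b => v b • u) = A' := by
      ext; simp
    rw [this]
    change A.transpose.det ∈ I
    rw [Matrix.det_transpose]
    exact det_mem_of_submatrix I A 0 fun a => h a 0
  · obtain ⟨b, hb⟩ : ∃ b, b ∉ s := by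
      by_contra! hc
      exact hs (Finset.eq_univ_iff_forall.mpr hc)
    by_cases hb' : ∃ b', b' ≠ b ∧ b' ∉ s
    · obtain ⟨b', hne, hb'⟩ := hb'
      have e2 : (s.piecewise A' fun b => v b • u) =
          Function.update (Function.update (s.piecewise A' fun b => v b • u) b (v b • u))
            b' (v b' • u) := by
        ext c d
        by_cases h1 : c = b'
        · subst h1; simp [hb']
        · by_cases h2 : c = b
          · subst h2; simp [hb, h1]
          · simp [h1, h2]
      rw [e2, MultilinearMap.map_update_smul, Function.update_comm hne.symm,
        MultilinearMap.map_update_smul]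
      have : (Matrix.detRowAlternating (R := R)).toMultilinearMap (Function.update (Function.update
          (s.piecewise A' fun b => v b • u) b' u) b u) = 0 := by
        refine (Matrix.detRowAlternating (R := R)).map_eq_zero_of_eq _ (i := b) (j := b') ?_ hne.symm
        simp [hne, Function.update_of_ne]
      rw [this]; simp
    · push Not at hb'
      change Matrix.det (Matrix.of (s.piecewise A' fun b => v b • u)) ∈ I
      rw [← Matrix.det_transpose]
      refine det_mem_of_submatrix I _ b fun a => ?_
      convert h a b using 2
      ext c d
      have : b.succAbove d ∈ s := hb' _ (Fin.succAbove_ne b d)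
      simp only [Matrix.submatrix_apply, Matrix.transpose_apply, Matrix.of_apply,
        Finset.piecewise_eq_of_mem _ _ _ this]
      rfl

/-- Substituting y = ∑ s_j x_j turns a relation involving y into one among the x_j, and changes the
relation matrix by a rank-one term. Conversely, a minor for x becomes one of size p + 1 when
bordered by the tautological relation y - ∑ s_j x_j = 0 and the column of y. -/
lemma minorIdeal_option (x : ι → M) (y : M) (s : ι → R) (hy : y = ∑ j, s j • x j) (p : ℕ) :
    (minorIdeal (fun o : Option ι => o.elim y x) (p + 1) : Ideal R) = minorIdeal x p := by
  apply le_antisymm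
  · refine Ideal.span_le.mpr ?_
    rintro _ ⟨r, c, h, rfl⟩
    let r' : Fin (p + 1) → ι → R := fun a j => r a (some j) + r a none * s j
    have hr' a : ∑ j, r' a j • x j = 0 := by
      have := h a
      rw [Fintype.sum_option] at this
      simp only [Option.elim_none, Option.elim_some, hy, Finset.smul_sum, smul_smul] at this
      simp only [r', add_smul, Finset.sum_add_distrib]
      rw [add_comm]; exact this
    have e : (Matrix.of fun a b => r a (c b)) = Matrix.of fun a b => (Matrix.of fun a b => (c b).elim 0 (r' a)) a b +
        r a none * (c b).elim 1 (fun j => - s j) := by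
      ext a b
      rcases hcb : c b with _ | j <;> simp [r', hcb]
    rw [e]
    refine det_add_mul_mem _ (Matrix.of fun a b => (c b).elim 0 (r' a)) (fun a => r a none)
      (fun b => (c b).elim 1 (fun j => - s j)) fun a b => ?_
    exact det_mem_minorIdeal_of_option (fun a' => r' (a.succAbove a')) (fun b' => c (b.succAbove b'))
      fun a' => hr' _
  · refine Ideal.span_le.mpr ?_
    rintro _ ⟨r, c, h, rfl⟩
    have := det_mem_minorIdeal (x := fun o : Option ι => o.elim y x) (R := R)
      (Fin.cons (fun o => o.elim 1 (fun j => - s j)) (fun a o => o.elim 0 (r a)))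
      (Fin.cons none fun b => some (c b)) (by
        intro a
        rw [Fintype.sum_option]
        refine Fin.cases ?_ (fun a => ?_) a
        · simp [hy]
        · simp [h a])
    rw [Matrix.det_succ_column_zero, Fin.sum_univ_succ] at this
    simp only [Matrix.of_apply, Fin.cons_zero, Fin.cons_succ, Option.elim_none] at this
    simp only [Fin.val_zero, pow_zero, one_mul, mul_zero, zero_mul, Finset.sum_const_zero,
      add_zero] at this
    convert! this using 2

lemma minorIdeal_sum (x : ι → M) (P : ℕ) (y : Fin P → M)
    (hy : ∀ b, y b ∈ Submodule.span R (Set.range x)) (p : ℕ) :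
    (minorIdeal (Sum.elim x y) (p + P) : Ideal R) = minorIdeal x p := by
  induction P with
  | zero =>
    rw [add_zero, ← minorIdeal_reindex (Equiv.sumEmpty ι (Fin 0)).symm]
    congr 1
  | succ P ih =>
    obtain ⟨s, hs⟩ := (Submodule.mem_span_range_iff_exists_fun R).mp (hy (Fin.last P))
    rw [← ih (fun b => y b.castSucc) (fun b => hy _)]
    rw [← minorIdeal_option (Sum.elim x fun b : Fin P => y b.castSucc) (y (Fin.last P))
      (Sum.elim s fun _ => 0) (by simp [hs]) (p + P)]
    let e : Option (ι ⊕ Fin P) ≃ ι ⊕ Fin (P + 1) :=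
      (Equiv.optionEquivSumPUnit.{0} _).trans ((Equiv.sumAssoc _ _ _).trans
        (Equiv.sumCongr (Equiv.refl _) ((Equiv.optionEquivSumPUnit.{0} _).symm.trans finSuccEquivLast.symm)))
    rw [← minorIdeal_reindex e, add_assoc]
    congr 1
    ext o
    rcases o with _ | (i | b)
    · simp [e]
    · simp [e]
    · simp [e]

/-- Both families are compared with their concatenation, each being redundant given the other. If N
≤ i, truncated subtraction makes the right side the ideal of 0-minors, which is the unit ideal. -/
theorem minorIdeal_le_of_span {N P : ℕ} (x : Fin N → M) (y : Fin P → M)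
    (hx : Submodule.span R (Set.range x) = ⊤) (hy : Submodule.span R (Set.range y) = ⊤) (i : ℕ) :
    (minorIdeal y (P - i) : Ideal R) ≤ minorIdeal x (N - i) := by
  have e1 (p) : (minorIdeal (Sum.elim x y) (p + P) : Ideal R) = minorIdeal x p :=
    minorIdeal_sum x P y (fun b => hx ▸ Submodule.mem_top) p
  have e2 (p) : (minorIdeal (Sum.elim x y) (p + N) : Ideal R) = minorIdeal y p := by
    rw [← minorIdeal_sum y N x (fun b => hy ▸ Submodule.mem_top) p,
      ← minorIdeal_reindex (Equiv.sumComm _ _)]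
    congr 1
    ext o
    rcases o with a | b <;> simp
  rcases le_total N i with h | h
  · rw [Nat.sub_eq_zero_of_le h, minorIdeal_zero]; exact le_top
  · rw [← e1, ← e2]
    exact minorIdeal_anti _ (by omega)

theorem fittingIdeal_eq_minorIdeal {N : ℕ} (x : Fin N → M)
    (hx : Submodule.span R (Set.range x) = ⊤) (i : ℕ) :
    fittingIdeal R M i = minorIdeal x (N - i) := by
  apply le_antisymm
  · refine Ideal.span_le.mpr ?_
    rintro _ ⟨P, y, r, c, hy, h, rfl⟩
    exact minorIdeal_le_of_span x y hx hy i (det_mem_minorIdeal r c h)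
  · refine Ideal.span_le.mpr ?_
    rintro _ ⟨r, c, h, rfl⟩
    exact Ideal.subset_span ⟨N, x, r, c, hx, h, rfl⟩

end MinorIdeal

/-! ### Fitting ideals of differentials under localization. -/

section FittingAlgebra

lemma fittingIdeal_le_of_linearEquiv {R M N : Type*} [CommRing R] [AddCommGroup M] [Module R M]
    [AddCommGroup N] [Module R N] (e : M ≃ₗ[R] N) (i : ℕ) :
    fittingIdeal R M i ≤ fittingIdeal R N i := by
  refine Ideal.span_mono ?_
  rintro _ ⟨P, y, r, c, hy, h, rfl⟩
  refine ⟨P, e ∘ y, r, c, ?_, fun a => ?_, rfl⟩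
  · rw [Set.range_comp]
    have := Submodule.map_span e.toLinearMap (Set.range y)
    rw [hy, Submodule.map_top, LinearEquiv.range] at this
    exact this.symm
  · have := congrArg e (h a)
    simpa using this

lemma fittingIdeal_congr {R M N : Type*} [CommRing R] [AddCommGroup M] [Module R M]
    [AddCommGroup N] [Module R N] (e : M ≃ₗ[R] N) (i : ℕ) :
    fittingIdeal R M i = fittingIdeal R N i :=
  le_antisymm (fittingIdeal_le_of_linearEquiv e i) (fittingIdeal_le_of_linearEquiv e.symm i)

/-- Clearing denominators turns relations over S into relations over R, so minors over S are, up to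
units, images of minors over R. -/
theorem fittingIdeal_of_isLocalizedModule {R S M N : Type*} [CommRing R] [CommRing S] [Algebra R S]
    [AddCommGroup M] [Module R M] [AddCommGroup N] [Module R N] [Module S N] [IsScalarTower R S N]
    (W : Submonoid R) [IsLocalization W S] (f : M →ₗ[R] N) [IsLocalizedModule W f]
    [Module.Finite R M] (i : ℕ) :
    fittingIdeal S N i = (fittingIdeal R M i).map (algebraMap R S) := by
  obtain ⟨P, x, hx⟩ := Module.Finite.exists_fin (R := R) (M := M)
  have hx' : Submodule.span S (Set.range (f ∘ x)) = ⊤ := by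
    rw [eq_top_iff]
    rintro y -
    obtain ⟨⟨m, s⟩, hm⟩ := IsLocalizedModule.surj W f y
    have h1 : f m ∈ Submodule.span S (Set.range (f ∘ x)) := by
      have : m ∈ Submodule.span R (Set.range x) := hx ▸ Submodule.mem_top
      have h2 : f m ∈ (Submodule.span R (Set.range x)).map f := ⟨m, this, rfl⟩
      rw [Submodule.map_span, ← Set.range_comp] at h2
      exact Submodule.span_le_restrictScalars R S _ h2
    have h3 : y = (IsLocalization.mk' S 1 s) • f m := by
      rw [← hm]
      change y = _ • ((s : R) • y)
      rw [← algebraMap_smul S (s : R) y, smul_smul, IsLocalization.mk'_spec]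
      simp
    rw [h3]
    exact Submodule.smul_mem _ _ h1
  classical
  rw [fittingIdeal_eq_minorIdeal x hx, fittingIdeal_eq_minorIdeal _ hx']
  apply le_antisymm
  · refine Ideal.span_le.mpr ?_
    rintro _ ⟨r, c, h, rfl⟩
    have key (a) : ∃ (s : W) (r' : Fin P → R), (∑ j, r' j • x j = 0) ∧
        ∀ j, algebraMap R S s * r a j = algebraMap R S (r' j) := by
      obtain ⟨s, hs⟩ := IsLocalization.exist_integer_multiples_of_finset W
        (Finset.univ.image (r a))
      choose r' hr' using fun j => hs (r a j) (Finset.mem_image_of_mem _ (Finset.mem_univ j))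
      have h0 : f (∑ j, r' j • x j) = 0 := by
        rw [map_sum]
        have : ∀ j, f (r' j • x j) = algebraMap R S (s : R) • r a j • f (x j) := fun j => by
          rw [map_smul, ← algebraMap_smul S (r' j), hr' j, Algebra.smul_def, mul_smul]
        simp only [this, ← Finset.smul_sum]
        rw [show ∑ j, r a j • f (x j) = 0 from h a, smul_zero]
      -- The cleared relation holds only after applying `f`; a second multiplier makes it hold in M.
      obtain ⟨s', hs'⟩ := (IsLocalizedModule.eq_zero_iff W f).mp h0
      refine ⟨s' * s, fun j => (s' : R) * r' j, ?_, fun j => ?_⟩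
      · simp only [mul_smul, ← Finset.smul_sum]
        exact hs'
      · rw [map_mul, hr' j, Algebra.smul_def]; simp [mul_assoc]
    choose s r' h1 h2 using key
    have h3 := Ideal.mem_map_of_mem (algebraMap R S) (det_mem_minorIdeal r' c h1)
    rw [RingHom.map_det] at h3
    have h4 : (algebraMap R S).mapMatrix (Matrix.of fun a b => r' a (c b)) =
        Matrix.of fun a b => (fun a => algebraMap R S (s a)) a * (Matrix.of fun a b => r a (c b)) a b := by
      ext a b
      simp [h2]
    rw [h4, Matrix.det_mul_column] at h3
    have h5 : IsUnit (∏ a, algebraMap R S (s a)) := by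
      rw [IsUnit.prod_univ_iff]
      exact fun a => IsLocalization.map_units S (s a)
    exact (Ideal.unit_mul_mem_iff_mem _ h5).mp h3
  · rw [minorIdeal, Ideal.map_span]
    refine Ideal.span_le.mpr ?_
    rintro _ ⟨_, ⟨r, c, h, rfl⟩, rfl⟩
    rw [RingHom.map_det]
    refine det_mem_minorIdeal (fun a j => algebraMap R S (r a j)) c fun a => ?_
    have := congrArg f (h a)
    simpa using this

/-- The kernel of Ω[C⁄R] → Ω[C⁄R'] is generated by the image of Ω[R'⁄R], which is zero. This permits
shrinking the affine open of the target. -/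
lemma fittingIdeal_kaehler_of_formallyUnramified (R R' C : Type*) [CommRing R] [CommRing R'] [CommRing C]
    [Algebra R R'] [Algebra R C] [Algebra R' C] [IsScalarTower R R' C]
    [Algebra.FormallyUnramified R R'] (i : ℕ) :
    fittingIdeal C (Ω[C⁄R]) i = fittingIdeal C (Ω[C⁄R']) i := by
  refine fittingIdeal_congr (LinearEquiv.ofBijective (KaehlerDifferential.map R R' C C)
    ⟨?_, KaehlerDifferential.map_surjective R R' C⟩) i
  rw [injective_iff_map_eq_zero]
  intro x hx
  obtain ⟨y, rfl⟩ := (KaehlerDifferential.exact_mapBaseChange_map R R' C x).mp hx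
  have : Subsingleton (Ω[R'⁄R]) := Algebra.FormallyUnramified.subsingleton_kaehlerDifferential
  rw [Subsingleton.elim y 0, map_zero]

lemma fittingKaehler_comp_localization {A B C : CommRingCat.{u}} (φ : A ⟶ B) (ψ : B ⟶ C)
    (hφ : φ.hom.FiniteType) (g : B)
    (hψ : letI := ψ.hom.toAlgebra; IsLocalization.Away g C) (i : ℕ) :
    fittingKaehler (φ ≫ ψ) i = (fittingKaehler φ i).map ψ.hom := by
  let := φ.hom.toAlgebra
  let := ψ.hom.toAlgebra
  let := (φ ≫ ψ).hom.toAlgebra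
  have : IsScalarTower A B C := .of_algebraMap_eq' rfl
  have : Algebra.FiniteType A B := hφ
  change fittingIdeal C (Ω[C⁄A]) i = (fittingIdeal B (Ω[B⁄A]) i).map (algebraMap B C)
  exact fittingIdeal_of_isLocalizedModule (.powers g) (KaehlerDifferential.map A A B C) i

lemma fittingKaehler_localization_comp {A B C : CommRingCat.{u}} (φ : A ⟶ B) (ψ : B ⟶ C)
    (g : A) (hφ : letI := φ.hom.toAlgebra; IsLocalization.Away g B) (i : ℕ) :
    fittingKaehler (φ ≫ ψ) i = fittingKaehler ψ i := by
  let := φ.hom.toAlgebra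
  let := ψ.hom.toAlgebra
  let := (φ ≫ ψ).hom.toAlgebra
  have : IsScalarTower A B C := .of_algebraMap_eq' rfl
  have : Algebra.FormallyUnramified A B := .of_isLocalization (.powers g)
  exact fittingIdeal_kaehler_of_formallyUnramified A B C i

end FittingAlgebra

/-! ### The Fitting ideal sheaf on affine opens. -/

section FittingSheaf
variable {X Y : Scheme.{u}} (f : X ⟶ Y) (i : ℕ)

lemma fittingKaehler_appLE_basicOpen [LocallyOfFiniteType f] (U : Y.affineOpens) (V : X.affineOpens)
    (e : V.1 ≤ f ⁻¹ᵁ U.1) (g : Γ(X, V.1)) {W : X.Opens} (hW : W = X.basicOpen g) (h : W ≤ V.1)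
    (e' : W ≤ f ⁻¹ᵁ U.1) :
    fittingKaehler (f.appLE U.1 W e') i =
      (fittingKaehler (f.appLE U.1 V.1 e) i).map (X.presheaf.map (homOfLE h).op).hom := by
  subst hW
  rw [← f.appLE_map e]
  exact fittingKaehler_comp_localization _ _ (f.finiteType_appLE U.2 V.2 e) g
    (V.2.isLocalization_basicOpen g) i

lemma fittingKaehler_appLE_target (U : Y.affineOpens) (V : X.Opens)
    (e : V ≤ f ⁻¹ᵁ U.1) (r : Γ(Y, U.1)) {D : Y.Opens} (hD : D = Y.basicOpen r)
    (e' : V ≤ f ⁻¹ᵁ D) :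
    fittingKaehler (f.appLE U.1 V e) i = fittingKaehler (f.appLE D V e') i := by
  subst hD
  rw [← f.map_appLE e' (homOfLE (Y.basicOpen_le r)).op]
  exact fittingKaehler_localization_comp _ _ r (U.2.isLocalization_basicOpen r) i

lemma mem_ideal_of_local (V : X.affineOpens) (I : Ideal Γ(X, V.1)) (s : Γ(X, V.1))
    (h : ∀ p ∈ V.1, ∃ g : Γ(X, V.1), p ∈ X.basicOpen g ∧
      (X.presheaf.map (homOfLE (X.basicOpen_le g)).op).hom s ∈
        I.map (X.presheaf.map (homOfLE (X.basicOpen_le g)).op).hom) : s ∈ I := by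
  let G : Set Γ(X, V.1) := {g | (X.presheaf.map (homOfLE (X.basicOpen_le g)).op).hom s ∈
        I.map (X.presheaf.map (homOfLE (X.basicOpen_le g)).op).hom}
  have hG : Ideal.span G = ⊤ := by
    rw [← IsAffineOpen.iSup_basicOpen_eq_self_iff V.2]
    apply le_antisymm
    · exact iSup_le fun g => X.basicOpen_le _
    · intro p hp
      obtain ⟨g, hg, hs⟩ := h p hp
      exact TopologicalSpace.Opens.mem_iSup.mpr ⟨⟨g, hs⟩, hg⟩
  refine Submodule.mem_of_span_eq_top_of_smul_pow_mem I G hG s fun ⟨g, hg⟩ => ?_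
  have := V.2.isLocalization_basicOpen g
  obtain ⟨⟨a, ⟨_, n, rfl⟩⟩, ha⟩ := (IsLocalization.mem_map_algebraMap_iff (.powers g) _).mp hg
  have h2 : (X.presheaf.map (homOfLE (X.basicOpen_le g)).op).hom (s * g ^ n) =
    (X.presheaf.map (homOfLE (X.basicOpen_le g)).op).hom a := by rw [map_mul]; exact ha
  obtain ⟨⟨_, l, rfl⟩, hl⟩ := (IsLocalization.eq_iff_exists (.powers g) _).mp h2
  refine ⟨l + n, ?_⟩
  have : g ^ (l + n) • s = g ^ l * (s * g ^ n) := by rw [smul_eq_mul]; ring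
  rw [this]
  exact hl ▸ I.mul_mem_left _ a.2

lemma res_res {U V W : X.Opens} (h : U ≤ V) (h' : V ≤ W) (s : Γ(X, W)) :
    (X.presheaf.map (homOfLE h).op).hom ((X.presheaf.map (homOfLE h').op).hom s) =
      (X.presheaf.map (homOfLE (h.trans h')).op).hom s := by
  rw [← CommRingCat.comp_apply, ← Functor.map_comp]; rfl

/-- Near `p` both pairs of affine opens shrink to a common basic open set of X over a common basic
open set of Y, and such shrinking only localizes the Fitting ideal. -/
lemma fittingKaehler_mem_of_mem [LocallyOfFiniteType f] {U₁ U₂ : Y.affineOpens}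
    {V₁ V₂ : X.affineOpens}
    (e₁ : V₁.1 ≤ f ⁻¹ᵁ U₁.1) (e₂ : V₂.1 ≤ f ⁻¹ᵁ U₂.1) {W : X.Opens} (h₁ : V₁.1 ≤ W) (h₂ : V₂.1 ≤ W)
    (s : Γ(X, W)) (hs : (X.presheaf.map (homOfLE h₁).op).hom s ∈ fittingKaehler (f.appLE U₁.1 V₁.1 e₁) i)
    (p : X) (hp₁ : p ∈ V₁.1) (hp₂ : p ∈ V₂.1) :
    ∃ g : Γ(X, V₂.1), p ∈ X.basicOpen g ∧
      (X.presheaf.map (homOfLE (X.basicOpen_le g)).op).hom ((X.presheaf.map (homOfLE h₂).op).hom s) ∈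
        (fittingKaehler (f.appLE U₂.1 V₂.1 e₂) i).map
          (X.presheaf.map (homOfLE (X.basicOpen_le g)).op).hom := by
  obtain ⟨r₁, r₂, hr, hpr⟩ := exists_basicOpen_le_affine_inter U₁.2 U₂.2 (f p) ⟨e₁ hp₁, e₂ hp₂⟩
  obtain ⟨a, ha, hpa⟩ := IsAffineOpen.exists_basicOpen_le V₂.2 (V := f ⁻¹ᵁ Y.basicOpen r₁)
    ⟨p, hpr⟩ hp₂
  obtain ⟨g₁, g', hg, hpg⟩ := exists_basicOpen_le_affine_inter V₁.2 (IsAffineOpen.basicOpen V₂.2 a) p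
    ⟨hp₁, hpa⟩
  obtain ⟨g₂, hg₂⟩ := IsAffineOpen.basicOpen_basicOpen_is_basicOpen V₂.2 a g'
  have e12 : X.basicOpen g₂ = X.basicOpen g₁ := hg₂.trans hg.symm
  have eD : X.basicOpen g₂ ≤ f ⁻¹ᵁ Y.basicOpen r₁ := hg₂ ▸ (X.basicOpen_le g').trans ha
  refine ⟨g₂, e12 ▸ hpg, ?_⟩
  have hW1 : X.basicOpen g₂ ≤ V₁.1 := e12 ▸ X.basicOpen_le g₁
  rw [res_res, ← fittingKaehler_appLE_basicOpen f i U₂ V₂ e₂ g₂ rfl _ ((X.basicOpen_le g₂).trans e₂),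
    fittingKaehler_appLE_target f i U₂ _ _ r₂ hr eD,
    ← fittingKaehler_appLE_target f i U₁ _ (hW1.trans e₁) r₁ rfl eD,
    fittingKaehler_appLE_basicOpen f i U₁ V₁ e₁ g₁ e12 hW1, ← res_res hW1 h₁]
  exact Ideal.mem_map_of_mem _ hs

/-- The family of ideals whose associated ideal sheaf is `fittingSheaf f i`. -/
noncomputable def fittingFamily (V : X.affineOpens) : Ideal Γ(X, V.1) :=
  ⨅ (V' : X.affineOpens) (U : Y.affineOpens) (h : V'.1 ≤ V.1) (e : V'.1 ≤ f ⁻¹ᵁ U.1),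
      (fittingKaehler (f.appLE U.1 V'.1 e) i).comap (X.presheaf.map (homOfLE h).op).hom

lemma mem_fittingFamily_iff {V : X.affineOpens} {s : Γ(X, V.1)} : s ∈ fittingFamily f i V ↔
    ∀ (V' : X.affineOpens) (U : Y.affineOpens) (h : V'.1 ≤ V.1) (e : V'.1 ≤ f ⁻¹ᵁ U.1),
      (X.presheaf.map (homOfLE h).op).hom s ∈ fittingKaehler (f.appLE U.1 V'.1 e) i := by
  simp [fittingFamily, Submodule.mem_iInf]

lemma mem_fittingFamily_of_local [LocallyOfFiniteType f] {V : X.affineOpens} {s : Γ(X, V.1)}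
    (hs : ∀ p ∈ V.1, ∃ (V' : X.affineOpens) (U : Y.affineOpens) (h : V'.1 ≤ V.1)
      (e : V'.1 ≤ f ⁻¹ᵁ U.1), p ∈ V'.1 ∧
      (X.presheaf.map (homOfLE h).op).hom s ∈ fittingKaehler (f.appLE U.1 V'.1 e) i) :
    s ∈ fittingFamily f i V := by
  rw [mem_fittingFamily_iff]
  intro V'' U'' h'' e''
  refine mem_ideal_of_local V'' _ _ fun p hp => ?_
  obtain ⟨V', U, h, e, hp', hs⟩ := hs p (h'' hp)
  exact fittingKaehler_mem_of_mem f i e e'' h h'' s hs p hp' hp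

lemma exists_affine_pair (V : X.affineOpens) (p : X) (hp : p ∈ V.1) :
    ∃ (g : Γ(X, V.1)) (U : Y.affineOpens), p ∈ X.basicOpen g ∧ X.basicOpen g ≤ f ⁻¹ᵁ U.1 := by
  obtain ⟨U, hU, hpU, -⟩ := exists_isAffineOpen_mem_and_subset (x := f p) (U := ⊤) trivial
  obtain ⟨a, ha, hpa⟩ := IsAffineOpen.exists_basicOpen_le V.2 (V := f ⁻¹ᵁ U) ⟨p, hpU⟩ hp
  exact ⟨a, ⟨U, hU⟩, hpa, ha⟩

/-- For the harder inclusion, a section over the basic open set of `g` is multiplied by a power of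
`g` until it extends to `V` and its restrictions lie in the local Fitting ideals. -/
lemma fittingFamily_map_basicOpen [LocallyOfFiniteType f] (V : X.affineOpens) (g : Γ(X, V.1)) :
    (fittingFamily f i V).map (X.presheaf.map (homOfLE <| X.basicOpen_le g).op).hom =
      fittingFamily f i (X.affineBasicOpen g) := by
  apply le_antisymm
  · refine Ideal.map_le_iff_le_comap.mpr fun s hs => ?_
    rw [mem_fittingFamily_iff] at hs
    refine (mem_fittingFamily_iff f i).mpr fun V' U h e => ?_
    exact (res_res h (X.basicOpen_le g) s) ▸ hs V' U (h.trans (X.basicOpen_le g)) e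
  · intro s hs
    replace hs := (mem_fittingFamily_iff f i).mp hs
    have hloc := IsAffineOpen.isLocalization_basicOpen V.2 g
    obtain ⟨a, ⟨_, n, rfl⟩, has⟩ := IsLocalization.exists_mk'_eq (.powers g) s
    have ha : (X.presheaf.map (homOfLE (X.basicOpen_le g)).op).hom a =
        s * (X.presheaf.map (homOfLE (X.basicOpen_le g)).op).hom (g ^ n) := by
      rw [← has]
      exact (IsLocalization.mk'_spec (M := .powers g) _ a ⟨_, n, rfl⟩).symm
    choose c U hc hcU using fun p : V.1 => exists_affine_pair f V p.1 p.2
    have key (p : V.1) : ∃ l : ℕ, (X.presheaf.map (homOfLE (X.basicOpen_le (c p))).op).hom (g ^ l * a) ∈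
        fittingKaehler (f.appLE (U p).1 (X.basicOpen (c p)) (hcU p)) i := by
      let V₁ : X.affineOpens := ⟨X.basicOpen (c p), IsAffineOpen.basicOpen V.2 (c p)⟩
      let g₁ : Γ(X, V₁.1) := (X.presheaf.map (homOfLE (X.basicOpen_le (c p))).op).hom g
      let W : X.affineOpens := ⟨X.basicOpen g₁, IsAffineOpen.basicOpen V₁.2 g₁⟩
      have hW : W.1 ≤ X.basicOpen g := by
        change X.basicOpen _ ≤ _
        rw [Scheme.basicOpen_res]; exact inf_le_right
      have h1 := hs W (U p) hW ((X.basicOpen_le g₁).trans (hcU p))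
      have h2 : (X.presheaf.map (homOfLE (X.basicOpen_le g₁)).op).hom
          ((X.presheaf.map (homOfLE (X.basicOpen_le (c p))).op).hom a) ∈
          fittingKaehler (f.appLE (U p).1 W.1 ((X.basicOpen_le g₁).trans (hcU p))) i := by
        rw [res_res, ← res_res hW (X.basicOpen_le g), ha, map_mul]
        exact Ideal.mul_mem_right _ _ h1
      rw [fittingKaehler_appLE_basicOpen f i (U p) V₁ (hcU p) g₁ rfl (X.basicOpen_le g₁)] at h2
      have hloc₁ := IsAffineOpen.isLocalization_basicOpen V₁.2 g₁
      obtain ⟨⟨b, ⟨_, l, rfl⟩⟩, hb⟩ := (IsLocalization.mem_map_algebraMap_iff (.powers g₁) _).mp h2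
      dsimp only at hb
      rw [RingHom.algebraMap_toAlgebra, ← map_mul] at hb
      obtain ⟨⟨_, l', rfl⟩, hl⟩ := (IsLocalization.eq_iff_exists (.powers g₁) _).mp hb
      refine ⟨l' + l, ?_⟩
      have : (X.presheaf.map (homOfLE (X.basicOpen_le (c p))).op).hom (g ^ (l' + l) * a) =
          g₁ ^ l' * ((X.presheaf.map (homOfLE (X.basicOpen_le (c p))).op).hom a * g₁ ^ l) := by
        rw [map_mul, map_pow]; ring
      rw [this]
      exact hl ▸ Ideal.mul_mem_left _ _ b.2
    choose l hl using key
    -- The exponent `l p` depends on the point; quasi-compactness of `V` gives a common one.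
    obtain ⟨t, ht⟩ := V.2.isCompact.elim_finite_subcover (fun p : V.1 => (X.basicOpen (c p) : Set X))
      (fun p => (X.basicOpen (c p)).2) (fun p hp => Set.mem_iUnion.mpr ⟨⟨p, hp⟩, hc ⟨p, hp⟩⟩)
    have hmem : g ^ (t.sup l) * a ∈ fittingFamily f i V := by
      refine mem_fittingFamily_of_local f i fun q hq => ?_
      obtain ⟨p, hpt, hp⟩ := Set.mem_iUnion₂.mp (ht hq)
      refine ⟨⟨_, IsAffineOpen.basicOpen V.2 (c p)⟩, U p, X.basicOpen_le _, hcU p, hp, ?_⟩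
      obtain ⟨d, hd⟩ := Nat.exists_eq_add_of_le (Finset.le_sup (f := l) hpt)
      have : g ^ (t.sup l) * a = g ^ d * (g ^ l p * a) := by rw [hd]; ring
      rw [this, map_mul]
      exact Ideal.mul_mem_left _ _ (hl p)
    have h3 := Ideal.mem_map_of_mem (X.presheaf.map (homOfLE (X.basicOpen_le g)).op).hom hmem
    rw [map_mul, ha, mul_comm s, ← mul_assoc, ← map_mul, ← pow_add] at h3
    have hu : IsUnit ((X.presheaf.map (homOfLE (X.basicOpen_le g)).op).hom (g ^ (t.sup l + n))) :=
      IsLocalization.map_units (M := .powers g) _ ⟨_, _, rfl⟩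
    exact (Ideal.unit_mul_mem_iff_mem _ hu).mp h3

/-- The family of intersections is already compatible with restriction to basic opens, so the ideal
sheaf built from it has exactly these sections; locality of membership then identifies the
intersection with the term for the pair (V, U). -/
theorem fittingSheaf_ideal [LocallyOfFiniteType f] {V : X.affineOpens} {U : Y.affineOpens}
    (e : V.1 ≤ f ⁻¹ᵁ U.1) :
    (fittingSheaf f i).ideal V = fittingKaehler (f.appLE U.1 V.1 e) i := by
  let K : X.IdealSheafData :=
    { ideal := fittingFamily f i
      map_ideal_basicOpen := fittingFamily_map_basicOpen f i }
  have hK : fittingSheaf f i = K := Scheme.IdealSheafData.ofIdeals_ideal K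
  have hid (s : Γ(X, V.1)) : (X.presheaf.map (homOfLE le_rfl).op).hom s = s := by
    have : (homOfLE (le_refl V.1)).op = 𝟙 _ := rfl
    rw [this, CategoryTheory.Functor.map_id]; rfl
  rw [hK]
  change fittingFamily f i V = _
  ext s
  constructor
  · intro hs
    have := (mem_fittingFamily_iff f i).mp hs V U le_rfl e
    rwa [hid] at this
  · intro hs
    exact mem_fittingFamily_of_local f i fun p hp => ⟨V, U, le_rfl, e, hp, (hid s).symm ▸ hs⟩

end FittingSheaf

/-! ### First-order calculus in étale coordinates. -/

section Differences
variable {k A C : Type*} [CommRing k] [CommRing A] [Algebra k A] [CommRing C] [Algebra k C]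

/-- A relation among differentials of `A` gives a relation, to second order, among the differences
of two homomorphisms out of `A` that agree to first order. -/
lemma sum_mul_sub_mem_sq (I : Ideal C) (u v : A →ₐ[k] C) (h : ∀ a, u a - v a ∈ I)
    {ι : Type*} [Fintype ι] (y r : ι → A) (hr : ∑ j, r j • KaehlerDifferential.D k A (y j) = 0) :
    ∑ j, v (r j) * (u (y j) - v (y j)) ∈ I ^ 2 := by
  let w : A →+* C ⧸ I ^ 2 := (Ideal.Quotient.mk (I ^ 2)).comp v.toRingHom
  let := Module.compHom (C ⧸ I ^ 2) w
  have hsm (a : A) (c : C) : a • (Ideal.Quotient.mk (I ^ 2) c) = Ideal.Quotient.mk (I ^ 2) (v a * c) :=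
    rfl
  have : IsScalarTower k A (C ⧸ I ^ 2) := ⟨fun c a x => by
    obtain ⟨x, rfl⟩ := Ideal.Quotient.mk_surjective x
    rw [hsm, hsm, map_smul, smul_mul_assoc]; rfl⟩
  -- With A acting on C ⧸ I² through `v`, the product (u a - v a)(u b - v b) lies in I², so u - v
  -- becomes a derivation and factors through the differentials.
  let d : Derivation k A (C ⧸ I ^ 2) := Derivation.mk'
    { toFun := fun a => Ideal.Quotient.mk (I ^ 2) (u a - v a)
      map_add' := fun a b => by rw [← map_add, map_add, map_add]; congr 1; ring
      map_smul' := fun c a => by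
        simp only [map_smul, ← smul_sub, RingHom.id_apply]; rfl } (fun a b => by
      simp only [LinearMap.coe_mk, AddHom.coe_mk]
      rw [hsm, hsm, ← map_add, Ideal.Quotient.mk_eq_mk_iff_sub_mem, map_mul, map_mul]
      have : u a * u b - v a * v b - (v a * (u b - v b) + v b * (u a - v a)) =
        (u a - v a) * (u b - v b) := by ring
      rw [this, pow_two]
      exact Ideal.mul_mem_mul (h a) (h b))
  have h1 := congrArg d.liftKaehlerDifferential hr
  rw [map_sum, map_zero] at h1
  simp only [map_smul, Derivation.liftKaehlerDifferential_comp_D] at h1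
  rw [← Ideal.Quotient.eq_zero_iff_mem, map_sum, ← h1]
  rfl

end Differences

section EtaleCoordinates
variable {k : Type*} [CommRing k] {n : ℕ} {B : Type*} [CommRing B] [Algebra k B]
  [Algebra (MvPolynomial (Fin n) k) B] [IsScalarTower k (MvPolynomial (Fin n) k) B]

variable (k n B) in
/-- The étale coordinates. -/
noncomputable def coord (i : Fin n) : B := algebraMap (MvPolynomial (Fin n) k) B (MvPolynomial.X i)

variable [Algebra.Etale (MvPolynomial (Fin n) k) B]

open scoped TensorProduct in
variable (k n B) in
/-- The basis of the module of differentials given by étale coordinates. -/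
noncomputable def coordBasis : Module.Basis (Fin n) B (Ω[B⁄k]) :=
  ((KaehlerDifferential.mvPolynomialBasis k (Fin n)).baseChange B).map
    (KaehlerDifferential.tensorKaehlerEquivOfFormallyEtale k (MvPolynomial (Fin n) k) B)

lemma coordBasis_apply (i : Fin n) :
    coordBasis k n B i = KaehlerDifferential.D k B (coord k n B i) := by
  have : KaehlerDifferential.mvPolynomialBasis k (Fin n) i =
      KaehlerDifferential.D k _ (MvPolynomial.X i) := by
    apply (KaehlerDifferential.mvPolynomialBasis k (Fin n)).repr.injective
    simp
  simp [coordBasis, this, coord]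

variable (k n B) in
/-- The partial derivatives with respect to étale coordinates. -/
noncomputable def pd (i : Fin n) : Derivation k B B :=
  ((coordBasis k n B).coord i).compDer (KaehlerDifferential.D k B)

lemma pd_coord (i j : Fin n) : pd k n B i (coord k n B j) = if i = j then 1 else 0 := by
  simp [pd, ← coordBasis_apply, Finsupp.single_apply, eq_comm]

lemma D_eq_sum_pd (b : B) : KaehlerDifferential.D k B b =
    ∑ i, pd k n B i b • KaehlerDifferential.D k B (coord k n B i) := by
  simp only [← coordBasis_apply]
  exact ((coordBasis k n B).sum_repr _).symm

/-- This is `sum_mul_sub_mem_sq` for the relation db - ∑ (∂_i b) dx_i = 0. -/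
lemma taylor {C : Type*} [CommRing C] [Algebra k C] (I : Ideal C) (u v : B →ₐ[k] C)
    (h : ∀ a, u a - v a ∈ I) (b : B) :
    u b - v b - ∑ i, v (pd k n B i b) * (u (coord k n B i) - v (coord k n B i)) ∈ I ^ 2 := by
  have := sum_mul_sub_mem_sq I u v h (fun o : Option (Fin n) => o.elim b (coord k n B))
    (fun o => o.elim 1 fun i => - pd k n B i b) (by
      rw [Fintype.sum_option]
      simp [D_eq_sum_pd (n := n) b])
  rw [Fintype.sum_option] at this
  simpa [sub_eq_add_neg] using this

/-- The homomorphism that differs from `v` by the derivation with values `z i` on coordinates. -/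
noncomputable def taylorHom {C : Type*} [CommRing C] [Algebra k C] (v : B →ₐ[k] C) (z : Fin n → C)
    (hz : ∀ i j, z i * z j = 0) : B →ₐ[k] C where
  toFun b := v b + ∑ i, v (pd k n B i b) * z i
  map_one' := by simp
  map_zero' := by simp
  map_add' a b := by simp only [map_add, add_mul, Finset.sum_add_distrib]; ring
  map_mul' a b := by
    have h0 : (∑ i, v (pd k n B i a) * z i) * (∑ i, v (pd k n B i b) * z i) = 0 := by
      rw [Finset.sum_mul_sum]
      refine Finset.sum_eq_zero fun i _ => Finset.sum_eq_zero fun j _ => ?_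
      rw [mul_mul_mul_comm, hz, mul_zero]
    have h1 : ∑ i, v (pd k n B i (a * b)) * z i =
        v a * (∑ i, v (pd k n B i b) * z i) + v b * (∑ i, v (pd k n B i a) * z i) := by
      rw [Finset.mul_sum, Finset.mul_sum, ← Finset.sum_add_distrib]
      refine Finset.sum_congr rfl fun i _ => ?_
      rw [Derivation.leibniz, smul_eq_mul, smul_eq_mul, map_add, map_mul, map_mul]; ring
    rw [h1, map_mul, add_mul, mul_add, mul_add, h0]; ring
  commutes' c := by simp

lemma taylorHom_apply {C : Type*} [CommRing C] [Algebra k C] (v : B →ₐ[k] C) (z : Fin n → C)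
    (hz : ∀ i j, z i * z j = 0) (b : B) :
    taylorHom v z hz b = v b + ∑ i, v (pd k n B i b) * z i := rfl

end EtaleCoordinates

/-! ### Lifting jets to arcs, and power series estimates. -/

section LiftArcs
open PowerSeries
variable {k : Type*} [Field k] {n : ℕ} {B : Type*} [CommRing B] [Algebra k B]
  [Algebra (MvPolynomial (Fin n) k) B] [IsScalarTower k (MvPolynomial (Fin n) k) B]
  [Algebra.Etale (MvPolynomial (Fin n) k) B]

/-- The series `q` make k⟦t⟧ an algebra over the polynomial ring of the coordinates. Since B is
formally smooth over that ring and k⟦t⟧ is t-adically complete, the reduction of `u₀` modulo t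
lifts. -/
theorem exists_arc_of_jet {j : ℕ} (hj : 1 ≤ j) (u₀ : B →ₐ[k] k⟦X⟧ ⧸ Ideal.span {(X : k⟦X⟧) ^ j})
    (q : Fin n → k⟦X⟧) (hq : ∀ i, Ideal.Quotient.mk _ (q i) = u₀ (coord k n B i)) :
    ∃ u : B →ₐ[k] k⟦X⟧, (∀ b, Ideal.Quotient.mk _ (u b) = u₀ b) ∧ ∀ i, u (coord k n B i) = q i := by
  let P := MvPolynomial (Fin n) k
  let := (MvPolynomial.aeval q : P →ₐ[k] k⟦X⟧).toRingHom.toAlgebra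
  have hP (p : P) : algebraMap P k⟦X⟧ p = MvPolynomial.aeval q p := rfl
  have : IsScalarTower k P k⟦X⟧ := .of_algebraMap_eq fun c => by
    rw [hP, MvPolynomial.algebraMap_eq, MvPolynomial.aeval_C]
  have h0 : (u₀.comp (IsScalarTower.toAlgHom k P B)) =
      (Ideal.Quotient.mkₐ k (Ideal.span {(X : k⟦X⟧) ^ j})).comp (MvPolynomial.aeval q) :=
    MvPolynomial.algHom_ext fun i => by
      rw [AlgHom.comp_apply, AlgHom.comp_apply, MvPolynomial.aeval_X]
      exact (hq i).symm
  let u₁ : B →ₐ[P] k⟦X⟧ ⧸ Ideal.span {(X : k⟦X⟧) ^ j} :=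
    { u₀ with commutes' := fun p => congr($h0 p) }
  have hle : Ideal.span {(X : k⟦X⟧) ^ j} ≤ Ideal.span {(X : k⟦X⟧)} := by
    rw [Ideal.span_singleton_le_span_singleton]
    exact dvd_pow_self _ (by omega)
  obtain ⟨g, hg⟩ := Algebra.FormallySmooth.exists_mkₐ_comp_eq_of_isAdicComplete
    ((Ideal.Quotient.factorₐ P hle).comp u₁)
  have key : (Ideal.Quotient.mkₐ P (Ideal.span {(X : k⟦X⟧) ^ j})).comp g = u₁ := by
    -- The lift is so far correct only modulo t. As t is nilpotent modulo t^j, formal unramifiedness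
    -- makes it agree with `u₀` modulo t^j.
    refine Algebra.FormallyUnramified.ext
      (I := (Ideal.span {(X : k⟦X⟧)}).map (Ideal.Quotient.mk (Ideal.span {(X : k⟦X⟧) ^ j}))) ?_ ?_
    · refine ⟨j, ?_⟩
      rw [← Ideal.map_pow, Ideal.span_singleton_pow, Ideal.zero_eq_bot, Ideal.map_eq_bot_iff_le_ker,
        Ideal.mk_ker]
    · intro b
      obtain ⟨w, hw⟩ := Ideal.Quotient.mk_surjective (u₁ b)
      have h1 := congr($hg b)
      simp only [AlgHom.comp_apply, ← hw] at h1 ⊢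
      change Ideal.Quotient.mk (Ideal.span {X}) (g b) = Ideal.Quotient.mk (Ideal.span {X}) w at h1
      change Ideal.Quotient.mk _ (Ideal.Quotient.mk _ (g b)) = _
      rw [Ideal.Quotient.mk_eq_mk_iff_sub_mem] at h1 ⊢
      rw [← map_sub]
      exact Ideal.mem_map_of_mem _ h1
  refine ⟨g.restrictScalars k, fun b => congr($key b), fun i => ?_⟩
  change g (algebraMap P B (MvPolynomial.X i)) = _
  rw [g.commutes, hP, MvPolynomial.aeval_X]

lemma exists_arc_of_arc {j : ℕ} (hj : 1 ≤ j) (v : B →ₐ[k] k⟦X⟧)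
    (q : Fin n → k⟦X⟧) (hq : ∀ i, X ^ j ∣ q i - v (coord k n B i)) :
    ∃ u : B →ₐ[k] k⟦X⟧, (∀ b, X ^ j ∣ u b - v b) ∧ ∀ i, u (coord k n B i) = q i := by
  obtain ⟨u, hu, hu'⟩ := exists_arc_of_jet hj ((Ideal.Quotient.mkₐ k _).comp v) q fun i => by
    have := hq i
    rw [← Ideal.mem_span_singleton, ← Ideal.Quotient.mk_eq_mk_iff_sub_mem] at this
    exact this
  refine ⟨u, fun b => ?_, hu'⟩
  rw [← Ideal.mem_span_singleton, ← Ideal.Quotient.mk_eq_mk_iff_sub_mem]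
  exact hu b

lemma taylor_dvd {j : ℕ} (u v : B →ₐ[k] k⟦X⟧) (h : ∀ a, X ^ j ∣ u a - v a) (b : B) :
    X ^ (2 * j) ∣ u b - v b - ∑ i, v (pd k n B i b) * (u (coord k n B i) - v (coord k n B i)) := by
  have := taylor (n := n) (Ideal.span {(X : k⟦X⟧) ^ j}) u v
    (fun a => Ideal.mem_span_singleton.mpr (h a)) b
  rwa [Ideal.span_singleton_pow, Ideal.mem_span_singleton, ← pow_mul, mul_comm] at this

end LiftArcs

open PowerSeries

section PowerSeriesLemmas
variable {k : Type*} [Field k]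

lemma dvd_mul_sub_mul {R : Type*} [CommRing R] {d a a' b b' : R} (h : d ∣ a - a') (h' : d ∣ b - b') :
    d ∣ a * b - a' * b' := by
  have : a * b - a' * b' = a * (b - b') + (a - a') * b' := by ring
  rw [this]
  exact dvd_add (h'.mul_left _) (h.mul_right _)

lemma dvd_det_sub_det {R ι : Type*} [CommRing R] [Fintype ι] [DecidableEq ι] {d : R}
    (M M' : Matrix ι ι R) (h : ∀ i j, d ∣ M i j - M' i j) : d ∣ M.det - M'.det := by
  simp only [← Ideal.mem_span_singleton, ← Ideal.Quotient.mk_eq_mk_iff_sub_mem] at h ⊢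
  rw [RingHom.map_det, RingHom.map_det]
  congr 1
  ext i j
  exact h i j

lemma eq_of_forall_X_pow_dvd {a b : k⟦X⟧} (h : ∀ j, X ^ j ∣ a - b) : a = b := by
  ext j
  have := (X_pow_dvd_iff.mp (h (j + 1))) j (Nat.lt_succ_self j)
  rwa [map_sub, sub_eq_zero] at this

lemma X_pow_dvd_of_dvd_mul {a b : ℕ} {g d : k⟦X⟧} (hg : ¬ X ^ (a + 1) ∣ g) (h : X ^ b ∣ g * d) :
    X ^ (b - a) ∣ d := by
  induction a generalizing b g with
  | zero => exact X_prime.pow_dvd_of_dvd_mul_left _ (by simpa using hg) h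
  | succ a ih =>
    by_cases h0 : (X : k⟦X⟧) ∣ g
    · obtain ⟨g, rfl⟩ := h0
      rcases b with _ | b
      · simp
      · rw [Nat.add_sub_add_right]
        refine ih (g := g) (fun hc => hg ?_) (b := b) ?_
        · rw [pow_succ']; exact mul_dvd_mul_left _ hc
        · rw [pow_succ', mul_assoc] at h
          exact (mul_dvd_mul_iff_left X_ne_zero).mp h
    · exact (pow_dvd_pow X (Nat.sub_le _ _)).trans (X_prime.pow_dvd_of_dvd_mul_left _ h0 h)

/-- Two elements congruent modulo `X ^ j` have the same order if it is less than `j`. -/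
lemma not_dvd_of_congr {a j : ℕ} (h : a < j) {f g : k⟦X⟧} (hfg : X ^ j ∣ f - g)
    (hg : ¬ X ^ (a + 1) ∣ g) : ¬ X ^ (a + 1) ∣ f := fun hf =>
  hg ((dvd_sub_right hf).mp ((pow_dvd_pow X h).trans hfg))

lemma exists_unit_of_order {a : ℕ} {f : k⟦X⟧} (h : X ^ a ∣ f) (h' : ¬ X ^ (a + 1) ∣ f) :
    ∃ u : (k⟦X⟧)ˣ, f = X ^ a * (u : k⟦X⟧) := by
  obtain ⟨g, rfl⟩ := h
  have : IsUnit g := by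
    rw [isUnit_iff_constantCoeff, isUnit_iff_ne_zero]
    intro h0
    rw [← X_dvd_iff] at h0
    exact h' (by rw [pow_succ]; exact mul_dvd_mul_left _ h0)
  obtain ⟨u, rfl⟩ := this
  exact ⟨u, rfl⟩

lemma map_det_congr {B : Type*} [CommRing B] [Algebra k B] {v w : B →ₐ[k] k⟦X⟧} {j : ℕ}
    (h : ∀ b, X ^ j ∣ w b - v b)
    {ι : Type*} [Fintype ι] [DecidableEq ι] (M : Matrix ι ι B) :
    X ^ j ∣ (w.mapMatrix M).det - (v.mapMatrix M).det := dvd_det_sub_det _ _ fun _ _ => h _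

/-- Coefficient l of the limit is read off from the iterate l + 1, from which point on it is
constant. -/
theorem exists_limit_algHom {B : Type*} [CommRing B] [Algebra k B] (s : ℕ) (v : ℕ → (B →ₐ[k] k⟦X⟧))
    (h : ∀ j b, X ^ (s + j) ∣ v (j + 1) b - v j b) :
    ∃ w : B →ₐ[k] k⟦X⟧, ∀ j b, X ^ (s + j) ∣ w b - v j b := by
  have h1 (i d : ℕ) (b : B) : X ^ (s + i) ∣ v (i + d) b - v i b := by
    induction d with
    | zero => simp
    | succ d ih =>
      have : v (i + (d + 1)) b - v i b = (v (i + d + 1) b - v (i + d) b) + (v (i + d) b - v i b) := by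
        rw [← add_assoc]; ring
      rw [this]
      exact dvd_add ((pow_dvd_pow X (by omega)).trans (h (i + d) b)) ih
  let w (b : B) : k⟦X⟧ := PowerSeries.mk fun l => coeff l (v (l + 1) b)
  have hw (j : ℕ) (b : B) : X ^ (s + j) ∣ w b - v j b := by
    rw [X_pow_dvd_iff]
    intro l hl
    rw [map_sub, coeff_mk, ← map_sub]
    rcases le_total j (l + 1) with hj | hj
    · obtain ⟨d, hd⟩ := Nat.exists_eq_add_of_le hj
      exact (X_pow_dvd_iff.mp (hd ▸ h1 j d b)) l hl
    · obtain ⟨d, hd⟩ := Nat.exists_eq_add_of_le hj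
      have := (X_pow_dvd_iff.mp (h1 (l + 1) d b)) l (by omega)
      rw [← hd] at this
      rw [← neg_sub, map_neg, this, neg_zero]
  have hw' (j : ℕ) (b : B) : X ^ j ∣ w b - v j b := (pow_dvd_pow X (by omega)).trans (hw j b)
  refine ⟨{ toFun := w, map_one' := ?_, map_mul' := ?_, map_zero' := ?_, map_add' := ?_,
            commutes' := ?_ }, hw⟩
  · exact eq_of_forall_X_pow_dvd fun j => by simpa using hw' j 1
  · refine fun a b => eq_of_forall_X_pow_dvd fun j => ?_
    have h2 := dvd_mul_sub_mul (hw' j a) (hw' j b)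
    rw [← map_mul] at h2
    have := dvd_sub (hw' j (a * b)) h2
    simpa using this
  · exact eq_of_forall_X_pow_dvd fun j => by simpa using hw' j 0
  · refine fun a b => eq_of_forall_X_pow_dvd fun j => ?_
    have := dvd_sub (hw' j (a + b)) (dvd_add (hw' j a) (hw' j b))
    rw [map_add] at this
    convert this using 1
    ring
  · exact fun c => eq_of_forall_X_pow_dvd fun j => by simpa using hw' j (algebraMap k B c)

end PowerSeriesLemmas

/-! ### Newton iteration for n functions. -/

section Newton
variable {k : Type*} [Field k] {n : ℕ} {B : Type*} [CommRing B] [Algebra k B]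
  [Algebra (MvPolynomial (Fin n) k) B] [IsScalarTower k (MvPolynomial (Fin n) k) B]
  [Algebra.Etale (MvPolynomial (Fin n) k) B]

variable (k n) in
/-- The Jacobian matrix of a family of functions with respect to étale coordinates. -/
noncomputable def jacMatrix {ι : Type*} (f : ι → B) : Matrix ι (Fin n) B :=
  Matrix.of fun l i => pd k n B i (f l)

/-- Write the error as t^(M+1)·c. The correction t^(M+1-e)·z with J·z = -t^e·c exists by Cramer's
rule, because det J is t^e times a unit. It cancels the error to first order, and the remainder has
order at least 2(M+1-e) ≥ M+2. -/
theorem newton_step {e M : ℕ} (hM : 2 * e ≤ M) (f : Fin n → B) (b : Fin n → k⟦X⟧) (v : B →ₐ[k] k⟦X⟧)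
    (hv : X ^ e ∣ (v.mapMatrix (jacMatrix k n f)).det)
    (hv' : ¬ X ^ (e + 1) ∣ (v.mapMatrix (jacMatrix k n f)).det)
    (hb : ∀ l, X ^ (M + 1) ∣ v (f l) - b l) :
    ∃ w : B →ₐ[k] k⟦X⟧, (∀ a, X ^ (M + 1 - e) ∣ w a - v a) ∧ ∀ l, X ^ (M + 2) ∣ w (f l) - b l := by
  let J : Matrix (Fin n) (Fin n) k⟦X⟧ := v.mapMatrix (jacMatrix k n f)
  change X ^ e ∣ J.det at hv
  change ¬ X ^ (e + 1) ∣ J.det at hv'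
  obtain ⟨u, hu⟩ := exists_unit_of_order hv hv'
  choose c hc using hb
  let z : Fin n → k⟦X⟧ := ((u⁻¹ : (k⟦X⟧)ˣ) : k⟦X⟧) • (J.adjugate.mulVec (-c))
  have hz : J.mulVec z = (X : k⟦X⟧) ^ e • (-c) := by
    simp only [z, Matrix.mulVec_smul, Matrix.mulVec_mulVec, Matrix.mul_adjugate, hu,
      Matrix.smul_mulVec, Matrix.one_mulVec, smul_smul]
    rw [mul_comm, mul_assoc, Units.mul_inv, mul_one]
  obtain ⟨w, hw, hw'⟩ := exists_arc_of_arc (n := n) (j := M + 1 - e) (by omega) v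
    (fun i => v (coord k n B i) + X ^ (M + 1 - e) * z i) (fun i => by simp)
  refine ⟨w, hw, fun l => ?_⟩
  have h1 := taylor_dvd (n := n) w v hw (f l)
  have h2 : ∑ i, v (pd k n B i (f l)) * (w (coord k n B i) - v (coord k n B i)) =
      X ^ (M + 1) * (- c l) := by
    have := congrFun hz l
    simp only [Matrix.mulVec, dotProduct, Pi.smul_apply, smul_eq_mul, Pi.neg_apply] at this
    have h3 : X ^ (M + 1) * (- c l) = X ^ (M + 1 - e) * (X ^ e * - c l) := by
      rw [← mul_assoc, ← pow_add]; congr 2; omega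
    rw [h3, ← this, Finset.mul_sum]
    refine Finset.sum_congr rfl fun i _ => ?_
    rw [hw', add_sub_cancel_left]
    change _ = X ^ (M + 1 - e) * (v (pd k n B i (f l)) * z i)
    ring
  have h4 : w (f l) - b l = w (f l) - v (f l) -
      ∑ i, v (pd k n B i (f l)) * (w (coord k n B i) - v (coord k n B i)) := by
    rw [h2]
    linear_combination hc l
  rw [h4]
  exact (pow_dvd_pow X (by omega)).trans h1

/-- The corrections live in degrees ≥ m+1-e > e, so the Jacobian determinant keeps its order e and
the step can be repeated; the iterates converge. -/
theorem newton {e m : ℕ} (hm : 2 * e ≤ m) (f : Fin n → B) (b : Fin n → k⟦X⟧) (v : B →ₐ[k] k⟦X⟧)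
    (hv : X ^ e ∣ (v.mapMatrix (jacMatrix k n f)).det)
    (hv' : ¬ X ^ (e + 1) ∣ (v.mapMatrix (jacMatrix k n f)).det)
    (hb : ∀ l, X ^ (m + 1) ∣ v (f l) - b l) :
    ∃ w : B →ₐ[k] k⟦X⟧, (∀ a, X ^ (m + 1 - e) ∣ w a - v a) ∧ ∀ l, w (f l) = b l := by
  let Q (j : ℕ) (v : B →ₐ[k] k⟦X⟧) : Prop := X ^ e ∣ (v.mapMatrix (jacMatrix k n f)).det ∧
    ¬ X ^ (e + 1) ∣ (v.mapMatrix (jacMatrix k n f)).det ∧ ∀ l, X ^ (m + j + 1) ∣ v (f l) - b l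
  have step (j : ℕ) (v : {v // Q j v}) :
      ∃ w : {w // Q (j + 1) w}, ∀ a, X ^ (m + 1 - e + j) ∣ w.1 a - v.1 a := by
    obtain ⟨v, h1, h2, h3⟩ := v
    obtain ⟨w, hw, hw'⟩ := newton_step (M := m + j) (by omega) f b v h1 h2 h3
    have hd := map_det_congr hw (jacMatrix k n f)
    refine ⟨⟨w, ?_, ?_, hw'⟩, fun a => (pow_dvd_pow X (by omega)).trans (hw a)⟩
    · exact (dvd_sub_left h1).mp ((pow_dvd_pow X (by omega)).trans hd)
    · exact not_dvd_of_congr (by omega) hd h2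
  choose F hF using step
  let V (j : ℕ) : {v // Q j v} := Nat.rec ⟨v, hv, hv', hb⟩ (fun j v => F j v) j
  obtain ⟨w, hw⟩ := exists_limit_algHom (m + 1 - e) (fun j => (V j).1) fun j a => hF j (V j) a
  refine ⟨w, fun a => hw 0 a, fun l => eq_of_forall_X_pow_dvd fun j => ?_⟩
  have h1 := (pow_dvd_pow (X : k⟦X⟧) (show j ≤ m + 1 - e + j by omega)).trans (hw j (f l))
  have h2 := (pow_dvd_pow (X : k⟦X⟧) (show j ≤ m + j + 1 by omega)).trans ((V j).2.2.2 l)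
  simpa using dvd_add h1 h2

end Newton

open PowerSeries

/-! ### Maximal minors, and lifting arcs through f. -/

section MinorDuality
variable {R : Type*} [CommRing R]

/-- If `G P = 0` and the rows `I` of `P` form the identity matrix, then a vector that vanishes on
`I` and is killed by `G` modulo `t` is killed modulo `t` by every maximal minor of `G`. -/
lemma dvd_minor_mul {c n N : ℕ} (hN : c + n = N) (G : Matrix (Fin c) (Fin N) R)
    (P : Matrix (Fin N) (Fin n) R) (hGP : G * P = 0) (I : Fin n → Fin N)
    (hP : P.submatrix I id = 1) (cc : Fin c → Fin N) (d : Fin N → R) (hd : ∀ l, d (I l) = 0) (t : R)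
    (ht : ∀ a, t ∣ G.mulVec d a) (j : Fin N) : t ∣ (G.submatrix id cc).det * d j := by
  let ε : Fin c ⊕ Fin n ≃ Fin N := finSumFinEquiv.trans (finCongr hN)
  -- `S` stacks `G` on the projections to the coordinates `I`; `Q` joins the unit columns selected
  -- by `cc` to `P`. Their product is block triangular with diagonal blocks the chosen minor and 1,
  -- so det S divides that minor. Since S·d is divisible by `t`, so is det S · d, by the adjugate.
  let S : Matrix (Fin c ⊕ Fin n) (Fin N) R := Matrix.fromRows G (Matrix.of fun l => Pi.single (I l) 1)
  let Q : Matrix (Fin N) (Fin c ⊕ Fin n) R :=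
    Matrix.fromCols (Matrix.of fun j b => if j = cc b then 1 else 0) P
  have hI (l : Fin n) (v : Fin N → R) : ∑ j, (Pi.single (I l) (1 : R) : Fin N → R) j * v j = v (I l) := by
    rw [Finset.sum_eq_single (I l)]
    · simp
    · intro b _ hb; simp [Pi.single_eq_of_ne hb]
    · simp
  have hSQ : S * Q = Matrix.fromBlocks (G.submatrix id cc) 0
      (Matrix.of fun l b => if I l = cc b then 1 else 0) 1 := by
    rw [Matrix.fromRows_mul_fromCols]
    congr 1
    · ext a b
      simp [Matrix.mul_apply]
    · ext l b
      simp only [Matrix.mul_apply, Matrix.of_apply]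
      exact hI l fun j => if j = cc b then 1 else 0
    · ext l i
      simp only [Matrix.mul_apply, Matrix.of_apply]
      rw [hI l fun j => P j i, ← hP]; rfl
  have hdet : (S.submatrix id ε).det * (Q.submatrix ε id).det = (G.submatrix id cc).det := by
    rw [← Matrix.det_mul, Matrix.submatrix_mul_equiv, hSQ, Matrix.submatrix_id_id,
      Matrix.det_fromBlocks_zero₁₂]
    simp
  have h1 : (S.submatrix id ε).mulVec (d ∘ ε) = S.mulVec d := by
    ext a
    simp only [Matrix.mulVec, dotProduct, Matrix.submatrix_apply, id, Function.comp]
    exact ε.sum_comp fun j => S a j * d j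
  have h2 : (S.submatrix id ε).det • (d ∘ ε) = (S.submatrix id ε).adjugate.mulVec (S.mulVec d) := by
    rw [← h1, Matrix.mulVec_mulVec, Matrix.adjugate_mul, Matrix.smul_mulVec, Matrix.one_mulVec]
  have h3 : ∀ a, t ∣ S.mulVec d a := by
    rintro (a | l)
    · exact ht a
    · have : S.mulVec d (Sum.inr l) = d (I l) := hI l d
      rw [this, hd]; exact dvd_zero _
  have h4 : t ∣ (S.submatrix id ε).det * d j := by
    have := congrFun h2 (ε.symm j)
    simp only [Pi.smul_apply, Function.comp, Equiv.apply_symm_apply, smul_eq_mul] at this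
    rw [this]
    change t ∣ ∑ a, (S.submatrix id ε).adjugate (ε.symm j) a * S.mulVec d a
    exact Finset.dvd_sum fun a _ => (h3 a).mul_left _
  rw [← hdet, mul_right_comm]
  exact h4.mul_right _

/-- By Cramer's rule, a matrix is a multiple of a square submatrix whose determinant divides
all the minors. -/
lemma exists_mul_submatrix [IsDomain R] {n N : ℕ} (D : Matrix (Fin N) (Fin n) R) (I : Fin n → Fin N)
    (hI : (D.submatrix I id).det ≠ 0)
    (h : ∀ I' : Fin n → Fin N, (D.submatrix I id).det ∣ (D.submatrix I' id).det) :
    ∃ P : Matrix (Fin N) (Fin n) R, P * D.submatrix I id = D ∧ P.submatrix I id = 1 := by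
  -- The (j, i) entry of D · adj(D_I) is the minor of D obtained from D_I by replacing its row i
  -- with row j of D.
  have h1 (j : Fin N) (i : Fin n) : (D.submatrix I id).det ∣ (D * (D.submatrix I id).adjugate) j i := by
    have : (D * (D.submatrix I id).adjugate) j i = (D.submatrix (Function.update I i j) id).det := by
      have e : D.submatrix (Function.update I i j) id = (D.submatrix I id).updateRow i (D j) := by
        ext a b
        by_cases ha : a = i
        · subst ha; simp
        · simp [ha]
      refine Eq.trans ?_ (congrArg Matrix.det e).symm
      refine Eq.trans ?_ (Matrix.cramer_transpose_apply _ _ _)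
      refine Eq.trans ?_ (congrFun (Matrix.cramer_eq_adjugate_mulVec _ _) i).symm
      rw [← Matrix.adjugate_transpose]
      change ∑ l, D j l * (D.submatrix I id).adjugate l i =
        ∑ l, (D.submatrix I id).adjugate l i * D j l
      exact Finset.sum_congr rfl fun l _ => mul_comm _ _
    rw [this]; exact h _
  choose P hP using h1
  have hPD : Matrix.of P * D.submatrix I id = D := by
    have h2 : (D.submatrix I id).det • (Matrix.of P * D.submatrix I id) = (D.submatrix I id).det • D := by
      have h3 : (D.submatrix I id).det • Matrix.of P = D * (D.submatrix I id).adjugate := by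
        ext j i; simp [hP]
      rw [← Matrix.smul_mul, h3, Matrix.mul_assoc, Matrix.adjugate_mul, Matrix.mul_smul, Matrix.mul_one]
    ext j i
    exact mul_left_cancel₀ hI congr($h2 j i)
  refine ⟨Matrix.of P, hPD, ?_⟩
  have h4 : (Matrix.of P).submatrix I id * D.submatrix I id = D.submatrix I id := by
    have := congr(($hPD).submatrix I id)
    rwa [Matrix.submatrix_mul _ _ _ id _ Function.bijective_id, Matrix.submatrix_id_id] at this
  have h5 : ((Matrix.of P).submatrix I id - 1) * D.submatrix I id = 0 := by
    rw [Matrix.sub_mul, h4, Matrix.one_mul, sub_self]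
  have h6 := congr($h5 * (D.submatrix I id).adjugate)
  rw [Matrix.mul_assoc, Matrix.mul_adjugate, Matrix.zero_mul, Matrix.mul_smul, Matrix.mul_one] at h6
  rw [← sub_eq_zero]
  ext a b
  have := congr($h6 a b)
  simpa [hI] using this

lemma mul_eq_zero_of_mul_submatrix [IsDomain R] {c n N : ℕ} {G : Matrix (Fin c) (Fin N) R}
    {P D : Matrix (Fin N) (Fin n) R} {M : Matrix (Fin n) (Fin n) R} (hM : M.det ≠ 0)
    (hP : P * M = D) (hGD : G * D = 0) : G * P = 0 := by
  have h6 := congr($hGD * M.adjugate)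
  rw [← hP, Matrix.mul_assoc, Matrix.mul_assoc, Matrix.mul_adjugate, Matrix.zero_mul, Matrix.mul_smul,
    Matrix.mul_one, Matrix.mul_smul] at h6
  ext a b
  have := congr($h6 a b)
  simpa [hM] using this

end MinorDuality

section LiftThrough
variable {k : Type*} [Field k] {n : ℕ} {B : Type*} [CommRing B] [Algebra k B]
  [Algebra (MvPolynomial (Fin n) k) B] [IsScalarTower k (MvPolynomial (Fin n) k) B]
  [Algebra.Etale (MvPolynomial (Fin n) k) B] {A : Type*} [CommRing A] [Algebra k A]

lemma congr_of_generators {N : ℕ} (y : Fin N → A) (hy : Algebra.adjoin k (Set.range y) = ⊤) (j : ℕ)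
    (u v : A →ₐ[k] k⟦X⟧) (h : ∀ l, X ^ j ∣ u (y l) - v (y l)) (a : A) : X ^ j ∣ u a - v a := by
  have : (Ideal.Quotient.mkₐ k (Ideal.span {(X : k⟦X⟧) ^ j})).comp u =
      (Ideal.Quotient.mkₐ k (Ideal.span {(X : k⟦X⟧) ^ j})).comp v := by
    refine AlgHom.ext_of_adjoin_eq_top hy ?_
    rintro _ ⟨l, rfl⟩
    have := h l
    rw [← Ideal.mem_span_singleton, ← Ideal.Quotient.mk_eq_mk_iff_sub_mem] at this
    exact this
  rw [← Ideal.mem_span_singleton, ← Ideal.Quotient.mk_eq_mk_iff_sub_mem]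
  exact congr($this a)

/-- ∂_i ∘ φ is a derivation of A with values in B, so it kills every relation among differentials of
A. -/
lemma sum_mul_pd_eq_zero (φ : A →ₐ[k] B) {ι : Type*} [Fintype ι] (y r : ι → A)
    (hr : ∑ j, r j • KaehlerDifferential.D k A (y j) = 0) (i : Fin n) :
    ∑ j, φ (r j) * pd k n B i (φ (y j)) = 0 := by
  let := φ.toRingHom.toAlgebra
  have : IsScalarTower k A B := .of_algebraMap_eq' φ.comp_algebraMap.symm
  have h1 := congrArg ((pd k n B i).compAlgebraMap A).liftKaehlerDifferential hr
  rw [map_sum, map_zero] at h1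
  simp only [map_smul, Derivation.liftKaehlerDifferential_comp_D] at h1
  rw [← h1]
  exact Finset.sum_congr rfl fun j _ => (Algebra.smul_def (r j) _).symm

/-- An arc of the target that is close to the image of an arc `v` lifts to an arc close to `v`. -/
theorem exists_lift_of_close {N : ℕ} (φ : A →ₐ[k] B) (y : Fin N → A)
    (hy : Algebra.adjoin k (Set.range y) = ⊤) {e e' m : ℕ} (he : 2 * e ≤ m) (he' : e + e' ≤ m)
    (v : B →ₐ[k] k⟦X⟧)
    (hD : ∀ I : Fin n → Fin N, X ^ e ∣ (v.mapMatrix (jacMatrix k n fun l => φ (y (I l)))).det)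
    (I : Fin n → Fin N)
    (hI : ¬ X ^ (e + 1) ∣ (v.mapMatrix (jacMatrix k n fun l => φ (y (I l)))).det)
    (r : Fin (N - n) → Fin N → A) (cc : Fin (N - n) → Fin N)
    (hr : ∀ a, ∑ j, r a j • KaehlerDifferential.D k A (y j) = 0)
    (hG : ¬ X ^ (e' + 1) ∣ v (φ (Matrix.of fun a b => r a (cc b)).det))
    (β : A →ₐ[k] k⟦X⟧) (hβ : ∀ a, X ^ (m + 1) ∣ v (φ a) - β a) :
    ∃ w : B →ₐ[k] k⟦X⟧, (∀ a, X ^ (m + 1 - e) ∣ w a - v a) ∧ ∀ a, w (φ a) = β a := by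
  -- Newton iteration prescribes only the n functions `y ∘ I`. That the remaining generators also
  -- take the values given by `β` has to come from the relations in A.
  obtain ⟨w, hw, hwI⟩ := newton he (fun l => φ (y (I l))) (fun l => β (y (I l))) v (hD I) hI
    fun l => hβ _
  refine ⟨w, hw, ?_⟩
  let D : Matrix (Fin N) (Fin n) k⟦X⟧ := Matrix.of fun l i => w (pd k n B i (φ (y l)))
  have hDI (I' : Fin n → Fin N) : D.submatrix I' id =
      w.mapMatrix (jacMatrix k n fun l => φ (y (I' l))) := rfl
  have hD' (I' : Fin n → Fin N) : X ^ e ∣ (D.submatrix I' id).det := by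
    rw [hDI]
    exact (dvd_sub_left (hD I')).mp ((pow_dvd_pow X (by omega)).trans (map_det_congr hw _))
  have hI' : ¬ X ^ (e + 1) ∣ (D.submatrix I id).det := by
    rw [hDI]; exact not_dvd_of_congr (by omega) (map_det_congr hw _) hI
  have hI0 : (D.submatrix I id).det ≠ 0 := fun h => hI' (h ▸ dvd_zero _)
  -- A nonzero minor forces `I` to be injective, so N - n is an honest subtraction and (N - n) + n =
  -- N in `dvd_minor_mul`.
  have hnN : n ≤ N := by
    have : Function.Injective I := fun a b hab => by
      by_contra hne
      exact hI0 (Matrix.det_zero_of_row_eq hne (by ext; simp [hab]))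
    simpa using Fintype.card_le_of_injective I this
  obtain ⟨u, hu⟩ := exists_unit_of_order (hD' I) hI'
  obtain ⟨P, hPD, hPI⟩ := exists_mul_submatrix D I hI0 fun I' => by
    rw [hu]; exact (Units.mul_right_dvd).mpr (hD' I')
  let G : Matrix (Fin (N - n)) (Fin N) k⟦X⟧ := Matrix.of fun a j => w (φ (r a j))
  have hGD : G * D = 0 := by
    refine Matrix.ext fun a i => ?_
    have := congrArg w (sum_mul_pd_eq_zero φ y (r a) (hr a) i)
    rw [map_sum, map_zero] at this
    refine Eq.trans ?_ this
    change ∑ j, w (φ (r a j)) * w (pd k n B i (φ (y j))) = _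
    exact Finset.sum_congr rfl fun j _ => (map_mul w _ _).symm
  have hGP := mul_eq_zero_of_mul_submatrix hI0 hPD hGD
  have hG' : ¬ X ^ (e' + 1) ∣ (G.submatrix id cc).det := by
    have : (G.submatrix id cc).det = w (φ (Matrix.of fun a b => r a (cc b)).det) := by
      rw [AlgHom.map_det, AlgHom.map_det]; rfl
    rw [this]
    exact not_dvd_of_congr (by omega) (hw _) hG
  have hβ' (a : A) : X ^ (m + 1 - e) ∣ β a - w (φ a) := by
    have h1 := (pow_dvd_pow (X : k⟦X⟧) (show m + 1 - e ≤ m + 1 by omega)).trans (hβ a)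
    have := dvd_add h1 (hw (φ a))
    rw [← dvd_neg]
    convert this using 1
    ring
  -- Let j = m+1-e+o be the current precision. The differences vanish at the indices `I` and are
  -- killed by the relation matrix `G` modulo t^(2j). A maximal minor of `G` of order at most e'
  -- then makes them divisible by t^(2j-e'), and 2j - e' ≥ j + 1 since m ≥ e + e'.
  have key (o : ℕ) (l : Fin N) : X ^ (m + 1 - e + o) ∣ β (y l) - w (φ (y l)) := by
    induction o generalizing l with
    | zero => exact hβ' _
    | succ o ih =>
      have h1 := congr_of_generators y hy _ β (w.comp φ) ih
      have h2 (a) : X ^ (2 * (m + 1 - e + o)) ∣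
          G.mulVec (fun j => β (y j) - w (φ (y j))) a := by
        have := sum_mul_sub_mem_sq (Ideal.span {(X : k⟦X⟧) ^ (m + 1 - e + o)}) β (w.comp φ)
          (fun a => Ideal.mem_span_singleton.mpr (h1 a)) y (r a) (hr a)
        rwa [Ideal.span_singleton_pow, Ideal.mem_span_singleton, ← pow_mul, mul_comm _ 2] at this
      have h3 := dvd_minor_mul (by omega) G P hGP I hPI cc _
        (fun l => by rw [hwI, sub_self]) _ h2 l
      exact (pow_dvd_pow X (by omega)).trans (X_pow_dvd_of_dvd_mul hG' h3)
  have h5 : w.comp φ = β := by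
    refine AlgHom.ext_of_adjoin_eq_top hy ?_
    rintro _ ⟨l, rfl⟩
    exact (eq_of_forall_X_pow_dvd fun j => (pow_dvd_pow X (by omega)).trans (key j l)).symm
  exact fun a => congr($h5 a)

end LiftThrough

/-! ### The Jacobian ideal of f as an ideal of minors. -/

section FittingOfJacobian

/-- Expand det(S·D) multilinearly in the rows; the sum is over all maps I, the non-injective ones
contributing zero. -/
lemma det_mem_span_of_rows {R : Type*} [CommRing R] {n N : ℕ} (D : Matrix (Fin N) (Fin n) R)
    (M : Matrix (Fin n) (Fin n) R) (S : Matrix (Fin n) (Fin N) R) (h : M = S * D) :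
    M.det ∈ Ideal.span (Set.range fun I : Fin n → Fin N => (D.submatrix I id).det) := by
  have h1 : M.det = ∑ I : Fin n → Fin N, (∏ a, S a (I a)) • (D.submatrix I id).det := by
    have h2 : M = Matrix.of fun a => ∑ l, S a l • D l := by
      subst h
      refine Matrix.ext fun a b => ?_
      change _ = (∑ l, S a l • D l) b
      rw [Finset.sum_apply]; rfl
    rw [h2]
    change Matrix.detRowAlternating.toMultilinearMap (fun a => ∑ l, S a l • D l) = _
    rw [MultilinearMap.map_sum]
    exact Finset.sum_congr rfl fun I _ => MultilinearMap.map_smul_univ _ _ _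
  rw [h1]
  exact Ideal.sum_mem _ fun I _ => Ideal.mul_mem_left _ _ (Ideal.subset_span ⟨I, rfl⟩)

lemma D_mem_span_of_adjoin {k A : Type*} [CommRing k] [CommRing A] [Algebra k A] {ι : Type*}
    (y : ι → A) (hy : Algebra.adjoin k (Set.range y) = ⊤) (a : A) :
    KaehlerDifferential.D k A a ∈
      Submodule.span A (Set.range fun l => KaehlerDifferential.D k A (y l)) := by
  have ha : a ∈ Algebra.adjoin k (Set.range y) := hy ▸ Algebra.mem_top
  induction ha using Algebra.adjoin_induction with
  | mem x hx =>
    obtain ⟨l, rfl⟩ := hx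
    exact Submodule.subset_span ⟨l, rfl⟩
  | algebraMap r => simp
  | add x y _ _ hx hy => rw [map_add]; exact add_mem hx hy
  | mul x y _ _ hx hy =>
    rw [Derivation.leibniz]
    exact add_mem (Submodule.smul_mem _ _ hy) (Submodule.smul_mem _ _ hx)

lemma span_D_eq_top {k A : Type*} [CommRing k] [CommRing A] [Algebra k A] {ι : Type*}
    (y : ι → A) (hy : Algebra.adjoin k (Set.range y) = ⊤) :
    Submodule.span A (Set.range fun l => KaehlerDifferential.D k A (y l)) = ⊤ := by
  rw [eq_top_iff, ← KaehlerDifferential.span_range_derivation, Submodule.span_le]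
  rintro _ ⟨a, rfl⟩
  exact D_mem_span_of_adjoin y hy a

variable {k : Type*} [Field k] {n : ℕ} {B : Type*} [CommRing B] [Algebra k B]
  [Algebra (MvPolynomial (Fin n) k) B] [IsScalarTower k (MvPolynomial (Fin n) k) B]
  [Algebra.Etale (MvPolynomial (Fin n) k) B] {A : Type*} [CommRing A] [Algebra k A]

open scoped TensorProduct in
-- Ω[B⁄A] is the quotient of the free module on the dx_i by the span of the d(y_l). Hence every
-- relation among the images of the dx_i is a combination of rows of the Jacobian matrix.
theorem fittingIdeal_kaehler_eq_span_minors [Algebra A B] [IsScalarTower k A B] {N : ℕ} (y : Fin N → A)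
    (hy : Algebra.adjoin k (Set.range y) = ⊤) :
    fittingIdeal B (Ω[B⁄A]) 0 = Ideal.span (Set.range fun I : Fin n → Fin N =>
      (jacMatrix k n fun l => algebraMap A B (y (I l))).det) := by
  let x (i : Fin n) : Ω[B⁄A] := KaehlerDifferential.D A B (coord k n B i)
  let π : Ω[B⁄k] →ₗ[B] Ω[B⁄A] := KaehlerDifferential.map k A B B
  have hπ : Function.Surjective π := KaehlerDifferential.map_surjective k A B
  have hπx (i : Fin n) : π (coordBasis k n B i) = x i := by
    rw [coordBasis_apply]
    exact KaehlerDifferential.map_D k A B B _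
  have hx : Submodule.span B (Set.range x) = ⊤ := by
    have : Set.range x = π '' Set.range (coordBasis k n B) := by
      rw [← Set.range_comp]; exact congrArg _ (funext fun i => (hπx i).symm)
    rw [this, Submodule.span_image, (coordBasis k n B).span_eq, Submodule.map_top,
      LinearMap.range_eq_top.mpr hπ]
  let D : Matrix (Fin N) (Fin n) B := jacMatrix k n fun l => algebraMap A B (y l)
  have hDsum (l : Fin N) : ∑ i, D l i • coordBasis k n B i =
      KaehlerDifferential.D k B (algebraMap A B (y l)) := by
    rw [D_eq_sum_pd (n := n)]
    exact Finset.sum_congr rfl fun i _ => by rw [coordBasis_apply]; rfl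
  have hker : LinearMap.ker π = Submodule.span B (Set.range fun l : Fin N =>
      KaehlerDifferential.D k B (algebraMap A B (y l))) := by
    have h1 : LinearMap.ker π = LinearMap.range (KaehlerDifferential.mapBaseChange k A B) :=
      (KaehlerDifferential.range_mapBaseChange k A B).symm
    rw [h1]
    apply le_antisymm
    · rintro _ ⟨z, rfl⟩
      induction z with
      | zero => simp
      | add a b ha hb => rw [map_add]; exact add_mem ha hb
      | tmul b w =>
        rw [KaehlerDifferential.mapBaseChange_tmul]
        refine Submodule.smul_mem _ _ ?_
        have hw : w ∈ Submodule.span A (Set.range fun l => KaehlerDifferential.D k A (y l)) :=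
          span_D_eq_top y hy ▸ Submodule.mem_top
        induction hw using Submodule.span_induction with
        | mem w hw =>
          obtain ⟨l, rfl⟩ := hw
          rw [KaehlerDifferential.map_D]
          exact Submodule.subset_span ⟨l, rfl⟩
        | zero => simp
        | add a b _ _ ha hb => rw [map_add]; exact add_mem ha hb
        | smul c w _ hw =>
          rw [map_smul, ← algebraMap_smul B c]
          exact Submodule.smul_mem _ _ hw
    · rw [Submodule.span_le]
      rintro _ ⟨l, rfl⟩
      exact ⟨1 ⊗ₜ KaehlerDifferential.D k A (y l), by simp⟩
  rw [fittingIdeal_eq_minorIdeal x hx 0]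
  apply le_antisymm
  · refine Ideal.span_le.mpr ?_
    rintro _ ⟨r, c, h, rfl⟩
    have h2 (a : Fin n) : ∃ s : Fin N → B, ∀ i, r a i = ∑ l, s l * D l i := by
      have h3 : ∑ i, r a i • coordBasis k n B i ∈ LinearMap.ker π := by
        rw [LinearMap.mem_ker, map_sum, ← h a]
        exact Finset.sum_congr rfl fun i _ => by rw [map_smul, hπx]
      rw [hker, Submodule.mem_span_range_iff_exists_fun] at h3
      obtain ⟨s, hs⟩ := h3
      refine ⟨s, fun i => ?_⟩
      have h4 := congrArg (fun w => (coordBasis k n B).repr w i) hs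
      simp only [← hDsum, Finset.smul_sum, smul_smul] at h4
      rw [Finset.sum_comm] at h4
      simp only [← Finset.sum_smul] at h4
      rw [Module.Basis.repr_sum_self, Module.Basis.repr_sum_self] at h4
      exact h4.symm
    choose s hs using h2
    have h5 := det_mem_span_of_rows (D.submatrix id c) (Matrix.of fun a b => r a (c b)) (Matrix.of s) (by
      refine Matrix.ext fun a b => ?_
      exact hs a (c b))
    refine (Ideal.span_le.mpr ?_) h5
    rintro _ ⟨I, rfl⟩
    have h6 : (D.submatrix id c).submatrix I id = (D.submatrix I id) * (1 : Matrix (Fin n) (Fin n) B).submatrix id c := by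
      refine Matrix.ext fun a b => ?_
      simp [Matrix.mul_apply, Matrix.one_apply]
    simp only
    rw [h6, Matrix.det_mul]
    exact Ideal.mul_mem_right _ _ (Ideal.subset_span ⟨I, rfl⟩)
  · refine Ideal.span_le.mpr ?_
    rintro _ ⟨I, rfl⟩
    refine Ideal.subset_span ⟨fun a i => D (I a) i, id, fun a => ?_, rfl⟩
    have h7 : ∑ i, D (I a) i • x i = π (KaehlerDifferential.D k B (algebraMap A B (y (I a)))) := by
      rw [← hDsum, map_sum]
      exact Finset.sum_congr rfl fun i _ => by rw [map_smul, hπx]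
    rw [h7, ← LinearMap.mem_ker, hker]
    exact Submodule.subset_span ⟨I a, rfl⟩

end FittingOfJacobian

/-! ### Pulling back ideal sheaves along arcs, and charts with étale coordinates. -/

section ArcIdeal

/-- Pullback of ideal sheaves is left adjoint to pushforward, and on affine schemes pushforward is
the preimage of ideals; so pullback is extension of ideals. -/
lemma ideal_comap_top {X Y : Scheme.{u}} [IsAffine X] [IsAffine Y] (f : X ⟶ Y) (J : Y.IdealSheafData) :
    (J.comap f).ideal ⟨⊤, isAffineOpen_top X⟩ =
      (J.ideal ⟨⊤, isAffineOpen_top Y⟩).map f.appTop.hom := by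
  let E (Z : Scheme.{u}) [IsAffine Z] : Z.IdealSheafData ≃o Ideal Γ(Z, ⊤) :=
    Scheme.IdealSheafData.equivOfIsAffine.toOrderIso
  have key (K : X.IdealSheafData) : J.comap f ≤ K ↔ (E Y J).map f.appTop.hom ≤ E X K := by
    have h : E Y (K.map f) = (E X K).comap f.appTop.hom :=
      Scheme.IdealSheafData.ideal_map_of_isAffineHom K f ⟨⊤, isAffineOpen_top Y⟩
    rw [← Scheme.IdealSheafData.le_map_iff_comap_le, Ideal.map_le_iff_le_comap, ← (E Y).le_iff_le, h]
  apply le_antisymm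
  · have h := (key ((E X).symm ((E Y J).map f.appTop.hom))).mpr (by rw [OrderIso.apply_symm_apply])
    have := (E X).le_iff_le.mpr h
    rwa [OrderIso.apply_symm_apply] at this
  · exact (key _).mp le_rfl

lemma ideal_comap_open {X Y : Scheme.{u}} [IsAffine Y] (f : Y ⟶ X) [IsOpenImmersion f]
    (I : X.IdealSheafData) (V : X.affineOpens) (h : f ''ᵁ ⊤ = V.1) (e : ⊤ ≤ f ⁻¹ᵁ V.1) :
    (I.comap f).ideal ⟨⊤, isAffineOpen_top Y⟩ = (I.ideal V).map (f.appLE V.1 ⊤ e).hom := by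
  obtain ⟨V, hV⟩ := V
  dsimp only at h e
  subst h
  rw [Scheme.IdealSheafData.ideal_comap_of_isOpenImmersion]
  have h1 : f.appLE (f ''ᵁ ⊤) ⊤ e = (f.appIso ⊤).hom := (f.appIso_hom' ⊤).symm
  rw [h1]
  apply le_antisymm
  · intro x hx
    have := Ideal.mem_map_of_mem (f.appIso ⊤).hom.hom (Ideal.mem_comap.mp hx)
    rwa [← CommRingCat.comp_apply, Iso.inv_hom_id] at this
  · refine Ideal.map_le_iff_le_comap.mpr fun s hs => ?_
    rw [Ideal.mem_comap, Ideal.mem_comap, ← CommRingCat.comp_apply, Iso.hom_inv_id]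
    exact hs

lemma ideal_comap_fromSpec {X : Scheme.{u}} (I : X.IdealSheafData) (V : X.affineOpens) :
    ((I.comap V.2.fromSpec).ideal ⟨⊤, isAffineOpen_top (Spec Γ(X, V.1))⟩).map
      (Scheme.ΓSpecIso Γ(X, V.1)).hom.hom = I.ideal V := by
  have hV : IsAffineOpen V.1 := V.2
  rw [ideal_comap_open hV.fromSpec I V (by
    rw [Scheme.Hom.image_top_eq_opensRange, IsAffineOpen.opensRange_fromSpec])
    hV.fromSpec_preimage_self.ge, Ideal.map_map, ← CommRingCat.hom_comp]
  have : hV.fromSpec.appLE V.1 ⊤ hV.fromSpec_preimage_self.ge ≫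
      (Scheme.ΓSpecIso Γ(X, V.1)).hom = 𝟙 _ := by
    rw [Scheme.Hom.appLE, IsAffineOpen.fromSpec_app_self, Category.assoc, Category.assoc,
      ← Functor.map_comp_assoc, Iso.inv_comp_eq, Category.comp_id]
    exact (congrArg (· ≫ _) (CategoryTheory.Functor.map_id _ _)).trans (Category.id_comp _)
  rw [this]
  exact Ideal.map_id _

lemma arcIdeal_eq_map {k : Type u} [CommRing k] {X : Over (Spec (.of k))} (I : X.left.IdealSheafData)
    (V : X.left.affineOpens) (γ : Arc X) (v : Γ(X.left, V.1) ⟶ .of (PowerSeries k))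
    (h : γ.left = Spec.map v ≫ V.2.fromSpec) : arcIdeal I γ = (I.ideal V).map v.hom := by
  rw [arcIdeal, ← ideal_comap_fromSpec I V, h, Scheme.IdealSheafData.comap_comp]
  have h1 := ideal_comap_top (Spec.map v) (I.comap V.2.fromSpec)
  refine (congrArg (Ideal.map (Scheme.ΓSpecIso (.of (PowerSeries k))).hom.hom) h1).trans ?_
  rw [Ideal.map_map, Ideal.map_map, ← CommRingCat.hom_comp, ← CommRingCat.hom_comp,
    Scheme.ΓSpecIso_naturality]

end ArcIdeal

section Charts
variable {k : Type u} [Field k]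

/-- The structure homomorphism of the ring of sections over an open subset. -/
noncomputable def sectionsHom (X : Over (Spec (.of k))) (V : X.left.Opens) :
    CommRingCat.of k ⟶ Γ(X.left, V) :=
  (Scheme.ΓSpecIso (.of k)).inv ≫ X.hom.appLE ⊤ V le_top

/-- The sections of a `k`-scheme as a `k`-algebra. -/
noncomputable abbrev sectionsAlgebra (X : Over (Spec (.of k))) (V : X.left.Opens) :
    Algebra k Γ(X.left, V) := (sectionsHom X V).hom.toAlgebra

lemma fromSpec_hom (X : Over (Spec (.of k))) {V : X.left.Opens} (hV : IsAffineOpen V) :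
    hV.fromSpec ≫ X.hom = Spec.map (sectionsHom X V) := by
  rw [← IsAffineOpen.SpecMap_appLE_fromSpec X.hom (isAffineOpen_top (Spec (.of k))) hV le_top,
    IsAffineOpen.fromSpec_top, Scheme.isoSpec_Spec_inv, sectionsHom, Spec.map_comp]

lemma sectionsHom_appLE {X' X : Over (Spec (.of k))} (f : X' ⟶ X) (U : X.left.Opens)
    (V : X'.left.Opens) (e : V ≤ f.left ⁻¹ᵁ U) :
    sectionsHom X U ≫ f.left.appLE U V e = sectionsHom X' V := by
  have : ∀ (g : X'.left ⟶ Spec (.of k)) (_ : f.left ≫ X.hom = g), (f.left ≫ X.hom).appLE ⊤ V le_top =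
      g.appLE ⊤ V le_top := fun g hg => by subst hg; rfl
  rw [sectionsHom, Category.assoc]
  exact congrArg ((Scheme.ΓSpecIso (.of k)).inv ≫ ·)
    ((Scheme.Hom.appLE_comp_appLE f.left X.hom ⊤ U V le_top e).trans (this _ (Over.w f)))

lemma sectionsHom_map (X : Over (Spec (.of k))) {U V : X.left.Opens} (h : U ≤ V) :
    sectionsHom X V ≫ X.left.presheaf.map (homOfLE h).op = sectionsHom X U := by
  rw [sectionsHom, Category.assoc]
  exact congrArg ((Scheme.ΓSpecIso (.of k)).inv ≫ ·) (Scheme.Hom.appLE_map X.hom le_top _)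

/-- An affine chart of `f : X' ⟶ X` with étale coordinates on the source. -/
structure JetChart {X' X : Over (Spec (.of k))} (f : X' ⟶ X) (n : ℕ) where
  /-- The ring of functions on the source. -/
  B : Type u
  /-- The ring of functions on the target. -/
  A : Type u
  [ringB : CommRing B]
  [algB : Algebra k B]
  [polyB : Algebra (MvPolynomial (Fin n) k) B]
  [towerB : IsScalarTower k (MvPolynomial (Fin n) k) B]
  [etaleB : Algebra.Etale (MvPolynomial (Fin n) k) B]
  [ringA : CommRing A]
  [algA : Algebra k A]
  /-- The expression of `f` in the chart. -/
  φ : A →ₐ[k] B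
  /-- The chart of the source. -/
  i : specOver k B ⟶ X'
  /-- The chart of the target. -/
  j : specOver k A ⟶ X
  open_i : IsOpenImmersion i.left
  open_j : IsOpenImmersion j.left
  comm : i ≫ f = specOverMap k φ ≫ j
  /-- The number of generators of `A`. -/
  N : ℕ
  /-- Generators of `A`. -/
  y : Fin N → A
  adjoin_y : Algebra.adjoin k (Set.range y) = ⊤
  arcIdeal_jacMor : ∀ v : B →ₐ[k] PowerSeries k, arcIdeal (jacMor f) (specOverMap k v ≫ i) =
    (Ideal.span (Set.range fun I : Fin n → Fin N => (jacMatrix k n fun l => φ (y (I l))).det)).map v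
  arcIdeal_jacScheme : ∀ v : A →ₐ[k] PowerSeries k, arcIdeal (jacScheme X n) (specOverMap k v ≫ j) =
    (minorIdeal (fun l => KaehlerDifferential.D k A (y l)) (N - n) : Ideal A).map v

attribute [instance] JetChart.ringB JetChart.algB JetChart.polyB JetChart.towerB JetChart.etaleB
  JetChart.ringA JetChart.algA JetChart.open_i JetChart.open_j

lemma bijective_sectionsHom_top : Function.Bijective (Scheme.ΓSpecIso (.of k)).inv.hom :=
  ConcreteCategory.bijective_of_isIso (Scheme.ΓSpecIso (.of k)).inv

lemma fittingKaehler_sections (X : Over (Spec (.of k))) {V : X.left.Opens} (i : ℕ) :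
    fittingKaehler (X.hom.appLE ⊤ V le_top) i = fittingKaehler (sectionsHom X V) i := by
  let := (X.hom.appLE ⊤ V le_top).hom.toAlgebra
  let := sectionsAlgebra X V
  let := (Scheme.ΓSpecIso (.of k)).inv.hom.toAlgebra
  have : IsScalarTower k Γ(Spec (.of k), ⊤) Γ(X.left, V) := .of_algebraMap_eq' rfl
  have : Algebra.FormallyUnramified k Γ(Spec (.of k), ⊤) :=
    (RingHom.Etale.of_bijective bijective_sectionsHom_top).formallyUnramified
  exact (fittingIdeal_kaehler_of_formallyUnramified k Γ(Spec (.of k), ⊤) Γ(X.left, V) i).symm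

theorem nonempty_jetChart {X' X : Over (Spec (.of k))} (f : X' ⟶ X) [LocallyOfFiniteType f.left]
    [LocallyOfFiniteType X.hom] (n : ℕ) {V : X'.left.Opens} (hV : IsAffineOpen V) {U : X.left.Opens}
    (hU : IsAffineOpen U) (e : V ≤ f.left ⁻¹ᵁ U) (G : MvPolynomial (Fin n) k →+* Γ(X'.left, V))
    (hG : G.Etale) (hGC : G.comp MvPolynomial.C = (sectionsHom X' V).hom) :
    ∃ c : JetChart f n, Set.range c.i.left = V := by
  let := sectionsAlgebra X' V
  let := sectionsAlgebra X U
  let := G.toAlgebra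
  have : IsScalarTower k (MvPolynomial (Fin n) k) Γ(X'.left, V) := .of_algebraMap_eq' hGC.symm
  have : Algebra.Etale (MvPolynomial (Fin n) k) Γ(X'.left, V) := hG
  let φ : Γ(X.left, U) →ₐ[k] Γ(X'.left, V) :=
    { (f.left.appLE U V e).hom with
      commutes' := fun r => congr($(sectionsHom_appLE f U V e).hom r) }
  let i : specOver k Γ(X'.left, V) ⟶ X' := Over.homMk hV.fromSpec (fromSpec_hom X' hV)
  let j : specOver k Γ(X.left, U) ⟶ X := Over.homMk hU.fromSpec (fromSpec_hom X hU)
  have hfin : Algebra.FiniteType k Γ(X.left, U) :=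
    (X.hom.finiteType_appLE (isAffineOpen_top _) hU le_top).comp
      (RingHom.FiniteType.of_surjective _ bijective_sectionsHom_top.2)
  obtain ⟨N, g, hg⟩ := Algebra.FiniteType.iff_quotient_mvPolynomial''.mp hfin
  let y (l : Fin N) : Γ(X.left, U) := g (MvPolynomial.X l)
  have hy : Algebra.adjoin k (Set.range y) = ⊤ := by
    have : Set.range y = g '' Set.range MvPolynomial.X := by rw [← Set.range_comp]; rfl
    rw [this, ← AlgHom.map_adjoin, MvPolynomial.adjoin_range_X, Algebra.map_top,
      AlgHom.range_eq_top]
    exact hg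
  have hci : IsOpenImmersion i.left := inferInstanceAs (IsOpenImmersion hV.fromSpec)
  have hcj : IsOpenImmersion j.left := inferInstanceAs (IsOpenImmersion hU.fromSpec)
  refine ⟨{ B := Γ(X'.left, V), A := Γ(X.left, U), φ := φ, i := i, j := j, open_i := hci,
            open_j := hcj, comm := ?_, N := N, y := y, adjoin_y := hy, arcIdeal_jacMor := fun v => ?_,
            arcIdeal_jacScheme := fun v => ?_ }, hV.range_fromSpec⟩
  · refine Over.OverMorphism.ext ?_
    exact (IsAffineOpen.SpecMap_appLE_fromSpec f.left hU hV e).symm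
  · rw [arcIdeal_eq_map (jacMor f) ⟨V, hV⟩ _ (CommRingCat.ofHom v.toRingHom) rfl]
    have h1 := fittingSheaf_ideal f.left 0 (V := ⟨V, hV⟩) (U := ⟨U, hU⟩) e
    let := φ.toRingHom.toAlgebra
    have : IsScalarTower k Γ(X.left, U) Γ(X'.left, V) := .of_algebraMap_eq' φ.comp_algebraMap.symm
    have h2 := fittingIdeal_kaehler_eq_span_minors (k := k) (n := n) (B := Γ(X'.left, V)) y hy
    exact congrArg (Ideal.map v.toRingHom) (h1.trans h2)
  · rw [arcIdeal_eq_map (jacScheme X n) ⟨U, hU⟩ _ (CommRingCat.ofHom v.toRingHom) rfl]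
    have h1 := fittingSheaf_ideal X.hom n (V := ⟨U, hU⟩) (U := ⟨⊤, isAffineOpen_top _⟩) le_top
    have h2 := h1.trans (fittingKaehler_sections X n)
    have h3 := fittingIdeal_eq_minorIdeal (fun l => KaehlerDifferential.D k Γ(X.left, U) (y l))
      (span_D_eq_top y hy) n
    exact congrArg (Ideal.map v.toRingHom) (h2.trans h3)

/-- A smooth morphism is étale over affine space near every point, and a basic open set mapping into
an affine open of X inherits the coordinates. Here `n` depends on the point; it is identified with
the dimension of X later. -/
theorem exists_jetChart {X' X : Over (Spec (.of k))} (f : X' ⟶ X) [LocallyOfFiniteType f.left]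
    [LocallyOfFiniteType X.hom] [Smooth X'.hom] (x : X'.left) :
    ∃ (n : ℕ) (c : JetChart f n), x ∈ Set.range c.i.left := by
  obtain ⟨U₀, hU₀, V₀, hV₀, hx, e₀, hs⟩ := Smooth.exists_isStandardSmooth X'.hom x
  -- Spec k has only one point.
  have hU₀' : U₀ = ⊤ := by
    refine eq_top_iff.mpr fun p _ => ?_
    have h : p = X'.hom x := Subsingleton.elim (α := PrimeSpectrum k) _ _
    rw [h]; exact e₀ hx
  subst hU₀'
  obtain ⟨n, g, hgC, hg⟩ := hs.exists_etale_mvPolynomial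
  obtain ⟨U, hU, hpU, -⟩ := exists_isAffineOpen_mem_and_subset (x := f.left x) (U := ⊤) trivial
  obtain ⟨a, ha, hpa⟩ := IsAffineOpen.exists_basicOpen_le hV₀ (V := f.left ⁻¹ᵁ U) ⟨x, hpU⟩ hx
  let σ : MvPolynomial (Fin n) k →+* MvPolynomial (Fin n) Γ(Spec (.of k), ⊤) :=
    MvPolynomial.map (Scheme.ΓSpecIso (.of k)).inv.hom
  have hσ : Function.Bijective σ := ⟨MvPolynomial.map_injective _ bijective_sectionsHom_top.1,
    MvPolynomial.map_surjective _ bijective_sectionsHom_top.2⟩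
  let r := (X'.left.presheaf.map (homOfLE (X'.left.basicOpen_le a)).op).hom
  have hr : r.Etale := by
    have := IsAffineOpen.isLocalization_basicOpen hV₀ a
    have : Algebra.Etale Γ(X'.left, V₀) Γ(X'.left, X'.left.basicOpen a) := .of_isLocalizationAway a
    exact this
  have hG : (r.comp (g.comp σ)).Etale :=
    RingHom.Etale.stableUnderComposition _ _
      (RingHom.Etale.stableUnderComposition _ _ (RingHom.Etale.of_bijective hσ) hg) hr
  obtain ⟨c, hc⟩ := nonempty_jetChart f n (hV₀.basicOpen a) hU ha _ hG (by
    have h1 : (g.comp σ).comp MvPolynomial.C = (sectionsHom X' V₀).hom := by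
      ext t
      change g (MvPolynomial.map _ (MvPolynomial.C t)) = _
      rw [MvPolynomial.map_C]
      exact congr($hgC _)
    rw [RingHom.comp_assoc, h1, ← sectionsHom_map X' (X'.left.basicOpen_le a)]
    rfl)
  exact ⟨n, c, hc ▸ hpa⟩

end Charts

/-! ### The number of étale coordinates is the dimension of X. -/

section KrullDimension

/-- Incomparability bounds the dimension of S from above; lying over and going up lift chains of
primes. -/
lemma ringKrullDim_eq_of_isIntegral (R S : Type*) [CommRing R] [CommRing S] [Algebra R S]
    [Algebra.IsIntegral R S] [FaithfulSMul R S] : ringKrullDim S = ringKrullDim R := by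
  apply le_antisymm
  · exact Order.krullDim_le_of_strictMono (PrimeSpectrum.comap (algebraMap R S)) fun P Q h =>
      Ideal.IsIntegral.comap_lt_comap (R := R) (A := S) (I := P.asIdeal) (J := Q.asIdeal) h
  · refine iSup_le fun l => ?_
    obtain ⟨Q, -, hQ, hQ'⟩ := Ideal.exists_ideal_over_prime_of_isIntegral (S := S) l.head.asIdeal ⊥
      (by rw [← RingHom.ker_eq_comap_bot,
            (RingHom.injective_iff_ker_eq_bot _).mp (FaithfulSMul.algebraMap_injective R S)]
          exact bot_le)
    have : Q.LiesOver l.head.asIdeal := ⟨hQ'.symm⟩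
    obtain ⟨L, hL, -⟩ := Ideal.exists_ltSeries_of_hasGoingUp l Q
    rw [← hL]
    exact Order.LTSeries.length_le_krullDim L

variable (k : Type u) [Field k]

/-- Noether normalization reduces both invariants to those of a polynomial ring. -/
theorem exists_trdeg_eq_ringKrullDim (A : Type u) [CommRing A] [IsDomain A] [Algebra k A]
    [Algebra.FiniteType k A] : ∃ s : ℕ, Algebra.trdeg k A = s ∧ ringKrullDim A = s := by
  obtain ⟨s, g, hg, hg'⟩ := exists_integral_inj_algHom_of_fg k A
  let := g.toRingHom.toAlgebra
  have : IsScalarTower k (MvPolynomial (Fin s) k) A := .of_algebraMap_eq' g.comp_algebraMap.symm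
  have : FaithfulSMul (MvPolynomial (Fin s) k) A := (faithfulSMul_iff_algebraMap_injective _ _).mpr hg
  have : Algebra.IsIntegral (MvPolynomial (Fin s) k) A := ⟨hg'⟩
  refine ⟨s, ?_, ?_⟩
  · rw [← trdeg_add_eq k (MvPolynomial (Fin s) k) (A := A), trdeg_eq_zero (R := MvPolynomial (Fin s) k) (A := A), add_zero,
      MvPolynomial.trdeg_of_isDomain]
    simp
  · rw [ringKrullDim_eq_of_isIntegral (MvPolynomial (Fin s) k) A,
      MvPolynomial.ringKrullDim_of_isNoetherianRing, ringKrullDim_eq_zero_of_field]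
    simp

lemma trdeg_fractionRing (A : Type u) [CommRing A] [IsDomain A] [Algebra k A] :
    Algebra.trdeg k (FractionRing A) = Algebra.trdeg k A := by
  have : Algebra.IsAlgebraic A (FractionRing A) := IsLocalization.isAlgebraic (R := A) (S := FractionRing A) (M := nonZeroDivisors A)
  rw [← trdeg_add_eq k A (A := FractionRing A), trdeg_eq_zero (R := A) (A := FractionRing A), add_zero]

/-- Quasi-finiteness passes to the fraction fields, where it means a finite extension. -/
theorem trdeg_of_quasiFinite {n : ℕ} (D : Type u) [CommRing D] [IsDomain D] [Algebra k D]
    [Algebra (MvPolynomial (Fin n) k) D] [IsScalarTower k (MvPolynomial (Fin n) k) D]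
    [Algebra.QuasiFinite (MvPolynomial (Fin n) k) D] [FaithfulSMul (MvPolynomial (Fin n) k) D] :
    Algebra.trdeg k D = n := by
  let P := MvPolynomial (Fin n) k
  let K := FractionRing P
  let L := FractionRing D
  have : FaithfulSMul P L := FaithfulSMul.trans P D L
  let : Algebra K L := FractionRing.liftAlgebra P L
  have : IsScalarTower P K L := inferInstance
  have : Algebra.QuasiFinite D L := .of_isLocalization (S := D) (nonZeroDivisors D)
  have : Algebra.QuasiFinite P L := .trans P D L
  have : Algebra.QuasiFinite K L := .of_restrictScalars P K L
  have : Module.Finite K L := .of_quasiFinite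
  have : Algebra.IsAlgebraic P L := (IsFractionRing.comap_isAlgebraic_iff (A := P) (K := K)).mpr
    inferInstance
  have : Algebra.IsAlgebraic P D := .tower_bot_of_injective (FaithfulSMul.algebraMap_injective D L)
  rw [← trdeg_add_eq k P (A := D), trdeg_eq_zero (R := P) (A := D), add_zero, MvPolynomial.trdeg_of_isDomain]
  simp

variable {k} {n : ℕ} {C : Type u} [CommRing C] [Algebra k C]
  [Algebra (MvPolynomial (Fin n) k) C] [IsScalarTower k (MvPolynomial (Fin n) k) C]
  [Algebra.Etale (MvPolynomial (Fin n) k) C]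

lemma trdeg_quotient (q : Ideal C) [q.IsPrime] (hq : q.under (MvPolynomial (Fin n) k) = ⊥) :
    Algebra.trdeg k (C ⧸ q) = n := by
  have : Algebra.QuasiFinite (MvPolynomial (Fin n) k) (C ⧸ q) :=
    .of_surjective_algHom (Ideal.Quotient.mkₐ (MvPolynomial (Fin n) k) q) Ideal.Quotient.mk_surjective
  have : FaithfulSMul (MvPolynomial (Fin n) k) (C ⧸ q) := by
    rw [faithfulSMul_iff_algebraMap_injective, injective_iff_map_eq_zero]
    intro p hp
    have : p ∈ q.under (MvPolynomial (Fin n) k) :=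
      Ideal.mem_comap.mpr (Ideal.Quotient.eq_zero_iff_mem.mp hp)
    rwa [hq] at this
  exact trdeg_of_quasiFinite k (C ⧸ q)

/-- A smaller prime would also lie over zero, and a quasi-finite algebra has no inclusions between
distinct primes of one fiber. -/
lemma mem_minimalPrimes_of_under_eq_bot (q : Ideal C) [q.IsPrime]
    (hq : q.under (MvPolynomial (Fin n) k) = ⊥) : q ∈ minimalPrimes C := by
  rw [minimalPrimes_eq_minimals]
  refine ⟨inferInstance, fun q' hq' hle => ?_⟩
  have : q'.under (MvPolynomial (Fin n) k) = ⊥ := eq_bot_iff.mpr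
    (hq ▸ Ideal.comap_mono hle)
  exact (Algebra.QuasiFinite.eq_of_le_of_under_eq (R := MvPolynomial (Fin n) k) q' q hle
    (this.trans hq.symm)).ge

variable (k n C) in
lemma exists_prime_under_eq_bot [Nontrivial C] :
    ∃ q : Ideal C, q.IsPrime ∧ q.under (MvPolynomial (Fin n) k) = ⊥ := by
  have hinj : Function.Injective (algebraMap (MvPolynomial (Fin n) k) C) := by
    have : Module.Flat (MvPolynomial (Fin n) k) C := inferInstance
    have : Module.IsTorsionFree (MvPolynomial (Fin n) k) C := inferInstance
    exact FaithfulSMul.algebraMap_injective _ _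
  obtain ⟨q, hq, hq'⟩ := Ideal.exists_comap_eq_of_mem_minimalPrimes_of_injective hinj ⊥ (by
    rw [IsDomain.minimalPrimes_eq_singleton_bot]; rfl)
  exact ⟨q, hq, hq'⟩

end KrullDimension

section OpenImmersions
variable {k : Type u} [Field k] {X : Over (Spec (.of k))}

/-- The fraction field of A ⧸ p defines a field-valued point of X at c(q). It factors through the
open chart Spec C with kernel q, so C ⧸ q embeds in that field. -/
lemma trdeg_le_of_openImmersion {A C : Type u} [CommRing A] [Algebra k A] [CommRing C] [Algebra k C]
    (a : specOver k A ⟶ X) (c : specOver k C ⟶ X) [IsOpenImmersion c.left]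
    (p : PrimeSpectrum A) (q : PrimeSpectrum C) (h : a.left p = c.left q) :
    Algebra.trdeg k (C ⧸ q.asIdeal) ≤ Algebra.trdeg k (A ⧸ p.asIdeal) := by
  let L := FractionRing (A ⧸ p.asIdeal)
  let ψ : A →ₐ[k] L := (IsScalarTower.toAlgHom k (A ⧸ p.asIdeal) L).comp (Ideal.Quotient.mkₐ k p.asIdeal)
  have hψ : RingHom.ker ψ.toRingHom = p.asIdeal := by
    ext x
    change algebraMap (A ⧸ p.asIdeal) L (Ideal.Quotient.mk _ x) = 0 ↔ _
    rw [map_eq_zero_iff _ (IsFractionRing.injective _ _), Ideal.Quotient.eq_zero_iff_mem]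
  let g : specOver k L ⟶ X := specOverMap k ψ ≫ a
  have hg (x : PrimeSpectrum L) : g.left x = c.left q := by
    rw [← h]
    change a.left (PrimeSpectrum.comap ψ.toRingHom x) = _
    congr 1
    refine PrimeSpectrum.ext ?_
    have : x.asIdeal = ⊥ := (Ideal.eq_bot_or_top x.asIdeal).resolve_right x.2.ne_top
    change Ideal.comap ψ.toRingHom x.asIdeal = _
    rw [this, ← RingHom.ker_eq_comap_bot, hψ]
  have hr : Set.range g.left ⊆ Set.range c.left := by
    rintro _ ⟨x, rfl⟩; exact ⟨q, (hg x).symm⟩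
  let l : specOver k L ⟶ specOver k C := Over.homMk (IsOpenImmersion.lift c.left g.left hr) (by
    rw [← Over.w c, IsOpenImmersion.lift_fac_assoc, Over.w])
  have hl : l ≫ c = g := Over.OverMorphism.ext (IsOpenImmersion.lift_fac _ _ _)
  obtain ⟨θ, hθ⟩ := exists_specOverMap k C l
  have hker : RingHom.ker θ.toRingHom = q.asIdeal := by
    let x : PrimeSpectrum L := ⊥
    have h1 : c.left (l.left x) = c.left q := by
      rw [← hg x, ← hl]; rfl
    have h2 : l.left x = q := c.left.isOpenEmbedding.injective h1
    rw [hθ] at h2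
    have h3 := congrArg PrimeSpectrum.asIdeal h2
    rw [← h3]
    change _ = Ideal.comap θ.toRingHom ⊥
    rw [RingHom.ker_eq_comap_bot]
  let θ' : (C ⧸ q.asIdeal) →ₐ[k] L := Ideal.Quotient.liftₐ q.asIdeal θ fun x hx => by
    rw [← hker] at hx; exact hx
  have hθ' : Function.Injective θ' := by
    rw [injective_iff_map_eq_zero]
    intro x hx
    obtain ⟨x, rfl⟩ := Ideal.Quotient.mk_surjective x
    rw [Ideal.Quotient.eq_zero_iff_mem, ← hker]
    exact hx
  rw [← trdeg_fractionRing k (A ⧸ p.asIdeal)]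
  exact trdeg_le_of_injective θ' hθ'

lemma trdeg_eq_of_openImmersion {A C : Type u} [CommRing A] [Algebra k A] [CommRing C] [Algebra k C]
    (a : specOver k A ⟶ X) (c : specOver k C ⟶ X) [IsOpenImmersion a.left] [IsOpenImmersion c.left]
    (p : PrimeSpectrum A) (q : PrimeSpectrum C) (h : a.left p = c.left q) :
    Algebra.trdeg k (C ⧸ q.asIdeal) = Algebra.trdeg k (A ⧸ p.asIdeal) :=
  le_antisymm (trdeg_le_of_openImmersion a c p q h) (trdeg_le_of_openImmersion c a q p h.symm)

lemma exists_openEmbedding_closure {A : Type u} [CommRing A] [Algebra k A]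
    (a : specOver k A ⟶ X) [IsOpenImmersion a.left] (p : PrimeSpectrum A) :
    ∃ j : PrimeSpectrum (A ⧸ p.asIdeal) → closure {a.left p}, Topology.IsOpenEmbedding j ∧
      Set.range j = Subtype.val ⁻¹' Set.range a.left := by
  let g : PrimeSpectrum (A ⧸ p.asIdeal) → X.left :=
    fun x => a.left (PrimeSpectrum.comap (Ideal.Quotient.mk p.asIdeal) x)
  have hg : Topology.IsEmbedding g := a.left.isOpenEmbedding.isEmbedding.comp
    (PrimeSpectrum.isClosedEmbedding_comap_of_surjective _ _ Ideal.Quotient.mk_surjective).isEmbedding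
  have hrange : Set.range g = closure {a.left p} ∩ Set.range a.left := by
    have h1 (x : PrimeSpectrum A) : a.left x ∈ closure {a.left p} ↔
        x ∈ Set.range (PrimeSpectrum.comap (Ideal.Quotient.mk p.asIdeal)) := by
      refine specializes_iff_mem_closure.symm.trans
        ((a.left.isOpenEmbedding.isInducing.specializes_iff).trans ?_)
      rw [range_comap_of_surjective _ _ Ideal.Quotient.mk_surjective, PrimeSpectrum.mem_zeroLocus,
        Ideal.mk_ker]
      exact (PrimeSpectrum.le_iff_specializes p x).symm
    ext z
    constructor
    · rintro ⟨x, rfl⟩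
      exact ⟨(h1 _).mpr ⟨x, rfl⟩, _, rfl⟩
    · rintro ⟨hz, x, rfl⟩
      obtain ⟨y, rfl⟩ := (h1 x).mp hz
      exact ⟨y, rfl⟩
  have hmem (x) : g x ∈ closure {a.left p} := (hrange.le ⟨x, rfl⟩).1
  have hr : Set.range (Set.codRestrict g _ hmem) = Subtype.val ⁻¹' Set.range a.left := by
    ext z
    constructor
    · rintro ⟨x, rfl⟩; exact (hrange.le ⟨x, rfl⟩).2
    · intro hz
      obtain ⟨x, hx⟩ := hrange.ge ⟨z.2, hz⟩
      exact ⟨x, Subtype.ext hx⟩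
  refine ⟨Set.codRestrict g _ hmem, ⟨hg.codRestrict _ _, ?_⟩, hr⟩
  rw [hr]
  exact a.left.isOpenEmbedding.isOpen_range.preimage continuous_subtype_val

/-- Every member of the chain contains the smallest one, hence meets any chart around a point `z` of
the smallest one; so the whole chain is visible in that chart. -/
lemma length_le_ringKrullDim {A : Type u} [CommRing A] [Algebra k A]
    (a : specOver k A ⟶ X) [IsOpenImmersion a.left] (p : PrimeSpectrum A) {ξ : X.left}
    (h : a.left p = ξ) (l : LTSeries (TopologicalSpace.IrreducibleCloseds (closure {ξ})))
    (z : closure {ξ}) (hz : z ∈ (l.head : Set (closure {ξ}))) (hza : z.1 ∈ Set.range a.left) :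
    l.length ≤ ringKrullDim (A ⧸ p.asIdeal) := by
  subst h
  obtain ⟨j, hj, hj'⟩ := exists_openEmbedding_closure a p
  obtain ⟨x, hx⟩ := hj'.ge hza
  have hjx : j x = z := Subtype.ext (congrArg Subtype.val hx)
  have hxl : x ∈ j ⁻¹' (l.head : Set (closure {a.left p})) := by
    change j x ∈ (l.head : Set (closure {a.left p}))
    rw [hjx]; exact hz
  let Z := (TopologicalSpace.IrreducibleCloseds.orderIsoOfIsOpenEmbedding j hj).symm
    ⟨l.head, x, hxl⟩
  have hZ : TopologicalSpace.IrreducibleCloseds.map j hj.continuous Z = l.head := by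
    have := congrArg Subtype.val
      ((TopologicalSpace.IrreducibleCloseds.orderIsoOfIsOpenEmbedding j hj).apply_symm_apply
        ⟨l.head, x, hxl⟩)
    exact this
  have h1 : (l.length : ℕ∞) ≤ Order.coheight Z := by
    rw [← hj.coheight_map, hZ]
    exact Order.length_le_coheight_head
  rw [← PrimeSpectrum.topologicalKrullDim_eq_ringKrullDim]
  refine le_trans ?_ (Order.coheight_le_krullDim Z)
  exact_mod_cast h1

/-- A prime of C over the zero ideal of the polynomial ring is minimal, so the closure of its image
is an irreducible component, of dimension n. The chart on C shows that n' ≤ n. For n ≤ n', look at a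
chain of length n in an affine chart around a point of its smallest member: the function field is
the same, so the dimension there is n' too. -/
theorem eq_of_isPureDimensional [LocallyOfFiniteType X.hom] {n n' : ℕ}
    (hX : IsPureDimensional X.left n) {C : Type u} [CommRing C] [Nontrivial C] [Algebra k C]
    [Algebra (MvPolynomial (Fin n') k) C] [IsScalarTower k (MvPolynomial (Fin n') k) C]
    [Algebra.Etale (MvPolynomial (Fin n') k) C] (c : specOver k C ⟶ X) [IsOpenImmersion c.left] :
    n' = n := by
  obtain ⟨q, hq, hq'⟩ := exists_prime_under_eq_bot k n' C
  have htr := trdeg_quotient q hq'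
  have hmin := mem_minimalPrimes_of_under_eq_bot q hq'
  let x : PrimeSpectrum C := ⟨q, hq⟩
  have hZ : closure {c.left x} ∈ irreducibleComponents X.left := by
    refine ⟨isIrreducible_singleton.closure, fun t ht hle => ?_⟩
    obtain ⟨η, hη⟩ := QuasiSober.sober ht.closure isClosed_closure
    have h1 : η ⤳ c.left x := by
      rw [specializes_iff_mem_closure, hη]
      exact subset_closure (hle (subset_closure rfl))
    obtain ⟨x', rfl⟩ := h1.mem_open c.left.isOpenEmbedding.isOpen_range ⟨x, rfl⟩
    have h2 : x'.asIdeal ≤ q := (PrimeSpectrum.le_iff_specializes x' x).mpr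
      (c.left.isOpenEmbedding.isInducing.specializes_iff.mp h1)
    rw [minimalPrimes_eq_minimals] at hmin
    have h3 : x' = x := PrimeSpectrum.ext (le_antisymm h2 (hmin.2 x'.2 h2))
    rw [← h3, hη]
    exact subset_closure
  have hdim := hX _ hZ
  have hkC : Algebra.FiniteType k C := .trans (S := MvPolynomial (Fin n') k) (inferInstanceAs
    (Algebra.FiniteType k (MvPolynomial (Fin n') k))) inferInstance
  apply le_antisymm
  · obtain ⟨s, hs, hs'⟩ := exists_trdeg_eq_ringKrullDim k (C ⧸ q)
    obtain ⟨j, hj, -⟩ := exists_openEmbedding_closure c x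
    have h1 := hj.isInducing.topologicalKrullDim_le
    rw [hdim, PrimeSpectrum.topologicalKrullDim_eq_ringKrullDim] at h1
    have h2 : s = n' := by exact_mod_cast hs.symm.trans htr
    change ringKrullDim (C ⧸ q) ≤ _ at h1
    rw [hs', h2] at h1
    exact_mod_cast h1
  · obtain ⟨l, hl⟩ := Order.le_krullDim_iff.mp (show (n : WithBot ℕ∞) ≤
      Order.krullDim (TopologicalSpace.IrreducibleCloseds (closure {c.left x})) from hdim.ge)
    obtain ⟨z, hz⟩ := l.head.isIrreducible.nonempty
    obtain ⟨U, hU, hzU, -⟩ := exists_isAffineOpen_mem_and_subset (x := z.1) (U := ⊤) trivial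
    let := sectionsAlgebra X U
    let a : specOver k Γ(X.left, U) ⟶ X := Over.homMk hU.fromSpec (fromSpec_hom X hU)
    have hca : IsOpenImmersion a.left := inferInstanceAs (IsOpenImmersion hU.fromSpec)
    have hra : Set.range a.left = U := hU.range_fromSpec
    have hfin : Algebra.FiniteType k Γ(X.left, U) :=
      (X.hom.finiteType_appLE (isAffineOpen_top _) hU le_top).comp
        (RingHom.FiniteType.of_surjective _ bijective_sectionsHom_top.2)
    have hxU : c.left x ∈ Set.range a.left := by
      rw [hra]
      exact (specializes_iff_mem_closure.mpr z.2).mem_open U.2 hzU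
    obtain ⟨p, hp⟩ := hxU
    have hpp : p.asIdeal.IsPrime := p.2
    obtain ⟨s, hs, hs'⟩ := exists_trdeg_eq_ringKrullDim k (Γ(X.left, U) ⧸ p.asIdeal)
    have h2 : s = n' := by
      have := trdeg_eq_of_openImmersion a c p x hp
      exact_mod_cast hs.symm.trans (this.symm.trans htr)
    have h3 := length_le_ringKrullDim a p hp l z hz (hra ▸ hzU)
    rw [hs', hl, h2] at h3
    exact_mod_cast h3

end OpenImmersions

section Dimension
variable {k : Type u} [Field k] {X' X : Over (Spec (.of k))} {f : X' ⟶ X}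

/-- The locus where f is an isomorphism onto an open subscheme is dense, so it meets the chart. A
basic open set in the intersection has étale coordinates and is open in X as well. -/
theorem JetChart.dim_eq [LocallyOfFiniteType X.hom] {n n' : ℕ} (hX : IsPureDimensional X.left n)
    (hf : IsBirational f.left) (c : JetChart f n') [Nontrivial c.B] : n' = n := by
  obtain ⟨p, hp⟩ := hf
  have : Nonempty (specOver k c.B).left := inferInstanceAs (Nonempty (PrimeSpectrum c.B))
  obtain ⟨x, hx, hx'⟩ := p.dense_source.inter_open_nonempty _
    c.i.left.isOpenEmbedding.isOpen_range (Set.range_nonempty c.i.left)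
  obtain ⟨y, rfl⟩ := hx
  obtain ⟨_, ⟨s, rfl⟩, (hys : y ∈ (PrimeSpectrum.basicOpen s : Set (PrimeSpectrum c.B))), hs⟩ :=
    PrimeSpectrum.isTopologicalBasis_basic_opens.exists_subset_of_mem_open
    (show y ∈ (c.i.left ⁻¹ᵁ p.source).carrier from hx') (c.i.left ⁻¹ᵁ p.source).isOpen
  let C := Localization.Away s
  have : Algebra.Etale c.B C := Algebra.Etale.of_isLocalizationAway s
  have : Algebra.Etale (MvPolynomial (Fin n') k) C := Algebra.Etale.comp _ c.B _
  have hrange := PrimeSpectrum.localization_away_comap_range (Localization.Away s) s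
  have : Nontrivial C := by
    obtain ⟨z, -⟩ : y ∈ Set.range (PrimeSpectrum.comap (algebraMap c.B C)) := hrange ▸ hys
    exact ⟨0, 1, fun h => z.2.ne_top ((Ideal.eq_top_iff_one _).mpr (h ▸ z.asIdeal.zero_mem))⟩
  let a : specOver k C ⟶ specOver k c.B := specOverMap k (IsScalarTower.toAlgHom k c.B C)
  have : IsOpenImmersion a.left :=
    inferInstanceAs (IsOpenImmersion (Spec.map (CommRingCat.ofHom (algebraMap c.B C))))
  let b := (a ≫ c.i).left
  have : IsOpenImmersion b := inferInstanceAs (IsOpenImmersion (a.left ≫ c.i.left))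
  have hb : Set.range b ⊆ Set.range p.source.ι := by
    rw [Scheme.Opens.range_ι]
    rintro _ ⟨z, rfl⟩
    have h : a.left z ∈ Set.range (PrimeSpectrum.comap (algebraMap c.B C)) := ⟨z, rfl⟩
    rw [hrange] at h
    exact hs h
  let b' := IsOpenImmersion.lift p.source.ι b hb
  have hb' : b' ≫ p.source.ι = b := IsOpenImmersion.lift_fac _ _ _
  have : IsOpenImmersion (b' ≫ p.source.ι) := hb' ▸ inferInstance
  have : IsOpenImmersion b' := .of_comp b' p.source.ι
  have : IsOpenImmersion ((a ≫ c.i) ≫ f).left := by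
    have h : ((a ≫ c.i) ≫ f).left = b' ≫ p.iso.hom ≫ p.target.ι := by
      rw [hp, ← Category.assoc, hb']; rfl
    rw [h]; infer_instance
  exact eq_of_isPureDimensional hX ((a ≫ c.i) ≫ f)

theorem exists_jetChart_of_isPureDimensional [LocallyOfFiniteType f.left] [LocallyOfFiniteType X.hom]
    [Smooth X'.hom] {n : ℕ} (hX : IsPureDimensional X.left n) (hf : IsBirational f.left)
    (x : X'.left) : ∃ c : JetChart f n, x ∈ Set.range c.i.left := by
  obtain ⟨n', c, y, rfl⟩ := exists_jetChart f x
  have : Nontrivial c.B := ⟨0, 1, fun h => (show PrimeSpectrum c.B from y).2.ne_top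
    ((Ideal.eq_top_iff_one _).mpr (h ▸ Ideal.zero_mem _))⟩
  obtain rfl := c.dim_eq hX hf
  exact ⟨c, y, rfl⟩

theorem exists_finite_jetCharts [LocallyOfFiniteType f.left] [LocallyOfFiniteType X.hom]
    [Smooth X'.hom] [CompactSpace X'.left] {n : ℕ} (hX : IsPureDimensional X.left n)
    (hf : IsBirational f.left) : ∃ (r : ℕ) (c : Fin r → JetChart f n),
      ∀ x : X'.left, ∃ a, x ∈ Set.range (c a).i.left := by
  choose c hc using exists_jetChart_of_isPureDimensional (f := f) hX hf
  obtain ⟨t, ht⟩ := isCompact_univ.elim_finite_subcover (fun x => Set.range (c x).i.left)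
    (fun x => (c x).i.left.isOpenEmbedding.isOpen_range) (fun x _ => Set.mem_iUnion.mpr ⟨x, hc x⟩)
  refine ⟨t.card, fun a => c (t.equivFin.symm a), fun x => ?_⟩
  obtain ⟨y, hy, hx⟩ := Set.mem_iUnion₂.mp (ht (Set.mem_univ x))
  obtain ⟨a, ha⟩ := t.equivFin.symm.surjective ⟨y, hy⟩
  refine ⟨a, ?_⟩
  change x ∈ Set.range (c (t.equivFin.symm a).1).i.left
  rw [ha]
  exact hx

end Dimension

/-! ### Lifting a jet to an arc with generic point in a dense open set. -/

section GenericLift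
open PowerSeries
variable {k : Type u} [Field k] {n : ℕ} {B : Type u} [CommRing B] [Algebra k B]
  [Algebra (MvPolynomial (Fin n) k) B] [IsScalarTower k (MvPolynomial (Fin n) k) B]
  [Algebra.Etale (MvPolynomial (Fin n) k) B]

/-- Otherwise some prime Q ⊇ I lies over zero and is therefore minimal. Removing the finitely many
other components leaves a nonempty open set on which Q is the only component, hence one contained in
V(I). This contradicts density of the complement of V(I). -/
theorem exists_ne_zero_algebraMap_mem (k : Type u) [Field k] (n : ℕ) (B : Type u) [CommRing B]
    [Algebra (MvPolynomial (Fin n) k) B] [Algebra.Etale (MvPolynomial (Fin n) k) B] (I : Ideal B)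
    (hI : Dense ((PrimeSpectrum.zeroLocus (I : Set B))ᶜ)) :
    ∃ h : MvPolynomial (Fin n) k, h ≠ 0 ∧ algebraMap _ B h ∈ I := by
  by_contra! H
  let _ : Algebra k B := ((algebraMap (MvPolynomial (Fin n) k) B).comp MvPolynomial.C).toAlgebra
  have : IsScalarTower k (MvPolynomial (Fin n) k) B := .of_algebraMap_eq' rfl
  have hd : Disjoint (I : Set B)
      (((nonZeroDivisors (MvPolynomial (Fin n) k)).map (algebraMap _ B) : Submonoid B) : Set B) := by
    rw [Set.disjoint_right]
    rintro _ ⟨h, hh, rfl⟩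
    exact H h (nonZeroDivisors.ne_zero hh)
  obtain ⟨Q, hQ, hIQ, hdQ⟩ := Ideal.exists_le_prime_disjoint I _ hd
  have hQ0 : Q.under (MvPolynomial (Fin n) k) = ⊥ := by
    rw [eq_bot_iff]
    intro h hh
    by_contra h0
    exact Set.disjoint_left.mp hdQ hh ⟨h, mem_nonZeroDivisors_of_ne_zero h0, rfl⟩
  have hmin := mem_minimalPrimes_of_under_eq_bot (k := k) Q hQ0
  have : IsNoetherianRing B := Algebra.FiniteType.isNoetherianRing (MvPolynomial (Fin n) k) B
  let F : Set (Ideal B) := minimalPrimes B \ {Q}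
  have hF : F.Finite := (minimalPrimes.finite_of_isNoetherianRing B).subset Set.sdiff_subset
  let Z : Set (PrimeSpectrum B) := ⋃ q ∈ F, PrimeSpectrum.zeroLocus (q : Set B)
  have hZ : IsClosed Z := hF.isClosed_biUnion fun q _ => PrimeSpectrum.isClosed_zeroLocus _
  obtain ⟨p, hp, hp'⟩ := hI.inter_open_nonempty Zᶜ hZ.isOpen_compl ⟨⟨Q, hQ⟩, fun hmem => by
    obtain ⟨q, hq, hqQ⟩ := Set.mem_iUnion₂.mp hmem
    rw [minimalPrimes_eq_minimals] at hmin
    have hq1 := hq.1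
    rw [minimalPrimes_eq_minimals] at hq1
    exact hq.2 (le_antisymm hqQ (hmin.2 hq1.1 hqQ))⟩
  obtain ⟨q, hq, hqp⟩ := Ideal.exists_minimalPrimes_le (I := (⊥ : Ideal B)) (J := p.asIdeal) bot_le
  by_cases h : q = Q
  · exact hp' fun x hx => hqp (h ▸ hIQ hx)
  · exact hp (Set.mem_iUnion₂.mpr ⟨q, ⟨hq, h⟩, hqp⟩)

/-- The series congruent to a given one modulo t^j form an infinite set, and a nonzero polynomial
over an infinite domain cannot vanish on a product of infinite sets. -/
lemma exists_aeval_ne_zero {h : MvPolynomial (Fin n) k} (hh : h ≠ 0) (p : Fin n → k⟦X⟧) (j : ℕ) :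
    ∃ q : Fin n → k⟦X⟧, (∀ i, X ^ j ∣ q i - p i) ∧ MvPolynomial.aeval q h ≠ 0 := by
  by_contra! H
  have hinf (i : Fin n) : ({q : k⟦X⟧ | X ^ j ∣ q - p i}).Infinite := by
    have : Function.Injective fun l : ℕ => p i + X ^ j * X ^ l := by
      intro a b hab
      have h1 := mul_left_cancel₀ (pow_ne_zero j X_ne_zero) (add_left_cancel hab)
      have h2 := congrArg PowerSeries.order h1
      simpa using h2
    exact (Set.infinite_range_of_injective this).mono (by rintro _ ⟨l, rfl⟩; simp)
  have h0 : MvPolynomial.map (algebraMap k k⟦X⟧) h = 0 := by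
    refine MvPolynomial.funext_set _ hinf fun q hq => ?_
    rw [MvPolynomial.eval_map, map_zero]
    exact H q fun i => hq i trivial
  exact hh (MvPolynomial.map_injective _ (algebraMap k k⟦X⟧).injective (h0.trans (map_zero _).symm))

theorem exists_generic_arc_of_jet {j : ℕ} (hj : 1 ≤ j)
    (u₀ : B →ₐ[k] k⟦X⟧ ⧸ Ideal.span {(X : k⟦X⟧) ^ j}) {h : MvPolynomial (Fin n) k} (hh : h ≠ 0) :
    ∃ u : B →ₐ[k] k⟦X⟧, (∀ b, Ideal.Quotient.mk _ (u b) = u₀ b) ∧ u (algebraMap _ B h) ≠ 0 := by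
  choose p hp using fun i => Ideal.Quotient.mk_surjective (u₀ (coord k n B i))
  obtain ⟨q, hq, hq0⟩ := exists_aeval_ne_zero hh p j
  obtain ⟨u, hu, hu'⟩ := exists_arc_of_jet hj u₀ q fun i => by
    rw [← hp i, Ideal.Quotient.mk_eq_mk_iff_sub_mem, Ideal.mem_span_singleton]
    exact hq i
  refine ⟨u, hu, ?_⟩
  have : u.comp (IsScalarTower.toAlgHom k (MvPolynomial (Fin n) k) B) = MvPolynomial.aeval q :=
    MvPolynomial.algHom_ext fun i => (hu' i).trans (MvPolynomial.aeval_X q i).symm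
  rwa [← this] at hq0

end GenericLift

section Truncation
open PowerSeries
variable (k : Type u) [Field k] (m : ℕ)

lemma truncHom_eq_iff (a b : k⟦X⟧) : truncHom k m a = truncHom k m b ↔ X ^ (m + 1) ∣ a - b := by
  refine (truncRing_mk_eq_iff k m _ _).trans ?_
  rw [X_pow_dvd_iff]
  refine forall₂_congr fun i hi => ?_
  rw [coeff_trunc, coeff_trunc, if_pos hi, if_pos hi, map_sub, sub_eq_zero]

lemma truncHom_surjective : Function.Surjective (truncHom k m) := by
  intro x
  obtain ⟨p, rfl⟩ := Ideal.Quotient.mk_surjective x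
  refine ⟨p, (truncRing_mk_eq_iff k m _ _).mpr fun i hi => ?_⟩
  rw [coeff_trunc, if_pos hi, Polynomial.coeff_coe]

instance : Nontrivial (TruncRing k m) := (truncAug k m).toRingHom.domain_nontrivial

instance : IsLocalRing (TruncRing k m) :=
  IsLocalRing.of_surjective' (truncHom k m).toRingHom (truncHom_surjective k m)

instance isLocalHom_truncHom : IsLocalHom (truncHom k m).toRingHom :=
  (truncHom_surjective k m).isLocalHom (f := (truncHom k m).toRingHom)

/-- `k⟦t⟧ / (t^(m+1))` is `k[t] / (t^(m+1))`. -/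
noncomputable def quotEquivTrunc :
    (k⟦X⟧ ⧸ Ideal.span {(X : k⟦X⟧) ^ (m + 1)}) ≃ₐ[k] TruncRing k m :=
  (Ideal.quotientEquivAlgOfEq k (by
    ext a
    rw [Ideal.mem_span_singleton, RingHom.mem_ker, ← map_zero (truncHom k m), truncHom_eq_iff,
      sub_zero])).trans (Ideal.quotientKerAlgEquivOfSurjective (truncHom_surjective k m))

lemma quotEquivTrunc_mk (a : k⟦X⟧) :
    quotEquivTrunc k m (Ideal.Quotient.mk _ a) = truncHom k m a := rfl

variable {k m} {n : ℕ} {B : Type u} [CommRing B] [Algebra k B]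
  [Algebra (MvPolynomial (Fin n) k) B] [IsScalarTower k (MvPolynomial (Fin n) k) B]
  [Algebra.Etale (MvPolynomial (Fin n) k) B]

theorem exists_generic_lift (u₀ : B →ₐ[k] TruncRing k m) {h : MvPolynomial (Fin n) k} (hh : h ≠ 0) :
    ∃ u : B →ₐ[k] k⟦X⟧, (truncHom k m).comp u = u₀ ∧ u (algebraMap _ B h) ≠ 0 := by
  obtain ⟨u, hu, hu'⟩ := exists_generic_arc_of_jet (Nat.le_add_left 1 m)
    ((quotEquivTrunc k m).symm.toAlgHom.comp u₀) hh
  refine ⟨u, AlgHom.ext fun b => ?_, hu'⟩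
  have := congrArg (quotEquivTrunc k m) (hu b)
  rw [quotEquivTrunc_mk] at this
  exact this.trans ((quotEquivTrunc k m).apply_symm_apply _)

end Truncation

/-! ### Uniqueness of arcs over X, and factoring through charts. -/

section Separated

/-- The inclusion of the source into the preimage of the target is, up to an isomorphism, a section
of a separated morphism, hence closed. The source is dense, so it is the whole preimage. -/
lemma preimage_target_le {X' X : Scheme.{u}} (f : X' ⟶ X) [IsSeparated f] (p : X'.PartialIso X)
    (hp : p.iso.hom ≫ p.target.ι = p.source.ι ≫ f) : f ⁻¹ᵁ p.target ≤ p.source := by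
  have hle : p.source ≤ f ⁻¹ᵁ p.target := by
    intro x hx
    let x' : p.source.toScheme := ⟨x, hx⟩
    have h : p.target.ι (p.iso.hom x') = f x := congr($hp x')
    change f x ∈ p.target
    rw [← h]
    exact (p.iso.hom x').2
  let s := X'.homOfLE hle
  have hs : s ≫ f ∣_ p.target = p.iso.hom := by
    rw [← cancel_mono p.target.ι, Category.assoc, morphismRestrict_ι, hp, ← Category.assoc,
      Scheme.homOfLE_ι]
  have : IsClosedImmersion (s ≫ f ∣_ p.target) := hs ▸ inferInstance
  have : IsClosedImmersion s := .of_comp s (f ∣_ p.target)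
  have hcl : IsClosed (Set.range s) := s.isClosedEmbedding.isClosed_range
  intro x hx
  by_contra hxs
  have hne : (⟨x, hx⟩ : f ⁻¹ᵁ p.target) ∈ (Set.range s)ᶜ := by
    rintro ⟨y, hy⟩
    refine hxs ?_
    have := congr((f ⁻¹ᵁ p.target).ι $hy)
    rw [← Scheme.Hom.comp_apply, Scheme.homOfLE_ι] at this
    exact (show _ = x from this) ▸ y.2
  obtain ⟨z, ⟨y, hy, rfl⟩, hz'⟩ := p.dense_source.inter_open_nonempty _
    ((f ⁻¹ᵁ p.target).ι.isOpenEmbedding.isOpenMap _ hcl.isOpen_compl) ⟨_, _, hne, rfl⟩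
  let z : p.source.toScheme := ⟨_, hz'⟩
  refine hy ⟨z, (f ⁻¹ᵁ p.target).ι.isOpenEmbedding.injective ?_⟩
  exact congr($(X'.homOfLE_ι hle) z)

variable {k : Type u} [Field k] {X' X : Over (Spec (.of k))}

/-- Both arcs send the generic point into the locus where f is an isomorphism, so they agree there.
The generic point is dense in the reduced scheme Spec k⟦t⟧ and f is separated. -/
lemma arc_ext (f : X' ⟶ X) [IsSeparated f.left] (p : X'.left.PartialIso X.left)
    (hp : p.iso.hom ≫ p.target.ι = p.source.ι ≫ f.left) (γ δ : Arc X') (h : γ ≫ f = δ ≫ f)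
    (hδ : δ.left (⊥ : PrimeSpectrum (PowerSeries k)) ∈ p.source) : γ = δ := by
  have hle := preimage_target_le f.left p hp
  let K := FractionRing (PowerSeries k)
  let a : Spec (.of K) ⟶ Spec (.of (PowerSeries k)) :=
    Spec.map (CommRingCat.ofHom (algebraMap (PowerSeries k) K))
  have ha (x : Spec (.of K)) : a x = (⊥ : PrimeSpectrum (PowerSeries k)) := by
    have hx : x = (⊥ : PrimeSpectrum K) := Subsingleton.elim (α := PrimeSpectrum K) _ _
    rw [hx]
    refine PrimeSpectrum.ext ?_
    change Ideal.comap (algebraMap (PowerSeries k) K) ⊥ = ⊥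
    exact (RingHom.injective_iff_ker_eq_bot _).mp (IsFractionRing.injective (PowerSeries k) K)
  have hdom : IsDominant a := ⟨by
    have hx : ∀ y : PrimeSpectrum (PowerSeries k), y ∈ closure (Set.range a) := fun y => by
      refine closure_mono (s := {(⊥ : PrimeSpectrum (PowerSeries k))}) ?_ ?_
      · rintro _ rfl
        exact ⟨(⊥ : PrimeSpectrum K), ha _⟩
      · exact ((PrimeSpectrum.le_iff_specializes _ _).mp bot_le).mem_closure
    exact hx⟩
  have h' : γ.left ≫ f.left = δ.left ≫ f.left := congrArg CommaMorphism.left h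
  have hδ' : Set.range (a ≫ δ.left) ⊆ Set.range p.source.ι := by
    rw [Scheme.Opens.range_ι]
    rintro _ ⟨x, rfl⟩
    rw [Scheme.Hom.comp_apply, ha]
    exact hδ
  -- Nothing was assumed about `γ` itself: its generic point lies over the target, hence in the
  -- source by `preimage_target_le`.
  have hγ' : Set.range (a ≫ γ.left) ⊆ Set.range p.source.ι := by
    rw [Scheme.Opens.range_ι]
    rintro _ ⟨x, rfl⟩
    refine hle ?_
    change f.left ((a ≫ γ.left) x) ∈ p.target
    rw [← Scheme.Hom.comp_apply, Category.assoc, h', ← Category.assoc,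
      ← IsOpenImmersion.lift_fac p.source.ι (a ≫ δ.left) hδ', Category.assoc, ← hp,
      ← Category.assoc, Scheme.Hom.comp_apply]
    exact ((IsOpenImmersion.lift p.source.ι (a ≫ δ.left) hδ' ≫ p.iso.hom) x).2
  have : AlgebraicGeometry.IsReduced (arcDisk k).left :=
    inferInstanceAs (AlgebraicGeometry.IsReduced (Spec (.of (PowerSeries k))))
  refine Over.OverMorphism.ext (ext_of_isDominant_of_isSeparated f.left h' a ?_)
  rw [← IsOpenImmersion.lift_fac p.source.ι (a ≫ δ.left) hδ',
    ← IsOpenImmersion.lift_fac p.source.ι (a ≫ γ.left) hγ']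
  congr 1
  rw [← cancel_mono p.iso.hom, ← cancel_mono p.target.ι, Category.assoc, Category.assoc, hp,
    ← Category.assoc, ← Category.assoc, IsOpenImmersion.lift_fac, IsOpenImmersion.lift_fac,
    Category.assoc, Category.assoc, h']

/-- Every point of the spectrum of a local ring specializes to the closed point, and open sets are
stable under generization. -/
lemma exists_factor_of_closedPoint {R B : Type u} [CommRing R] [IsLocalRing R] [Algebra k R]
    [CommRing B] [Algebra k B] (i : specOver k B ⟶ X) [IsOpenImmersion i.left] (δ : specOver k R ⟶ X)
    (h : δ.left (IsLocalRing.closedPoint R) ∈ Set.range i.left) :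
    ∃ u : B →ₐ[k] R, δ = specOverMap k u ≫ i := by
  have hr : Set.range δ.left ⊆ Set.range i.left := by
    rintro _ ⟨x, rfl⟩
    have h1 : (show PrimeSpectrum R from x) ⤳ IsLocalRing.closedPoint R :=
      IsLocalRing.specializes_closedPoint x
    exact (h1.map δ.left.continuous).mem_open i.left.isOpenEmbedding.isOpen_range h
  let g : specOver k R ⟶ specOver k B := Over.homMk (IsOpenImmersion.lift i.left δ.left hr) (by
    rw [← Over.w i, ← Over.w δ, ← Category.assoc, IsOpenImmersion.lift_fac])
  have hg : g ≫ i = δ := Over.OverMorphism.ext (IsOpenImmersion.lift_fac _ _ _)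
  obtain ⟨u, hu⟩ := exists_specOverMap k B g
  exact ⟨u, by rw [← hu, hg]⟩

lemma jetDiskToArcDisk_closedPoint (m : ℕ) : (jetDiskToArcDisk k m).left
    (IsLocalRing.closedPoint (TruncRing k m)) = IsLocalRing.closedPoint (PowerSeries k) :=
  IsLocalRing.comap_closedPoint (truncHom k m).toRingHom

lemma specOverMap_comp {A B C : Type u} [CommRing A] [Algebra k A] [CommRing B] [Algebra k B]
    [CommRing C] [Algebra k C] (φ : A →ₐ[k] B) (ψ : B →ₐ[k] C) :
    specOverMap k ψ ≫ specOverMap k φ = specOverMap k (ψ.comp φ) := by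
  refine Over.OverMorphism.ext ?_
  exact (Spec.map_comp _ _).symm

lemma jetDiskToArcDisk_comp {B : Type u} [CommRing B] [Algebra k B] (m : ℕ)
    (v : B →ₐ[k] PowerSeries k) :
    jetDiskToArcDisk k m ≫ specOverMap k v = specOverMap k ((truncHom k m).comp v) :=
  specOverMap_comp v (truncHom k m)

instance mono_of_isOpenImmersion {Y X : Over (Spec (.of k))} (i : Y ⟶ X) [IsOpenImmersion i.left] :
    Mono i := Over.mono_of_mono_left i

end Separated

/-! ### Jets with the same image are congruent modulo t^(m+1-e). -/

section Contact
open PowerSeries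

lemma map_span_eq_span_X_pow_iff {k A : Type*} [Field k] [CommRing A] (g : A →+* k⟦X⟧) (S : Set A)
    (e : ℕ) : (Ideal.span S).map g = Ideal.span {(X : k⟦X⟧) ^ e} ↔
      (∀ s ∈ S, X ^ e ∣ g s) ∧ ∃ s ∈ S, ¬ X ^ (e + 1) ∣ g s := by
  rw [Ideal.map_span]
  constructor
  · intro h
    refine ⟨fun s hs => ?_, ?_⟩
    · rw [← Ideal.mem_span_singleton, ← h]
      exact Ideal.subset_span ⟨s, hs, rfl⟩
    · by_contra! H
      have : Ideal.span (g '' S) ≤ Ideal.span {(X : k⟦X⟧) ^ (e + 1)} := by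
        rw [Ideal.span_le]
        rintro _ ⟨s, hs, rfl⟩
        exact Ideal.mem_span_singleton.mpr (H s hs)
      rw [h, Ideal.span_singleton_le_span_singleton] at this
      have := (pow_dvd_pow_iff X_ne_zero X_prime.not_isUnit).mp this
      omega
  · rintro ⟨h1, s, hs, h2⟩
    refine le_antisymm ?_ ?_
    · rw [Ideal.span_le]
      rintro _ ⟨s, hs, rfl⟩
      exact Ideal.mem_span_singleton.mpr (h1 s hs)
    · rw [Ideal.span_singleton_le_iff_mem]
      obtain ⟨a, ha⟩ := exists_unit_of_order (h1 s hs) h2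
      have : (X : k⟦X⟧) ^ e = g s * ((a⁻¹ : (k⟦X⟧)ˣ) : k⟦X⟧) := by rw [ha, mul_assoc, a.mul_inv, mul_one]
      rw [this]
      exact Ideal.mul_mem_right _ _ (Ideal.subset_span ⟨s, hs, rfl⟩)

variable {k : Type u} [Field k] {X' X : Over (Spec (.of k))} {f : X' ⟶ X} {n : ℕ}

/-- The minors of the Jacobian matrix of `f` in a chart. -/
noncomputable def JetChart.minor (c : JetChart f n) (I : Fin n → Fin c.N) : c.B :=
  (jacMatrix k n fun l => c.φ (c.y (I l))).det

/-- Generators of the Jacobian ideal of the target of a chart. -/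
def JetChart.targetMinors (c : JetChart f n) : Set c.A :=
  {d | ∃ (r : Fin (c.N - n) → Fin c.N → c.A) (cc : Fin (c.N - n) → Fin c.N),
    (∀ a, ∑ j, r a j • KaehlerDifferential.D k c.A (c.y j) = 0) ∧
      d = Matrix.det (Matrix.of fun a b => r a (cc b))}

lemma JetChart.mem_jacContact_iff (c : JetChart f n) (e e' : ℕ) (v : c.B →ₐ[k] k⟦X⟧) :
    specOverMap k v ≫ c.i ∈ jacContact f n e e' ↔
      ((∀ I, PowerSeries.X ^ e ∣ v (c.minor I)) ∧ ∃ I, ¬ PowerSeries.X ^ (e + 1) ∣ v (c.minor I)) ∧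
      (∀ d ∈ c.targetMinors, PowerSeries.X ^ e' ∣ v (c.φ d)) ∧
        ∃ d ∈ c.targetMinors, ¬ PowerSeries.X ^ (e' + 1) ∣ v (c.φ d) := by
  refine and_congr ?_ ?_
  · change arcIdeal _ _ = _ ↔ _
    rw [c.arcIdeal_jacMor]
    refine (map_span_eq_span_X_pow_iff v.toRingHom _ e).trans ?_
    simp only [Set.forall_mem_range, Set.exists_range_iff]
    rfl
  · change arcIdeal _ _ = _ ↔ _
    have h : (specOverMap k v ≫ c.i) ≫ f = specOverMap k (v.comp c.φ) ≫ c.j := by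
      rw [Category.assoc, c.comm, ← Category.assoc, specOverMap_comp]
    rw [h, c.arcIdeal_jacScheme]
    exact map_span_eq_span_X_pow_iff (v.comp c.φ).toRingHom c.targetMinors e'

/-- The complement of the isomorphism locus is cut out in the chart by an ideal containing a nonzero
polynomial in the coordinates, and a lift can be chosen on which that polynomial does not vanish. -/
lemma exists_chart_lift [IsSeparated f.left] {n : ℕ} (p : X'.left.PartialIso X.left)
    (c : JetChart f n) {m : ℕ} (u : c.B →ₐ[k] TruncRing k m) :
    ∃ v : c.B →ₐ[k] k⟦X⟧, (truncHom k m).comp v = u ∧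
      (specOverMap k v ≫ c.i).left (⊥ : PrimeSpectrum k⟦X⟧) ∈ p.source := by
  let W : TopologicalSpace.Opens (PrimeSpectrum c.B) := c.i.left ⁻¹ᵁ p.source
  obtain ⟨S, hS⟩ := (PrimeSpectrum.isClosed_iff_zeroLocus _).mp W.isOpen.isClosed_compl
  have hW : Dense ((PrimeSpectrum.zeroLocus (Ideal.span S : Set c.B))ᶜ) := by
    rw [PrimeSpectrum.zeroLocus_span, ← hS, compl_compl]
    exact p.dense_source.preimage c.i.left.isOpenEmbedding.isOpenMap
  obtain ⟨h, hh, hhS⟩ := exists_ne_zero_algebraMap_mem k n c.B _ hW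
  obtain ⟨v, hv, hvh⟩ := exists_generic_lift u hh
  refine ⟨v, hv, ?_⟩
  let q : PrimeSpectrum c.B := PrimeSpectrum.comap v.toRingHom ⊥
  have hq : q ∈ W := by
    by_contra hq
    have h1 : q ∈ PrimeSpectrum.zeroLocus (Ideal.span S : Set c.B) := by
      rw [PrimeSpectrum.zeroLocus_span, ← hS]; exact hq
    exact hvh (h1 hhS)
  exact hq

/-- The key step. Lift `δ₀` to an arc `δ` with generic point in the isomorphism locus. Its image is
close to that of `v`, so `exists_lift_of_close` yields an arc `w` close to `v` with the same image
as `δ`; then w = δ by `arc_ext`. In particular `δ₀` must lie in the chart of `v`. -/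
theorem JetChart.exists_arc_of_jet_comp_eq [IsSeparated f.left] (hf : IsBirational f.left)
    (hc : ∀ x : X'.left, ∃ c : JetChart f n, x ∈ Set.range c.i.left) {e e' m : ℕ} (he : 2 * e ≤ m)
    (he' : e + e' ≤ m) (c : JetChart f n) (v : c.B →ₐ[k] k⟦X⟧)
    (hv : specOverMap k v ≫ c.i ∈ jacContact f n e e') (δ₀ : jetDisk k m ⟶ X')
    (h : δ₀ ≫ f = jetDiskToArcDisk k m ≫ (specOverMap k v ≫ c.i) ≫ f) :
    ∃ w : c.B →ₐ[k] k⟦X⟧, (∀ b, PowerSeries.X ^ (m + 1 - e) ∣ w b - v b) ∧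
      δ₀ = jetDiskToArcDisk k m ≫ specOverMap k w ≫ c.i := by
  obtain ⟨p, hp⟩ := hf
  obtain ⟨⟨hD, I, hI⟩, -, d, ⟨r, cc, hr, rfl⟩, hG⟩ := (c.mem_jacContact_iff e e' v).mp hv
  -- A priori `δ₀` may be centered outside the chart `c`, so it is lifted in a chart of its own.
  obtain ⟨c', hc'⟩ := hc (δ₀.left (IsLocalRing.closedPoint (TruncRing k m)))
  obtain ⟨u, rfl⟩ := exists_factor_of_closedPoint c'.i δ₀ hc'
  obtain ⟨v', rfl, hv'⟩ := exists_chart_lift p c' u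
  have hδ : jetDiskToArcDisk k m ≫ (specOverMap k v' ≫ c'.i) =
      specOverMap k ((truncHom k m).comp v') ≫ c'.i := by
    rw [← Category.assoc, jetDiskToArcDisk_comp]
  rw [← hδ] at h ⊢
  generalize specOverMap k v' ≫ c'.i = δ at h hv' ⊢
  have hcf : (specOverMap k v ≫ c.i) ≫ f = specOverMap k (v.comp c.φ) ≫ c.j := by
    rw [Category.assoc, c.comm, ← Category.assoc, specOverMap_comp]
  -- The center of an arc is seen by its m-jet, so f∘δ starts in the target chart of `c`.
  have hpt : (δ ≫ f).left (IsLocalRing.closedPoint k⟦X⟧) ∈ Set.range c.j.left := by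
    have h1 : jetDiskToArcDisk k m ≫ δ ≫ f =
        (jetDiskToArcDisk k m ≫ specOverMap k (v.comp c.φ)) ≫ c.j := by
      rw [← Category.assoc, h, hcf, Category.assoc]
    let y : (jetDisk k m).left := IsLocalRing.closedPoint (TruncRing k m)
    have h2 : (δ ≫ f).left ((jetDiskToArcDisk k m).left y) =
        c.j.left ((jetDiskToArcDisk k m ≫ specOverMap k (v.comp c.φ)).left y) :=
      congr(($h1).left y)
    rw [← jetDiskToArcDisk_closedPoint m]
    exact ⟨_, h2.symm⟩
  obtain ⟨β, hβ⟩ := exists_factor_of_closedPoint c.j (δ ≫ f) hpt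
  have hβ' : (truncHom k m).comp (v.comp c.φ) = (truncHom k m).comp β := by
    refine specOverMap_injective k c.A ?_
    rw [← cancel_mono c.j, ← jetDiskToArcDisk_comp, ← jetDiskToArcDisk_comp, Category.assoc,
      Category.assoc, ← hcf, ← hβ, ← h, Category.assoc]
  have hdet (v : c.B →ₐ[k] k⟦X⟧) (I : Fin n → Fin c.N) :
      (v.mapMatrix (jacMatrix k n fun l => c.φ (c.y (I l)))).det = v (c.minor I) :=
    (v.map_det _).symm
  obtain ⟨w, hw, hw'⟩ := exists_lift_of_close c.φ c.y c.adjoin_y he he' v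
    (fun I => by rw [hdet]; exact hD I) I (by rw [hdet]; exact hI) r cc hr hG β
    fun a => (truncHom_eq_iff k m _ _).mp congr($hβ' a)
  refine ⟨w, hw, ?_⟩
  congr 1
  refine (arc_ext f p hp _ _ ?_ hv').symm
  rw [hβ, Category.assoc, c.comm, ← Category.assoc, specOverMap_comp]
  congr 2
  exact AlgHom.ext hw'

end Contact

/-! ### k-points of jet schemes, and the saturation statement (i). -/

section JetPoints
open PowerSeries
variable {k : Type u} [Field k] {X' X : Over (Spec (.of k))}

/-- The jet corresponding to a `k`-point of the jet scheme. -/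
noncomputable def jetOf {m : ℕ} (x : KPoint (jetScheme m X)) : jetDisk k m ⟶ X :=
  (λ_ (jetDisk k m)).inv ≫ (jetSchemeRepr m X).homEquiv x

lemma jetOf_injective {m : ℕ} : Function.Injective (jetOf : KPoint (jetScheme m X) → _) := by
  intro x y h
  exact (jetSchemeRepr m X).homEquiv.injective ((cancel_epi _).mp h)

lemma jetOf_arcTrunc {m : ℕ} (γ : Arc X) : jetOf (arcTrunc m γ) = jetDiskToArcDisk k m ≫ γ := by
  rw [jetOf, arcTrunc, Equiv.apply_symm_apply, ← leftUnitor_hom, Iso.inv_hom_id_assoc]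

lemma homEquiv_comp_jetMap {m : ℕ} (f : X' ⟶ X) {T : Over (Spec (.of k))} (x : T ⟶ jetScheme m X') :
    (jetSchemeRepr m X).homEquiv (x ≫ jetMap m f) = (jetSchemeRepr m X').homEquiv x ≫ f := by
  rw [(jetSchemeRepr m X).homEquiv_comp, jetMap, Equiv.apply_symm_apply,
    (jetSchemeRepr m X').homEquiv_eq x, homPresheaf_map, homPresheaf_map, Category.assoc]

lemma jetOf_comp_jetMap {m : ℕ} (f : X' ⟶ X) (x : KPoint (jetScheme m X')) :
    jetOf (x ≫ jetMap m f) = jetOf x ≫ f := by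
  rw [jetOf, homEquiv_comp_jetMap, jetOf, Category.assoc]

variable {f : X' ⟶ X} {n : ℕ}

lemma JetChart.mem_jacContact_of_congr (c : JetChart f n) {e e' j : ℕ} (he : e < j) (he' : e' < j)
    {v w : c.B →ₐ[k] k⟦X⟧} (h : ∀ b, PowerSeries.X ^ j ∣ w b - v b)
    (hv : specOverMap k v ≫ c.i ∈ jacContact f n e e') :
    specOverMap k w ≫ c.i ∈ jacContact f n e e' := by
  rw [c.mem_jacContact_iff] at hv ⊢
  obtain ⟨⟨h1, I, h2⟩, h3, d, hd, h4⟩ := hv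
  refine ⟨⟨fun I => ?_, I, not_dvd_of_congr he (h _) h2⟩, fun d hd => ?_, d, hd,
    not_dvd_of_congr he' (h _) h4⟩
  · exact (dvd_sub_left (h1 I)).mp ((pow_dvd_pow _ he.le).trans (h _))
  · exact (dvd_sub_left (h3 d hd)).mp ((pow_dvd_pow _ he'.le).trans (h _))

lemma exists_chart_factor {n : ℕ} (hc : ∀ x : X'.left, ∃ c : JetChart f n, x ∈ Set.range c.i.left)
    (γ : Arc X') : ∃ (c : JetChart f n) (v : c.B →ₐ[k] k⟦X⟧), γ = specOverMap k v ≫ c.i := by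
  obtain ⟨c, hc⟩ := hc (γ.left (IsLocalRing.closedPoint k⟦X⟧))
  obtain ⟨v, hv⟩ := exists_factor_of_closedPoint c.i γ hc
  exact ⟨c, v, hv⟩

theorem mem_image_arcTrunc_of_comp_jetMap_eq [IsSeparated f.left] (hf : IsBirational f.left)
    (hc : ∀ x : X'.left, ∃ c : JetChart f n, x ∈ Set.range c.i.left) {e e' m : ℕ} (he : 2 * e ≤ m)
    (he' : e + e' ≤ m) (x y : KPoint (jetScheme m X'))
    (hx : x ∈ arcTrunc m '' jacContact f n e e') (h : y ≫ jetMap m f = x ≫ jetMap m f) :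
    y ∈ arcTrunc m '' jacContact f n e e' := by
  obtain ⟨γ, hγ, rfl⟩ := hx
  obtain ⟨c, v, rfl⟩ := exists_chart_factor hc γ
  have h' := congrArg jetOf h
  rw [jetOf_comp_jetMap, jetOf_comp_jetMap, jetOf_arcTrunc, Category.assoc] at h'
  obtain ⟨w, hw, hδ⟩ := c.exists_arc_of_jet_comp_eq hf hc he he' v hγ _ h'
  -- From m ≥ 2e and m ≥ e + e' one gets m+1-e > e and m+1-e > e', so `w` has the same contact
  -- orders as `v`.
  refine ⟨_, c.mem_jacContact_of_congr (by omega) (by omega) hw hγ, jetOf_injective ?_⟩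
  rw [jetOf_arcTrunc, hδ]

end JetPoints

/-! ### Detecting algebra and geometry on k-points. -/

section Points
variable {k : Type u} [Field k] [IsAlgClosed k]

lemma exists_point_of_nontrivial (k : Type u) [Field k] [IsAlgClosed k] (E : Type u) [CommRing E]
    [Nontrivial E] [Algebra k E] [Algebra.FiniteType k E] : Nonempty (E →ₐ[k] k) := by
  obtain ⟨M, hM⟩ := Ideal.exists_maximal E
  let _ := Ideal.Quotient.field M
  have : Module.Finite k (E ⧸ M) := finite_of_finite_type_of_isJacobsonRing k (E ⧸ M)
  let eq := AlgEquiv.ofBijective (Algebra.ofId k (E ⧸ M))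
    (IsAlgClosed.algebraMap_bijective_of_isIntegral)
  exact ⟨eq.symm.toAlgHom.comp (Ideal.Quotient.mkₐ k M)⟩

/-- Rabinowitsch trick: otherwise the localization away from `a` is nonzero and, by the
Nullstellensatz, has a k-point. -/
lemma isNilpotent_of_forall_point {E : Type u} [CommRing E] [Algebra k E] [Algebra.FiniteType k E]
    {a : E} (h : ∀ τ : E →ₐ[k] k, τ a = 0) : IsNilpotent a := by
  by_contra ha
  have : Nontrivial (Localization.Away a) := by
    rw [← not_subsingleton_iff_nontrivial]
    intro hs
    exact ha ((IsLocalization.subsingleton_iff (S := Localization.Away a)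
      (M := Submonoid.powers a)).mp hs)
  have : Algebra.FiniteType E (Localization.Away a) := IsLocalization.finiteType_of_monoid_fg (Submonoid.powers a) _
  have : Algebra.FiniteType k (Localization.Away a) := .trans ‹_› this
  obtain ⟨τ⟩ := exists_point_of_nontrivial k (Localization.Away a)
  have h1 : IsUnit (τ (algebraMap E _ a)) :=
    (IsLocalization.Away.algebraMap_isUnit (S := Localization.Away a) a).map τ
  exact h1.ne_zero (h (τ.comp (IsScalarTower.toAlgHom k E _)))

lemma algHom_ext_points {H E : Type u} [CommRing H] [Algebra k H] [CommRing E] [Algebra k E]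
    [Algebra.FiniteType k E] [IsReduced E] {g g' : H →ₐ[k] E}
    (h : ∀ τ : E →ₐ[k] k, τ.comp g = τ.comp g') : g = g' := by
  ext a
  rw [← sub_eq_zero]
  exact (isNilpotent_of_forall_point (k := k) fun τ => by
    rw [map_sub, sub_eq_zero]; exact congr($(h τ) a)).eq_zero

lemma exists_point_of_prime {E : Type u} [CommRing E] [Algebra k E] [Algebra.FiniteType k E]
    (p : Ideal E) [p.IsPrime] {a : E} (ha : a ∉ p) :
    ∃ τ : E →ₐ[k] k, (∀ b ∈ p, τ b = 0) ∧ τ a ≠ 0 := by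
  by_contra! H
  have : Algebra.FiniteType k (E ⧸ p) := .of_surjective (Ideal.Quotient.mkₐ k p) Ideal.Quotient.mk_surjective
  have := (isNilpotent_of_forall_point (k := k) (a := Ideal.Quotient.mk p a) fun τ =>
    H (τ.comp (Ideal.Quotient.mkₐ k p)) fun b hb => by
      change τ (Ideal.Quotient.mk p b) = 0
      rw [Ideal.Quotient.eq_zero_iff_mem.mpr hb, map_zero]).eq_zero
  exact ha (Ideal.Quotient.eq_zero_iff_mem.mp this)

/-- By Chevalley the image is constructible, so membership in it depends only on which of finitely
many functions vanish at the point. This is what later cuts images into locally closed pieces. -/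
theorem exists_pattern {R E : Type u} [CommRing R] [Algebra k R] [Algebra.FiniteType k R] [CommRing E]
    [Algebra k E] [Algebra.FiniteType k E] (g : R →ₐ[k] E) : ∃ G : Set R, G.Finite ∧
      ∀ τ τ' : R →ₐ[k] k, (∀ a ∈ G, τ a = 0 ↔ τ' a = 0) → (∃ σ : E →ₐ[k] k, σ.comp g = τ) →
        ∃ σ : E →ₐ[k] k, σ.comp g = τ' := by
  have : IsNoetherianRing R := Algebra.FiniteType.isNoetherianRing k R
  have hg : g.toRingHom.FinitePresentation := RingHom.FinitePresentation.of_finiteType.mp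
    (RingHom.FiniteType.of_comp_finiteType (f := algebraMap k R) (by
      rw [AlgHom.toRingHom_eq_coe, AlgHom.comp_algebraMap]
      exact RingHom.finiteType_algebraMap.mpr ‹_›))
  obtain ⟨S, hS⟩ := PrimeSpectrum.exists_constructibleSetData_iff.mpr
    (PrimeSpectrum.isConstructible_range_comap hg)
  let pt (τ : R →ₐ[k] k) : PrimeSpectrum R := PrimeSpectrum.comap τ.toRingHom ⊥
  have hpt (τ : R →ₐ[k] k) (a : R) : a ∈ (pt τ).asIdeal ↔ τ a = 0 := Iff.rfl
  have hrange (τ : R →ₐ[k] k) : pt τ ∈ Set.range (PrimeSpectrum.comap g.toRingHom) ↔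
      ∃ σ : E →ₐ[k] k, σ.comp g = τ := by
    constructor
    · rintro ⟨q, hq⟩
      obtain ⟨σ, hσ, -⟩ := exists_point_of_prime (k := k) q.asIdeal (a := 1)
        ((Ideal.ne_top_iff_one _).mp q.2.ne_top)
      refine ⟨σ, AlgHom.ext fun a => ?_⟩
      have h1 : a - algebraMap k R (τ a) ∈ (pt τ).asIdeal := by
        rw [hpt, map_sub, AlgHom.commutes, Algebra.algebraMap_self, RingHom.id_apply, sub_self]
      rw [← hq] at h1
      have h2 := hσ _ h1
      change σ (g (a - algebraMap k R (τ a))) = 0 at h2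
      rw [map_sub, map_sub, AlgHom.commutes, AlgHom.commutes, Algebra.algebraMap_self,
        RingHom.id_apply, sub_eq_zero] at h2
      exact h2
    · rintro ⟨σ, rfl⟩
      exact ⟨PrimeSpectrum.comap σ.toRingHom ⊥, rfl⟩
  refine ⟨⋃ C ∈ S, insert C.f (Set.range C.g),
    S.finite_toSet.biUnion fun C _ => (Set.finite_range _).insert _, fun τ τ' h hτ => ?_⟩
  rw [← hrange, ← hS] at hτ ⊢
  obtain ⟨C, hC, h1, h2⟩ := Set.mem_iUnion₂.mp hτ
  have hG (a : R) (ha : a ∈ insert C.f (Set.range C.g)) := h a (Set.mem_iUnion₂.mpr ⟨C, hC, ha⟩)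
  refine Set.mem_iUnion₂.mpr ⟨C, hC, fun a ha => (hG a (Or.inr ha)).mp (h1 ha), fun h3 => h2 ?_⟩
  rintro _ rfl
  exact (hG _ (Or.inl rfl)).mpr (h3 rfl)

/-- The complement of the image is constructible, so if it were nonempty it would contain a k-point.
-/
theorem comap_surjective_of_points {A E : Type u} [CommRing A] [Algebra k A] [Algebra.FiniteType k A]
    [CommRing E] [Algebra k E] [Algebra.FiniteType k E] (g : A →ₐ[k] E)
    (hg : ∀ τ : A →ₐ[k] k, ∃ σ : E →ₐ[k] k, σ.comp g = τ) :
    Function.Surjective (PrimeSpectrum.comap g.toRingHom) := by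
  have : IsNoetherianRing A := Algebra.FiniteType.isNoetherianRing k A
  have hfp : g.toRingHom.FinitePresentation := RingHom.FinitePresentation.of_finiteType.mp
    (RingHom.FiniteType.of_comp_finiteType (f := algebraMap k A) (by
      rw [AlgHom.toRingHom_eq_coe, AlgHom.comp_algebraMap]
      exact RingHom.finiteType_algebraMap.mpr ‹_›))
  obtain ⟨S, hS⟩ := PrimeSpectrum.exists_constructibleSetData_iff.mpr
    (PrimeSpectrum.isConstructible_range_comap hfp).compl
  intro p
  by_contra hp
  have hp' : p ∈ S.toSet := hS ▸ hp
  obtain ⟨C, hC, h1, h2⟩ := Set.mem_iUnion₂.mp hp'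
  obtain ⟨τ, hτ, hτ'⟩ := exists_point_of_prime (k := k) p.asIdeal (a := C.f)
    fun h => h2 (by rintro _ rfl; exact h)
  obtain ⟨σ, rfl⟩ := hg τ
  have h3 : PrimeSpectrum.comap (σ.comp g).toRingHom ⊥ ∈ S.toSet :=
    Set.mem_iUnion₂.mpr ⟨C, hC, fun a ha => hτ a (h1 ha), fun h => hτ' (h rfl)⟩
  rw [hS] at h3
  exact h3 ⟨PrimeSpectrum.comap σ.toRingHom ⊥, rfl⟩

open scoped TensorProduct in
-- In E ⊗ E over A, the elements b ⊗ 1 - 1 ⊗ b vanish at all k-points by `hg`, hence are nilpotent.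
-- Two primes of E over the same prime of A are the contractions of one prime of E ⊗ E, so they
-- coincide.
theorem comap_injective_of_points {A E : Type u} [CommRing A] [Algebra k A]
    [CommRing E] [Algebra k E] [Algebra.FiniteType k E] (g : A →ₐ[k] E)
    (hg : Function.Injective fun σ : E →ₐ[k] k => σ.comp g) :
    Function.Injective (PrimeSpectrum.comap g.toRingHom) := by
  intro q q' hq
  let := g.toRingHom.toAlgebra
  have : IsScalarTower k A E := .of_algebraMap_eq' g.comp_algebraMap.symm
  have : Algebra.FiniteType A E := .of_restrictScalars_finiteType k A E
  have : Algebra.FiniteType k (E ⊗[A] E) := .trans (S := E) ‹_› inferInstance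
  let l : E →ₐ[k] E ⊗[A] E := IsScalarTower.toAlgHom k E (E ⊗[A] E)
  let r : E →ₐ[k] E ⊗[A] E := (Algebra.TensorProduct.includeRight (R := A) (A := E) (B := E)).restrictScalars k
  have hlr (b : E) : IsNilpotent (l b - r b) := isNilpotent_of_forall_point (k := k) fun τ => by
    rw [map_sub, sub_eq_zero]
    refine congr($(hg (a₁ := τ.comp l) (a₂ := τ.comp r) (AlgHom.ext fun a => ?_)) b)
    change τ (g a ⊗ₜ 1) = τ (1 ⊗ₜ g a)
    congr 1
    have : g a = a • (1 : E) := (Algebra.algebraMap_eq_smul_one a)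
    rw [this, TensorProduct.smul_tmul]
  obtain ⟨z, hz, hz'⟩ := Scheme.Pullback.exists_preimage_pullback
    (f := Spec.map (CommRingCat.ofHom (algebraMap A E)))
    (g := Spec.map (CommRingCat.ofHom (algebraMap A E))) q q' hq
  let Q : PrimeSpectrum (E ⊗[A] E) := (pullbackSpecIso A E E).hom z
  have h1 : PrimeSpectrum.comap l.toRingHom Q = q :=
    (congr($(pullbackSpecIso_hom_fst A E E) z)).trans hz
  have h2 : PrimeSpectrum.comap r.toRingHom Q = q' :=
    (congr($(pullbackSpecIso_hom_snd A E E) z)).trans hz'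
  rw [← h1, ← h2]
  refine PrimeSpectrum.ext (Ideal.ext fun b => ?_)
  have h3 : l b - r b ∈ Q.asIdeal := by
    obtain ⟨N, hN⟩ := hlr b
    exact Q.2.mem_of_pow_mem N (hN ▸ Q.asIdeal.zero_mem)
  change l b ∈ Q.asIdeal ↔ r b ∈ Q.asIdeal
  exact ⟨fun h => by simpa using Q.asIdeal.sub_mem h h3, fun h => by
    simpa using Q.asIdeal.add_mem h3 h⟩

end Points

/-! ### Reduced affine schemes with prescribed k-points. -/

section PointModels
variable {k : Type u} [Field k]

/-- A reduced affine scheme of finite type, immersed in `Spec H`, whose points are those in `Z`. -/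
structure PointModel {H : Type u} [CommRing H] [Algebra k H] (Z : Set (H →ₐ[k] k)) where
  /-- The ring of functions. -/
  O : Type u
  [ring : CommRing O]
  [alg : Algebra k O]
  [finiteType : Algebra.FiniteType k O]
  [reduced : IsReduced O]
  /-- The restriction of functions. -/
  π : H →ₐ[k] O
  immersion : IsImmersion (specOverMap k π).left
  mem_iff : ∀ σ, σ ∈ Z ↔ ∃ τ : O →ₐ[k] k, τ.comp π = σ
  exists_factor : ∀ {E : Type u} [CommRing E] [Algebra k E] [Algebra.FiniteType k E] [IsReduced E]
    (g : H →ₐ[k] E), (∀ τ : E →ₐ[k] k, τ.comp g ∈ Z) → ∃ g' : O →ₐ[k] E, g'.comp π = g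
  ext : ∀ {E : Type u} [CommRing E] [Algebra k E] {g g' : O →ₐ[k] E}, g.comp π = g'.comp π → g = g'

attribute [instance] PointModel.ring PointModel.alg PointModel.finiteType PointModel.reduced
  PointModel.immersion

lemma PointModel.mem {H : Type u} [CommRing H] [Algebra k H] {Z : Set (H →ₐ[k] k)}
    (M : PointModel Z) (τ : M.O →ₐ[k] k) : τ.comp M.π ∈ Z := (M.mem_iff _).mpr ⟨τ, rfl⟩

variable [IsAlgClosed k]

/-- The ring is the localization of H modulo the radical of I away from h. A homomorphism to a
reduced E factors because its points decide which elements vanish and which are units. -/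
theorem nonempty_pointModel {H : Type u} [CommRing H] [Algebra k H] [Algebra.FiniteType k H]
    (I : Set H) (h : H) :
    Nonempty (PointModel (k := k) {σ : H →ₐ[k] k | (∀ a ∈ I, σ a = 0) ∧ σ h ≠ 0}) := by
  let J := (Ideal.span I).radical
  let Q := H ⧸ J
  let s : Q := Ideal.Quotient.mk J h
  let O := Localization.Away s
  have hI {E : Type u} [CommRing E] [IsReduced E] (g : H →+* E) (hg : ∀ a ∈ I, g a = 0) :
      ∀ a ∈ J, g a = 0 := by
    rintro a ⟨N, hN⟩
    have : a ^ N ∈ RingHom.ker g := (Ideal.span_le (I := RingHom.ker g)).mpr hg hN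
    rw [RingHom.mem_ker, map_pow] at this
    exact eq_zero_of_pow_eq_zero this
  have : Algebra.FiniteType k Q := .of_surjective (Ideal.Quotient.mkₐ k J) Ideal.Quotient.mk_surjective
  have : IsReduced Q := (Ideal.isRadical_iff_quotient_reduced J).mp (Ideal.radical_isRadical _)
  have : Algebra.FiniteType Q O := IsLocalization.finiteType_of_monoid_fg (Submonoid.powers s) _
  have : Algebra.FiniteType k O := .trans ‹Algebra.FiniteType k Q› this
  let π₁ : H →ₐ[k] Q := Ideal.Quotient.mkₐ k J
  let π₂ : Q →ₐ[k] O := IsScalarTower.toAlgHom k Q O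
  have hs : IsUnit (π₂ (π₁ h)) := IsLocalization.Away.algebraMap_isUnit (S := O) s
  have h1 : IsClosedImmersion (specOverMap k π₁).left :=
    IsClosedImmersion.spec_of_surjective (CommRingCat.ofHom (Ideal.Quotient.mk J))
      Ideal.Quotient.mk_surjective
  have h2 : IsOpenImmersion (specOverMap k π₂).left :=
    inferInstanceAs (IsOpenImmersion (Spec.map (CommRingCat.ofHom (algebraMap Q O))))
  have lift {E : Type u} [CommRing E] [Algebra k E] [IsReduced E] (g : H →ₐ[k] E)
      (hg : ∀ a ∈ I, g a = 0) (hgh : IsUnit (g h)) : ∃ g' : O →ₐ[k] E, g'.comp (π₂.comp π₁) = g := by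
    let g₁ : Q →ₐ[k] E := Ideal.Quotient.liftₐ J g (hI g.toRingHom hg)
    refine ⟨IsLocalization.liftAlgHom (M := Submonoid.powers s) (f := g₁) ?_, ?_⟩
    · rintro ⟨_, N, rfl⟩
      rw [map_pow]
      exact hgh.pow N
    · ext a
      exact IsLocalization.lift_eq (M := Submonoid.powers s) _ (Ideal.Quotient.mk J a)
  refine ⟨{ O := O, π := π₂.comp π₁, immersion := ?_, mem_iff := fun σ => ⟨fun hσ => ?_, ?_⟩, exists_factor := fun {E} _ _ _ _ g hg => ?_, ext := fun {E} _ _ g g' hgg => ?_ }⟩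
  · rw [← specOverMap_comp]
    exact inferInstanceAs (IsImmersion ((specOverMap k π₂).left ≫ (specOverMap k π₁).left))
  · exact lift σ hσ.1 (isUnit_iff_ne_zero.mpr hσ.2)
  · rintro ⟨τ, rfl⟩
    refine ⟨fun a ha => ?_, (hs.map τ).ne_zero⟩
    have : π₁ a = 0 := Ideal.Quotient.eq_zero_iff_mem.mpr (Ideal.le_radical (Ideal.subset_span ha))
    change τ (π₂ (π₁ a)) = 0
    rw [this, map_zero, map_zero]
  · refine lift g (fun a ha => ?_) ?_
    · exact (isNilpotent_of_forall_point fun τ => (hg τ).1 a ha).eq_zero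
    · by_contra hu
      obtain ⟨M, hM, hgM⟩ := exists_max_ideal_of_mem_nonunits hu
      obtain ⟨τ, hτ, -⟩ := exists_point_of_prime (k := k) M (a := 1)
        ((Ideal.ne_top_iff_one _).mp hM.ne_top)
      exact (hg τ).2 (hτ _ hgM)
  · refine AlgHom.coe_ringHom_injective (IsLocalization.ringHom_ext (Submonoid.powers s) ?_)
    refine Ideal.Quotient.ringHom_ext (RingHom.ext fun a => ?_)
    exact congr($hgg a)

end PointModels

/-! ### Splitting off an affine space by motions. -/

section Fibration
variable {k : Type u} [Field k] {R H : Type u} [CommRing R] [Algebra k R]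
  [CommRing H] [Algebra k H]

lemma mvPolynomial_algHom_ext {O E : Type*} [CommRing O] [Algebra k O] [CommRing E] [Algebra k E]
    {e : ℕ} {g g' : MvPolynomial (Fin e) O →ₐ[k] E}
    (hC : ∀ a, g (MvPolynomial.C a) = g' (MvPolynomial.C a))
    (hX : ∀ i, g (MvPolynomial.X i) = g' (MvPolynomial.X i)) : g = g' :=
  AlgHom.coe_ringHom_injective (MvPolynomial.ringHom_ext hC hX)

lemma mvPolynomial_point {O : Type u} [CommRing O] [Algebra k O] {e : ℕ}
    (τ : MvPolynomial (Fin e) O →ₐ[k] k) :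
    τ = MvPolynomial.aevalTower (τ.comp (IsScalarTower.toAlgHom k O _)) fun i => τ (.X i) := by
  refine mvPolynomial_algHom_ext (fun a => ?_) fun i => ?_
  · rw [MvPolynomial.aevalTower_C]; rfl
  · rw [MvPolynomial.aevalTower_X]

variable [IsAlgClosed k]

/-- A family of motions of the points of `Z`, parametrized by an affine space, makes `Z` a product
with that affine space, over the image of `Z`. -/
theorem PointModel.fibration (ψ : R →ₐ[k] H) {Z : Set (H →ₐ[k] k)} {T : Set (R →ₐ[k] k)}
    (M : PointModel Z) (N : PointModel T) {e : ℕ} (piv : Fin e → H)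
    (M₀ : PointModel {σ | σ ∈ Z ∧ ∀ i, σ (piv i) = 0}) (α : H →ₐ[k] MvPolynomial (Fin e) M.O)
    (hT : ∀ σ ∈ Z, σ.comp ψ ∈ T) (hT' : ∀ τ ∈ T, ∃ σ ∈ Z, σ.comp ψ = τ)
    (h1 : ∀ (τ : M.O →ₐ[k] k) (a : Fin e → k), (MvPolynomial.aevalTower τ a).comp α ∈ Z)
    (h2 : ∀ (τ : M.O →ₐ[k] k) (a : Fin e → k) (i : Fin e),
      MvPolynomial.aevalTower τ a (α (piv i)) = τ (M.π (piv i)) + a i)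
    (h3 : ∀ (τ τ' : M.O →ₐ[k] k) (a b : Fin e → k), τ'.comp M.π = (MvPolynomial.aevalTower τ a).comp α →
      (MvPolynomial.aevalTower τ' b).comp α = (MvPolynomial.aevalTower τ (a + b)).comp α)
    (h4 : ∀ τ : M.O →ₐ[k] k, (MvPolynomial.aevalTower τ 0).comp α = τ.comp M.π)
    (h5 : ∀ (τ : M.O →ₐ[k] k) (a : Fin e → k),
      ((MvPolynomial.aevalTower τ a).comp α).comp ψ = (τ.comp M.π).comp ψ)
    (h6 : ∀ τ τ' : M.O →ₐ[k] k, (τ.comp M.π).comp ψ = (τ'.comp M.π).comp ψ →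
      ∃ a, τ'.comp M.π = (MvPolynomial.aevalTower τ a).comp α) :
    ∃ (q : N.O →ₐ[k] M.O) (w : N.O →ₐ[k] M₀.O) (Φ : M.O ≃ₐ[k] MvPolynomial (Fin e) M₀.O),
      q.comp N.π = M.π.comp ψ ∧
      Φ.toAlgHom.comp q = (IsScalarTower.toAlgHom k M₀.O (MvPolynomial (Fin e) M₀.O)).comp w ∧
      Function.Bijective (PrimeSpectrum.comap w.toRingHom) := by
  obtain ⟨q, hq⟩ := N.exists_factor (M.π.comp ψ) fun τ => hT _ (M.mem τ)
  obtain ⟨w, hw⟩ := N.exists_factor (M₀.π.comp ψ) fun τ => hT _ (M₀.mem τ).1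
  obtain ⟨r, hr⟩ := M.exists_factor M₀.π fun τ => (M₀.mem τ).1
  have hr' (τ₀ : M₀.O →ₐ[k] k) : (τ₀.comp r).comp M.π = τ₀.comp M₀.π := by
    rw [AlgHom.comp_assoc, hr]
  have hmap (τ₀ : M₀.O →ₐ[k] k) (a : Fin e → k) :
      (MvPolynomial.aevalTower τ₀ a).comp (MvPolynomial.mapAlgHom r) =
        MvPolynomial.aevalTower (τ₀.comp r) a := by
    refine mvPolynomial_algHom_ext (fun x => ?_) fun i => ?_
    · simp
    · simp
  -- Dual to (x, a) ↦ x moved by a, from the slice times affine space to the stratum.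
  obtain ⟨A, hA⟩ := M.exists_factor ((MvPolynomial.mapAlgHom r).comp α) fun τ => by
    rw [mvPolynomial_point τ, ← AlgHom.comp_assoc, hmap]
    exact h1 _ _
  have hA' (τ₀ : M₀.O →ₐ[k] k) (a : Fin e → k) : ((MvPolynomial.aevalTower τ₀ a).comp A).comp M.π =
      (MvPolynomial.aevalTower (τ₀.comp r) a).comp α := by
    rw [AlgHom.comp_assoc, hA, ← AlgHom.comp_assoc, hmap]
  have hneg (τ : M.O →ₐ[k] k) : τ.comp (MvPolynomial.aevalTower (AlgHom.id k M.O)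
      (fun i => -M.π (piv i))) = MvPolynomial.aevalTower τ (-fun i => τ (M.π (piv i))) := by
    refine mvPolynomial_algHom_ext (fun x => ?_) fun i => ?_
    · simp
    · simp
  -- Dual to the retraction onto the slice: by `h2`, moving a point by minus its pivots makes the
  -- pivots vanish.
  obtain ⟨s, hs⟩ := M₀.exists_factor
    ((MvPolynomial.aevalTower (AlgHom.id k M.O) (fun i => -M.π (piv i))).comp α) fun τ => by
      rw [← AlgHom.comp_assoc, hneg]
      exact ⟨h1 _ _, fun i => by rw [AlgHom.comp_apply, h2]; simp⟩
  have hs' (τ : M.O →ₐ[k] k) : (τ.comp s).comp M₀.π =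
      (MvPolynomial.aevalTower τ (-fun i => τ (M.π (piv i)))).comp α := by
    rw [AlgHom.comp_assoc, hs, ← AlgHom.comp_assoc, hneg]
  -- Dual to the inverse map, which sends x to its retraction and its pivots.
  let Bi : MvPolynomial (Fin e) M₀.O →ₐ[k] M.O := MvPolynomial.aevalTower s fun i => M.π (piv i)
  have hBi (τ : M.O →ₐ[k] k) : τ.comp Bi =
      MvPolynomial.aevalTower (τ.comp s) fun i => τ (M.π (piv i)) := by
    refine mvPolynomial_algHom_ext (fun x => ?_) fun i => ?_
    · simp [Bi]
    · simp [Bi]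
  -- All rings involved are reduced and of finite type, so identities of homomorphisms are checked
  -- on k-points, where they express the additivity `h3` of motions.
  have hBA : Bi.comp A = AlgHom.id k M.O := by
    refine algHom_ext_points fun τ => M.ext ?_
    rw [← AlgHom.comp_assoc, hBi, hA', AlgHom.comp_id, h3 τ _ (-fun i => τ (M.π (piv i))),
      neg_add_cancel, h4]
    rw [hr', hs']
  have hAB : A.comp Bi = AlgHom.id k _ := by
    refine algHom_ext_points fun τ => ?_
    rw [AlgHom.comp_id, ← AlgHom.comp_assoc, mvPolynomial_point τ]
    generalize τ.comp (IsScalarTower.toAlgHom k M₀.O _) = τ₀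
    generalize (fun i => τ (MvPolynomial.X i)) = a
    have hp : (fun i => (MvPolynomial.aevalTower τ₀ a).comp A (M.π (piv i))) = a := by
      funext i
      refine congr($(hA' τ₀ a) (piv i)).trans ?_
      rw [AlgHom.comp_apply, h2]
      have := (M₀.mem τ₀).2 i
      rw [← hr'] at this
      rw [show (τ₀.comp r) (M.π (piv i)) = 0 from this, zero_add]
    rw [hBi, hp]
    congr 1
    refine M₀.ext ?_
    rw [hs', hp, h3 (τ₀.comp r) _ a _ (hA' τ₀ a), add_neg_cancel, h4, hr']
  refine ⟨q, w, AlgEquiv.ofAlgHom A Bi hAB hBA, hq, ?_, ?_⟩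
  · change A.comp q = _
    have h7 : q = Bi.comp ((IsScalarTower.toAlgHom k M₀.O (MvPolynomial (Fin e) M₀.O)).comp w) := by
      refine algHom_ext_points fun τ => N.ext ?_
      rw [AlgHom.comp_assoc, hq, ← AlgHom.comp_assoc, ← h5 τ (-fun i => τ (M.π (piv i))), ← hs',
        AlgHom.comp_assoc, ← hw]
      ext a
      simp [Bi]
    rw [h7, ← AlgHom.comp_assoc, hAB, AlgHom.id_comp]
  -- Two slice points with the same image differ by a motion (`h6`), which is trivial because the
  -- pivots of both vanish. Conversely a preimage in the stratum can be moved into the slice without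
  -- changing its image.
  · refine ⟨comap_injective_of_points w fun τ τ' h => ?_, comap_surjective_of_points w fun τ => ?_⟩
    · have h' : (τ.comp M₀.π).comp ψ = (τ'.comp M₀.π).comp ψ := by
        have := congrArg (fun g => AlgHom.comp g N.π) h
        dsimp only at this
        rwa [AlgHom.comp_assoc, hw, AlgHom.comp_assoc, hw] at this
      rw [← hr', ← hr'] at h'
      obtain ⟨a, ha⟩ := h6 _ _ h'
      have ha0 : a = 0 := by
        funext i
        have h8 := congr($ha (piv i))
        rw [AlgHom.comp_apply (MvPolynomial.aevalTower _ _), h2] at h8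
        have e1 := (M₀.mem τ).2 i
        have e2 := (M₀.mem τ').2 i
        rw [← hr'] at e1 e2
        rw [e2, show (τ.comp r) (M.π (piv i)) = 0 from e1, zero_add] at h8
        exact h8.symm
      rw [ha0, h4, hr', hr'] at ha
      exact M₀.ext ha.symm
    · obtain ⟨σ, hσ, hσT⟩ := hT' _ (N.mem τ)
      obtain ⟨σ', rfl⟩ := (M.mem_iff σ).mp hσ
      refine ⟨σ'.comp s, N.ext ?_⟩
      rw [AlgHom.comp_assoc, hw, ← AlgHom.comp_assoc, hs', h5, hσT]

end Fibration

/-! ### Coordinate rings of jets of affine charts. -/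

section JetAlgebra
open scoped TensorProduct
variable {k : Type u} [Field k]

/-- The ring of functions on the jets of an affine scheme. -/
structure JetAlgebra (m : ℕ) (k B : Type u) [Field k] [CommRing B] [Algebra k B] where
  /-- The ring of functions. -/
  H : Type u
  [ring : CommRing H]
  [alg : Algebra k H]
  [finiteType : Algebra.FiniteType k H]
  /-- The universal jet. -/
  jet : B →ₐ[k] H ⊗[k] TruncRing k m
  existsUnique : ∀ {E : Type u} [CommRing E] [Algebra k E] (v : B →ₐ[k] E ⊗[k] TruncRing k m),
    ∃! φ : H →ₐ[k] E, (Algebra.TensorProduct.map φ (AlgHom.id k (TruncRing k m))).comp jet = v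

attribute [instance] JetAlgebra.ring JetAlgebra.alg JetAlgebra.finiteType

/-- Only finite generation of H is at issue. The universal jet is already defined over the
subalgebra H₀ generated by the coefficients of its values on generators of B. Universality gives a
map H → H₀ which followed by the inclusion is the identity, so H₀ is everything. -/
theorem nonempty_jetAlgebra (m : ℕ) (B : Type u) [CommRing B] [Algebra k B] [Algebra.FiniteType k B] :
    Nonempty (JetAlgebra m k B) := by
  let T := TruncRing k m
  obtain ⟨H, _, _, w, hw⟩ := exists_weilRestriction k T B
  obtain ⟨s, hs⟩ := Algebra.FiniteType.out (R := k) (A := B)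
  let b : Module.Basis _ H (H ⊗[k] T) :=
    Algebra.TensorProduct.basis H (Module.Free.chooseBasis k T)
  let G : Set H := ⋃ a ∈ s, Set.range fun i => b.repr (w a) i
  let H₀ := Algebra.adjoin k G
  have hG : G.Finite := s.finite_toSet.biUnion fun a _ => Set.finite_range _
  let ι := Algebra.TensorProduct.map H₀.val (AlgHom.id k T)
  have hι : Function.Injective ι := Module.Flat.rTensor_preserves_injective_linearMap (M := T)
    H₀.val.toLinearMap Subtype.val_injective
  have hr : w.range ≤ ι.range := by
    rw [← Algebra.map_top, ← hs, AlgHom.map_adjoin, Algebra.adjoin_le_iff]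
    rintro _ ⟨a, ha, rfl⟩
    change w a ∈ ι.range
    rw [← b.sum_repr (w a)]
    refine Subalgebra.sum_mem _ fun i _ => ?_
    have hi : b.repr (w a) i ∈ H₀ := Algebra.subset_adjoin (Set.mem_iUnion₂.mpr ⟨a, ha, i, rfl⟩)
    refine ⟨⟨_, hi⟩ ⊗ₜ Module.Free.chooseBasis k T i, ?_⟩
    change Algebra.TensorProduct.map _ _ _ = _
    rw [Algebra.TensorProduct.map_tmul, Algebra.TensorProduct.basis_apply, TensorProduct.smul_tmul',
      smul_eq_mul, mul_one]
    rfl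
  let w₀ : B →ₐ[k] H₀ ⊗[k] T := (AlgEquiv.ofInjective ι hι).symm.toAlgHom.comp
    (w.codRestrict ι.range fun a => hr ⟨a, rfl⟩)
  have hw₀ : ι.comp w₀ = w := AlgHom.ext fun a =>
    congrArg Subtype.val ((AlgEquiv.ofInjective ι hι).apply_symm_apply ⟨w a, hr ⟨a, rfl⟩⟩)
  obtain ⟨φ, hφ, -⟩ := hw H₀ w₀
  have hφ' : H₀.val.comp φ = AlgHom.id k H := by
    refine (hw H w).unique ?_ ?_
    · have : Algebra.TensorProduct.map (H₀.val.comp φ) (AlgHom.id k T) =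
          ι.comp (Algebra.TensorProduct.map φ (AlgHom.id k T)) := by
        rw [← Algebra.TensorProduct.map_comp, AlgHom.id_comp]
      rw [this, AlgHom.comp_assoc, hφ, hw₀]
    · rw [Algebra.TensorProduct.map_id, AlgHom.id_comp]
  have hfin : Algebra.FiniteType k H := by
    have h0 : H₀.FG := ⟨hG.toFinset, by rw [hG.coe_toFinset]⟩
    have := H₀.fg_iff_finiteType.mp h0
    exact .of_surjective H₀.val fun a => ⟨φ a, congr($hφ' a)⟩
  exact ⟨{ H := H, jet := w, existsUnique := fun v => hw _ v }⟩

variable {m : ℕ} {B : Type u} [CommRing B] [Algebra k B]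

lemma JetAlgebra.hom_ext (J : JetAlgebra m k B) {E : Type u} [CommRing E] [Algebra k E]
    {φ ψ : J.H →ₐ[k] E} (h : (Algebra.TensorProduct.map φ (AlgHom.id k (TruncRing k m))).comp J.jet =
      (Algebra.TensorProduct.map ψ (AlgHom.id k (TruncRing k m))).comp J.jet) : φ = ψ :=
  (J.existsUnique _).unique h rfl

/-- The jet corresponding to a point. -/
noncomputable def JetAlgebra.jetAt (J : JetAlgebra m k B) (σ : J.H →ₐ[k] k) : B →ₐ[k] TruncRing k m :=
  (Algebra.TensorProduct.lid k (TruncRing k m)).toAlgHom.comp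
    ((Algebra.TensorProduct.map σ (AlgHom.id k (TruncRing k m))).comp J.jet)

lemma JetAlgebra.jetAt_injective (J : JetAlgebra m k B) : Function.Injective J.jetAt := by
  intro σ τ h
  refine J.hom_ext (AlgHom.ext fun a => ?_)
  exact (Algebra.TensorProduct.lid k (TruncRing k m)).injective congr($h a)

lemma JetAlgebra.jetAt_surjective (J : JetAlgebra m k B) : Function.Surjective J.jetAt := by
  intro v
  obtain ⟨σ, hσ, -⟩ := J.existsUnique ((Algebra.TensorProduct.lid k (TruncRing k m)).symm.toAlgHom.comp v)
  refine ⟨σ, AlgHom.ext fun a => ?_⟩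
  exact (congrArg (Algebra.TensorProduct.lid k (TruncRing k m)) congr($hσ a)).trans
    ((Algebra.TensorProduct.lid k (TruncRing k m)).apply_symm_apply _)

/-- The homomorphism of jet algebras induced by a homomorphism. -/
noncomputable def JetAlgebra.map {A : Type u} [CommRing A] [Algebra k A] (JA : JetAlgebra m k A)
    (J : JetAlgebra m k B) (φ : A →ₐ[k] B) : JA.H →ₐ[k] J.H :=
  (JA.existsUnique (J.jet.comp φ)).choose

lemma JetAlgebra.map_jet {A : Type u} [CommRing A] [Algebra k A] (JA : JetAlgebra m k A)
    (J : JetAlgebra m k B) (φ : A →ₐ[k] B) :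
    (Algebra.TensorProduct.map (JA.map J φ) (AlgHom.id k (TruncRing k m))).comp JA.jet =
      J.jet.comp φ := (JA.existsUnique (J.jet.comp φ)).choose_spec.1

lemma JetAlgebra.jetAt_comp_map {A : Type u} [CommRing A] [Algebra k A] (JA : JetAlgebra m k A)
    (J : JetAlgebra m k B) (φ : A →ₐ[k] B) (σ : J.H →ₐ[k] k) :
    JA.jetAt (σ.comp (JA.map J φ)) = (J.jetAt σ).comp φ := by
  have h : Algebra.TensorProduct.map (σ.comp (JA.map J φ)) (AlgHom.id k (TruncRing k m)) =
      (Algebra.TensorProduct.map σ (AlgHom.id k (TruncRing k m))).comp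
        (Algebra.TensorProduct.map (JA.map J φ) (AlgHom.id k (TruncRing k m))) := by
    rw [← Algebra.TensorProduct.map_comp, AlgHom.id_comp]
  rw [JetAlgebra.jetAt, h, AlgHom.comp_assoc, JA.map_jet]
  rfl

/-- The universal jet as a morphism of schemes. -/
noncomputable def JetAlgebra.univ (J : JetAlgebra m k B) :
    specOver k J.H ⊗ jetDisk k m ⟶ specOver k B :=
  (tensorSpec k (TruncRing k m) J.H).hom ≫ specOverMap k J.jet

lemma JetAlgebra.whiskerRight_univ (J : JetAlgebra m k B) {E : Type u} [CommRing E] [Algebra k E]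
    (ψ : J.H →ₐ[k] E) : specOverMap k ψ ▷ jetDisk k m ≫ J.univ =
      (tensorSpec k (TruncRing k m) E).hom ≫
        specOverMap k ((Algebra.TensorProduct.map ψ (AlgHom.id k (TruncRing k m))).comp J.jet) := by
  have h := tensorSpec_naturality k (TruncRing k m) J.H E ψ
  rw [Iso.inv_comp_eq] at h
  rw [h, univ]
  simp only [Category.assoc, Iso.inv_hom_id_assoc]
  exact congrArg ((tensorSpec k (TruncRing k m) E).hom ≫ ·) (specOverMap_comp _ _)

theorem JetAlgebra.existsUnique_univ (J : JetAlgebra m k B) (Z : Over (Spec (.of k)))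
    (z : Z ⊗ jetDisk k m ⟶ specOver k B) : ∃! φ : Z ⟶ specOver k J.H, φ ▷ jetDisk k m ≫ J.univ = z := by
  refine universal_of_affine (fun A s z => ?_) Z z
  obtain ⟨σ, rfl⟩ := Spec.map_surjective s
  let _ : Algebra k A := σ.hom.toAlgebra
  change ∃! φ : specOver k A ⟶ specOver k J.H, _
  obtain ⟨v, hv⟩ := exists_specOverMap k B ((tensorSpec k (TruncRing k m) A).inv ≫ z)
  obtain ⟨φ, h1, h2⟩ := J.existsUnique (E := A) v
  refine ⟨specOverMap k φ, ?_, fun ψ hψ => ?_⟩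
  · beta_reduce
    rw [whiskerRight_univ, h1, ← hv, Iso.hom_inv_id_assoc]
  · obtain ⟨ψ, rfl⟩ := exists_specOverMap k J.H ψ
    rw [whiskerRight_univ, ← Iso.eq_inv_comp, hv] at hψ
    rw [h2 ψ (specOverMap_injective k B hψ)]

end JetAlgebra

section JetCharts
open scoped TensorProduct
variable {k : Type u} [Field k] {m : ℕ} {B : Type u} [CommRing B] [Algebra k B]
  {X' X : Over (Spec (.of k))}

/-- The jets contained in an affine chart. -/
noncomputable def JetAlgebra.toJetScheme (J : JetAlgebra m k B) (i : specOver k B ⟶ X) :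
    specOver k J.H ⟶ jetScheme m X := (jetSchemeRepr m X).homEquiv.symm (J.univ ≫ i)

lemma jetSchemeRepr_comp {Y Z : Over (Spec (.of k))} (g : Z ⟶ Y) (h : Y ⟶ jetScheme m X) :
    (jetSchemeRepr m X).homEquiv (g ≫ h) = g ▷ jetDisk k m ≫ (jetSchemeRepr m X).homEquiv h :=
  (jetSchemeRepr m X).homEquiv_comp g h

lemma JetAlgebra.homEquiv_toJetScheme (J : JetAlgebra m k B) (i : specOver k B ⟶ X) :
    (jetSchemeRepr m X).homEquiv (J.toJetScheme i) = J.univ ≫ i := Equiv.apply_symm_apply _ _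

/-- The open subscheme V of Y over which `t` comes from `w` maps to J by `v`, and J maps to V
because `ι` pulls `t` back to `w`. The two maps are mutually inverse. -/
lemma IsOpenElement.isOpenImmersion {F : Scheme.{u}ᵒᵖ ⥤ Type u} {J Y : Scheme.{u}}
    {w : F.obj (op J)} (hw : IsOpenElement w) {t : F.obj (op Y)}
    (ht : ∀ (T : Scheme.{u}) (φ ψ : T ⟶ Y), F.map φ.op t = F.map ψ.op t → φ = ψ) (ι : J ⟶ Y)
    (hι : F.map ι.op t = w) : IsOpenImmersion ι := by
  have hid : F.map (𝟙 J).op w = w := by rw [op_id, F.map_id]; rfl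
  obtain ⟨V, p, v, hp, hv, hV⟩ := hw.exists_open Y t
  obtain ⟨ψ, hψ⟩ := hV _ ι (𝟙 _) (by rw [hι, hid])
  have hvι : v ≫ ι = p := ht _ _ _ (by rw [op_comp, Functor.map_comp_apply, hι, hv])
  have h1 : ψ ≫ v = 𝟙 _ := hw.inj _ _ _ (by
    rw [op_comp, Functor.map_comp_apply, hv, ← Functor.map_comp_apply, ← op_comp, hψ, hι, hid])
  have h2 : v ≫ ψ = 𝟙 _ := by rw [← cancel_mono p, Category.assoc, hψ, hvι, Category.id_comp]
  have : IsIso ψ := ⟨v, h1, h2⟩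
  rw [← hψ]
  infer_instance

/-- The jet disk is a nilpotent thickening of a point, so a family of jets factors through an open
subscheme wherever its centers do; jets in an open chart are thus open in the jet scheme. -/
instance (J : JetAlgebra m k B) (i : specOver k B ⟶ X) [IsOpenImmersion i.left] :
    IsOpenImmersion (J.toJetScheme i).left := by
  let D := jetDisk k m
  let σ : 𝟙_ (Over (Spec (.of k))) ⟶ D :=
    Over.homMk (Spec.map (CommRingCat.ofHom (truncAug k m).toRingHom)) (by
      change Spec.map _ ≫ Spec.map _ = 𝟙 _
      rw [← Spec.map_comp, ← CommRingCat.ofHom_comp, ← Spec.map_id]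
      congr 2
      ext x
      simp)
  have : Surjective σ.left := by
    have hsurj : Function.Surjective (truncAug k m) := fun c => ⟨algebraMap k _ c, AlgHom.commutes _ c⟩
    have hp (p : PrimeSpectrum (TruncRing k m)) :
        p ∈ Set.range (PrimeSpectrum.comap (truncAug k m).toRingHom) := by
      rw [range_comap_of_surjective _ (truncAug k m).toRingHom hsurj, PrimeSpectrum.mem_zeroLocus]
      intro b hb
      obtain ⟨n, hn⟩ := isNilpotent_of_truncAug k m b hb
      exact p.2.mem_of_pow_mem n (hn ▸ p.asIdeal.zero_mem)
    exact ⟨hp⟩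
  have hopen := isOpenElement σ i J.univ J.existsUnique_univ
  let Y := jetScheme m X
  let U : Y ⊗ D ⟶ X := (jetSchemeRepr m X).homEquiv (𝟙 Y)
  have hU {Z : Over (Spec (.of k))} (g : Z ⟶ Y) : g ▷ D ≫ U = (jetSchemeRepr m X).homEquiv g := by
    rw [(jetSchemeRepr m X).homEquiv_eq g]; rfl
  let ι := J.toJetScheme i
  have hι : (sig (homPresheaf D X)).map ι.left.op ⟨Y.hom, U⟩ = ⟨(specOver k J.H).hom, J.univ ≫ i⟩ :=
    sig_map_eq _ _ _ _ _ ι rfl ((hU ι).trans (J.homEquiv_toJetScheme i))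
  refine hopen.isOpenImmersion (t := (⟨Y.hom, U⟩ : (sig (homPresheaf D X)).obj (op Y.left)))
    (fun T φ ψ e => ?_) ι.left hι
  let a : Over.mk (φ ≫ Y.hom) ⟶ Y := Over.homMk φ
  obtain ⟨b, hb, hb'⟩ := (sig_map_eq_iff (homPresheaf D X) ψ Y.hom U (a ▷ D ≫ U)).mp e.symm
  have hab : b = a := (jetSchemeRepr m X).homEquiv.injective (by rw [← hU, ← hU]; exact hb')
  rw [← hb, hab]
  rfl

lemma JetAlgebra.toJetScheme_comp_jetMap {A : Type u} [CommRing A] [Algebra k A]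
    (JA : JetAlgebra m k A) (J : JetAlgebra m k B) (f : X' ⟶ X) (φ : A →ₐ[k] B)
    (i : specOver k B ⟶ X') (j : specOver k A ⟶ X) (h : i ≫ f = specOverMap k φ ≫ j) :
    J.toJetScheme i ≫ jetMap m f = specOverMap k (JA.map J φ) ≫ JA.toJetScheme j := by
  refine (jetSchemeRepr m X).homEquiv.injective ?_
  rw [homEquiv_comp_jetMap, J.homEquiv_toJetScheme, Category.assoc, h, jetSchemeRepr_comp,
    JA.homEquiv_toJetScheme, ← Category.assoc (_ ▷ _), JA.whiskerRight_univ, JA.map_jet, univ,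
    ← specOverMap_comp]
  simp only [Category.assoc]

/-- The one-point scheme as the spectrum of `k`. -/
noncomputable def unitIso (k : Type u) [Field k] : 𝟙_ (Over (Spec (.of k))) ≅ specOver k k :=
  Over.isoMk (Iso.refl _) (by
    change 𝟙 _ ≫ Spec.map (CommRingCat.ofHom (algebraMap k k)) = 𝟙 _
    rw [Category.id_comp]
    exact Spec.map_id _)

/-- The `k`-point given by a homomorphism to `k`. -/
noncomputable def kPointOf (τ : B →ₐ[k] k) : KPoint (specOver k B) :=
  (unitIso k).hom ≫ specOverMap k τ

lemma exists_kPointOf (t : KPoint (specOver k B)) : ∃ τ : B →ₐ[k] k, t = kPointOf τ := by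
  obtain ⟨τ, hτ⟩ := exists_specOverMap k B ((unitIso k).inv ≫ t)
  exact ⟨τ, by rw [kPointOf, ← hτ, Iso.hom_inv_id_assoc]⟩

lemma kPointOf_comp {A : Type u} [CommRing A] [Algebra k A] (φ : A →ₐ[k] B) (τ : B →ₐ[k] k) :
    kPointOf τ ≫ specOverMap k φ = kPointOf (τ.comp φ) := by
  rw [kPointOf, Category.assoc, specOverMap_comp, kPointOf]

lemma leftUnitor_inv_unitIso (T : Type u) [CommRing T] [Algebra k T] :
    (λ_ (specOver k T)).inv ≫ (unitIso k).hom ▷ specOver k T ≫ (tensorSpec k T k).hom =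
      specOverMap k (Algebra.TensorProduct.lid k T).toAlgHom := by
  rw [← Category.assoc, ← Iso.eq_comp_inv]
  have hterm (Z : Over (Spec (.of k))) (g g' : Z ⟶ specOver k k) : g = g' := by
    rw [← cancel_mono (unitIso k).inv]; exact Subsingleton.elim _ _
  refine CartesianMonoidalCategory.hom_ext _ _ (hterm _ _ _) ?_
  have h : (tensorSpec k T k).inv ≫ snd (specOver k k) (specOver k T) =
      specOverMap k (Algebra.TensorProduct.includeRight (R := k) (A := k) (B := T)) :=
    Over.OverMorphism.ext (pullbackSpecIso_inv_snd k k T)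
  rw [Category.assoc, Category.assoc, h, specOverMap_comp, whiskerRight_snd,
    leftUnitor_inv_snd]
  have h2 : (Algebra.TensorProduct.lid k T).toAlgHom.comp
      (Algebra.TensorProduct.includeRight (R := k) (A := k) (B := T)) = AlgHom.id k T := by
    ext x; simp
  rw [h2]
  exact Over.OverMorphism.ext (Spec.map_id _).symm

lemma specOverMap_lid_comp {T : Type u} [CommRing T] [Algebra k T] (g : B →ₐ[k] k ⊗[k] T) :
    (λ_ (specOver k T)).inv ≫ (unitIso k).hom ▷ specOver k T ≫ (tensorSpec k T k).hom ≫
      specOverMap k g = specOverMap k ((Algebra.TensorProduct.lid k T).toAlgHom.comp g) := by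
  rw [← specOverMap_comp, ← leftUnitor_inv_unitIso]
  simp only [Category.assoc]

lemma JetAlgebra.jetOf_kPointOf (J : JetAlgebra m k B) (i : specOver k B ⟶ X) (σ : J.H →ₐ[k] k) :
    jetOf (kPointOf σ ≫ J.toJetScheme i) = specOverMap k (J.jetAt σ) ≫ i := by
  rw [jetOf, jetSchemeRepr_comp, J.homEquiv_toJetScheme, kPointOf, comp_whiskerRight, Category.assoc,
    ← Category.assoc (specOverMap k σ ▷ _), J.whiskerRight_univ]
  refine Eq.trans ?_ (congrArg (· ≫ i) (specOverMap_lid_comp (T := TruncRing k m)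
    ((Algebra.TensorProduct.map σ (AlgHom.id k (TruncRing k m))).comp J.jet)))
  simp only [Category.assoc]

end JetCharts

/-! ### Linear systems modulo t^e and their kernels. -/

section Toeplitz
open PowerSeries
variable {k : Type*} [Field k]

/-- The coefficients below `e` of a vector of power series. -/
noncomputable def lowCoeffs (k : Type*) [Field k] (n e : ℕ) :
    (Fin n → k⟦X⟧) →ₗ[k] (Fin n × Fin e → k) :=
  LinearMap.pi fun p => (coeff (R := k) (p.2 : ℕ)).comp (LinearMap.proj p.1)

lemma lowCoeffs_apply {n e : ℕ} (v : Fin n → k⟦X⟧) (i : Fin n) (l : Fin e) :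
    lowCoeffs k n e v (i, l) = coeff (l : ℕ) (v i) := rfl

lemma lowCoeffs_eq_zero_iff {n e : ℕ} (v : Fin n → k⟦X⟧) :
    lowCoeffs k n e v = 0 ↔ ∀ i, X ^ e ∣ v i := by
  simp only [X_pow_dvd_iff, funext_iff, Prod.forall, lowCoeffs_apply, Pi.zero_apply]
  exact forall_congr' fun i => ⟨fun h l hl => h ⟨l, hl⟩, fun h l => h l l.2⟩

lemma lowCoeffs_eq_iff {n e : ℕ} (v w : Fin n → k⟦X⟧) :
    lowCoeffs k n e v = lowCoeffs k n e w ↔ ∀ i, X ^ e ∣ v i - w i := by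
  rw [← sub_eq_zero, ← map_sub, lowCoeffs_eq_zero_iff]
  rfl

lemma coeff_sum_C_mul_X_pow {d : ℕ} (c : Fin d → k) (l : ℕ) :
    coeff l (∑ l', C (c l') * X ^ (l' : ℕ) : k⟦X⟧) = if h : l < d then c ⟨l, h⟩ else 0 := by
  rw [map_sum]
  simp only [coeff_C_mul, coeff_X_pow, mul_ite, mul_one, mul_zero]
  split_ifs with h
  · rw [Finset.sum_eq_single ⟨l, h⟩]
    · simp
    · intro b _ hb
      rw [if_neg]
      rintro rfl
      exact hb rfl
    · simp
  · refine Finset.sum_eq_zero fun b _ => if_neg ?_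
    rintro rfl
    exact h b.2

lemma lowCoeffs_surjective (n e : ℕ) : Function.Surjective (lowCoeffs k n e) := by
  intro y
  refine ⟨fun i => ∑ l, C (y (i, l)) * X ^ (l : ℕ), funext fun ⟨i, l⟩ => ?_⟩
  rw [lowCoeffs_apply, coeff_sum_C_mul_X_pow, dif_pos l.2]

/-- The action of a matrix of power series on coefficients below `e`. -/
noncomputable def toeplitz {n N : ℕ} (e : ℕ) (D : Matrix (Fin N) (Fin n) k⟦X⟧) :
    Matrix (Fin N × Fin e) (Fin n × Fin e) k :=
  Matrix.of fun p q => if q.2 ≤ p.2 then coeff (p.2 - q.2 : ℕ) (D p.1 q.1) else 0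

lemma toeplitz_mulVec {n N e : ℕ} (D : Matrix (Fin N) (Fin n) k⟦X⟧) (v : Fin n → k⟦X⟧) :
    (toeplitz e D).mulVec (lowCoeffs k n e v) = lowCoeffs k N e (D.mulVec v) := by
  funext ⟨j, l⟩
  rw [lowCoeffs_apply, Matrix.mulVec, dotProduct, Fintype.sum_prod_type, Matrix.mulVec, dotProduct,
    map_sum]
  refine Finset.sum_congr rfl fun i _ => ?_
  rw [coeff_mul, Finset.Nat.sum_antidiagonal_eq_sum_range_succ (fun a b => coeff a (D j i) * coeff b (v i)),
    ← Finset.sum_range_reflect, Nat.succ_eq_add_one]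
  have h1 : ∑ l' : Fin e, toeplitz e D (j, l) (i, l') * lowCoeffs k n e v (i, l') =
      ∑ l' ∈ Finset.range e, if l' ≤ l then coeff (l - l' : ℕ) (D j i) * coeff l' (v i) else 0 := by
    rw [← Fin.sum_univ_eq_sum_range (fun l' => if l' ≤ (l : ℕ) then coeff (l - l' : ℕ) (D j i) * coeff l' (v i) else 0)]
    refine Finset.sum_congr rfl fun l' _ => ?_
    rw [lowCoeffs_apply, toeplitz, Matrix.of_apply, ite_mul, zero_mul]
    rfl
  rw [h1, ← Finset.sum_filter]
  have h2 : Finset.filter (fun l' => l' ≤ (l : ℕ)) (Finset.range e) = Finset.range (l + 1) := by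
    ext a
    have := l.2
    simp only [Finset.mem_filter, Finset.mem_range]
    omega
  rw [h2]
  refine Finset.sum_congr rfl fun a ha => ?_
  have := Finset.mem_range.mp ha
  rw [show (l : ℕ) + 1 - 1 - a = l - a by omega, show (l : ℕ) - (l - a) = a by omega]

lemma toeplitz_mulVec_eq_zero_iff {n N e : ℕ} (D : Matrix (Fin N) (Fin n) k⟦X⟧) (v : Fin n → k⟦X⟧) :
    (toeplitz e D).mulVec (lowCoeffs k n e v) = 0 ↔ ∀ j, X ^ e ∣ D.mulVec v j := by
  rw [toeplitz_mulVec, lowCoeffs_eq_zero_iff]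

/-- Smith normal form of the image of the injective endomorphism Δ; the two changes of basis alter
the determinant by units. -/
theorem exists_smith {R : Type*} [CommRing R] [IsDomain R] [IsPrincipalIdealRing R] {n : ℕ}
    (Δ : Matrix (Fin n) (Fin n) R) (hΔ : Δ.det ≠ 0) :
    ∃ (α β : (Fin n → R) ≃ₗ[R] (Fin n → R)) (a : Fin n → R),
      (∀ x, Δ.mulVec x = β fun i => a i * α x i) ∧ Associated Δ.det (∏ i, a i) := by
  let f : (Fin n → R) →ₗ[R] (Fin n → R) := Matrix.toLin' Δ
  have hf : Function.Injective f := by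
    rw [← LinearMap.ker_eq_bot, LinearMap.ker_eq_bot']
    exact fun x hx => Matrix.eq_zero_of_mulVec_eq_zero hΔ hx
  let eN := LinearEquiv.ofInjective f hf
  have h : Module.finrank R (LinearMap.range f) = Module.finrank R (Fin n → R) := eN.symm.finrank_eq
  let t := Submodule.smithNormalFormTopBasis (Pi.basisFun R (Fin n)) h
  let b := Submodule.smithNormalFormBotBasis (Pi.basisFun R (Fin n)) h
  let a := Submodule.smithNormalFormCoeffs (Pi.basisFun R (Fin n)) h
  let α := eN.trans b.equivFun
  let β := t.equivFun.symm
  have hx (x : Fin n → R) : Δ.mulVec x = β fun i => a i * α x i := by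
    have h1 : eN x = ∑ i, α x i • b i := (b.sum_equivFun (eN x)).symm
    have h2 := congrArg Subtype.val h1
    rw [AddSubmonoidClass.coe_finsetSum] at h2
    refine h2.trans ?_
    rw [Module.Basis.equivFun_symm_apply]
    refine Finset.sum_congr rfl fun i _ => ?_
    rw [Submodule.coe_smul, mul_comm, mul_smul]
    congr 1
    exact Submodule.smithNormalFormBotBasis_def (Pi.basisFun R (Fin n)) h i
  refine ⟨α, β, a, hx, ?_⟩
  have hcomp : f = β.toLinearMap ∘ₗ Matrix.toLin' (Matrix.diagonal a) ∘ₗ α.toLinearMap := by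
    refine LinearMap.ext fun x => (hx x).trans ?_
    change _ = β ((Matrix.diagonal a).mulVec (α x))
    congr 1
    funext i
    rw [Matrix.mulVec_diagonal]
  have hdet : Δ.det = LinearMap.det f := (LinearMap.det_toLin' Δ).symm
  rw [hdet, hcomp, LinearMap.det_comp, LinearMap.det_comp, LinearMap.det_toLin', Matrix.det_diagonal]
  refine Associated.trans (associated_unit_mul_left _ _ β.isUnit_det') (associated_mul_unit_left _ _ α.isUnit_det')

end Toeplitz

section Kernel
open PowerSeries
variable {k : Type*} [Field k]

lemma exists_exponents {n e : ℕ} {a : Fin n → k⟦X⟧} (h : X ^ e ∣ ∏ i, a i)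
    (h' : ¬ X ^ (e + 1) ∣ ∏ i, a i) : ∃ (d : Fin n → ℕ) (u : Fin n → (k⟦X⟧)ˣ),
      (∀ i, a i = X ^ d i * (u i : k⟦X⟧)) ∧ ∑ i, d i = e := by
  have h0 (i) : a i ≠ 0 := fun hi => h' (by rw [Finset.prod_eq_zero (Finset.mem_univ i) hi]; exact dvd_zero _)
  have h1 (i) : ∃ (d : ℕ) (u : (k⟦X⟧)ˣ), a i = X ^ d * (u : k⟦X⟧) := by
    refine ⟨(a i).order.toNat, exists_unit_of_order (X_pow_order_dvd) fun hd => ?_⟩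
    have := nat_le_order _ _ (X_pow_dvd_iff.mp hd)
    rw [← coe_toNat_order (h0 i)] at this
    exact absurd (by exact_mod_cast this : (a i).order.toNat + 1 ≤ (a i).order.toNat) (by omega)
  choose d u hdu using h1
  refine ⟨d, u, hdu, ?_⟩
  have hp : ∏ i, a i = X ^ (∑ i, d i) * ((∏ i, u i : (k⟦X⟧)ˣ) : k⟦X⟧) := by
    rw [Finset.prod_congr rfl fun i _ => hdu i, Finset.prod_mul_distrib, Finset.prod_pow_eq_pow_sum,
      Units.coe_prod]
  rw [hp, Units.dvd_mul_right, pow_dvd_pow_iff X_ne_zero X_prime.not_isUnit] at h h'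
  omega

/-- In Smith form Δ is diagonal with entries t^(d_i) times units and ∑ d_i = e. Modulo t^e the
kernel consists of the vectors whose i-th entry is divisible by t^(e-d_i), which leaves d_i free
coefficients for each i. -/
theorem finrank_ker_toeplitz_of_square {n e : ℕ} (Δ : Matrix (Fin n) (Fin n) k⟦X⟧)
    (h : X ^ e ∣ Δ.det) (h' : ¬ X ^ (e + 1) ∣ Δ.det) :
    Module.finrank k (LinearMap.ker (toeplitz e Δ).mulVecLin) = e := by
  obtain ⟨α, β, a, hΔ, hdet⟩ := exists_smith Δ fun h0 => h' (h0 ▸ dvd_zero _)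
  obtain ⟨d, u, hdu, hd⟩ := exists_exponents ((hdet.dvd_iff_dvd_right).mp h)
    fun hh => h' ((hdet.dvd_iff_dvd_right).mpr hh)
  have hde (i) : d i ≤ e := hd ▸ Finset.single_le_sum (fun _ _ => Nat.zero_le _) (Finset.mem_univ i)
  have hlin (γ : (Fin n → k⟦X⟧) ≃ₗ[k⟦X⟧] (Fin n → k⟦X⟧)) (x : Fin n → k⟦X⟧) (hx : ∀ i, X ^ e ∣ x i)
      (i : Fin n) : X ^ e ∣ γ x i := by
    choose y hy using hx
    have : x = (X ^ e : k⟦X⟧) • y := funext hy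
    rw [this, map_smul]
    exact dvd_mul_right _ _
  have hker (v : Fin n → k⟦X⟧) : lowCoeffs k n e v ∈ LinearMap.ker (toeplitz e Δ).mulVecLin ↔
      ∀ i, X ^ (e - d i) ∣ α v i := by
    rw [LinearMap.mem_ker, Matrix.mulVecLin_apply, toeplitz_mulVec_eq_zero_iff, hΔ]
    have h1 : (∀ j, X ^ e ∣ β (fun i => a i * α v i) j) ↔ ∀ i, X ^ e ∣ a i * α v i := by
      refine ⟨fun hh => ?_, fun hh => hlin β _ hh⟩
      have := hlin β.symm _ hh
      rwa [β.symm_apply_apply] at this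
    rw [h1]
    refine forall_congr' fun i => ?_
    rw [hdu, mul_assoc]
    conv_lhs => rw [← Nat.add_sub_cancel' (hde i), pow_add]
    rw [mul_dvd_mul_iff_left (pow_ne_zero _ X_ne_zero), mul_comm, Units.dvd_mul_right]
  let z : ((Σ i, Fin (d i)) → k) →ₗ[k] (Fin n → k⟦X⟧) := LinearMap.pi fun i =>
    ∑ l : Fin (d i), (LinearMap.toSpanSingleton k k⟦X⟧ (X ^ (e - d i) * X ^ (l : ℕ))).comp
      (LinearMap.proj ⟨i, l⟩)
  have hz (c) (i) : z c i = X ^ (e - d i) * ∑ l : Fin (d i), C (c ⟨i, l⟩) * X ^ (l : ℕ) := by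
    simp only [z, LinearMap.pi_apply, LinearMap.sum_apply, LinearMap.comp_apply, LinearMap.proj_apply,
      LinearMap.toSpanSingleton_apply, Finset.mul_sum, smul_eq_C_mul]
    exact Finset.sum_congr rfl fun l _ => by ring
  let Ψ := (lowCoeffs k n e) ∘ₗ (α.symm.restrictScalars k).toLinearMap ∘ₗ z
  have hΨ (c) : Ψ c = lowCoeffs k n e (α.symm (z c)) := rfl
  have hinj : Function.Injective Ψ := by
    rw [← LinearMap.ker_eq_bot, LinearMap.ker_eq_bot']
    intro c hc
    rw [hΨ, lowCoeffs_eq_zero_iff] at hc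
    have h1 := hlin α _ hc
    rw [α.apply_symm_apply] at h1
    funext ⟨i, l⟩
    have h2 := h1 i
    rw [hz] at h2
    conv_lhs at h2 => rw [← Nat.sub_add_cancel (hde i), pow_add]
    rw [mul_dvd_mul_iff_left (pow_ne_zero _ X_ne_zero), X_pow_dvd_iff] at h2
    have h3 := h2 l l.2
    rwa [coeff_sum_C_mul_X_pow (fun l => c ⟨i, l⟩), dif_pos l.2] at h3
  have hrange : LinearMap.range Ψ = LinearMap.ker (toeplitz e Δ).mulVecLin := by
    refine le_antisymm ?_ fun y hy => ?_
    · rintro _ ⟨c, rfl⟩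
      rw [hΨ, hker, α.apply_symm_apply]
      intro i
      rw [hz]
      exact dvd_mul_right _ _
    · obtain ⟨v, rfl⟩ := lowCoeffs_surjective n e y
      rw [hker] at hy
      choose g hg using hy
      refine ⟨fun p => coeff (p.2 : ℕ) (g p.1), ?_⟩
      rw [hΨ, lowCoeffs_eq_iff]
      have h1 : ∀ i, X ^ e ∣ z (fun p => coeff (p.2 : ℕ) (g p.1)) i - α v i := by
        intro i
        rw [hz, hg, ← mul_sub]
        conv_lhs => rw [← Nat.sub_add_cancel (hde i), pow_add]
        refine mul_dvd_mul_left _ (X_pow_dvd_iff.mpr fun l hl => ?_)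
        rw [map_sub, coeff_sum_C_mul_X_pow (fun l : Fin (d i) => coeff (l : ℕ) (g i)), dif_pos hl, sub_self]
      have h2 := hlin α.symm (z (fun p => coeff (p.2 : ℕ) (g p.1)) - α v) h1
      rwa [map_sub, α.symm_apply_apply] at h2
  rw [← hrange, LinearMap.finrank_range_of_inj hinj, Module.finrank_fintype_fun_eq_card,
    Fintype.card_sigma]
  simpa using hd

/-- Since the minor at `I` divides all the others, every row of D is a k⟦t⟧-combination of the rows
in `I`, and the kernel is that of the square submatrix. -/
theorem finrank_ker_toeplitz {n N e : ℕ} (D : Matrix (Fin N) (Fin n) k⟦X⟧)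
    (h : ∀ I : Fin n → Fin N, X ^ e ∣ (D.submatrix I id).det) (I : Fin n → Fin N)
    (hI : ¬ X ^ (e + 1) ∣ (D.submatrix I id).det) :
    Module.finrank k (LinearMap.ker (toeplitz e D).mulVecLin) = e := by
  have hI0 : (D.submatrix I id).det ≠ 0 := fun h0 => hI (h0 ▸ dvd_zero _)
  obtain ⟨u, hu⟩ := exists_unit_of_order (h I) hI
  obtain ⟨P, hP, -⟩ := exists_mul_submatrix D I hI0 fun I' => by
    rw [hu]; exact (Units.mul_right_dvd).mpr (h I')
  have hker : LinearMap.ker (toeplitz e D).mulVecLin =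
      LinearMap.ker (toeplitz e (D.submatrix I id)).mulVecLin := by
    ext y
    obtain ⟨v, rfl⟩ := lowCoeffs_surjective n e y
    rw [LinearMap.mem_ker, LinearMap.mem_ker, Matrix.mulVecLin_apply, Matrix.mulVecLin_apply,
      toeplitz_mulVec_eq_zero_iff, toeplitz_mulVec_eq_zero_iff]
    refine ⟨fun hv j => hv (I j), fun hv j => ?_⟩
    rw [← hP, ← Matrix.mulVec_mulVec]
    change X ^ e ∣ ∑ i, P j i * (D.submatrix I id).mulVec v i
    exact Finset.dvd_sum fun i _ => (hv i).mul_left _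
  rw [hker]
  exact finrank_ker_toeplitz_of_square (D.submatrix I id) (h I) hI

end Kernel

/-! ### Solving a system by selected rows and free coordinates. -/

section RowSelection
variable {K : Type*} [Field K]

/-- The matrix whose rows are rows of `D` or unit vectors. -/
def selectRows {R ι κ : Type*} [CommRing R] [DecidableEq κ] {e : ℕ} (D : Matrix ι κ R) (p : Fin e → κ)
    (ρ : κ → ι ⊕ Fin e) : Matrix κ κ R :=
  Matrix.of fun r => Sum.elim D (fun s => Pi.single (p s) 1) (ρ r)

/-- The row space has codimension e. Take a basis of it among the rows, together with e unit vectors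
whose classes form a basis of the quotient. -/
theorem exists_selectRows {ι κ : Type*} [Fintype ι] [Fintype κ] [DecidableEq κ] {e : ℕ}
    (D : Matrix ι κ K) (hD : Module.finrank K (LinearMap.ker D.mulVecLin) = e) :
    ∃ (p : Fin e → κ) (ρ : κ → ι ⊕ Fin e), (∀ s, ∃ r, ρ r = Sum.inr s) ∧
      (selectRows D p ρ).det ≠ 0 := by
  classical
  let S := Submodule.span K (Set.range D)
  have hS : Module.finrank K S + e = Fintype.card κ := by
    have h1 := LinearMap.finrank_range_add_finrank_ker D.mulVecLin
    rw [hD, Module.finrank_fintype_fun_eq_card] at h1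
    have h2 : Module.finrank K S = D.rank := (Matrix.rank_eq_finrank_span_row D).symm
    rw [h2]
    exact h1
  obtain ⟨κ₁, a, ha, hspan, hli⟩ := exists_linearIndependent' K (fun i => D i)
  obtain ⟨κ₂, b, hb, hspan₂, hli₂⟩ := exists_linearIndependent' K
    (fun j : κ => (Submodule.Quotient.mk (Pi.single j 1) : (κ → K) ⧸ S))
  have : Finite κ₁ := .of_injective a ha
  have : Finite κ₂ := .of_injective b hb
  have := Fintype.ofFinite κ₁
  have := Fintype.ofFinite κ₂
  have hc₁ : Fintype.card κ₁ = Module.finrank K S := by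
    rw [← finrank_span_eq_card hli]
    exact congrArg (fun T : Submodule K (κ → K) => Module.finrank K T) hspan
  have hc₂ : Fintype.card κ₂ = e := by
    rw [← finrank_span_eq_card hli₂, hspan₂]
    have h1 : Submodule.span K (Set.range fun j : κ =>
        (Submodule.Quotient.mk (Pi.single j 1) : (κ → K) ⧸ S)) = ⊤ := by
      have h2 : (Set.range fun j : κ => (Submodule.Quotient.mk (Pi.single j 1) : (κ → K) ⧸ S)) =
          S.mkQ '' Set.range (Pi.basisFun K κ) := by
        rw [← Set.range_comp]
        congr 1
        funext j
        simp
      rw [h2, ← Submodule.map_span, (Pi.basisFun K κ).span_eq, Submodule.map_top, Submodule.range_mkQ]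
    rw [h1, finrank_top]
    have h3 := Submodule.finrank_quotient_add_finrank S
    rw [Module.finrank_fintype_fun_eq_card] at h3
    omega
  let E₂ : κ₂ ≃ Fin e := Fintype.equivFinOfCardEq hc₂
  let E : κ ≃ κ₁ ⊕ κ₂ := Fintype.equivOfCardEq (by rw [Fintype.card_sum]; omega)
  have hliS : LinearIndependent K (fun x : κ₁ => (⟨D (a x), Submodule.subset_span ⟨a x, rfl⟩⟩ : S)) :=
    LinearIndependent.of_comp S.subtype hli
  have hall := LinearIndependent.sumElim_of_quotient hliS (fun y => Pi.single (b y) 1) hli₂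
  refine ⟨fun s => b (E₂.symm s), fun r => Sum.map a E₂ (E r), fun s =>
    ⟨E.symm (Sum.inr (E₂.symm s)), by simp⟩, ?_⟩
  rw [← isUnit_iff_ne_zero, ← Matrix.isUnit_iff_isUnit_det, ← Matrix.linearIndependent_rows_iff_isUnit]
  have hrow : (selectRows D (fun s => b (E₂.symm s)) fun r => Sum.map a E₂ (E r)).row =
      (Sum.elim (fun x : κ₁ => D (a x)) fun y => Pi.single (b y) 1) ∘ E := by
    funext r
    change Sum.elim D (fun s => Pi.single (b (E₂.symm s)) 1) (Sum.map a E₂ (E r)) = _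
    rw [Function.comp_apply]
    cases E r with
    | inl x => rfl
    | inr x => exact congrArg (fun s => (Pi.single (b s) 1 : κ → K)) (E₂.symm_apply_apply x)
  rw [hrow]
  exact hall.comp E E.injective

end RowSelection

/-! ### Coefficients of the universal jet, and motions of jets. -/

section Coefficients
open scoped TensorProduct
variable (k : Type u) [Field k] (m : ℕ)

/-- The `l`-th coefficient of a truncated polynomial, for `l ≤ m`. -/
noncomputable def truncCoeff (l : ℕ) : TruncRing k m →ₗ[k] k :=
  (Polynomial.lcoeff k l).comp (AdjoinRoot.modByMonicHom (Polynomial.monic_X_pow (R := k) (m + 1)))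

lemma truncCoeff_truncHom {l : ℕ} (hl : l < m + 1) (a : PowerSeries k) :
    truncCoeff k m l (truncHom k m a) = PowerSeries.coeff l a := by
  have h : truncCoeff k m l (truncHom k m a) =
      ((PowerSeries.trunc (m + 1) a) %ₘ ((Polynomial.X : Polynomial k) ^ (m + 1))).coeff l :=
    congrArg (Polynomial.coeff · l)
      (AdjoinRoot.modByMonicHom_mk (Polynomial.monic_X_pow (R := k) (m + 1)) (PowerSeries.trunc (m + 1) a))
  rw [h, (Polynomial.modByMonic_eq_self_iff (Polynomial.monic_X_pow (R := k) (m + 1))).mpr,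
    PowerSeries.coeff_trunc, if_pos hl]
  rw [Polynomial.degree_X_pow]
  exact PowerSeries.degree_trunc_lt a (m + 1)

variable {k m} {B : Type u} [CommRing B] [Algebra k B]

/-- The coefficients of the universal jet. -/
noncomputable def JetAlgebra.coeff (J : JetAlgebra m k B) (b : B) (l : ℕ) : J.H :=
  TensorProduct.rid k J.H (LinearMap.lTensor J.H (truncCoeff k m l) (J.jet b))

lemma JetAlgebra.apply_coeff (J : JetAlgebra m k B) (σ : J.H →ₐ[k] k) (b : B) (l : ℕ) :
    σ (J.coeff b l) = truncCoeff k m l (J.jetAt σ b) := by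
  change σ (TensorProduct.rid k J.H (LinearMap.lTensor J.H (truncCoeff k m l) (J.jet b))) =
    truncCoeff k m l (Algebra.TensorProduct.lid k (TruncRing k m)
      (Algebra.TensorProduct.map σ (AlgHom.id k (TruncRing k m)) (J.jet b)))
  induction J.jet b with
  | zero => simp
  | add x y hx hy => simp only [map_add, hx, hy]
  | tmul x y =>
    rw [LinearMap.lTensor_tmul, TensorProduct.rid_tmul, Algebra.TensorProduct.map_tmul,
      Algebra.TensorProduct.lid_tmul, map_smul, map_smul, smul_eq_mul, smul_eq_mul, mul_comm]
    rfl

lemma JetAlgebra.apply_coeff_of_lift (J : JetAlgebra m k B) {σ : J.H →ₐ[k] k}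
    {v : B →ₐ[k] PowerSeries k} (hv : (truncHom k m).comp v = J.jetAt σ) (b : B) {l : ℕ}
    (hl : l < m + 1) : σ (J.coeff b l) = PowerSeries.coeff l (v b) := by
  rw [J.apply_coeff, ← hv]
  exact truncCoeff_truncHom k m hl (v b)

/-- The functions on jets that depend on the coefficients below `j` only. -/
noncomputable def JetAlgebra.low (J : JetAlgebra m k B) (j : ℕ) : Subalgebra k J.H :=
  Algebra.adjoin k {x | ∃ b, ∃ l < j, x = J.coeff b l}

lemma JetAlgebra.coeff_mem_low (J : JetAlgebra m k B) {j l : ℕ} (hl : l < j) (b : B) :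
    J.coeff b l ∈ J.low j := Algebra.subset_adjoin ⟨b, l, hl, rfl⟩

lemma JetAlgebra.eq_of_mem_low (J : JetAlgebra m k B) {j : ℕ} (hj : j ≤ m + 1) {σ σ' : J.H →ₐ[k] k}
    {v v' : B →ₐ[k] PowerSeries k} (hv : (truncHom k m).comp v = J.jetAt σ)
    (hv' : (truncHom k m).comp v' = J.jetAt σ') (h : ∀ b, PowerSeries.X ^ j ∣ v' b - v b) {x : J.H}
    (hx : x ∈ J.low j) : σ' x = σ x := by
  have : J.low j ≤ AlgHom.equalizer σ' σ := by
    refine Algebra.adjoin_le ?_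
    rintro _ ⟨b, l, hl, rfl⟩
    change σ' _ = σ _
    rw [J.apply_coeff_of_lift hv b (hl.trans_le hj), J.apply_coeff_of_lift hv' b (hl.trans_le hj)]
    have := PowerSeries.X_pow_dvd_iff.mp (h b) l hl
    rwa [map_sub, sub_eq_zero] at this
  exact this hx

end Coefficients

lemma sum_mul_sum_eq_zero {S ι κ : Type*} [CommSemiring S] [Fintype ι] [Fintype κ] {a : ι → S}
    {b : κ → S} (h : ∀ i j, a i * b j = 0) : (∑ i, a i) * ∑ j, b j = 0 := by
  rw [Finset.sum_mul_sum]
  exact Finset.sum_eq_zero fun i _ => Finset.sum_eq_zero fun j _ => h i j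

section Motion
open scoped TensorProduct
open PowerSeries
variable {k : Type u} [Field k] {m n : ℕ} {B : Type u} [CommRing B] [Algebra k B]
  [Algebra (MvPolynomial (Fin n) k) B] [IsScalarTower k (MvPolynomial (Fin n) k) B]
  [Algebra.Etale (MvPolynomial (Fin n) k) B]

/-- The jet `σ'` arises from the jet `σ` by moving the coordinates by `t ^ (m + 1 - e) * y`. -/
def JetAlgebra.Moved (J : JetAlgebra m k B) {e : ℕ} (y : Fin n × Fin e → k) (σ σ' : J.H →ₐ[k] k) :
    Prop :=
  ∀ b, J.jetAt σ' b = J.jetAt σ b + ∑ i, J.jetAt σ (pd k n B i b) *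
    truncHom k m (X ^ (m + 1 - e) * ∑ l, C (y (i, l)) * X ^ (l : ℕ))

/-- Jets with coefficients in an algebra can be moved. -/
theorem JetAlgebra.exists_moved (J : JetAlgebra m k B) {e : ℕ} (he : 2 * e ≤ m) {E : Type u}
    [CommRing E] [Algebra k E] (s : J.H →ₐ[k] E) (y : Fin n × Fin e → E) :
    ∃ α : J.H →ₐ[k] E, ∀ g : E →ₐ[k] k, J.Moved (fun p => g (y p)) (g.comp s) (g.comp α) := by
  let z (i : Fin n) : E ⊗[k] TruncRing k m :=
    ∑ l : Fin e, y (i, l) ⊗ₜ truncHom k m (X ^ (m + 1 - e) * X ^ (l : ℕ))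
  -- Products of displacements are divisible by t^(2(m+1-e)), and 2(m+1-e) ≥ m+1; so `taylorHom`
  -- really is a homomorphism.
  have hz (i j) : z i * z j = 0 := by
    refine sum_mul_sum_eq_zero (S := E ⊗[k] TruncRing k m) fun l l' => ?_
    rw [Algebra.TensorProduct.tmul_mul_tmul, ← map_mul]
    have : truncHom k m (X ^ (m + 1 - e) * X ^ (l : ℕ) * (X ^ (m + 1 - e) * X ^ (l' : ℕ))) =
        truncHom k m 0 := by
      rw [truncHom_eq_iff, sub_zero]
      refine dvd_trans (pow_dvd_pow X (by omega : m + 1 ≤ (m + 1 - e) + (m + 1 - e)))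
        ⟨X ^ (l : ℕ) * X ^ (l' : ℕ), by ring⟩
    rw [this, map_zero, TensorProduct.tmul_zero]
  let v := (Algebra.TensorProduct.map s (AlgHom.id k (TruncRing k m))).comp J.jet
  obtain ⟨α, hα, -⟩ := J.existsUnique (taylorHom v z hz)
  refine ⟨α, fun g b => ?_⟩
  have hcomp (β : J.H →ₐ[k] E) (b : B) : J.jetAt (g.comp β) b = Algebra.TensorProduct.lid k (TruncRing k m)
      (Algebra.TensorProduct.map g (AlgHom.id k (TruncRing k m))
        ((Algebra.TensorProduct.map β (AlgHom.id k (TruncRing k m))).comp J.jet b)) := by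
    have h : Algebra.TensorProduct.map (g.comp β) (AlgHom.id k (TruncRing k m)) =
        (Algebra.TensorProduct.map g (AlgHom.id k (TruncRing k m))).comp
          (Algebra.TensorProduct.map β (AlgHom.id k (TruncRing k m))) := by
      rw [← Algebra.TensorProduct.map_comp, AlgHom.id_comp]
    rw [JetAlgebra.jetAt, h]
    rfl
  rw [hcomp, hα, taylorHom_apply, map_add, map_add, map_sum, map_sum]
  refine congrArg₂ (· + ·) (hcomp s b).symm (Finset.sum_congr rfl fun i _ => ?_)
  rw [map_mul, map_mul]
  refine congrArg₂ (· * ·) (hcomp s _).symm ?_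
  rw [map_sum, map_sum, Finset.mul_sum, map_sum]
  refine Finset.sum_congr rfl fun l _ => ?_
  rw [Algebra.TensorProduct.map_tmul, Algebra.TensorProduct.lid_tmul, ← map_smul]
  refine (map_smul (truncHom k m) (g (y (i, l))) (X ^ (m + 1 - e) * X ^ (l : ℕ))).symm.trans
    (congrArg (truncHom k m) ?_)
  rw [smul_eq_C_mul]
  ring

end Motion

section MovedJets
open PowerSeries
variable {k : Type u} [Field k] {m n e : ℕ}

/-- The power series with given coefficients below `e`. -/
noncomputable def vecSeries (y : Fin n × Fin e → k) (i : Fin n) : k⟦X⟧ :=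
  ∑ l, C (y (i, l)) * X ^ (l : ℕ)

lemma lowCoeffs_vecSeries (y : Fin n × Fin e → k) : lowCoeffs k n e (vecSeries y) = y :=
  funext fun ⟨i, l⟩ => by
    rw [lowCoeffs_apply, vecSeries, coeff_sum_C_mul_X_pow, dif_pos l.2]

lemma vecSeries_add (y y' : Fin n × Fin e → k) (i : Fin n) :
    vecSeries (y + y') i = vecSeries y i + vecSeries y' i := by
  rw [vecSeries, vecSeries, vecSeries, ← Finset.sum_add_distrib]
  exact Finset.sum_congr rfl fun l _ => by rw [Pi.add_apply, map_add, add_mul]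

lemma vecSeries_zero (i : Fin n) : vecSeries (0 : Fin n × Fin e → k) i = 0 :=
  Finset.sum_eq_zero fun l _ => by rw [Pi.zero_apply, map_zero, zero_mul]

lemma JetAlgebra.exists_lift {B : Type u} [CommRing B] [Algebra k B] (J : JetAlgebra m k B) (n : ℕ)
    [Algebra (MvPolynomial (Fin n) k) B] [IsScalarTower k (MvPolynomial (Fin n) k) B]
    [Algebra.Etale (MvPolynomial (Fin n) k) B] (σ : J.H →ₐ[k] k) :
    ∃ v : B →ₐ[k] k⟦X⟧, (truncHom k m).comp v = J.jetAt σ := by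
  -- No genericity is needed here: the polynomial 1 never vanishes.
  obtain ⟨v, hv, -⟩ := exists_generic_lift (n := n) (J.jetAt σ) (one_ne_zero (α := MvPolynomial (Fin n) k))
  exact ⟨v, hv⟩

variable {B : Type u} [CommRing B] [Algebra k B]
  [Algebra (MvPolynomial (Fin n) k) B] [IsScalarTower k (MvPolynomial (Fin n) k) B]
  [Algebra.Etale (MvPolynomial (Fin n) k) B] (J : JetAlgebra m k B) {y y' : Fin n × Fin e → k}
  {σ σ' σ'' : J.H →ₐ[k] k} {v w : B →ₐ[k] k⟦X⟧}

lemma JetAlgebra.moved_iff (hv : (truncHom k m).comp v = J.jetAt σ)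
    (hw : (truncHom k m).comp w = J.jetAt σ') : J.Moved y σ σ' ↔
      ∀ b, X ^ (m + 1) ∣ w b - (v b + ∑ i, v (pd k n B i b) * (X ^ (m + 1 - e) * vecSeries y i)) := by
  refine forall_congr' fun b => ?_
  rw [← truncHom_eq_iff, map_add, map_sum, ← hv, ← hw]
  simp only [map_mul]
  rfl

lemma JetAlgebra.Moved.unique {J : JetAlgebra m k B} {σ σ' σ'' : J.H →ₐ[k] k} (h : J.Moved y σ σ')
    (h' : J.Moved y σ σ'') : σ' = σ'' :=
  J.jetAt_injective (AlgHom.ext fun b => (h b).trans (h' b).symm)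

lemma JetAlgebra.moved_zero : J.Moved (0 : Fin n × Fin e → k) σ σ := by
  obtain ⟨v, hv⟩ := J.exists_lift n σ
  rw [J.moved_iff hv hv]
  intro b
  simp [vecSeries_zero]

lemma JetAlgebra.Moved.dvd {J : JetAlgebra m k B} {σ σ' : J.H →ₐ[k] k} (h : J.Moved y σ σ')
    (hv : (truncHom k m).comp v = J.jetAt σ) (hw : (truncHom k m).comp w = J.jetAt σ') (b : B) :
    X ^ (m + 1 - e) ∣ w b - v b := by
  have h1 := dvd_trans (pow_dvd_pow X (Nat.sub_le (m + 1) e)) ((J.moved_iff hv hw).mp h b)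
  have h2 : X ^ (m + 1 - e) ∣ ∑ i, v (pd k n B i b) * (X ^ (m + 1 - e) * vecSeries y i) :=
    Finset.dvd_sum fun i _ => (dvd_mul_right _ _).mul_left _
  have := dvd_add h1 h2
  rwa [show w b - (v b + ∑ i, v (pd k n B i b) * (X ^ (m + 1 - e) * vecSeries y i)) +
    ∑ i, v (pd k n B i b) * (X ^ (m + 1 - e) * vecSeries y i) = w b - v b by ring] at this

lemma JetAlgebra.Moved.eq_of_mem_low {J : JetAlgebra m k B} {σ σ' : J.H →ₐ[k] k} (h : J.Moved y σ σ')
    {x : J.H} (hx : x ∈ J.low (m + 1 - e)) : σ' x = σ x := by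
  obtain ⟨v, hv⟩ := J.exists_lift n σ
  obtain ⟨w, hw⟩ := J.exists_lift n σ'
  exact J.eq_of_mem_low (Nat.sub_le _ _) hv hw (h.dvd hv hw) hx

/-- The partial derivatives along σ and σ' differ by multiples of t^(m+1-e) and are multiplied by
t^(m+1-e), so the discrepancy vanishes modulo t^(m+1). -/
lemma JetAlgebra.Moved.trans {J : JetAlgebra m k B} (he : 2 * e ≤ m) {σ σ' σ'' : J.H →ₐ[k] k}
    (h : J.Moved y σ σ') (h' : J.Moved y' σ' σ'') : J.Moved (y + y') σ σ'' := by
  obtain ⟨v, hv⟩ := J.exists_lift n σ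
  obtain ⟨w, hw⟩ := J.exists_lift n σ'
  obtain ⟨x, hx⟩ := J.exists_lift n σ''
  have h0 := h.dvd hv hw
  rw [J.moved_iff hv hw] at h
  rw [J.moved_iff hw hx] at h'
  rw [J.moved_iff hv hx]
  intro b
  have h3 : X ^ (m + 1) ∣ ∑ i, (w (pd k n B i b) - v (pd k n B i b)) * (X ^ (m + 1 - e) * vecSeries y' i) := by
    refine Finset.dvd_sum fun i _ => ?_
    refine dvd_trans (pow_dvd_pow X (by omega : m + 1 ≤ (m + 1 - e) + (m + 1 - e))) ?_
    rw [pow_add]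
    exact mul_dvd_mul (h0 _) (dvd_mul_right _ _)
  have := dvd_add (dvd_add (h b) (h' b)) h3
  convert this using 1
  simp only [vecSeries_add, mul_add, sub_mul, Finset.sum_add_distrib, Finset.sum_sub_distrib]
  ring

/-- As ∂_i x_j is 1 or 0, the coordinates move exactly by t^(m+1-e)·y. This is why the pivots are
translated. -/
lemma JetAlgebra.Moved.coeff_coord {J : JetAlgebra m k B} {σ σ' : J.H →ₐ[k] k} (he : 2 * e ≤ m)
    (h : J.Moved y σ σ') (p : Fin n × Fin e) :
    σ' (J.coeff (coord k n B p.1) (m + 1 - e + p.2)) =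
      σ (J.coeff (coord k n B p.1) (m + 1 - e + p.2)) + y p := by
  obtain ⟨v, hv⟩ := J.exists_lift n σ
  obtain ⟨w, hw⟩ := J.exists_lift n σ'
  have hp := p.2.2
  have hl : m + 1 - e + (p.2 : ℕ) < m + 1 := by omega
  rw [J.apply_coeff_of_lift hv _ hl, J.apply_coeff_of_lift hw _ hl]
  have h1 := (J.moved_iff hv hw).mp h (coord k n B p.1)
  have h2 : ∑ i, v (pd k n B i (coord k n B p.1)) * (X ^ (m + 1 - e) * vecSeries y i) =
      X ^ (m + 1 - e) * vecSeries y p.1 := by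
    rw [Finset.sum_eq_single p.1]
    · rw [pd_coord, if_pos rfl, map_one, one_mul]
    · intro i _ hi
      rw [pd_coord, if_neg hi, map_zero, zero_mul]
    · simp
  rw [h2] at h1
  have h3 := X_pow_dvd_iff.mp h1 _ hl
  rw [map_sub, map_add, sub_eq_zero, coeff_X_pow_mul', if_pos (Nat.le_add_right _ _),
    Nat.add_sub_cancel_left] at h3
  rw [h3]
  congr 1
  have := congrFun (lowCoeffs_vecSeries y) p
  exact this

/-- Take for `y` the lowest e coefficients of the coordinate differences divided by t^(m+1-e). The
quadratic Taylor remainder has order at least 2(m+1-e) ≥ m+1 and disappears. -/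
lemma JetAlgebra.moved_of_dvd (he : 2 * e ≤ m) (hv : (truncHom k m).comp v = J.jetAt σ)
    (hw : (truncHom k m).comp w = J.jetAt σ') (h : ∀ b, X ^ (m + 1 - e) ∣ w b - v b) :
    ∃ y : Fin n × Fin e → k, J.Moved y σ σ' := by
  choose u hu using fun i => h (coord k n B i)
  refine ⟨lowCoeffs k n e u, (J.moved_iff hv hw).mpr fun b => ?_⟩
  have h1 := dvd_trans (pow_dvd_pow X (by omega : m + 1 ≤ 2 * (m + 1 - e))) (taylor_dvd (n := n) w v h b)
  have h2 : X ^ (m + 1) ∣ ∑ i, v (pd k n B i b) * (X ^ (m + 1 - e) * (u i - vecSeries (lowCoeffs k n e u) i)) := by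
    refine Finset.dvd_sum fun i _ => Dvd.dvd.mul_left ?_ _
    have h3 := (lowCoeffs_eq_iff u (vecSeries (lowCoeffs k n e u))).mp (lowCoeffs_vecSeries _).symm i
    have := mul_dvd_mul_left (X ^ (m + 1 - e)) h3
    rwa [← pow_add, Nat.sub_add_cancel (by omega)] at this
  have := dvd_add h1 h2
  convert this using 1
  simp only [hu, mul_sub, Finset.sum_sub_distrib]
  ring

end MovedJets

/-! ### The linear system governing the fibers of f_m. -/

section CoeffMatrix
open PowerSeries
variable {k : Type u} [Field k] {m n N e : ℕ} {B : Type u} [CommRing B] [Algebra k B]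

/-- The action of a matrix on coefficients of jets. -/
noncomputable def JetAlgebra.coeffMatrix (J : JetAlgebra m k B) (e : ℕ)
    (D : Matrix (Fin N) (Fin n) B) : Matrix (Fin N × Fin e) (Fin n × Fin e) J.H :=
  Matrix.of fun p q => if q.2 ≤ p.2 then J.coeff (D p.1 q.1) (p.2 - q.2 : ℕ) else 0

lemma JetAlgebra.map_coeffMatrix (J : JetAlgebra m k B) (he : e ≤ m + 1) {σ : J.H →ₐ[k] k}
    {v : B →ₐ[k] k⟦X⟧} (hv : (truncHom k m).comp v = J.jetAt σ) (D : Matrix (Fin N) (Fin n) B) :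
    (J.coeffMatrix e D).map σ = toeplitz e (D.map v) := by
  ext p q
  have := p.2.2
  rw [Matrix.map_apply, coeffMatrix, toeplitz, Matrix.of_apply, Matrix.of_apply]
  split_ifs with h
  · exact J.apply_coeff_of_lift hv _ (by omega)
  · exact map_zero _

lemma JetAlgebra.coeffMatrix_mem_low (J : JetAlgebra m k B) {j : ℕ} (he : e ≤ j)
    (D : Matrix (Fin N) (Fin n) B) (p q) : J.coeffMatrix e D p q ∈ J.low j := by
  rw [coeffMatrix, Matrix.of_apply]
  have := p.2.2
  split_ifs with h
  · exact J.coeff_mem_low (by omega) _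
  · exact zero_mem _

variable [Algebra (MvPolynomial (Fin n) k) B] [IsScalarTower k (MvPolynomial (Fin n) k) B]
  [Algebra.Etale (MvPolynomial (Fin n) k) B]

/-- The generators of the target change by t^(m+1-e) times Jac·y, which is zero modulo t^(m+1)
exactly when Jac·y is zero modulo t^e. -/
lemma JetAlgebra.Moved.comp_map_eq_iff {A : Type u} [CommRing A] [Algebra k A] {J : JetAlgebra m k B}
    {JA : JetAlgebra m k A} {φ : A →ₐ[k] B} {a : Fin N → A} (ha : Algebra.adjoin k (Set.range a) = ⊤)
    (he : 2 * e ≤ m) {y : Fin n × Fin e → k} {σ σ' : J.H →ₐ[k] k} (h : J.Moved y σ σ') :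
    σ'.comp (JA.map J φ) = σ.comp (JA.map J φ) ↔
      ((J.coeffMatrix e (jacMatrix k n fun l => φ (a l))).map σ).mulVec y = 0 := by
  obtain ⟨v, hv⟩ := J.exists_lift n σ
  rw [← JA.jetAt_injective.eq_iff, JA.jetAt_comp_map, JA.jetAt_comp_map,
    J.map_coeffMatrix (by omega) hv]
  conv_rhs => rw [← lowCoeffs_vecSeries y]
  rw [toeplitz_mulVec_eq_zero_iff]
  have h1 (j : Fin N) : J.jetAt σ' (φ (a j)) = J.jetAt σ (φ (a j)) ↔
      X ^ e ∣ ((jacMatrix k n fun l => φ (a l)).map v).mulVec (vecSeries y) j := by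
    have h2 : J.jetAt σ' (φ (a j)) = J.jetAt σ (φ (a j)) + truncHom k m
        (X ^ (m + 1 - e) * ((jacMatrix k n fun l => φ (a l)).map v).mulVec (vecSeries y) j) := by
      rw [h, ← hv]
      congr 1
      change ∑ i, truncHom k m (v (pd k n B i (φ (a j)))) * truncHom k m (X ^ (m + 1 - e) * vecSeries y i) =
        truncHom k m (X ^ (m + 1 - e) * ∑ i, v (pd k n B i (φ (a j))) * vecSeries y i)
      rw [Finset.mul_sum, map_sum]
      refine Finset.sum_congr rfl fun i _ => ?_
      rw [← map_mul]
      exact congrArg _ (by ring)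
    rw [h2, add_eq_left, ← map_zero (truncHom k m), truncHom_eq_iff, sub_zero]
    conv_lhs => rw [show m + 1 = (m + 1 - e) + e by omega, pow_add, Nat.add_sub_cancel]
    exact mul_dvd_mul_iff_left (pow_ne_zero _ X_ne_zero)
  refine Iff.trans ⟨fun h3 j => congr($h3 (a j)), fun h3 => ?_⟩ (forall_congr' h1)
  refine AlgHom.ext_of_adjoin_eq_top ha ?_
  rintro _ ⟨j, rfl⟩
  exact h3 j

end CoeffMatrix

section SelectedRows
lemma map_selectRows {ι κ R S : Type*} [CommRing R] [CommRing S] [DecidableEq κ] {e : ℕ} (g : R →+* S) (D : Matrix ι κ R)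
    (p : Fin e → κ) (ρ : κ → ι ⊕ Fin e) :
    (selectRows D p ρ).map g = selectRows (D.map g) p ρ := by
  ext r x
  change g ((Sum.elim D (fun s => Pi.single (p s) 1) (ρ r) : κ → R) x) =
    (Sum.elim (D.map g) (fun s => Pi.single (p s) 1) (ρ r) : κ → S) x
  cases ρ r with
  | inl i => rfl
  | inr s =>
    change g ((Pi.single (p s) 1 : κ → R) x) = (Pi.single (p s) 1 : κ → S) x
    rw [Pi.single_apply, Pi.single_apply, apply_ite g, map_one, map_zero]

variable {K : Type*} [Field K] {ι κ : Type*} [Fintype κ] [DecidableEq κ] {e : ℕ}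

/-- The right hand side of the linear system that prescribes the values `a` of the unit rows. -/
def selectVec {R : Type*} [Zero R] (ρ : κ → ι ⊕ Fin e) (a : Fin e → R) : κ → R :=
  fun r => Sum.elim (0 : ι → R) a (ρ r)

lemma selectRows_mulVec_of_mem_ker {D : Matrix ι κ K} (p : Fin e → κ) (ρ : κ → ι ⊕ Fin e)
    {y : κ → K} (hy : D.mulVec y = 0) :
    (selectRows D p ρ).mulVec y = selectVec ρ (fun s => y (p s)) := by
  funext r
  change ∑ x, (Sum.elim D (fun s => Pi.single (p s) 1) (ρ r) : κ → K) x * y x = Sum.elim (0 : ι → K) _ (ρ r)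
  cases ρ r with
  | inl i => exact congrFun hy i
  | inr s =>
    change ∑ x, (Pi.single (p s) 1 : κ → K) x * y x = y (p s)
    simp [Pi.single_apply]

/-- The solutions of the system given by selected rows lie in the kernel. -/
theorem mem_ker_of_selectRows_mulVec [Fintype ι] {D : Matrix ι κ K}
    (hD : Module.finrank K (LinearMap.ker D.mulVecLin) = e) {p : Fin e → κ} {ρ : κ → ι ⊕ Fin e}
    (h : (selectRows D p ρ).det ≠ 0) {a : Fin e → K} {y : κ → K}
    (hy : (selectRows D p ρ).mulVec y = selectVec ρ a) : D.mulVec y = 0 ∧ ∀ s, y (p s) = a s := by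
  have hinj : Function.Injective (selectRows D p ρ).mulVec :=
    Matrix.mulVec_injective_iff_isUnit.mpr ((Matrix.isUnit_iff_isUnit_det _).mpr (isUnit_iff_ne_zero.mpr h))
  let L : LinearMap.ker D.mulVecLin →ₗ[K] (Fin e → K) :=
    (LinearMap.funLeft K K p).comp (LinearMap.ker D.mulVecLin).subtype
  have hL : Function.Injective L := by
    rintro ⟨x, hx⟩ ⟨x', hx'⟩ hxx
    refine Subtype.ext (hinj ?_)
    change (selectRows D p ρ).mulVec x = (selectRows D p ρ).mulVec x'
    rw [selectRows_mulVec_of_mem_ker p ρ hx, selectRows_mulVec_of_mem_ker p ρ hx']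
    exact congrArg (selectVec ρ) hxx
  -- Kernel and target both have dimension e, so the free coordinates parametrize the kernel. The
  -- kernel vector with values `a` solves the selected system, whose solution is unique.
  have hL' : Function.Surjective L :=
    (LinearMap.injective_iff_surjective_of_finrank_eq_finrank (by simp [hD])).mp hL
  obtain ⟨⟨x, hx⟩, rfl⟩ := hL' a
  have : y = x := hinj (hy.trans (selectRows_mulVec_of_mem_ker p ρ hx).symm)
  subst this
  exact ⟨hx, fun s => rfl⟩

end SelectedRows

section PointInjectivity
variable {k : Type u} [Field k] {m : ℕ} {B : Type u} [CommRing B] [Algebra k B]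
  {X' X : Over (Spec (.of k))}

lemma kPointOf_injective : Function.Injective (kPointOf : (B →ₐ[k] k) → _) := by
  intro σ τ h
  exact specOverMap_injective k B ((cancel_epi _).mp h)

lemma JetAlgebra.toJetScheme_injective (J : JetAlgebra m k B) (i : specOver k B ⟶ X)
    [IsOpenImmersion i.left] {σ σ' : J.H →ₐ[k] k}
    (h : kPointOf σ ≫ J.toJetScheme i = kPointOf σ' ≫ J.toJetScheme i) : σ = σ' :=
  kPointOf_injective ((cancel_mono _).mp h)

lemma JetAlgebra.kPointOf_comp_jetMap {A : Type u} [CommRing A] [Algebra k A]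
    (JA : JetAlgebra m k A) (J : JetAlgebra m k B) (f : X' ⟶ X) (φ : A →ₐ[k] B)
    (i : specOver k B ⟶ X') (j : specOver k A ⟶ X) (h : i ≫ f = specOverMap k φ ≫ j)
    (σ : J.H →ₐ[k] k) : (kPointOf σ ≫ J.toJetScheme i) ≫ jetMap m f =
      kPointOf (σ.comp (JA.map J φ)) ≫ JA.toJetScheme j := by
  rw [Category.assoc, JA.toJetScheme_comp_jetMap J f φ i j h, ← Category.assoc, kPointOf_comp]

variable {f : X' ⟶ X} {n : ℕ}

/-- Jets with the same image as a jet in the contact locus arise from it by moving. -/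
theorem JetChart.exists_moved [IsSeparated f.left] (hf : IsBirational f.left)
    (hc : ∀ x : X'.left, ∃ c : JetChart f n, x ∈ Set.range c.i.left) {e e' m : ℕ} (he : 2 * e ≤ m)
    (he' : e + e' ≤ m) (c : JetChart f n) (J : JetAlgebra m k c.B) {σ : J.H →ₐ[k] k}
    {v : c.B →ₐ[k] PowerSeries k} (hv : (truncHom k m).comp v = J.jetAt σ)
    (hσ : specOverMap k v ≫ c.i ∈ jacContact f n e e') {x : KPoint (jetScheme m X')}
    (h : x ≫ jetMap m f = (kPointOf σ ≫ J.toJetScheme c.i) ≫ jetMap m f) :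
    ∃ (σ' : J.H →ₐ[k] k) (y : Fin n × Fin e → k), x = kPointOf σ' ≫ J.toJetScheme c.i ∧
      J.Moved y σ σ' := by
  have h' := congrArg jetOf h
  rw [jetOf_comp_jetMap, jetOf_comp_jetMap, J.jetOf_kPointOf, ← hv, ← jetDiskToArcDisk_comp,
    Category.assoc, Category.assoc] at h'
  obtain ⟨w, hw, hδ⟩ := c.exists_arc_of_jet_comp_eq hf hc he he' v hσ (jetOf x)
    (h'.trans (by rw [Category.assoc]))
  obtain ⟨σ', hσ'⟩ := J.jetAt_surjective ((truncHom k m).comp w)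
  obtain ⟨y, hy⟩ := J.moved_of_dvd (n := n) he hv hσ'.symm hw
  refine ⟨σ', y, jetOf_injective ?_, hy⟩
  rw [J.jetOf_kPointOf, hσ', ← jetDiskToArcDisk_comp, hδ, Category.assoc]

end PointInjectivity

/-! ### The fibration over one stratum of a chart. -/

section ChartFibration
variable {k : Type u} [Field k]

lemma isUnit_of_forall_point [IsAlgClosed k] {O : Type u} [CommRing O] [Algebra k O]
    [Algebra.FiniteType k O] {a : O} (h : ∀ τ : O →ₐ[k] k, τ a ≠ 0) : IsUnit a := by
  by_contra ha
  obtain ⟨P, hP, haP⟩ := exists_max_ideal_of_mem_nonunits ha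
  obtain ⟨τ, hτ, -⟩ := exists_point_of_prime (k := k) P (a := 1) ((Ideal.ne_top_iff_one _).mp hP.ne_top)
  exact h τ (hτ a haP)

/-- A linear system with selected rows can be solved over polynomials. -/
lemma exists_selectRows_mulVec {O ι κ : Type*} [CommRing O] [Fintype κ] [DecidableEq κ] {e : ℕ}
    (D : Matrix ι κ O) (p : Fin e → κ) (ρ : κ → ι ⊕ Fin e) (h : IsUnit (selectRows D p ρ).det) :
    ∃ y : κ → MvPolynomial (Fin e) O,
      (selectRows (D.map MvPolynomial.C) p ρ).mulVec y = selectVec ρ MvPolynomial.X := by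
  have h1 : selectRows (D.map MvPolynomial.C) p ρ =
      (MvPolynomial.C (σ := Fin e)).mapMatrix (selectRows D p ρ) := (map_selectRows _ D p ρ).symm
  have h2 : IsUnit (selectRows (D.map (MvPolynomial.C (σ := Fin e))) p ρ).det := by
    rw [h1, ← RingHom.map_det]
    exact h.map _
  refine ⟨(selectRows (D.map MvPolynomial.C) p ρ)⁻¹.mulVec (selectVec ρ MvPolynomial.X), ?_⟩
  rw [Matrix.mulVec_mulVec, Matrix.mul_nonsing_inv _ h2, Matrix.one_mulVec]

lemma selectRows_mulVec_map {E K ι κ : Type*} [CommRing E] [CommRing K] [Fintype κ] [DecidableEq κ]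
    {e : ℕ} (g : E →+* K) {D : Matrix ι κ E} {p : Fin e → κ} {ρ : κ → ι ⊕ Fin e} {y : κ → E}
    {a : Fin e → E} (h : (selectRows D p ρ).mulVec y = selectVec ρ a) :
    (selectRows (D.map g) p ρ).mulVec (fun x => g (y x)) = selectVec ρ fun i => g (a i) := by
  rw [← map_selectRows]
  funext r
  have h1 := congrArg g (congrFun h r)
  rw [RingHom.map_mulVec] at h1
  refine h1.trans ?_
  change g (Sum.elim (0 : ι → E) a (ρ r)) = Sum.elim (0 : ι → K) _ (ρ r)
  cases ρ r with
  | inl i => exact map_zero g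
  | inr s => rfl

variable {X' X : Over (Spec (.of k))} {f : X' ⟶ X} {n : ℕ} {e e' m : ℕ}

/-- The Jacobian matrix of a chart. -/
noncomputable def JetChart.jac (c : JetChart f n) : Matrix (Fin c.N) (Fin n) c.B :=
  jacMatrix k n fun l => c.φ (c.y l)

lemma JetChart.finrank_ker (c : JetChart f n) (J : JetAlgebra m k c.B) (he : e ≤ m + 1)
    {σ : J.H →ₐ[k] k} {v : c.B →ₐ[k] PowerSeries k} (hv : (truncHom k m).comp v = J.jetAt σ)
    (hσ : specOverMap k v ≫ c.i ∈ jacContact f n e e') :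
    Module.finrank k (LinearMap.ker ((J.coeffMatrix e c.jac).map σ).mulVecLin) = e := by
  obtain ⟨⟨h1, I, h2⟩, -⟩ := (c.mem_jacContact_iff e e' v).mp hσ
  have hdet (I : Fin n → Fin c.N) : ((c.jac.map v).submatrix I id).det = v (c.minor I) :=
    (v.map_det (c.jac.submatrix I id)).symm
  rw [J.map_coeffMatrix he hv]
  exact finrank_ker_toeplitz (c.jac.map v) (fun I => by rw [hdet]; exact h1 I) I (by rw [hdet]; exact h2)

/-- The jets in a part of the contact locus on which the Jacobian matrix has a fixed pattern form a
product with an affine space, over their image. -/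
theorem JetChart.fibration [IsAlgClosed k] [IsSeparated f.left] (hf : IsBirational f.left)
    (hc : ∀ x : X'.left, ∃ c : JetChart f n, x ∈ Set.range c.i.left) (he : 2 * e ≤ m)
    (he' : e + e' ≤ m) (c : JetChart f n) (J : JetAlgebra m k c.B) (JA : JetAlgebra m k c.A)
    {Z : Set (J.H →ₐ[k] k)}
    (hlow : ∀ σ ∈ Z, ∀ σ' : J.H →ₐ[k] k, (∀ x ∈ J.low (m + 1 - e), σ' x = σ x) → σ' ∈ Z)
    (hZ : ∀ σ ∈ Z, ∀ v : c.B →ₐ[k] PowerSeries k, (truncHom k m).comp v = J.jetAt σ →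
      specOverMap k v ≫ c.i ∈ jacContact f n e e')
    (p : Fin e → Fin n × Fin e) (ρ : Fin n × Fin e → (Fin c.N × Fin e) ⊕ Fin e)
    (hdet : ∀ σ ∈ Z, (selectRows ((J.coeffMatrix e c.jac).map σ) p ρ).det ≠ 0)
    {T : Set (JA.H →ₐ[k] k)} (N : PointModel T) (hT : ∀ τ ∈ T, ∃ σ ∈ Z, σ.comp (JA.map J c.φ) = τ)
    (M : PointModel {σ | σ ∈ Z ∧ σ.comp (JA.map J c.φ) ∈ T})
    (M₀ : PointModel {σ : J.H →ₐ[k] k | (σ ∈ Z ∧ σ.comp (JA.map J c.φ) ∈ T) ∧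
      ∀ s, σ (J.coeff (coord k n c.B (p s).1) (m + 1 - e + (p s).2)) = 0}) :
    ∃ (q : N.O →ₐ[k] M.O) (w : N.O →ₐ[k] M₀.O) (Φ : M.O ≃ₐ[k] MvPolynomial (Fin e) M₀.O),
      q.comp N.π = M.π.comp (JA.map J c.φ) ∧
      Φ.toAlgHom.comp q = (IsScalarTower.toAlgHom k M₀.O (MvPolynomial (Fin e) M₀.O)).comp w ∧
      Function.Bijective (PrimeSpectrum.comap w.toRingHom) := by
  have hD (σ) (hσ : σ ∈ Z) :
      Module.finrank k (LinearMap.ker ((J.coeffMatrix e c.jac).map σ).mulVecLin) = e := by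
    obtain ⟨v, hv⟩ := J.exists_lift n σ
    exact c.finrank_ker J (by omega) hv (hZ σ hσ v hv)
  have hmapπ (τ : M.O →ₐ[k] k) : ((J.coeffMatrix e c.jac).map M.π).map (τ : M.O →+* k) =
      (J.coeffMatrix e c.jac).map (τ.comp M.π) := rfl
  -- A function on `M` that vanishes at no k-point is a unit, so the selected system can be solved
  -- over the ring of `M`.
  have hu : IsUnit (selectRows ((J.coeffMatrix e c.jac).map M.π) p ρ).det := by
    refine isUnit_of_forall_point (k := k) fun τ => ?_
    have h1 := (τ : M.O →+* k).map_det (selectRows ((J.coeffMatrix e c.jac).map M.π) p ρ)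
    rw [RingHom.mapMatrix_apply, map_selectRows, hmapπ] at h1
    exact fun h2 => hdet _ (M.mem τ).1 (h1.symm.trans h2)
  -- `y` is the kernel vector with indeterminate free coordinates, and `α` moves the universal jet
  -- of the stratum by it.
  obtain ⟨y, hy⟩ := exists_selectRows_mulVec _ p ρ hu
  obtain ⟨α, hα⟩ := J.exists_moved (n := n) he
    ((IsScalarTower.toAlgHom k M.O (MvPolynomial (Fin e) M.O)).comp M.π) y
  have hs (τ : M.O →ₐ[k] k) (a : Fin e → k) : (MvPolynomial.aevalTower τ a).comp
      ((IsScalarTower.toAlgHom k M.O (MvPolynomial (Fin e) M.O)).comp M.π) = τ.comp M.π := by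
    ext x
    exact MvPolynomial.aevalTower_C τ a (M.π x)
  have hmove (τ : M.O →ₐ[k] k) (a : Fin e → k) :
      J.Moved (fun x => MvPolynomial.aevalTower τ a (y x)) (τ.comp M.π)
        ((MvPolynomial.aevalTower τ a).comp α) := by
    have h1 := hα (MvPolynomial.aevalTower τ a)
    rwa [hs] at h1
  have hsol (τ : M.O →ₐ[k] k) (a : Fin e → k) :
      (selectRows ((J.coeffMatrix e c.jac).map (τ.comp M.π)) p ρ).mulVec
        (fun x => MvPolynomial.aevalTower τ a (y x)) = selectVec ρ a := by
    have h1 := selectRows_mulVec_map (MvPolynomial.aevalTower τ a : MvPolynomial (Fin e) M.O →+* k) hy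
    have h2 : (((J.coeffMatrix e c.jac).map M.π).map (MvPolynomial.C (σ := Fin e))).map
        (MvPolynomial.aevalTower τ a : MvPolynomial (Fin e) M.O →+* k) =
          (J.coeffMatrix e c.jac).map (τ.comp M.π) := by
      ext x x'
      exact MvPolynomial.aevalTower_C τ a _
    rw [h2] at h1
    refine h1.trans (congrArg (selectVec ρ) (funext fun i => ?_))
    exact MvPolynomial.aevalTower_X τ a i
  have hker (τ : M.O →ₐ[k] k) (a : Fin e → k) :=
    mem_ker_of_selectRows_mulVec (hD _ (M.mem τ).1) (hdet _ (M.mem τ).1) (hsol τ a)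
  have huniq (τ : M.O →ₐ[k] k) {x x' : Fin n × Fin e → k}
      (h : (selectRows ((J.coeffMatrix e c.jac).map (τ.comp M.π)) p ρ).mulVec x =
        (selectRows ((J.coeffMatrix e c.jac).map (τ.comp M.π)) p ρ).mulVec x') : x = x' :=
    (Matrix.mulVec_injective_iff_isUnit.mpr ((Matrix.isUnit_iff_isUnit_det _).mpr
      (isUnit_iff_ne_zero.mpr (hdet _ (M.mem τ).1)))) h
  have h5 (τ : M.O →ₐ[k] k) (a : Fin e → k) :
      ((MvPolynomial.aevalTower τ a).comp α).comp (JA.map J c.φ) =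
        (τ.comp M.π).comp (JA.map J c.φ) :=
    ((hmove τ a).comp_map_eq_iff c.adjoin_y he).mpr (hker τ a).1
  refine M.fibration (JA.map J c.φ) N _ M₀ α (fun σ hσ => hσ.2) (fun τ hτ => ?_) (fun τ a => ⟨?_, ?_⟩)
    (fun τ a i => ?_) (fun τ τ' a b h => ?_) (fun τ => ?_) h5 fun τ τ' h => ?_
  · obtain ⟨σ, hσ, rfl⟩ := hT τ hτ
    exact ⟨σ, ⟨hσ, hτ⟩, rfl⟩
  · exact hlow _ (M.mem τ).1 _ fun x hx => (hmove τ a).eq_of_mem_low hx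
  · rw [h5]
    exact (M.mem τ).2
  · exact ((hmove τ a).coeff_coord he (p i)).trans (congrArg (_ + ·) ((hker τ a).2 i))
  · have h1 := hmove τ' b
    rw [h] at h1
    have h2 := (hmove τ a).trans he h1
    have h3 : (fun x => MvPolynomial.aevalTower τ a (y x)) + (fun x => MvPolynomial.aevalTower τ' b (y x)) =
        fun x => MvPolynomial.aevalTower τ (a + b) (y x) := by
      refine huniq τ ?_
      -- The matrix involves only coefficients below e ≤ m+1-e, which motions do not change; so both
      -- motions solve the same linear system and their vectors add.
      have h4 : (J.coeffMatrix e c.jac).map (τ'.comp M.π) = (J.coeffMatrix e c.jac).map (τ.comp M.π) := by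
        rw [h]
        ext x x'
        exact (hmove τ a).eq_of_mem_low (J.coeffMatrix_mem_low (by omega) _ x x')
      have h5 := hsol τ' b
      rw [h4] at h5
      rw [Matrix.mulVec_add, hsol, h5, hsol]
      funext r
      change Sum.elim (0 : Fin c.N × Fin e → k) a (ρ r) + Sum.elim (0 : Fin c.N × Fin e → k) b (ρ r) =
        Sum.elim (0 : Fin c.N × Fin e → k) (a + b) (ρ r)
      cases ρ r with
      | inl i => exact add_zero 0
      | inr s => rfl
    rw [h3] at h2
    exact h2.unique (hmove τ (a + b))
  · have h1 : (fun x => MvPolynomial.aevalTower τ (0 : Fin e → k) (y x)) = 0 := by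
      refine huniq τ ?_
      rw [hsol, Matrix.mulVec_zero]
      funext r
      change Sum.elim (0 : Fin c.N × Fin e → k) 0 (ρ r) = 0
      cases ρ r <;> rfl
    have h2 := hmove τ 0
    rw [h1] at h2
    exact h2.unique J.moved_zero
  · have hσ := (M.mem τ).1
    obtain ⟨v, hv⟩ := J.exists_lift n (τ.comp M.π)
    -- A jet with the same image arises by a motion whose vector lies in the kernel, and such a
    -- vector is determined by its free coordinates.
    obtain ⟨σ', x, h1, h2⟩ := c.exists_moved hf hc he he' J hv (hZ _ hσ v hv)
      (x := kPointOf (τ'.comp M.π) ≫ J.toJetScheme c.i) (by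
        rw [JA.kPointOf_comp_jetMap J f c.φ c.i c.j c.comm, JA.kPointOf_comp_jetMap J f c.φ c.i c.j c.comm, h])
    rw [← J.toJetScheme_injective c.i h1] at h2
    have hx := (h2.comp_map_eq_iff (JA := JA) (φ := c.φ) c.adjoin_y he).mp h.symm
    have h3 := selectRows_mulVec_of_mem_ker p ρ hx
    refine ⟨fun s => x (p s), h2.unique ?_⟩
    have h4 := hmove τ fun s => x (p s)
    rwa [← huniq τ (h3.trans (hsol τ fun s => x (p s)).symm)] at h4

end ChartFibration

/-! ### Stratifying the contact locus in a chart. -/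

section Strata
variable {k : Type u} [Field k]

/-- The points at which the functions in `I` vanish and `h` does not. -/
def basicSet {H : Type u} [CommRing H] [Algebra k H] (I : Set H) (h : H) : Set (H →ₐ[k] k) :=
  {σ | (∀ a ∈ I, σ a = 0) ∧ σ h ≠ 0}

lemma mem_basicSet {H : Type u} [CommRing H] [Algebra k H] {I : Set H} {h : H} {σ : H →ₐ[k] k} :
    σ ∈ basicSet I h ↔ (∀ a ∈ I, σ a = 0) ∧ σ h ≠ 0 := Iff.rfl

/-- The piece with index s consists of the zeros of I₀ at which `g s` is the first of the functions
`g` that does not vanish. -/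
lemma basicSet_disjoint {H : Type u} [CommRing H] [Algebra k H] (I₀ : Set H) {K : ℕ} (g : Fin K → H) :
    Pairwise fun s t => Disjoint (basicSet (k := k) (I₀ ∪ g '' Set.Iio s) (g s))
      (basicSet (I₀ ∪ g '' Set.Iio t) (g t)) := by
  intro s t hst
  refine Set.disjoint_left.mpr fun σ h1 h2 => ?_
  rcases lt_or_gt_of_ne hst with h | h
  · exact h1.2 (h2.1 _ (Or.inr ⟨s, h, rfl⟩))
  · exact h2.2 (h1.1 _ (Or.inr ⟨t, h, rfl⟩))

lemma mem_iUnion_basicSet {H : Type u} [CommRing H] [Algebra k H] (I₀ : Set H) {K : ℕ} (g : Fin K → H)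
    (σ : H →ₐ[k] k) : (∃ s, σ ∈ basicSet (I₀ ∪ g '' Set.Iio s) (g s)) ↔
      (∀ a ∈ I₀, σ a = 0) ∧ ∃ s, σ (g s) ≠ 0 := by
  constructor
  · rintro ⟨s, h⟩
    exact ⟨fun a ha => h.1 a (Or.inl ha), s, h.2⟩
  · rintro ⟨h0, h⟩
    obtain ⟨s, hs, hmin⟩ := WellFounded.has_min (wellFounded_lt (α := Fin K)) {s | σ (g s) ≠ 0} h
    refine ⟨s, ?_, hs⟩
    rintro a (ha | ⟨t, ht, rfl⟩)
    · exact h0 a ha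
    · by_contra h1
      exact hmin t h1 ht

variable {X' X : Over (Spec (.of k))} {f : X' ⟶ X} {n : ℕ} {e e' m : ℕ}

lemma not_X_pow_succ_dvd_iff {a : PowerSeries k} (h : PowerSeries.X ^ e ∣ a) :
    ¬ PowerSeries.X ^ (e + 1) ∣ a ↔ PowerSeries.coeff e a ≠ 0 := by
  rw [not_iff_not, PowerSeries.X_pow_dvd_iff]
  rw [PowerSeries.X_pow_dvd_iff] at h
  refine ⟨fun h1 => h1 e (Nat.lt_succ_self e), fun h1 l hl => ?_⟩
  rcases Nat.lt_succ_iff_lt_or_eq.mp hl with hl | rfl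
  · exact h l hl
  · exact h1

lemma JetChart.mem_jacContact_iff_coeff (c : JetChart f n) (J : JetAlgebra m k c.B) (he : e ≤ m)
    (he' : e' ≤ m) {σ : J.H →ₐ[k] k} {v : c.B →ₐ[k] PowerSeries k}
    (hv : (truncHom k m).comp v = J.jetAt σ) : specOverMap k v ≫ c.i ∈ jacContact f n e e' ↔
      ((∀ I, ∀ l < e, σ (J.coeff (c.minor I) l) = 0) ∧ ∃ I, σ (J.coeff (c.minor I) e) ≠ 0) ∧
      (∀ d ∈ c.targetMinors, ∀ l < e', σ (J.coeff (c.φ d) l) = 0) ∧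
        ∃ d ∈ c.targetMinors, σ (J.coeff (c.φ d) e') ≠ 0 := by
  have h1 (b : c.B) {j : ℕ} (hj : j ≤ m) : PowerSeries.X ^ j ∣ v b ↔ ∀ l < j, σ (J.coeff b l) = 0 := by
    rw [PowerSeries.X_pow_dvd_iff]
    exact forall₂_congr fun l hl => by rw [J.apply_coeff_of_lift hv b (by omega)]
  rw [c.mem_jacContact_iff]
  refine and_congr ?_ ?_
  · simp only [h1 _ he]
    refine and_congr_right fun h2 => exists_congr fun I => ?_
    rw [not_X_pow_succ_dvd_iff ((h1 _ he).mpr (h2 I)), J.apply_coeff_of_lift hv _ (by omega)]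
  · simp only [h1 _ he']
    refine and_congr_right fun h2 => exists_congr fun d => and_congr_right fun hd => ?_
    rw [not_X_pow_succ_dvd_iff ((h1 _ he').mpr (h2 d hd)), J.apply_coeff_of_lift hv _ (by omega)]

lemma det_mem_of_forall_mem {R H κ : Type*} [CommRing R] [CommRing H] [Algebra R H] [Fintype κ]
    [DecidableEq κ] (S : Subalgebra R H) {A : Matrix κ κ H} (h : ∀ i j, A i j ∈ S) : A.det ∈ S := by
  rw [Matrix.det_apply]
  refine sum_mem fun g _ => ?_
  rw [Units.smul_def]
  exact zsmul_mem (prod_mem fun i _ => h _ _) _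

lemma selectRows_mem {R H ι κ : Type*} [CommRing R] [CommRing H] [Algebra R H]
    [DecidableEq κ] (S : Subalgebra R H) {D : Matrix ι κ H} (h : ∀ i j, D i j ∈ S) (p : Fin e → κ)
    (ρ : κ → ι ⊕ Fin e) (i j) : selectRows D p ρ i j ∈ S := by
  change (Sum.elim D (fun s => Pi.single (p s) 1) (ρ i) : κ → H) j ∈ S
  cases ρ i with
  | inl r => exact h r j
  | inr s =>
    change (Pi.single (p s) 1 : κ → H) j ∈ S
    rw [Pi.single_apply]
    split_ifs
    · exact one_mem S
    · exact zero_mem S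

lemma JetChart.isNoetherianRing (c : JetChart f n) : IsNoetherianRing c.A := by
  have : Algebra.FiniteType k c.A :=
    ⟨⟨(Set.finite_range c.y).toFinset, by rw [Set.Finite.coe_toFinset]; exact c.adjoin_y⟩⟩
  exact Algebra.FiniteType.isNoetherianRing k c.A

/-- The pieces into which the jets of the contact locus are divided in a chart. -/
theorem JetChart.exists_strata (c : JetChart f n) (J : JetAlgebra m k c.B) (he : 2 * e ≤ m)
    (he' : e + e' ≤ m) (S : Set c.B) :
    ∃ (K : ℕ) (I : Fin K → Set J.H) (h : Fin K → J.H) (p : Fin K → Fin e → Fin n × Fin e)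
      (ρ : Fin K → Fin n × Fin e → (Fin c.N × Fin e) ⊕ Fin e),
      (Pairwise fun s t => Disjoint (basicSet (k := k) (I s) (h s)) (basicSet (I t) (h t))) ∧
      (∀ (σ : J.H →ₐ[k] k) (v : c.B →ₐ[k] PowerSeries k), (truncHom k m).comp v = J.jetAt σ →
        ((∃ s, σ ∈ basicSet (I s) (h s)) ↔ (∀ b ∈ S, σ (J.coeff b 0) = 0) ∧
          specOverMap k v ≫ c.i ∈ jacContact f n e e')) ∧
      (∀ s, ∀ σ ∈ basicSet (I s) (h s), ∀ σ' : J.H →ₐ[k] k,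
        (∀ x ∈ J.low (m + 1 - e), σ' x = σ x) → σ' ∈ basicSet (I s) (h s)) ∧
      ∀ s, ∀ σ ∈ basicSet (k := k) (I s) (h s),
        (selectRows ((J.coeffMatrix e c.jac).map σ) (p s) (ρ s)).det ≠ 0 := by
  have := c.isNoetherianRing
  -- There may be infinitely many target minors; by noetherianity finitely many of them detect the
  -- contact order e'.
  obtain ⟨F, hF, hspan⟩ := (Submodule.fg_span_iff_fg_span_finset_subset c.targetMinors).mp
    (IsNoetherian.noetherian (Ideal.span c.targetMinors))
  let Q := (Fin n → Fin c.N) × F × (Fin e → Fin n × Fin e) ×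
    (Fin n × Fin e → (Fin c.N × Fin e) ⊕ Fin e)
  let E := Fintype.equivFin Q
  -- Once the lower coefficients vanish, g q ≠ 0 says that the chosen minor has order exactly e, the
  -- chosen target minor has order exactly e', and the selected linear system is invertible.
  let g (q : Q) : J.H := J.coeff (c.minor q.1) e * J.coeff (c.φ q.2.1) e' *
    (selectRows (J.coeffMatrix e c.jac) q.2.2.1 q.2.2.2).det
  -- The lower coefficients of all minors vanish, and the center of the jet lies on V(S).
  let I₀ : Set J.H := {x | (∃ I, ∃ l < e, x = J.coeff (c.minor I) l) ∨
    (∃ d ∈ c.targetMinors, ∃ l < e', x = J.coeff (c.φ d) l) ∨ ∃ b ∈ S, x = J.coeff b 0}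
  have hdet (σ : J.H →ₐ[k] k) (p : Fin e → Fin n × Fin e)
      (ρ : Fin n × Fin e → (Fin c.N × Fin e) ⊕ Fin e) : σ (selectRows (J.coeffMatrix e c.jac) p ρ).det =
      (selectRows ((J.coeffMatrix e c.jac).map σ) p ρ).det :=
    ((σ : J.H →+* k).map_det _).trans (congrArg Matrix.det (map_selectRows (σ : J.H →+* k) _ p ρ))
  have hg (σ : J.H →ₐ[k] k) (q : Q) : σ (g q) = σ (J.coeff (c.minor q.1) e) *
      σ (J.coeff (c.φ q.2.1) e') *
        (selectRows ((J.coeffMatrix e c.jac).map σ) q.2.2.1 q.2.2.2).det := by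
    rw [map_mul, map_mul, hdet]
  -- Only coefficients of degree at most max(e, e') < m+1-e occur, so motions preserve the pieces.
  have hlowg (q : Q) : g q ∈ J.low (m + 1 - e) :=
    mul_mem (mul_mem (J.coeff_mem_low (by omega) _) (J.coeff_mem_low (by omega) _))
      (det_mem_of_forall_mem _ (selectRows_mem _ (J.coeffMatrix_mem_low (by omega) _) _ _))
  refine ⟨Fintype.card Q, fun s => I₀ ∪ (g ∘ E.symm) '' Set.Iio s, g ∘ E.symm, fun s => (E.symm s).2.2.1,
    fun s => (E.symm s).2.2.2, basicSet_disjoint I₀ _, fun σ v hv => ?_, fun s σ hσ σ' h => ?_,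
    fun s σ hσ h0 => ?_⟩
  · rw [mem_iUnion_basicSet, c.mem_jacContact_iff_coeff J (by omega) (by omega) hv]
    constructor
    · rintro ⟨h0, s, hs⟩
      change σ (g (E.symm s)) ≠ 0 at hs
      rw [hg] at hs
      exact ⟨fun b hb => h0 _ (Or.inr (Or.inr ⟨b, hb, rfl⟩)),
        ⟨fun I l hl => h0 _ (Or.inl ⟨I, l, hl, rfl⟩), _, left_ne_zero_of_mul (left_ne_zero_of_mul hs)⟩,
        fun d hd l hl => h0 _ (Or.inr (Or.inl ⟨d, hd, l, hl, rfl⟩)), _, hF (E.symm s).2.1.2,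
        right_ne_zero_of_mul (left_ne_zero_of_mul hs)⟩
    · intro hall
      have hcont := (c.mem_jacContact_iff_coeff J (by omega) (by omega) hv).mpr hall.2
      obtain ⟨h1, ⟨h2, I, hI⟩, h3, d, hd, hd'⟩ := hall
      obtain ⟨d', hd'F, hd'e⟩ : ∃ d' ∈ F, σ (J.coeff (c.φ d') e') ≠ 0 := by
        by_contra! H
        have h4 : Ideal.span (F : Set c.A) ≤ (Ideal.span {(PowerSeries.X : PowerSeries k) ^ (e' + 1)}).comap
            (v.comp c.φ).toRingHom := by
          rw [Ideal.span_le]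
          intro a ha
          refine Ideal.mem_comap.mpr (Ideal.mem_span_singleton.mpr (PowerSeries.X_pow_dvd_iff.mpr fun l hl => ?_))
          change PowerSeries.coeff l (v (c.φ a)) = 0
          rw [← J.apply_coeff_of_lift hv _ (by omega)]
          rcases Nat.lt_succ_iff_lt_or_eq.mp hl with hl | rfl
          · exact h3 a (hF ha) l hl
          · exact H a ha
        have h5 : d ∈ Ideal.span (F : Set c.A) := by
          have := Ideal.subset_span (α := c.A) hd
          rwa [show Ideal.span c.targetMinors = Ideal.span (F : Set c.A) from hspan] at this
        have h6 := PowerSeries.X_pow_dvd_iff.mp (Ideal.mem_span_singleton.mp (h4 h5)) e' (Nat.lt_succ_self _)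
        refine hd' ?_
        rw [J.apply_coeff_of_lift hv _ (by omega)]
        exact h6
      obtain ⟨p, ρ, -, hρ⟩ := exists_selectRows _ (c.finrank_ker J (by omega) hv hcont)
      refine ⟨?_, E (I, ⟨d', hd'F⟩, p, ρ), ?_⟩
      · rintro _ (⟨I, l, hl, rfl⟩ | ⟨d, hd, l, hl, rfl⟩ | ⟨b, hb, rfl⟩)
        · exact h2 I l hl
        · exact h3 d hd l hl
        · exact h1 b hb
      · rw [Function.comp_apply, E.symm_apply_apply, hg]
        exact mul_ne_zero (mul_ne_zero hI hd'e) hρ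
  · refine ⟨?_, ?_⟩
    · intro a ha
      refine (h a ?_).trans (hσ.1 a ha)
      rcases ha with (⟨I, l, hl, rfl⟩ | ⟨d, hd, l, hl, rfl⟩ | ⟨b, hb, rfl⟩) | ⟨t, -, rfl⟩
      · exact J.coeff_mem_low (by omega) _
      · exact J.coeff_mem_low (by omega) _
      · exact J.coeff_mem_low (by omega) _
      · exact hlowg _
    · exact (h _ (hlowg (E.symm s))).trans_ne hσ.2
  · refine hσ.2 ?_
    rw [Function.comp_apply, hg, h0, mul_zero]

end Strata

/-! ### From algebras and points back to schemes. -/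

section AffineSpaces
open scoped TensorProduct
variable {k : Type u} [Field k]

lemma specOverMap_id (O : Type u) [CommRing O] [Algebra k O] :
    specOverMap k (AlgHom.id k O) = 𝟙 (specOver k O) := Over.OverMorphism.ext (Spec.map_id _)

/-- The isomorphism of spectra given by an isomorphism of algebras. -/
noncomputable def specOverIso {A B : Type u} [CommRing A] [Algebra k A] [CommRing B] [Algebra k B]
    (Φ : A ≃ₐ[k] B) : specOver k B ≅ specOver k A where
  hom := specOverMap k Φ.toAlgHom
  inv := specOverMap k Φ.symm.toAlgHom
  hom_inv_id := by
    rw [specOverMap_comp, ← specOverMap_id]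
    congr 1
    ext x
    simp
  inv_hom_id := by
    rw [specOverMap_comp, ← specOverMap_id]
    congr 1
    ext x
    simp

lemma exists_specOver_mvPolynomial (O : Type u) [CommRing O] [Algebra k O] (e : ℕ) :
    ∃ θ : specOver k (MvPolynomial (Fin e) O) ≅ specOver k O ⊗ affineSpace k e,
      θ.hom ≫ fst _ _ = specOverMap k (IsScalarTower.toAlgHom k O (MvPolynomial (Fin e) O)) := by
  let P := MvPolynomial (ULift.{u} (Fin e)) k
  let A : specOver k P ≅ affineSpace k e := Over.isoMk (AffineSpace.SpecIso _ (.of k)).symm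
    (AffineSpace.SpecIso_inv_over (.of k))
  let Ψ₀ : O ⊗[k] P ≃+* MvPolynomial (Fin e) O :=
    (MvPolynomial.algebraTensorAlgEquiv k O).toRingEquiv.trans
      (MvPolynomial.renameEquiv O (Equiv.ulift (α := Fin e))).toRingEquiv
  have hΨ₀ (a : O) : Ψ₀ (a ⊗ₜ 1) = MvPolynomial.C a := by
    change MvPolynomial.rename Equiv.ulift (MvPolynomial.algebraTensorAlgEquiv k O (a ⊗ₜ 1)) = _
    rw [MvPolynomial.algebraTensorAlgEquiv_tmul, map_one, MvPolynomial.smul_eq_C_mul, mul_one,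
      MvPolynomial.rename_C]
  let Ψ : O ⊗[k] P ≃ₐ[k] MvPolynomial (Fin e) O := AlgEquiv.ofRingEquiv (f := Ψ₀) fun r => hΨ₀ _
  refine ⟨specOverIso Ψ ≪≫ (tensorSpec k P O).symm ≪≫ whiskerLeftIso (specOver k O) A, ?_⟩
  have h : (tensorSpec k P O).inv ≫ fst (specOver k O) (specOver k P) =
      specOverMap k (Algebra.TensorProduct.includeLeft (R := k) (S := k) (A := O) (B := P)) :=
    Over.OverMorphism.ext (pullbackSpecIso_inv_fst k O P)
  rw [Iso.trans_hom, Iso.trans_hom, Iso.symm_hom, whiskerLeftIso_hom, Category.assoc, Category.assoc,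
    whiskerLeft_fst, h]
  refine (specOverMap_comp _ _).trans (congrArg (specOverMap k) (AlgHom.ext fun a => ?_))
  exact hΨ₀ a

end AffineSpaces

section ModelPoints
variable {k : Type u} [Field k] {m : ℕ} {B : Type u} [CommRing B] [Algebra k B]
  {X : Over (Spec (.of k))}

lemma kPointsIn_pointModel (J : JetAlgebra m k B) (i : specOver k B ⟶ X)
    {Z : Set (J.H →ₐ[k] k)} (M : PointModel Z) :
    kPointsIn (specOverMap k M.π ≫ J.toJetScheme i) =
      (fun σ => kPointOf σ ≫ J.toJetScheme i) '' Z := by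
  ext x
  constructor
  · rintro ⟨t, rfl⟩
    obtain ⟨τ, rfl⟩ := exists_kPointOf t
    refine ⟨_, M.mem τ, ?_⟩
    dsimp only
    rw [← kPointOf_comp, Category.assoc]
  · rintro ⟨σ, hσ, rfl⟩
    obtain ⟨τ, rfl⟩ := (M.mem_iff σ).mp hσ
    refine ⟨kPointOf τ, ?_⟩
    dsimp only
    rw [← kPointOf_comp, Category.assoc]

lemma isImmersion_pointModel (J : JetAlgebra m k B) (i : specOver k B ⟶ X) [IsOpenImmersion i.left]
    {Z : Set (J.H →ₐ[k] k)} (M : PointModel Z) :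
    IsImmersion (specOverMap k M.π ≫ J.toJetScheme i).left :=
  inferInstanceAs (IsImmersion ((specOverMap k M.π).left ≫ (J.toJetScheme i).left))

lemma isReduced_pointModel {H : Type u} [CommRing H] [Algebra k H] {Z : Set (H →ₐ[k] k)}
    (M : PointModel Z) : AlgebraicGeometry.IsReduced (specOver k M.O).left :=
  inferInstanceAs (AlgebraicGeometry.IsReduced (Spec (.of M.O)))

end ModelPoints

/-! ### Images as disjoint unions of locally closed pieces. -/

section ImagePieces
variable {k : Type u} [Field k] [IsAlgClosed k]

/-- The image of a basic set is a finite disjoint union of basic sets. -/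
theorem exists_basicSet_image {R H : Type u} [CommRing R] [Algebra k R] [Algebra.FiniteType k R]
    [CommRing H] [Algebra k H] [Algebra.FiniteType k H] (ψ : R →ₐ[k] H) (I : Set H) (h : H) :
    ∃ (r : ℕ) (I' : Fin r → Set R) (h' : Fin r → R),
      (Pairwise fun s t => Disjoint (basicSet (k := k) (I' s) (h' s)) (basicSet (I' t) (h' t))) ∧
      ∀ τ : R →ₐ[k] k, (∃ s, τ ∈ basicSet (I' s) (h' s)) ↔ ∃ σ ∈ basicSet I h, σ.comp ψ = τ := by
  classical
  obtain ⟨M⟩ : Nonempty (PointModel (basicSet (k := k) I h)) := nonempty_pointModel I h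
  obtain ⟨G, hG, hpat⟩ := exists_pattern (M.π.comp ψ)
  have himage (τ : R →ₐ[k] k) : (∃ σ : M.O →ₐ[k] k, σ.comp (M.π.comp ψ) = τ) ↔
      ∃ σ ∈ basicSet I h, σ.comp ψ = τ := by
    constructor
    · rintro ⟨σ, rfl⟩
      exact ⟨_, M.mem σ, rfl⟩
    · rintro ⟨_, hσ, rfl⟩
      obtain ⟨σ, rfl⟩ := (M.mem_iff _).mp hσ
      exact ⟨σ, rfl⟩
  -- The pattern of a point: the functions of `G` that do not vanish there. Each pattern cuts out a
  -- basic set, and the image is the union of those for the patterns that occur in it.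
  let P (τ : R →ₐ[k] k) : Finset R := hG.toFinset.filter fun a => τ a ≠ 0
  have hP (Q : Finset R) (hQ : (Q : Set R) ⊆ G) (τ : R →ₐ[k] k) :
      τ ∈ basicSet (G \ Q) (∏ a ∈ Q, a) ↔ P τ = Q := by
    rw [mem_basicSet, map_prod, Finset.prod_ne_zero_iff, Finset.ext_iff]
    simp only [P, Finset.mem_filter, Set.Finite.mem_toFinset, Set.mem_sdiff, Finset.mem_coe]
    constructor
    · rintro ⟨h1, h2⟩ a
      refine ⟨fun h3 => ?_, fun h3 => ⟨hQ h3, h2 a h3⟩⟩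
      by_contra h4
      exact h3.2 (h1 a ⟨h3.1, h4⟩)
    · intro h1
      refine ⟨fun a ha => ?_, fun a ha => ((h1 a).mpr ha).2⟩
      by_contra h4
      exact ha.2 ((h1 a).mp ⟨ha.1, h4⟩)
  let ι := {Q : Finset R // Q ∈ hG.toFinset.powerset ∧ ∃ σ ∈ basicSet I h, P (σ.comp ψ) = Q}
  have : Finite ι := Finite.of_injective (fun Q : ι => (⟨Q.1, Q.2.1⟩ : hG.toFinset.powerset))
    fun Q Q' h => Subtype.ext (congrArg (fun x => x.1) h)
  obtain ⟨r, ⟨E⟩⟩ := Finite.exists_equiv_fin ι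
  have hsub (Q : ι) : (Q.1 : Set R) ⊆ G := fun a ha =>
    hG.mem_toFinset.mp (Finset.mem_powerset.mp Q.2.1 ha)
  refine ⟨r, fun s => G \ (E.symm s).1, fun s => ∏ a ∈ (E.symm s).1, a, fun s t hst => ?_, fun τ => ?_⟩
  · refine Set.disjoint_left.mpr fun τ h1 h2 => hst (E.symm.injective (Subtype.ext ?_))
    rw [hP _ (hsub _)] at h1 h2
    exact h1.symm.trans h2
  · rw [← himage]
    constructor
    · rintro ⟨s, hs⟩
      rw [hP _ (hsub _)] at hs
      obtain ⟨σ, hσ, hσP⟩ := (E.symm s).2.2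
      refine hpat (σ.comp ψ) τ (fun a ha => ?_) ((himage _).mpr ⟨σ, hσ, rfl⟩)
      have h1 := Finset.ext_iff.mp (hσP.trans hs.symm) a
      simp only [P, Finset.mem_filter, hG.mem_toFinset] at h1
      exact not_iff_not.mp ⟨fun h2 => (h1.mp ⟨ha, h2⟩).2, fun h2 => (h1.mpr ⟨ha, h2⟩).2⟩
    · intro hτ
      obtain ⟨σ, hσ, rfl⟩ := (himage _).mp hτ
      refine ⟨E ⟨P (σ.comp ψ), Finset.mem_powerset.mpr (Finset.filter_subset _ _), σ, hσ, rfl⟩, ?_⟩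
      rw [hP _ (hsub _), Equiv.symm_apply_apply]

end ImagePieces

/-! ### Strata of jets and their images. -/

section JetStrata
variable {k : Type u} [Field k] {X' X : Over (Spec (.of k))}

/-- A set of jets in the contact locus, contained in a chart, on which the Jacobian matrix has a
fixed pattern. -/
structure JetStratum (f : X' ⟶ X) (n e e' m : ℕ) where
  /-- The chart. -/
  c : JetChart f n
  /-- The functions on the jets in the chart. -/
  J : JetAlgebra m k c.B
  /-- The functions on the jets in the target of the chart. -/
  JA : JetAlgebra m k c.A
  /-- The functions that vanish. -/
  I : Set J.H
  /-- The function that does not vanish. -/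
  h : J.H
  /-- The free coordinates. -/
  p : Fin e → Fin n × Fin e
  /-- The pattern of the Jacobian matrix. -/
  ρ : Fin n × Fin e → (Fin c.N × Fin e) ⊕ Fin e
  low : ∀ σ ∈ basicSet I h, ∀ σ' : J.H →ₐ[k] k, (∀ x ∈ J.low (m + 1 - e), σ' x = σ x) →
    σ' ∈ basicSet I h
  contact : ∀ σ ∈ basicSet I h, ∀ v : c.B →ₐ[k] PowerSeries k, (truncHom k m).comp v = J.jetAt σ →
    specOverMap k v ≫ c.i ∈ jacContact f n e e'
  det_ne_zero : ∀ σ ∈ basicSet (k := k) I h,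
    (selectRows ((J.coeffMatrix e c.jac).map σ) p ρ).det ≠ 0

variable {f : X' ⟶ X} {n e e' m : ℕ}

/-- The homomorphism that describes the map of jets on a stratum. -/
noncomputable def JetStratum.ψ (Z : JetStratum f n e e' m) : Z.JA.H →ₐ[k] Z.J.H := Z.JA.map Z.J Z.c.φ

/-- The jet given by a point of the chart. -/
noncomputable def JetStratum.point (Z : JetStratum f n e e' m) (σ : Z.J.H →ₐ[k] k) :
    KPoint (jetScheme m X') := kPointOf σ ≫ Z.J.toJetScheme Z.c.i

/-- The jet given by a point of the target of the chart. -/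
noncomputable def JetStratum.targetPoint (Z : JetStratum f n e e' m) (τ : Z.JA.H →ₐ[k] k) :
    KPoint (jetScheme m X) := kPointOf τ ≫ Z.JA.toJetScheme Z.c.j

/-- The jets in a stratum. -/
def JetStratum.points (Z : JetStratum f n e e' m) : Set (KPoint (jetScheme m X')) :=
  Z.point '' basicSet Z.I Z.h

lemma JetStratum.point_injective (Z : JetStratum f n e e' m) : Function.Injective Z.point :=
  fun _ _ h => Z.J.toJetScheme_injective _ h

lemma JetStratum.targetPoint_injective (Z : JetStratum f n e e' m) :
    Function.Injective Z.targetPoint :=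
  fun _ _ h => Z.JA.toJetScheme_injective _ h

lemma JetStratum.point_comp_jetMap (Z : JetStratum f n e e' m) (σ : Z.J.H →ₐ[k] k) :
    Z.point σ ≫ jetMap m f = Z.targetPoint (σ.comp Z.ψ) :=
  Z.JA.kPointOf_comp_jetMap Z.J f Z.c.φ Z.c.i Z.c.j Z.c.comm σ

/-- A jet with the same image is moved from `x`, a motion fixes all coefficients below m+1-e, and
membership in the stratum depends on these only. -/
theorem JetStratum.saturated [IsSeparated f.left] (hf : IsBirational f.left)
    (hc : ∀ x : X'.left, ∃ c : JetChart f n, x ∈ Set.range c.i.left) (he : 2 * e ≤ m)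
    (he' : e + e' ≤ m) (Z : JetStratum f n e e' m) {x y : KPoint (jetScheme m X')}
    (hx : x ∈ Z.points) (h : y ≫ jetMap m f = x ≫ jetMap m f) : y ∈ Z.points := by
  obtain ⟨σ, hσ, rfl⟩ := hx
  obtain ⟨v, hv⟩ := Z.J.exists_lift n σ
  obtain ⟨σ', z, rfl, hz⟩ := Z.c.exists_moved hf hc he he' Z.J hv (Z.contact σ hσ v hv) h
  exact ⟨σ', Z.low σ hσ σ' fun a ha => hz.eq_of_mem_low ha, rfl⟩

/-- The jets in a stratum over a basic set contained in its image form a product with an affine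
space, over that basic set. -/
theorem JetStratum.exists_fibration [IsAlgClosed k] [IsSeparated f.left] (hf : IsBirational f.left)
    (hc : ∀ x : X'.left, ∃ c : JetChart f n, x ∈ Set.range c.i.left) (he : 2 * e ≤ m)
    (he' : e + e' ≤ m) (Z : JetStratum f n e e' m) {I' : Set Z.JA.H} {h' : Z.JA.H}
    (hT : ∀ τ ∈ basicSet I' h', ∃ σ ∈ basicSet Z.I Z.h, σ.comp Z.ψ = τ) :
    ∃ (T : Over (Spec (.of k))) (i : T ⟶ jetScheme m X),
      AlgebraicGeometry.IsReduced T.left ∧ IsImmersion i.left ∧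
      kPointsIn i = Z.targetPoint '' basicSet I' h' ∧
      ∃ (T' : Over (Spec (.of k))) (i' : T' ⟶ jetScheme m X') (q : T' ⟶ T),
        AlgebraicGeometry.IsReduced T'.left ∧ IsImmersion i'.left ∧
        kPointsIn i' = Z.point '' {σ | σ ∈ basicSet Z.I Z.h ∧ σ.comp Z.ψ ∈ basicSet I' h'} ∧
        q ≫ i = i' ≫ jetMap m f ∧
        ∃ (Y : Over (Spec (.of k))) (v : T' ≅ Y ⊗ affineSpace k e) (w : Y ⟶ T),
          Function.Bijective w.left ∧ q = v.hom ≫ fst Y (affineSpace k e) ≫ w := by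
  let piv (s : Fin e) : Z.J.H := Z.J.coeff (coord k n Z.c.B (Z.p s).1) (m + 1 - e + (Z.p s).2)
  -- The part of a stratum over a basic set is again a basic set; with the pivots set to zero, so is
  -- its slice. Both therefore have point models.
  have h1 : {σ | σ ∈ basicSet Z.I Z.h ∧ σ.comp Z.ψ ∈ basicSet I' h'} =
      basicSet (k := k) (Z.I ∪ Z.ψ '' I') (Z.h * Z.ψ h') := by
    ext σ
    simp only [Set.mem_ofPred_eq, mem_basicSet, Set.union_def, Set.mem_image, AlgHom.comp_apply,
      map_mul, mul_ne_zero_iff]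
    constructor
    · rintro ⟨⟨a1, a2⟩, a3, a4⟩
      refine ⟨?_, a2, a4⟩
      rintro _ (ha | ⟨b, hb, rfl⟩)
      · exact a1 _ ha
      · exact a3 _ hb
    · rintro ⟨a1, a2, a4⟩
      exact ⟨⟨fun a ha => a1 a (Or.inl ha), a2⟩, fun b hb => a1 _ (Or.inr ⟨b, hb, rfl⟩), a4⟩
  have h2 : {σ : Z.J.H →ₐ[k] k | (σ ∈ basicSet Z.I Z.h ∧ σ.comp Z.ψ ∈ basicSet I' h') ∧
      ∀ s, σ (piv s) = 0} = basicSet (k := k) ((Z.I ∪ Z.ψ '' I') ∪ Set.range piv) (Z.h * Z.ψ h') := by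
    ext σ
    have h3 := Set.ext_iff.mp h1 σ
    simp only [Set.mem_ofPred_eq] at h3 ⊢
    rw [h3, mem_basicSet, mem_basicSet]
    constructor
    · rintro ⟨⟨a1, a2⟩, a3⟩
      refine ⟨?_, a2⟩
      rintro _ (ha | ⟨s, rfl⟩)
      · exact a1 _ ha
      · exact a3 s
    · rintro ⟨a1, a2⟩
      exact ⟨⟨fun a ha => a1 a (Or.inl ha), a2⟩, fun s => a1 _ (Or.inr ⟨s, rfl⟩)⟩
  obtain ⟨N⟩ : Nonempty (PointModel (basicSet (k := k) I' h')) := nonempty_pointModel I' h'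
  obtain ⟨M⟩ : Nonempty (PointModel {σ | σ ∈ basicSet Z.I Z.h ∧ σ.comp Z.ψ ∈ basicSet I' h'}) := by
    rw [h1]; exact nonempty_pointModel _ _
  obtain ⟨M₀⟩ : Nonempty (PointModel {σ : Z.J.H →ₐ[k] k | (σ ∈ basicSet Z.I Z.h ∧
      σ.comp Z.ψ ∈ basicSet I' h') ∧ ∀ s, σ (piv s) = 0}) := by
    rw [h2]; exact nonempty_pointModel _ _
  obtain ⟨q, w, Φ, hq, hw, hbij⟩ := Z.c.fibration hf hc he he' Z.J Z.JA Z.low Z.contact Z.p Z.ρ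
    Z.det_ne_zero N hT M M₀
  obtain ⟨θ, hθ⟩ := exists_specOver_mvPolynomial (k := k) M₀.O e
  refine ⟨specOver k N.O, specOverMap k N.π ≫ Z.JA.toJetScheme Z.c.j, isReduced_pointModel N,
    isImmersion_pointModel Z.JA Z.c.j N, kPointsIn_pointModel Z.JA Z.c.j N,
    specOver k M.O, specOverMap k M.π ≫ Z.J.toJetScheme Z.c.i, specOverMap k q,
    isReduced_pointModel M, isImmersion_pointModel Z.J Z.c.i M, kPointsIn_pointModel Z.J Z.c.i M, ?_,
    specOver k M₀.O, specOverIso Φ.symm ≪≫ θ, specOverMap k w, hbij, ?_⟩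
  · rw [Category.assoc, Z.JA.toJetScheme_comp_jetMap Z.J f Z.c.φ Z.c.i Z.c.j Z.c.comm,
      ← Category.assoc, ← Category.assoc, specOverMap_comp, specOverMap_comp, hq]
  · rw [Iso.trans_hom, Category.assoc, ← Category.assoc θ.hom, hθ]
    change _ = specOverMap k Φ.symm.toAlgHom ≫ _
    rw [specOverMap_comp, ← hw, specOverMap_comp]
    congr 1
    ext x
    simp

end JetStrata

/-! ### Gluing the strata of finitely many charts. -/

section Cover
variable {k : Type u} [Field k] {X' X : Over (Spec (.of k))} {f : X' ⟶ X} {n e e' m : ℕ}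

/-- The center of a jet. -/
noncomputable def center (x : KPoint (jetScheme m X)) : X.left :=
  (jetOf x).left (IsLocalRing.closedPoint (TruncRing k m))

lemma JetAlgebra.center_kPointOf {B : Type u} [CommRing B] [Algebra k B] (J : JetAlgebra m k B)
    (i : specOver k B ⟶ X) {σ : J.H →ₐ[k] k} {v : B →ₐ[k] PowerSeries k}
    (hv : (truncHom k m).comp v = J.jetAt σ) : center (kPointOf σ ≫ J.toJetScheme i) =
      i.left (PrimeSpectrum.comap v.toRingHom (IsLocalRing.closedPoint (PowerSeries k))) := by
  rw [center, J.jetOf_kPointOf, ← hv, ← jetDiskToArcDisk_comp]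
  exact congrArg (fun x => i.left ((specOverMap k v).left x)) (jetDiskToArcDisk_closedPoint m)

lemma JetAlgebra.mem_zeroLocus_iff {B : Type u} [CommRing B] [Algebra k B] (J : JetAlgebra m k B)
    {σ : J.H →ₐ[k] k} {v : B →ₐ[k] PowerSeries k} (hv : (truncHom k m).comp v = J.jetAt σ) (S : Set B) :
    PrimeSpectrum.comap v.toRingHom (IsLocalRing.closedPoint (PowerSeries k)) ∈
      PrimeSpectrum.zeroLocus S ↔ ∀ b ∈ S, σ (J.coeff b 0) = 0 := by
  refine forall₂_congr fun b hb => ?_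
  change v b ∈ IsLocalRing.maximalIdeal (PowerSeries k) ↔ _
  rw [J.apply_coeff_of_lift hv b (Nat.succ_pos m), PowerSeries.maximalIdeal_eq_span_X,
    Ideal.mem_span_singleton, PowerSeries.X_dvd_iff, PowerSeries.coeff_zero_eq_constantCoeff_apply]

/-- The jets of the contact locus are a finite disjoint union of strata. -/
theorem exists_strata_cover (he : 2 * e ≤ m) (he' : e + e' ≤ m)
    {r : ℕ} (c : Fin r → JetChart f n) (hc : ∀ x : X'.left, ∃ a, x ∈ Set.range (c a).i.left) :
    ∃ (R : ℕ) (Z : Fin R → JetStratum f n e e' m),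
      (Pairwise fun s t => Disjoint (Z s).points (Z t).points) ∧
      ⋃ s, (Z s).points = arcTrunc m '' jacContact f n e e' := by
  have hB (a) : Algebra.FiniteType k (c a).B :=
    .trans (inferInstance : Algebra.FiniteType k (MvPolynomial (Fin n) k)) inferInstance
  have hA (a) : Algebra.FiniteType k (c a).A :=
    ⟨⟨(Set.finite_range (c a).y).toFinset, by rw [Set.Finite.coe_toFinset]; exact (c a).adjoin_y⟩⟩
  let J (a) : JetAlgebra m k (c a).B := (nonempty_jetAlgebra m (c a).B).some
  let JA (a) : JetAlgebra m k (c a).A := (nonempty_jetAlgebra m (c a).A).some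
  -- The union of the earlier charts. Assigning each jet to the first chart that contains its center
  -- makes the strata of different charts disjoint.
  let V (a : Fin r) : TopologicalSpace.Opens X'.left := ⨆ b : Set.Iio a, (c b).i.left.opensRange
  have hV (a : Fin r) (x : X'.left) : x ∈ V a ↔ ∃ b < a, x ∈ Set.range (c b).i.left := by
    rw [TopologicalSpace.Opens.mem_iSup]
    exact ⟨fun ⟨b, hb⟩ => ⟨b.1, b.2, hb⟩, fun ⟨b, hb, h⟩ => ⟨⟨b, hb⟩, h⟩⟩
  have hS (a : Fin r) : ∃ S : Set (c a).B, ∀ x : PrimeSpectrum (c a).B,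
      (c a).i.left x ∉ V a ↔ x ∈ PrimeSpectrum.zeroLocus S := by
    let W : TopologicalSpace.Opens (PrimeSpectrum (c a).B) := (c a).i.left ⁻¹ᵁ V a
    obtain ⟨S, hS⟩ := (PrimeSpectrum.isClosed_iff_zeroLocus _).mp W.isOpen.isClosed_compl
    exact ⟨S, fun x => by rw [← hS]; rfl⟩
  choose S hS using hS
  choose K I h p ρ h1 h2 h3 h4 using fun a => (c a).exists_strata (J a) he he' (S a)
  let Z (q : Σ a, Fin (K a)) : JetStratum f n e e' m :=
    { c := c q.1, J := J q.1, JA := JA q.1, I := I q.1 q.2, h := h q.1 q.2, p := p q.1 q.2,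
      ρ := ρ q.1 q.2, low := h3 q.1 q.2
      contact := fun σ hσ v hv => ((h2 q.1 σ v hv).mp ⟨_, hσ⟩).2
      det_ne_zero := h4 q.1 q.2 }
  have hcen (q) (x) (hx : x ∈ (Z q).points) :
      center x ∈ Set.range (c q.1).i.left ∧ center x ∉ V q.1 := by
    obtain ⟨σ, hσ, rfl⟩ := hx
    obtain ⟨v, hv⟩ := (J q.1).exists_lift n σ
    have h5 : center ((Z q).point σ) = _ := (J q.1).center_kPointOf (c q.1).i hv
    rw [h5]
    refine ⟨⟨_, rfl⟩, (hS _ _).mpr (((J q.1).mem_zeroLocus_iff hv _).mpr ((h2 q.1 σ v hv).mp ⟨_, hσ⟩).1)⟩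
  have hdisj : Pairwise fun q q' => Disjoint (Z q).points (Z q').points := by
    rintro ⟨a, s⟩ ⟨b, t⟩ hne
    refine Set.disjoint_left.mpr fun x hx hx' => ?_
    rcases lt_trichotomy a b with hab | rfl | hab
    · exact (hcen _ x hx').2 ((hV _ _).mpr ⟨a, hab, (hcen _ x hx).1⟩)
    · obtain ⟨σ, hσ, rfl⟩ := hx
      obtain ⟨σ', hσ', h5⟩ := hx'
      have h6 : σ' = σ := (Z ⟨a, s⟩).point_injective h5
      subst h6
      exact Set.disjoint_left.mp (h1 a fun hst => hne (congrArg (Sigma.mk a) hst)) hσ hσ'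
    · exact (hcen _ x hx).2 ((hV _ _).mpr ⟨b, hab, (hcen _ x hx').1⟩)
  have hunion : ⋃ q, (Z q).points = arcTrunc m '' jacContact f n e e' := by
    ext x
    rw [Set.mem_iUnion]
    constructor
    · rintro ⟨q, σ, hσ, rfl⟩
      obtain ⟨v, hv⟩ := (J q.1).exists_lift n σ
      refine ⟨_, ((h2 q.1 σ v hv).mp ⟨_, hσ⟩).2, jetOf_injective ?_⟩
      rw [jetOf_arcTrunc, ← Category.assoc, jetDiskToArcDisk_comp, hv]
      exact ((J q.1).jetOf_kPointOf (c q.1).i σ).symm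
    · rintro ⟨γ, hγ, rfl⟩
      obtain ⟨a, ha, hmin⟩ := WellFounded.has_min (wellFounded_lt (α := Fin r))
        {a | γ.left (IsLocalRing.closedPoint (PowerSeries k)) ∈ Set.range (c a).i.left} (hc _)
      obtain ⟨v, rfl⟩ := exists_factor_of_closedPoint (c a).i γ ha
      obtain ⟨σ, hσ⟩ := (J a).jetAt_surjective ((truncHom k m).comp v)
      obtain ⟨s, hs⟩ := (h2 a σ v hσ.symm).mpr ⟨((J a).mem_zeroLocus_iff hσ.symm _).mp ((hS a _).mp
        fun hmem => by
          obtain ⟨b, hb, hb'⟩ := (hV a _).mp hmem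
          exact hmin b hb' hb), hγ⟩
      refine ⟨⟨a, s⟩, σ, hs, jetOf_injective ?_⟩
      rw [jetOf_arcTrunc, ← Category.assoc, jetDiskToArcDisk_comp, ← hσ]
      exact (J a).jetOf_kPointOf (c a).i σ
  obtain ⟨R, ⟨E⟩⟩ := Finite.exists_equiv_fin (Σ a, Fin (K a))
  refine ⟨R, fun s => Z (E.symm s), fun s t hst => hdisj (E.symm.injective.ne hst), ?_⟩
  rw [← hunion]
  exact E.symm.surjective.iUnion_comp fun q => (Z q).points

/-- The jets of the contact locus are a piecewise trivial fibration over their image, up to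
bijective morphisms. -/
theorem isWeaklyPiecewiseTrivial_jetMap [IsAlgClosed k] [IsSeparated f.left] (hf : IsBirational f.left)
    (he : 2 * e ≤ m) (he' : e + e' ≤ m)
    {r : ℕ} (c : Fin r → JetChart f n) (hc : ∀ x : X'.left, ∃ a, x ∈ Set.range (c a).i.left) :
    IsWeaklyPiecewiseTrivial (jetMap m f) (arcTrunc m '' jacContact f n e e')
      ((fun x => x ≫ jetMap m f) '' (arcTrunc m '' jacContact f n e e')) (affineSpace k e) := by
  have hc' (x : X'.left) : ∃ c : JetChart f n, x ∈ Set.range c.i.left :=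
    let ⟨a, ha⟩ := hc x; ⟨c a, ha⟩
  obtain ⟨R, Z, hdisj, hunion⟩ := exists_strata_cover he he' c hc
  choose K I h hI himage using fun s => exists_basicSet_image (Z s).ψ (Z s).I (Z s).h
  have hT (s) (t : Fin (K s)) (τ) (hτ : τ ∈ basicSet (I s t) (h s t)) :
      ∃ σ ∈ basicSet (Z s).I (Z s).h, σ.comp (Z s).ψ = τ := (himage s τ).mp ⟨t, hτ⟩
  choose T i hTred hi hTi T' i' q hTred' hi' hTi' hq Y v w hw hqv using fun x : Σ s, Fin (K s) =>
    (Z x.1).exists_fibration hf hc' he he' (hT x.1 x.2)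
  have hsat {s x y} (hx : x ∈ (Z s).points) (hxy : y ≫ jetMap m f = x ≫ jetMap m f) : y ∈ (Z s).points :=
    (Z s).saturated hf hc' he he' hx hxy
  have hlift (x : Σ s, Fin (K s)) (t) (ht : t ∈ kPointsIn (i x)) :
      ∃ σ ∈ basicSet (Z x.1).I (Z x.1).h, (Z x.1).targetPoint (σ.comp (Z x.1).ψ) = t ∧
        σ.comp (Z x.1).ψ ∈ basicSet (I x.1 x.2) (h x.1 x.2) := by
    rw [hTi] at ht
    obtain ⟨τ, hτ, rfl⟩ := ht
    obtain ⟨σ, hσ, rfl⟩ := hT x.1 x.2 τ hτ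
    exact ⟨σ, hσ, rfl, hτ⟩
  -- Strata are saturated, so two strata with a common image point coincide; within one stratum the
  -- pieces of the image are disjoint by construction.
  have hTdisj : Pairwise fun x y => Disjoint (kPointsIn (i x)) (kPointsIn (i y)) := by
    rintro ⟨s, a⟩ ⟨s', b⟩ hne
    refine Set.disjoint_left.mpr fun t ht ht' => ?_
    obtain ⟨σ, hσ, h5, h6⟩ := hlift ⟨s, a⟩ t ht
    obtain ⟨σ', hσ', h7, h8⟩ := hlift ⟨s', b⟩ t ht'
    have h9 : (Z s').point σ' ∈ (Z s).points := hsat ⟨σ, hσ, rfl⟩ (by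
      rw [(Z s).point_comp_jetMap, (Z s').point_comp_jetMap]
      exact h7.trans h5.symm)
    have hss : s = s' := by
      by_contra hss
      exact Set.disjoint_left.mp (hdisj hss) h9 ⟨σ', hσ', rfl⟩
    subst hss
    have h10 := (Z s).targetPoint_injective (h5.trans h7.symm)
    rw [h10] at h6
    exact Set.disjoint_left.mp (hI s fun hab => hne (congrArg (Sigma.mk s) hab)) h6 h8
  have himg : (fun x => x ≫ jetMap m f) '' (arcTrunc m '' jacContact f n e e') =
      ⋃ x, kPointsIn (i x) := by
    rw [← hunion]
    ext t
    rw [Set.mem_iUnion]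
    constructor
    · rintro ⟨x, hx, rfl⟩
      obtain ⟨s, σ, hσ, rfl⟩ := Set.mem_iUnion.mp hx
      obtain ⟨a, ha⟩ := (himage s (σ.comp (Z s).ψ)).mpr ⟨σ, hσ, rfl⟩
      refine ⟨⟨s, a⟩, ?_⟩
      rw [hTi]
      exact ⟨_, ha, ((Z s).point_comp_jetMap σ).symm⟩
    · rintro ⟨x, hx⟩
      obtain ⟨σ, hσ, rfl, -⟩ := hlift x t hx
      exact ⟨_, Set.mem_iUnion.mpr ⟨x.1, σ, hσ, rfl⟩, (Z x.1).point_comp_jetMap σ⟩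
  -- Again by saturation, every jet of the whole contact locus over a piece already lies in the
  -- stratum from which the piece was made.
  have hpts (x) : kPointsIn (i' x) =
      {y | y ∈ arcTrunc m '' jacContact f n e e' ∧ y ≫ jetMap m f ∈ kPointsIn (i x)} := by
    rw [hTi', ← hunion]
    ext y
    constructor
    · rintro ⟨σ, ⟨hσ, h5⟩, rfl⟩
      refine ⟨Set.mem_iUnion.mpr ⟨x.1, σ, hσ, rfl⟩, ?_⟩
      rw [hTi, (Z x.1).point_comp_jetMap]
      exact ⟨_, h5, rfl⟩
    · rintro ⟨-, hy⟩
      obtain ⟨σ, hσ, h5, h6⟩ := hlift x _ hy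
      obtain ⟨σ', hσ', rfl⟩ := hsat (y := y) ⟨σ, hσ, rfl⟩ (by
        rw [(Z x.1).point_comp_jetMap]; exact h5.symm)
      refine ⟨σ', ⟨hσ', ?_⟩, rfl⟩
      rw [(Z x.1).point_comp_jetMap] at h5
      rwa [← (Z x.1).targetPoint_injective h5]
  obtain ⟨r', ⟨E⟩⟩ := Finite.exists_equiv_fin (Σ s, Fin (K s))
  exact ⟨fun x hx => ⟨x, hx, rfl⟩, r', fun a => T (E.symm a), fun a => i (E.symm a),
    fun a => ⟨hTred _, hi _⟩, fun a b hab => hTdisj (E.symm.injective.ne hab),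
    himg.trans (E.symm.surjective.iUnion_comp fun x => kPointsIn (i x)).symm,
    fun a => ⟨T' (E.symm a), i' (E.symm a), q (E.symm a), hTred' _, hi' _, hpts _, hq _, Y _, v _,
      w _, hw _, hqv _⟩⟩

end Cover

end JetScheme

theorem mainTheorem4 {k : Type u} [Field k] [IsAlgClosed k]
    (X' X : Over (Spec (CommRingCat.of k))) (f : X' ⟶ X) (n : ℕ)
    (hX : LocallyOfFiniteType X.hom) (hX_qc : QuasiCompact X.hom)
    (hX_red : AlgebraicGeometry.IsReduced X.left)
    (hX_dim : JetScheme.IsPureDimensional X.left n)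
    (hX' : AlgebraicGeometry.Smooth X'.hom)
    (hf_proper : IsProper f.left) (hf_birational : JetScheme.IsBirational f.left)
    (e e' m : ℕ) (hm : max (2 * e) (e + e') ≤ m) :
    (∃ S : Set (JetScheme.KPoint (JetScheme.jetScheme m X)),
      JetScheme.arcTrunc m '' JetScheme.jacContact f n e e' =
        {x | x ≫ JetScheme.jetMap m f ∈ S}) ∧
    JetScheme.IsWeaklyPiecewiseTrivial (JetScheme.jetMap m f)
      (JetScheme.arcTrunc m '' JetScheme.jacContact f n e e')
      ((fun x => x ≫ JetScheme.jetMap m f) ''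
        (JetScheme.arcTrunc m '' JetScheme.jacContact f n e e'))
      (JetScheme.affineSpace k e) := by
  have he : 2 * e ≤ m := (le_max_left _ _).trans hm
  have he' : e + e' ≤ m := (le_max_right _ _).trans hm
  have : CompactSpace X.left := QuasiCompact.compactSpace_of_compactSpace X.hom
  have : CompactSpace X'.left := QuasiCompact.compactSpace_of_compactSpace f.left
  obtain ⟨r, c, hc⟩ := JetScheme.exists_finite_jetCharts hX_dim hf_birational
  -- The set of fibers is the image itself; that the locus contains every fiber it meets is the
  -- saturation statement.
  refine ⟨⟨(fun x => x ≫ JetScheme.jetMap m f) ''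
    (JetScheme.arcTrunc m '' JetScheme.jacContact f n e e'), ?_⟩,
    JetScheme.isWeaklyPiecewiseTrivial_jetMap hf_birational he he' c hc⟩
  ext y
  refine ⟨fun hy => ⟨y, hy, rfl⟩, ?_⟩
  rintro ⟨x, hx, h⟩
  exact JetScheme.mem_image_arcTrunc_of_comp_jetMap_eq hf_birational
    (fun x => let ⟨a, ha⟩ := hc x; ⟨c a, ha⟩) he he' x y hx h.symm
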